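/- Let $\mathbb F=\mathbb Z/2$. For a finite set $X$ (of colours) let $R_X=\mathbb F[X]/(x^2 : x\in X)$ and $\Xi_X=\bigotimes_{x\in X}\mathbb F[\xi_x,\xi_x^{-1}]/\xi_x\mathbb F[\xi_x]$. An $X$-pointed tangle $(T,\vec p)$ with endpoints $e$ is a generic tangle $T\subset D^2\times[-1,1]$ with endpoints $e$ together with pairwise disjoint finite sets $p_x\subset T$ ($x\in X$) of points away from the crossings. Let $C_{\mathrm{BN}}(T)$ be Bar-Natan's complex of $T$ over $\mathbb F$, in the category of dotted cobordisms (where a sphere is $0$, a sphere with one dot is $1$, two dots on a component give $0$, and the neck-cutting relation holds), with the action of $R_X$ in which $x$ acts by $\rho(x)=\sum_{p\in p_x}(\text{identity cobordism with a dot at }p)$. Let $\overline D_{\mathrm{BN}}(T,\vec p)=C_{\mathrm{BN}}(T)\otimes_{\mathbb F} R_X\otimes_{\mathbb F}\Xi_X$, with differential $\partial\otimes 1\otimes 1+\sum_{x\in X}(\rho(x)\otimes 1+1\otimes x)\otimes\xi_x$ and with $R_X$ acting on the middle factor. A generic $X$-decorated tangle cobordism $(\Sigma,\vec A):(T,\vec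 p)\to(T',\vec p\,')$ is, up to isotopy through generic ones, a composition of elementary movies: planar isotopies; Reidemeister and Morse movies away from the basepoints; cap and cup movies (two neighbouring basepoints of the same colour annihilate or are created); swap movies (two neighbouring basepoints are exchanged); and slide movies (a basepoint moves through a crossing). The map $\overline D_{\mathrm{BN}}(\Sigma,\vec A)$ is the composition of the maps of the elementary movies, which are $\mathrm{Id}\otimes 1\otimes 1+H\otimes 1\otimes\xi_y$ for a slide movie of a basepoint of colour $y$, where $H$ is the sum of the saddle cobordisms from the $1$-smoothing to the $0$-smoothing of the crossing, and $C_{\mathrm{BN}}(\Sigma)\otimes 1\otimes 1$ for all the others, where $C_{\mathrm{BN}}(\Sigma)$ is Bar-Natan's map. Maps are finite sums of maps that are homogeneous in the homological grading, and two maps are $R_X$-chain homotopic if they differ by $\partial h+h\partial$ for some such $R_X$-linear $h$. **Proposition.** Let $D$ be an oriented planar arc diagram with input endpoints $e_1,\dots,e_d$ and output endpoints $e$. For $i=1,\dots,d$ let $X_i$ be a finite set, and let $(\Sigma_i,\vec A_i)$ and $(\Sigma_i',\vec A_i')$ be generic $X_i$-decorated tangle cobordisms between the same two $X_i$-pointed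 tangles $(T_i,\vec p_i)$ and $(T_i',\vec p_i{}')$ with endpoints $e_i$. Let $X=\bigcup_{i=1}^d X_i$ (the sets $X_i$ need not be disjoint), and let $(\Sigma,\vec A)$ and $(\Sigma',\vec A')$ be the generic $X$-decorated tangle cobordisms, between the same two $X$-pointed tangles with endpoints $e$, that are obtained by gluing the $(\Sigma_i,\vec A_i)$, respectively the $(\Sigma_i',\vec A_i')$, along $D$. If for every $i=1,\dots,d$ the maps $\overline D_{\mathrm{BN}}(\Sigma_i,\vec A_i)$ and $\overline D_{\mathrm{BN}}(\Sigma_i',\vec A_i')$ are $R_{X_i}$-chain homotopic, then $\overline D_{\mathrm{BN}}(\Sigma,\vec A)$ and $\overline D_{\mathrm{BN}}(\Sigma',\vec A')$ are $R_X$-chain homotopic. -/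

import Mathlib

/-!
# The enhanced Bar-Natan invariant of decorated tangle cobordisms

Everything is over `𝔽 = ℤ/2`.

* `Flat e` : crossingless tangles with endpoints `e`;  `Hom a b` : the morphism spaces of the
  dotted Bar-Natan category over `𝔽` with composition `Hom.comp`.
* `Tangle e U` : tangle diagrams with endpoints `e` with basepoints coloured by `U`.
* `Tangle.CBN`, `Tangle.DBN` : the cube of resolutions with its basepoint action, and its preferred
  free resolution.
* `Kind`, `Step`, `Movie` : elementary local movies, elementary movies, and movies, that is,
  generic decorated tangle cobordisms presented as compositions of elementary movies.
* `Movie.DBN` : the induced map.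
* `ArcDiagram`, `ArcDiagram.glue`, `JointMovie` : gluing of tangles and of movies.

Diagrams and arc diagrams are recorded combinatorially, by the pattern in which their pieces are
joined.  Nothing below depends on how such a pattern is drawn in the disc, and neither planarity
nor orientations are imposed (orientations enter the invariant only through overall grading shifts,
and maps of complexes are not required to be homogeneous), so that planar diagrams with any
orientations are included as particular cases.
-/

noncomputable section

open Classical

namespace BarNatan

/-! ## Crossingless tangles and dotted cobordisms -/

/-- A crossingless tangle with endpoints `e` (a compact `1`-manifold), cut into finitely many
segments.  `link` says which segments are joined to each other, `bd` gives the segment that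
ends at a given endpoint. -/
structure Flat (e : Type) where
  S : Type
  [fin : Finite S]
  link : S → S → Prop
  bd : e → S

attribute [instance] Flat.fin

variable {e h o U : Type}

/-- The connected components of a crossingless tangle. -/
abbrev Flat.Comp (a : Flat e) : Type := Quot a.link

/-- The components which are arcs; the other components are circles. -/
def Flat.arcs (a : Flat e) : Set a.Comp := {c | ∃ p, Quot.mk _ (a.bd p) = c}

inductive circLink (a b : Flat e) : a.S ⊕ b.S → a.S ⊕ b.S → Prop
  | left {s t : a.S} : a.link s t → circLink a b (.inl s) (.inl t)
  | right {s t : b.S} : b.link s t → circLink a b (.inr s) (.inr t)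
  | bd (p : e) : circLink a b (.inl (a.bd p)) (.inr (b.bd p))

/-- The circles of the closed `1`-manifold `a ∪ (e × [0,1]) ∪ b`, which is the boundary of any
cobordism from `a` to `b`. -/
abbrev Circ (a b : Flat e) : Type := Quot (circLink a b)

/-- Morphisms from `a` to `b` in the dotted Bar-Natan category over `ℤ/2`.  Modulo the local
relations (a sphere is `0`, a sphere with one dot is `1`, two dots on a component give `0`, and
neck cutting) the dotted cobordisms from `a` to `b` have as a basis the collections of discs
that bound the circles of `Circ a b`, each with at most one dot.  A basis element is recorded as
the set of the circles whose disc is dotted. -/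
abbrev Hom (a b : Flat e) : Type := Set (Circ a b) → ZMod 2

/-- A dotted surface with boundary `a ∪ (e × [0,1]) ∪ b`: its components, their Euler
characteristics and numbers of dots, and the component at each boundary segment. -/
structure Surface (a b : Flat e) where
  K : Type
  χ : K → ℤ
  dots : K → ℕ
  bd : a.S ⊕ b.S → K

/-- The boundary circles of a component. -/
def Surface.circles {a b : Flat e} (F : Surface a b) (k : F.K) : Set (Circ a b) :=
  {q | ∃ s, Quot.mk _ s = q ∧ F.bd s = k}

/-- The morphism represented by a dotted surface, expanded in the basis by cutting the neck at
every boundary circle. The coefficient at a collection of discs is the product over the components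
`k` of the values of the closed surfaces that are left over: such a surface has to be a sphere
(a handle is twice a dot, hence zero) with exactly one dot on it, where every boundary circle of
`k` contributes one dot unless its disc is dotted. -/
def Surface.toHom {a b : Flat e} (F : Surface a b) : Hom a b := fun V =>
  if ∀ k, F.χ k + (F.circles k).ncard = 2 ∧ F.dots k + (F.circles k \ V).ncard = 1 then 1 else 0

inductive stackLink (a b c : Flat e) : a.S ⊕ b.S ⊕ c.S → a.S ⊕ b.S ⊕ c.S → Prop
  | fst {s t : a.S} : a.link s t → stackLink a b c (.inl s) (.inl t)
  | snd {s t : b.S} : b.link s t → stackLink a b c (.inr (.inl s)) (.inr (.inl t))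
  | trd {s t : c.S} : c.link s t → stackLink a b c (.inr (.inr s)) (.inr (.inr t))
  | bd₁ (p : e) : stackLink a b c (.inl (a.bd p)) (.inr (.inl (b.bd p)))
  | bd₂ (p : e) : stackLink a b c (.inr (.inl (b.bd p))) (.inr (.inr (c.bd p)))

/-- The surface obtained by stacking two collections of dotted discs, from `a` to `b` and from
`b` to `c`.  Its Euler characteristic is the number of discs minus the number of arcs of `b`
along which they are glued (gluing along a circle does not change the Euler characteristic). -/
def stack (a b c : Flat e) (V : Set (Circ a b)) (W : Set (Circ b c)) : Surface a c where
  K := Quot (stackLink a b c)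
  χ k := ({q : Circ a b | ∃ s, Quot.mk _ s = q ∧ Quot.mk _ (Sum.map id Sum.inl s) = k}.ncard : ℤ)
    + {q : Circ b c | ∃ s, Quot.mk _ s = q ∧ Quot.mk _ (Sum.inr s) = k}.ncard
    - {q : b.Comp | q ∈ b.arcs ∧ ∃ s, Quot.mk _ s = q ∧
        Quot.mk _ (Sum.inr (Sum.inl s)) = k}.ncard
  dots k := {q | q ∈ V ∧ ∃ s, Quot.mk _ s = q ∧ Quot.mk _ (Sum.map id Sum.inl s) = k}.ncard
    + {q | q ∈ W ∧ ∃ s, Quot.mk _ s = q ∧ Quot.mk _ (Sum.inr s) = k}.ncard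
  bd s := Quot.mk _ (Sum.map id Sum.inr s)

/-- Composition of morphisms (first `f`, then `g`), by stacking. -/
def Hom.comp {a b c : Flat e} (f : Hom a b) (g : Hom b c) : Hom a c :=
  ∑ᶠ V : Set (Circ a b), ∑ᶠ W : Set (Circ b c), (f V * g W) • (stack a b c V W).toHom

inductive traceLink (a b : Flat e) (r : a.S → b.S → Prop) : a.S ⊕ b.S → a.S ⊕ b.S → Prop
  | left {s t : a.S} : a.link s t → traceLink a b r (.inl s) (.inl t)
  | right {s t : b.S} : b.link s t → traceLink a b r (.inr s) (.inr t)
  | rel {s : a.S} {t : b.S} : r s t → traceLink a b r (.inl s) (.inr t)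

/-- The surface from `a` to `b` obtained from the cylinder `a × [0,1]` by attaching one band at
every segment in `bands` and by putting one dot on every segment in `dots`, where the segments of
`a` and of `b` which stay in place correspond under `r`.  An arc times an interval has
Euler characteristic `1`, a circle times an interval `0`, and a band contributes `-1`. -/
def trace (a b : Flat e) (r : a.S → b.S → Prop) (bands dots : Set a.S) : Surface a b where
  K := Quot (traceLink a b r)
  χ k := ({q : a.Comp | q ∈ a.arcs ∧ ∃ s, Quot.mk _ s = q ∧
        Quot.mk _ (Sum.inl s) = k}.ncard : ℤ)
    - {s | s ∈ bands ∧ Quot.mk _ (Sum.inl s) = k}.ncard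
  dots k := {s | s ∈ dots ∧ Quot.mk _ (Sum.inl s) = k}.ncard
  bd s := Quot.mk _ s

/-- The identity cobordism. -/
def Hom.id (a : Flat e) : Hom a a := (trace a a Eq ∅ ∅).toHom

/-- The undotted discs. -/
def disc (a b : Flat e) : Hom a b := fun V => if V = ∅ then 1 else 0

/-- The connected undotted surface of genus zero bounded by all the circles. -/
def tube (a b : Flat e) : Hom a b := fun V => if Vᶜ.ncard = 1 then 1 else 0

/-! ## Complexes with an action -/

/-- A formal direct sum of crossingless tangles in various homological gradings. -/
structure Obj (e : Type) where
  ι : Type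
  fl : ι → Flat e
  deg : ι → ℤ

/-- Matrices of morphisms; `M i j` is the component from the `i`-th to the `j`-th summand. -/
abbrev Mat (A B : Obj e) : Type := ∀ (i : A.ι) (j : B.ι), Hom (A.fl i) (B.fl j)

/-- Composition of matrices, first `M`, then `N`. -/
def Mat.comp {A B C : Obj e} (M : Mat A B) (N : Mat B C) : Mat A C :=
  fun i k => ∑ᶠ j, (M i j).comp (N j k)

def Mat.one (A : Obj e) : Mat A A := fun i j =>
  if eq : i = j then eq ▸ Hom.id (A.fl i) else 0

/-- Maps are finite sums of maps that are homogeneous in the homological grading. -/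
def Mat.Bounded {A B : Obj e} (M : Mat A B) : Prop :=
  ∃ N : ℤ, ∀ i j, M i j ≠ 0 → |B.deg j - A.deg i| ≤ N

/-- A complex `C` with an action of `R_X = 𝔽[X]/(x² : x ∈ X)`, given by the actions of the
generators `x ∈ X`. -/
structure RComplex (X e : Type) extends Obj e where
  d : Mat toObj toObj
  act : X → Mat toObj toObj

variable {X : Type}

/-- `R_X`-linearity; it suffices to commute with the generators of `R_X`. -/
def RComplex.Linear (A B : RComplex X e) (M : Mat A.toObj B.toObj) : Prop :=
  ∀ x, (A.act x).comp M = M.comp (B.act x)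

/-- Two maps are `R_X`-chain homotopic: they differ by `∂H + H∂` for some `R_X`-linear `H`. -/
def RComplex.Homotopic (A B : RComplex X e) (f g : Mat A.toObj B.toObj) : Prop :=
  ∃ H : Mat A.toObj B.toObj, H.Bounded ∧ RComplex.Linear A B H ∧
    f - g = H.comp B.d + A.d.comp H

/-- `A ⊗ (R_X ⊗ Ξ_X)`.  The vector space `R_X` has as a basis the squarefree monomials, that is
the finite sets `Z ⊆ X`, and `Ξ_X` has as a basis the monomials `∏ ξ_x^{-n x}` for `n : X → ℕ`.
The variable `ξ_x` has homological grading `1`. -/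
def Obj.free (X : Type) [Fintype X] (A : Obj e) : Obj e where
  ι := A.ι × Finset X × (X → ℕ)
  fl i := A.fl i.1
  deg i := A.deg i.1 - ∑ x, (i.2.2 x : ℤ)

/-- `M ⊗ r ⊗ ξ`, where `r` and `ξ` are matrices of linear maps `R_X → R_X` and `Ξ_X → Ξ_X`. -/
def Mat.tens [Fintype X] {A B : Obj e} (M : Mat A B) (r : Finset X → Finset X → ZMod 2)
    (ξ : (X → ℕ) → (X → ℕ) → ZMod 2) : Mat (A.free X) (B.free X) :=
  fun i j => (r i.2.1 j.2.1 * ξ i.2.2 j.2.2) • M i.1 j.1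

/-- The matrix of an identity map. -/
def unitMat {α : Type} : α → α → ZMod 2 := fun i j => if i = j then 1 else 0

/-- Multiplication by `x` on `R_X`. -/
def mulR (x : X) : Finset X → Finset X → ZMod 2 :=
  fun Z Z' => if x ∉ Z ∧ Z' = insert x Z then 1 else 0

/-- Multiplication by `ξ_x` on `Ξ_X = ⨂_x 𝔽[ξ_x, ξ_x⁻¹]/ξ_x 𝔽[ξ_x]`: it lowers the exponent
`n x` by one, and is zero if `n x = 0`. -/
def mulXi (x : X) : (X → ℕ) → (X → ℕ) → ZMod 2 :=
  fun n n' => if n = n' + Pi.single x 1 then 1 else 0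

/-- The preferred free `R_X`-resolution of a complex with an `R_X`-action. -/
def RComplex.resolution [Fintype X] (A : RComplex X e) : RComplex X e where
  toObj := A.toObj.free X
  d := Mat.tens A.d unitMat unitMat
    + ∑ x, (Mat.tens (A.act x) unitMat (mulXi x)
      + Mat.tens (Mat.one A.toObj) (mulR x) (mulXi x))
  act x := Mat.tens (Mat.one A.toObj) (mulR x) unitMat

/-! ## Pointed tangle diagrams and their complexes -/

/-- A pointed tangle diagram with endpoints `e` and colours in `U`, cut into finitely many
segments `S`.

`C` is the set of crossings; the four segments at a crossing `c` are `cr c 0, …, cr c 3` in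
counterclockwise order, where `cr c 0` and `cr c 2` belong to the lower strand.

`P` is a set of points in the interior of the tangle at which two segments `pt p 0` and
`pt p 1` meet; `col p = some x` says that `p` is a basepoint of colour `x`, while
`col p = none` says that `p` is an unmarked point at which the strand has merely been cut.

`bd` gives the segment that ends at an endpoint. -/
structure Tangle (e U : Type) where
  S : Type
  C : Type
  P : Type
  [finS : Finite S]
  [finC : Finite C]
  [finP : Finite P]
  cr : C → Fin 4 → S
  pt : P → Fin 2 → S
  col : P → Option U
  bd : e → S

attribute [instance] Tangle.finS Tangle.finC Tangle.finP

namespace Tangle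

/-- The segment at every end of a segment. -/
def ends (T : Tangle e U) : (T.C × Fin 4) ⊕ (T.P × Fin 2) ⊕ e → T.S
  | .inl (c, i) => T.cr c i
  | .inr (.inl (p, i)) => T.pt p i
  | .inr (.inr q) => T.bd q

/-- Every segment has two ends, or is a closed circle without ends. -/
def WF (T : Tangle e U) : Prop := ∀ s, (T.ends ⁻¹' {s}).ncard = 0 ∨ (T.ends ⁻¹' {s}).ncard = 2

/-- All basepoints have colours in `X`. -/
def Pointed (T : Tangle e U) (X : Finset U) : Prop := ∀ p, ∀ x ∈ T.col p, x ∈ X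

inductive strandLink (T : Tangle e U) : T.S → T.S → Prop
  | pt (p : T.P) : T.col p = none → strandLink T (T.pt p 0) (T.pt p 1)

/-- Two segments lie on the same strand, where strands are cut at crossings and at
basepoints. -/
def SameStrand (T : Tangle e U) (s t : T.S) : Prop := Relation.EqvGen T.strandLink s t

/-- At a crossing the `0`-smoothing joins the ends `0, 1` and the ends `2, 3`, and the
`1`-smoothing joins the ends `1, 2` and the ends `3, 0`. -/
inductive resLink (T : Tangle e U) (ε : T.C → Bool) : T.S → T.S → Prop
  | pt (p : T.P) : resLink T ε (T.pt p 0) (T.pt p 1)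
  | zero₁ (c : T.C) : ε c = false → resLink T ε (T.cr c 0) (T.cr c 1)
  | zero₂ (c : T.C) : ε c = false → resLink T ε (T.cr c 2) (T.cr c 3)
  | one₁ (c : T.C) : ε c = true → resLink T ε (T.cr c 1) (T.cr c 2)
  | one₂ (c : T.C) : ε c = true → resLink T ε (T.cr c 3) (T.cr c 0)

/-- The `ε`-resolution. -/
def res (T : Tangle e U) (ε : T.C → Bool) : Flat e where
  S := T.S
  link := T.resLink ε
  bd := T.bd

/-- The objects of the cube of resolutions. -/
def cube (T : Tangle e U) : Obj e where
  ι := T.C → Bool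
  fl := T.res
  deg ε := {c | ε c = true}.ncard

/-- The basepoint action of a point on the segment `s`: the identity cobordism with a dot
at `s`. -/
def dot (T : Tangle e U) (s : T.S) : Mat T.cube T.cube := fun ε ε' =>
  if ε = ε' then (trace (T.res ε) (T.res ε') Eq ∅ {s}).toHom else 0

/-- The saddle cobordism at the crossing `c`. -/
def saddle (T : Tangle e U) (c : T.C) (ε ε' : T.C → Bool) : Hom (T.res ε) (T.res ε') :=
  (trace (T.res ε) (T.res ε') Eq {T.cr c 0} ∅).toHom

/-- Bar-Natan's complex of a tangle diagram, with the action in which `x` acts by the sum of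
the basepoint actions of the basepoints of colour `x`. -/
def CBN (T : Tangle e U) (X : Finset U) : RComplex X e where
  toObj := T.cube
  d := fun ε ε' => ∑ᶠ c : T.C,
    if ε c = false ∧ ε' = Function.update ε c true then T.saddle c ε ε' else 0
  act x := ∑ᶠ p : T.P, if T.col p = some x.1 then T.dot (T.pt p 0) else 0

/-- The enhanced invariant of an `X`-pointed tangle diagram. -/
def DBN (T : Tangle e U) (X : Finset U) : RComplex X e := (T.CBN X).resolution

/-- Put a tangle `L` into the hole of `E`.  Here `E` is a tangle diagram in an annulus, whose
inner endpoints are `h`, and whose outer endpoints are `e`. -/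
def fill [Finite h] (E : Tangle (h ⊕ e) U) (L : Tangle h U) : Tangle e U where
  S := L.S ⊕ E.S
  C := L.C ⊕ E.C
  P := (L.P ⊕ E.P) ⊕ h
  cr := Sum.elim (fun c i => .inl (L.cr c i)) (fun c i => .inr (E.cr c i))
  pt := Sum.elim (Sum.elim (fun p i => .inl (L.pt p i)) (fun p i => .inr (E.pt p i)))
    (fun q => ![.inl (L.bd q), .inr (E.bd (.inl q))])
  col := Sum.elim (Sum.elim L.col E.col) (fun _ => none)
  bd q := .inr (E.bd (.inr q))

end Tangle

inductive extLink (F : Flat (h ⊕ e)) (a b : Flat h) :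
    (a.S ⊕ b.S) ⊕ F.S → (a.S ⊕ b.S) ⊕ F.S → Prop
  | inner {s t : a.S ⊕ b.S} : circLink a b s t → extLink F a b (.inl s) (.inl t)
  | outer {s t : F.S} : F.link s t → extLink F a b (.inr s) (.inr t)
  | glue (q : h) : extLink F a b (.inl (.inl (a.bd q))) (.inr (F.bd (.inl q)))

/-- The surface obtained from a collection of dotted discs from `a` to `b` by gluing the product
of the outside `F` with `[0,1]` to it along the intervals `q × [0,1]` for `q : h`. -/
def extSurface (F : Flat (h ⊕ e)) (a b : Flat h) (V : Set (Circ a b)) (A B : Flat e)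
    (f : A.S → a.S ⊕ F.S) (g : B.S → b.S ⊕ F.S) : Surface A B where
  K := Quot (extLink F a b)
  χ k := ({q : Circ a b | ∃ s, Quot.mk _ s = q ∧ Quot.mk _ (Sum.inl s) = k}.ncard : ℤ)
    + {q : F.Comp | q ∈ F.arcs ∧ ∃ s, Quot.mk _ s = q ∧ Quot.mk _ (Sum.inr s) = k}.ncard
    - {q : h | Quot.mk _ (Sum.inl (Sum.inl (a.bd q))) = k}.ncard
  dots k := {q | q ∈ V ∧ ∃ s, Quot.mk _ s = q ∧ Quot.mk _ (Sum.inl s) = k}.ncard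
  bd := Sum.elim (fun s => Quot.mk _ (Sum.map Sum.inl _root_.id (f s)))
    (fun s => Quot.mk _ (Sum.map Sum.inr _root_.id (g s)))

/-- The map of cubes of resolutions which is `φ` in the hole and the identity outside. -/
def fillMap [Finite h] (E : Tangle (h ⊕ e) U) (L L' : Tangle h U) (φ : Mat L.cube L'.cube) :
    Mat (E.fill L).cube (E.fill L').cube := fun ε ε' =>
  if ∀ c : E.C, ε (.inr c) = ε' (.inr c) then
    ∑ᶠ V : Set (Circ (L.res fun c => ε (.inl c)) (L'.res fun c => ε' (.inl c))),
      φ (fun c => ε (.inl c)) (fun c => ε' (.inl c)) V •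
        (extSurface (E.res fun c => ε (.inr c)) _ _ V
          ((E.fill L).res ε) ((E.fill L').res ε') (fun s => s) (fun s => s)).toHom
  else 0

/-! ## Elementary movies -/

/-- The local models of the elementary movies.  `iso` is a planar isotopy (no local model).
The inverse Reidemeister III and slide movies, and the ones with other positions of the strands,
are the given ones in a rotated position. -/
inductive Kind (U : Type) : Type
  | iso
  /-- create a kink, whose `v`-smoothing has a circle -/
  | r1 (v : Bool)
  /-- undo a kink, whose `v`-smoothing has a circle -/
  | r1' (v : Bool)
  /-- create two crossings -/
  | r2
  /-- undo two crossings -/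
  | r2'
  /-- move a strand over a crossing, which is of one of two types -/
  | r3 (v : Bool)
  | birth
  | death
  | saddle
  /-- two neighbouring basepoints of the same colour annihilate -/
  | cap (x : U)
  /-- two neighbouring basepoints of the same colour are created -/
  | cup (x : U)
  /-- two neighbouring basepoints are swapped -/
  | swap (x y : U)
  /-- a basepoint slides through a crossing along the lower or (`v = true`) the upper strand -/
  | slide (x : U) (v : Bool)

/-- A tangle diagram given by explicit tables. -/
def table {n : ℕ} (s : ℕ) {c p : ℕ} (cr : Fin c → Fin 4 → Fin s) (pt : Fin p → Fin 2 → Fin s)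
    (col : Fin p → Option U) (bd : Fin n → Fin s) : Tangle (Fin n) U where
  S := Fin s
  C := Fin c
  P := Fin p
  cr := cr
  pt := pt
  col := col
  bd := bd

namespace Kind

/-- The number of endpoints of the local model; they are numbered counterclockwise. -/
def arity : Kind U → ℕ
  | iso | birth | death => 0
  | r1 _ | r1' _ | cap _ | cup _ | swap _ _ => 2
  | r2 | r2' | saddle | slide _ _ => 4
  | r3 _ => 6

/-- One arc. -/
def arc : Tangle (Fin 2) U := table 1 ![] ![] ![] ![0, 0]

/-- A kink, whose `v`-smoothing has a circle. -/
def kink : Bool → Tangle (Fin 2) U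
  | false => table 3 ![![0, 0, 1, 2]] ![] ![] ![1, 2]
  | true => table 3 ![![1, 0, 0, 2]] ![] ![] ![1, 2]

/-- Two disjoint arcs. -/
def arcs : Tangle (Fin 4) U := table 2 ![] ![] ![] ![0, 1, 1, 0]

/-- One arc crosses twice over another one. -/
def bigon : Tangle (Fin 4) U :=
  table 6 ![![1, 5, 4, 0], ![4, 5, 2, 3]] ![] ![] ![0, 1, 2, 3]

/-- An arc from `0` to `3` passes over two arcs, from `1` to `4` and from `2` to `5`, and on the
side of the endpoints `1, 2` of the crossing (number `2`) of those two. -/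
def triangle : Bool → Tangle (Fin 6) U
  | false => table 9 ![![1, 6, 7, 0], ![2, 3, 8, 6], ![7, 8, 4, 5]] ![] ![] ![0, 1, 2, 3, 4, 5]
  | true => table 9 ![![1, 6, 7, 0], ![2, 3, 8, 6], ![8, 4, 5, 7]] ![] ![] ![0, 1, 2, 3, 4, 5]

/-- The same, on the side of the endpoints `4, 5`. -/
def triangle' : Bool → Tangle (Fin 6) U
  | false => table 9 ![![7, 6, 5, 0], ![8, 3, 4, 6], ![1, 2, 8, 7]] ![] ![] ![0, 1, 2, 3, 4, 5]
  | true => table 9 ![![7, 6, 5, 0], ![8, 3, 4, 6], ![2, 8, 7, 1]] ![] ![] ![0, 1, 2, 3, 4, 5]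

/-- An arc with two basepoints. -/
def twoPoints (x y : U) : Tangle (Fin 2) U :=
  table 3 ![] ![![0, 1], ![1, 2]] ![some x, some y] ![0, 2]

/-- A crossing with a basepoint on its leg number `k`. -/
def leg (x : U) (k : Fin 4) : Tangle (Fin 4) U :=
  table 5 ![Function.update ![0, 1, 2, 3] k 4] ![![k.castSucc, 4]] ![some x] ![0, 1, 2, 3]

/-- The local model before the movie. -/
def src : (k : Kind U) → Tangle (Fin k.arity) U
  | iso | birth => table 0 ![] ![] ![] ![]
  | r1 _ => arc
  | r1' v => kink v
  | r2 => arcs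
  | r2' => bigon
  | r3 v => triangle v
  | death => table 1 ![] ![] ![] ![]
  | saddle => table 2 ![] ![] ![] ![0, 0, 1, 1]
  | cap x => twoPoints x x
  | cup _ => arc
  | swap x y => twoPoints x y
  | slide x v => leg x (if v then 1 else 0)

/-- The local model after the movie. -/
def tgt : (k : Kind U) → Tangle (Fin k.arity) U
  | iso | death => table 0 ![] ![] ![] ![]
  | r1 v => kink v
  | r1' _ => arc
  | r2 => bigon
  | r2' => arcs
  | r3 v => triangle' v
  | birth => table 1 ![] ![] ![] ![]
  | saddle => table 2 ![] ![] ![] ![0, 1, 1, 0]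
  | cap _ => arc
  | cup x => twoPoints x x
  | swap x y => twoPoints y x
  | slide x v => leg x (if v then 3 else 2)

/-- The nonzero components, all of them undotted discs, of the Reidemeister III map, obtained from
the Reidemeister II maps by viewing both sides as mapping cones over the crossing number `2`.
For `v = false` the `0`-smoothing of that crossing allows a Reidemeister II move, for `v = true`
the `1`-smoothing does. -/
def r3Entry (v : Bool) (ε ε' : Fin 3 → Bool) : Prop :=
  (ε 2 = v ∧ ε' 2 = v ∧ ε 0 ≠ ε 1 ∧ ε' 0 ≠ ε' 1) ∨
  (ε 2 = !v ∧ ε' 2 = !v ∧ ε 0 = ε' 0 ∧ ε 1 = ε' 1) ∨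
  (ε 2 = false ∧ ε' 2 = true ∧ if v
    then ε 1 = true ∧ ε' 0 = false ∧ ε' 1 = ε 0
    else ε 0 = true ∧ ε' 1 = false ∧ ε' 0 = ε 1)

/-- Bar-Natan's maps for the undecorated local movies; for the movies in which only the
basepoints move this is the identity. -/
def map : (k : Kind U) → Mat k.src.cube k.tgt.cube
  | iso | birth | death | saddle | cap _ | cup _ | swap _ _ => fun _ _ => disc _ _
  | r1 false => fun _ ε' => if ε' (0 : Fin 1) = false then tube _ _ else 0
  | r1 true => fun _ ε' => if ε' (0 : Fin 1) = true then disc _ _ else 0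
  | r1' false => fun ε _ => if ε (0 : Fin 1) = false then disc _ _ else 0
  | r1' true => fun ε _ => if ε (0 : Fin 1) = true then tube _ _ else 0
  | r2 => fun _ ε' => if ε' (0 : Fin 2) ≠ ε' (1 : Fin 2) then disc _ _ else 0
  | r2' => fun ε _ => if ε (0 : Fin 2) ≠ ε (1 : Fin 2) then disc _ _ else 0
  | r3 false => fun ε ε' => if r3Entry false ε ε' then disc _ _ else 0
  | r3 true => fun ε ε' => if r3Entry true ε ε' then disc _ _ else 0
  | slide _ _ => fun ε ε' => if ε (0 : Fin 1) = ε' (0 : Fin 1) then disc _ _ else 0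

/-- The colour of the sliding basepoint. -/
def slideCol : Kind U → Option U
  | slide x _ => some x
  | _ => none

/-- The basepoint sliding homotopy of the crossing of a slide movie: the saddle from the
`1`-smoothing to the `0`-smoothing. -/
def slideH : (k : Kind U) → Mat k.src.cube k.tgt.cube
  | slide _ _ => fun ε ε' =>
      if ε (0 : Fin 1) = true ∧ ε' (0 : Fin 1) = false then disc _ _ else 0
  | _ => 0

end Kind

/-- The data of an identification of two tangle diagrams. -/
structure Corr (T T' : Tangle e U) where
  c : T.C → T'.C → Prop
  s : T.S → T'.S → Prop

/-- The induced correspondence between strands. -/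
def Corr.Strand {T T' : Tangle e U} (f : Corr T T') (s : T.S) (s' : T'.S) : Prop :=
  ∃ t t', T.SameStrand s t ∧ f.s t t' ∧ T'.SameStrand t' s'

/-- `f` is a planar isotopy of pointed tangle diagrams: crossings, basepoints and strands
correspond bijectively, compatibly with the endpoints, the colours, and the cyclic order and the
lower strand at each crossing (which is preserved by rotations by two steps). -/
structure Corr.IsIso {T T' : Tangle e U} (f : Corr T T') : Prop where
  cr_left : ∀ c, ∃! c', f.c c c'
  cr_right : ∀ c', ∃! c, f.c c c'
  s_left : ∀ s, ∃ s', f.Strand s s'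
  s_right : ∀ s', ∃ s, f.Strand s s'
  s_iff : ∀ s t s' t', f.s s s' → f.s t t' → (T.SameStrand s t ↔ T'.SameStrand s' t')
  bd : ∀ q, f.Strand (T.bd q) (T'.bd q)
  cr : ∀ c c', f.c c c' →
    (∀ i, f.Strand (T.cr c i) (T'.cr c' i)) ∨ (∀ i, f.Strand (T.cr c i) (T'.cr c' (i + 2)))
  pt : ∃ σ : {p // T.col p ≠ none} ≃ {p // T'.col p ≠ none}, ∀ p, T'.col (σ p) = T.col p ∧
    ((∀ i, f.Strand (T.pt p i) (T'.pt (σ p) i)) ∨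
      (∀ i, f.Strand (T.pt p i) (T'.pt (σ p) (i + 1))))

/-- The map of cubes of resolutions induced by a planar isotopy. -/
def Corr.cyl {T T' : Tangle e U} (f : Corr T T') : Mat T.cube T'.cube := fun ε ε' =>
  if ∀ c c', f.c c c' → ε c = ε' c' then (trace (T.res ε) (T'.res ε') f.s ∅ ∅).toHom else 0

/-- An elementary movie from `T` to `T'`: a planar isotopy from `T` to a diagram that consists of
a local model and its outside `E`, then the local movie (with the outside vertical), then another
planar isotopy. -/
structure Step (T T' : Tangle e U) where
  kind : Kind U
  E : Tangle (Fin kind.arity ⊕ e) U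
  before : Corr T (E.fill kind.src)
  after : Corr (E.fill kind.tgt) T'

structure Step.IsElementary {T T' : Tangle e U} (m : Step T T') : Prop where
  wf : m.E.WF
  before : m.before.IsIso
  after : m.after.IsIso

/-- `M ⊗ Id ⊗ Id` on the preferred free resolutions. -/
def lift (X : Finset U) {T T' : Tangle e U} (M : Mat T.cube T'.cube) :
    Mat (T.DBN X).toObj (T'.DBN X).toObj :=
  Mat.tens M unitMat unitMat

/-- `H ⊗ Id ⊗ ξ_y` on the preferred free resolutions. -/
def liftXi (X : Finset U) (y : X) {T T' : Tangle e U} (H : Mat T.cube T'.cube) :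
    Mat (T.DBN X).toObj (T'.DBN X).toObj :=
  Mat.tens H unitMat (mulXi y)

/-- The map of an elementary movie: the undecorated map tensored with the identity and, for a
slide movie of colour `y`, additionally `H ⊗ Id ⊗ ξ_y`. -/
def Step.DBN (X : Finset U) {T T' : Tangle e U} (m : Step T T') :
    Mat (T.DBN X).toObj (T'.DBN X).toObj :=
  ((lift X m.before.cyl).comp
    (lift X (fillMap m.E _ _ m.kind.map) +
      ∑ y : X, if m.kind.slideCol = some y.1
        then liftXi X y (fillMap m.E _ _ m.kind.slideH) else 0)).comp
    (lift X m.after.cyl)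

/-- Movies: compositions of elementary movies. -/
inductive Movie {e U : Type} : Tangle e U → Tangle e U → Type 1
  | nil (T : Tangle e U) : Movie T T
  | cons {T T' T'' : Tangle e U} (m : Step T T') (M : Movie T' T'') : Movie T T''

/-- `M` is a movie of an `X`-decorated tangle cobordism. -/
def Movie.IsDecorated (X : Finset U) {T T' : Tangle e U} : Movie T T' → Prop
  | nil T => T.WF ∧ T.Pointed X
  | cons (T := T) m M => T.WF ∧ T.Pointed X ∧ m.IsElementary ∧ M.IsDecorated X

/-- The map of a movie. -/
def Movie.DBN (X : Finset U) {T T' : Tangle e U} :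
    Movie T T' → Mat (T.DBN X).toObj (T'.DBN X).toObj
  | nil T => lift X (Mat.one T.cube)
  | cons m M => (m.DBN X).comp (M.DBN X)

/-! ## Gluing -/

/-- An arc diagram with input endpoints `e i` and output endpoints `o`: a collection of arcs and
circles outside of the input discs. -/
structure ArcDiagram {I : Type} (e : I → Type) (o : Type) where
  S : Type
  [fin : Finite S]
  bd : (Σ i, e i) ⊕ o → S

attribute [instance] ArcDiagram.fin

namespace ArcDiagram

variable {I : Type} [Finite I] {e : I → Type} [∀ i, Finite (e i)]

/-- Every component is an arc with two endpoints or a circle without endpoints. -/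
def WF (D : ArcDiagram e o) : Prop :=
  ∀ s, (D.bd ⁻¹' {s}).ncard = 0 ∨ (D.bd ⁻¹' {s}).ncard = 2

/-- Put tangles into the input discs. -/
def glue (D : ArcDiagram e o) (T : ∀ i, Tangle (e i) U) : Tangle o U where
  S := (Σ i, (T i).S) ⊕ D.S
  C := Σ i, (T i).C
  P := (Σ i, (T i).P) ⊕ (Σ i, e i)
  cr c k := .inl ⟨c.1, (T c.1).cr c.2 k⟩
  pt := Sum.elim (fun p k => .inl ⟨p.1, (T p.1).pt p.2 k⟩)
    (fun q => ![.inl ⟨q.1, (T q.1).bd q.2⟩, .inr (D.bd (.inl q))])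
  col := Sum.elim (fun p => (T p.1).col p.2) (fun _ => none)
  bd q := .inr (D.bd (.inr q))

variable {T T' : ∀ i, Tangle (e i) U}

/-- The outside of the local model of the `i₀`-th elementary movie after gluing. -/
def outside (D : ArcDiagram e o) (i₀ : I) (m : ∀ i, Step (T i) (T' i)) :
    Tangle (Fin (m i₀).kind.arity ⊕ o) U where
  S := (Σ i, (m i).E.S) ⊕ D.S
  C := Σ i, (m i).E.C
  P := (Σ i, (m i).E.P) ⊕ (Σ i, e i)
  cr c k := .inl ⟨c.1, (m c.1).E.cr c.2 k⟩
  pt := Sum.elim (fun p k => .inl ⟨p.1, (m p.1).E.pt p.2 k⟩)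
    (fun q => ![.inl ⟨q.1, (m q.1).E.bd (.inr q.2)⟩, .inr (D.bd (.inl q))])
  col := Sum.elim (fun p => (m p.1).E.col p.2) (fun _ => none)
  bd := Sum.elim (fun q => .inl ⟨i₀, (m i₀).E.bd (.inl q)⟩) (fun q => .inr (D.bd (.inr q)))

section

variable (D : ArcDiagram e o) (i₀ : I) (m : ∀ i, Step (T i) (T' i))

inductive beforeC : (D.glue T).C → ((D.outside i₀ m).fill (m i₀).kind.src).C → Prop
  | hole {c c'} : (m i₀).before.c c (.inl c') → beforeC ⟨i₀, c⟩ (.inl c')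
  | part {i c c'} : (m i).before.c c (.inr c') → beforeC ⟨i, c⟩ (.inr ⟨i, c'⟩)

inductive beforeS : (D.glue T).S → ((D.outside i₀ m).fill (m i₀).kind.src).S → Prop
  | hole {s s'} : (m i₀).before.s s (.inl s') → beforeS (.inl ⟨i₀, s⟩) (.inl s')
  | part {i s s'} : (m i).before.s s (.inr s') → beforeS (.inl ⟨i, s⟩) (.inr (.inl ⟨i, s'⟩))
  | arc (s) : beforeS (.inr s) (.inr (.inr s))

inductive afterC : ((D.outside i₀ m).fill (m i₀).kind.tgt).C → (D.glue T').C → Prop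
  | hole {c c'} : (m i₀).after.c (.inl c) c' → afterC (.inl c) ⟨i₀, c'⟩
  | part {i c c'} : (m i).after.c (.inr c) c' → afterC (.inr ⟨i, c⟩) ⟨i, c'⟩

inductive afterS : ((D.outside i₀ m).fill (m i₀).kind.tgt).S → (D.glue T').S → Prop
  | hole {s s'} : (m i₀).after.s (.inl s) s' → afterS (.inl s) (.inl ⟨i₀, s'⟩)
  | part {i s s'} : (m i).after.s (.inr s) s' → afterS (.inr (.inl ⟨i, s⟩)) (.inl ⟨i, s'⟩)
  | arc (s) : afterS (.inr (.inr s)) (.inr s)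

/-- Gluing of elementary movies, all of which are planar isotopies except possibly the
`i₀`-th one. -/
def glueStep : Step (D.glue T) (D.glue T') where
  kind := (m i₀).kind
  E := D.outside i₀ m
  before := ⟨beforeC D i₀ m, beforeS D i₀ m⟩
  after := ⟨afterC D i₀ m, afterS D i₀ m⟩

end

end ArcDiagram

/-- A family of movies from `T i` to `T' i`, for `i : I`, that run simultaneously in such a way
that at any time at most one of them (the `i₀`-th one) is not a planar isotopy; in other words,
a family of movies together with the relative timing of their elementary movies.  Since the
identity is a planar isotopy, an elementary movie can happen in one of the tangles while the
others stay in place. -/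
inductive JointMovie {I : Type} {e : I → Type} {U : Type} :
    (∀ i, Tangle (e i) U) → (∀ i, Tangle (e i) U) → Type 1
  | nil (T : ∀ i, Tangle (e i) U) : JointMovie T T
  | cons {T T' T'' : ∀ i, Tangle (e i) U} (i₀ : I) (m : ∀ i, Step (T i) (T' i))
      (iso : ∀ i, i ≠ i₀ → (m i).kind = .iso) (M : JointMovie T' T'') : JointMovie T T''

namespace JointMovie

variable {I : Type} {e : I → Type} {T T' : ∀ i, Tangle (e i) U}

/-- The `i`-th movie. -/
def movie {T T' : ∀ i, Tangle (e i) U} : JointMovie T T' → ∀ i, Movie (T i) (T' i)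
  | nil T, i => .nil (T i)
  | cons _ m _ M, i => .cons (m i) (M.movie i)

/-- The movie obtained by gluing. -/
def glue [Finite I] [∀ i, Finite (e i)] (D : ArcDiagram e o) {T T' : ∀ i, Tangle (e i) U} :
    JointMovie T T' → Movie (D.glue T) (D.glue T')
  | nil T => .nil (D.glue T)
  | cons i₀ m _ M => .cons (D.glueStep i₀ m) (M.glue D)

end JointMovie

end BarNatan

end

noncomputable section

open Classical

set_option linter.unusedSectionVars false

open Finset (sum_congr sum_add_distrib sum_eq_zero sum_comm sum_eq_single)
open Function (update update_self update_of_ne)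

namespace BarNatan

section
instance (priority := low) fintypeOfFinite (N : Type) [Finite N] : Fintype N := .ofFinite N

theorem fsum_eq {N M : Type} [Fintype N] [AddCommMonoid M] (f : N → M) : ∑ᶠ n, f n = ∑ n, f n :=
  finsum_eq_sum_of_fintype f

/-- The sum of `w` over the fibres of `f`. -/
def push {N K M : Type} [AddCommMonoid M] [Finite N] (f : N → K) : (N → M) →+ (K → M) where
  toFun w k := ∑ᶠ n, if f n = k then w n else 0
  map_zero' := by ext; simp
  map_add' v w := by
    ext k
    simp only [fsum_eq, Pi.add_apply, ← sum_add_distrib]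
    refine sum_congr rfl fun n _ => ?_
    split_ifs <;> simp

section push

variable {N K L M : Type} [AddCommMonoid M] [Finite N]

theorem push_apply (f : N → K) (w : N → M) (k : K) :
  push f w k = ∑ᶠ n, if f n = k then w n else 0 := rfl

theorem push_eq [Fintype N] (f : N → K) (w : N → M) (k : K) :
  push f w k = ∑ n, if f n = k then w n else 0 := fsum_eq _

theorem push_push [Finite K] (f : N → K) (g : K → L) (w : N → M) :
  push g (push f w) = push (g ∘ f) w := by
  ext l
  simp only [push_eq, Function.comp]
  have : ∀ k, (if g k = l then ∑ n, if f n = k then w n else 0 else 0)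
      = ∑ n, if f n = k then (if g k = l then w n else 0) else 0 := by
    intro k; split_ifs <;> simp
  simp only [this]
  rw [sum_comm]
  simp

theorem push_single (f : N → K) (n : N) (w : M) : push f (Pi.single n w) = Pi.single (f n) w := by
  ext k
  rw [push_eq, sum_eq_single n]
  · simp [Pi.single_apply, eq_comm]
  · intro m _ h; simp [h]
  · simp

theorem push_comp_apply {φ : K → L} (hφ : φ.Injective) (f : N → K) (w : N → M) (k : K) :
  push (φ ∘ f) w (φ k) = push f w k := by
  simp [push_apply, hφ.eq_iff]

theorem push_eq_zero (f : N → K) (w : N → M) (k : K) (h : ∀ n, f n ≠ k) : push f w k = 0 := by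
  simp [push_apply, h]

theorem push_of_injective {f : N → K} (hf : f.Injective) (w : N → M) (n : N) :
  push f w (f n) = w n := by
  simp [push_eq, hf.eq_iff]

@[simp] theorem push_id (w : N → M) : push (fun n : N => n) w = w := by
  ext n; exact push_of_injective (f := fun n : N => n) (fun _ _ h => h) w n

theorem push_sum {N' : Type} [Finite N'] (f : N ⊕ N' → K) (w : N ⊕ N' → M) :
  push f w = push (fun n => f (.inl n)) (fun n => w (.inl n))
    + push (fun n => f (.inr n)) (fun n => w (.inr n)) := by
  ext k
  simp [push_eq]

theorem push_inl {N' : Type} (f : N → K) (w : N → M) (n : K) :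
  push (fun n => (Sum.inl (f n) : K ⊕ N')) w (.inl n) = push f w n :=
  push_comp_apply Sum.inl_injective f w n

theorem push_inr {N' : Type} (f : N → K) (w : N → M) (n : K) :
  push (fun n => (Sum.inr (f n) : N' ⊕ K)) w (.inr n) = push f w n :=
  push_comp_apply Sum.inr_injective f w n

theorem push_map_inl {N' K' : Type} [Finite N'] (f : N → K) (g : N' → K') (w : N ⊕ N' → M)
  (k : K) : push (Sum.map f g) w (.inl k) = push f (fun n => w (.inl n)) k := by
  rw [push_sum]
  simp only [Sum.map_inl, Sum.map_inr, Pi.add_apply]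
  rw [push_inl, push_eq_zero _ _ _ (fun n => Sum.inr_ne_inl), add_zero]

theorem push_map_inr {N' K' : Type} [Finite N'] (f : N → K) (g : N' → K') (w : N ⊕ N' → M)
  (k : K') : push (Sum.map f g) w (.inr k) = push g (fun n => w (.inr n)) k := by
  rw [push_sum]
  simp only [Sum.map_inl, Sum.map_inr, Pi.add_apply]
  rw [push_inr, push_eq_zero _ _ _ (fun n => Sum.inl_ne_inr), zero_add]

theorem push_equiv {N' : Type} [Finite N'] (e : N' ≃ N) (f : N → K) (w : N → M) :
  push (f ∘ e) (w ∘ e) = push f w := by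
  ext k
  simp only [push_eq, Function.comp]
  exact Fintype.sum_equiv e _ _ fun _ => rfl

end push

theorem push_sigma_apply {I M : Type} {N K : I → Type} [AddCommMonoid M] [Finite I]
  [∀ i, Finite (N i)] (f : ∀ i, N i → K i) (w : (Σ i, N i) → M) (i : I) (k : K i) :
  push (fun n : Σ i, N i => (⟨n.1, f n.1 n.2⟩ : Σ i, K i)) w ⟨i, k⟩
    = push (f i) (fun n => w ⟨i, n⟩) k := by
  simp only [push_eq, Fintype.sum_sigma]
  rw [sum_eq_single i]
  · refine sum_congr rfl fun n _ => ?_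
    by_cases h : f i n = k <;> simp [h]
  · intro j _ hj
    refine sum_eq_zero fun n _ => ?_
    rw [if_neg]
    intro h
    exact hj (congrArg Sigma.fst h)
  · simp

theorem push_fiber {I M L : Type} {N K : I → Type} [AddCommMonoid M] [Finite I] [∀ i, Finite (N i)]
  [∀ i, Finite (K i)] (f : ∀ i, N i → K i) (α : ∀ i, K i → L) (w : ∀ i, N i → M) :
  push (fun k : Σ i, K i => α k.1 k.2) (fun k => push (f k.1) (w k.1) k.2)
    = push (fun n : Σ i, N i => α n.1 (f n.1 n.2)) fun n => w n.1 n.2 :=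
  (congrArg _ (funext fun k : Σ i, K i => (push_sigma_apply f (fun n => w n.1 n.2) k.1 k.2).symm)).trans (push_push _ _ _)

theorem push_fun_add {N K M : Type} [AddCommMonoid M] [Finite N] (f : N → K) (v w : N → M) :
  push f (fun n => v n + w n) = push f v + push f w := map_add _ v w

theorem push_fun_sub {N K M : Type} [AddCommGroup M] [Finite N] (f : N → K) (v w : N → M) :
  push f (fun n => v n - w n) = push f v - push f w := map_sub _ v w

theorem push_fun_nsmul {N K M : Type} [AddCommMonoid M] [Finite N] (f : N → K) (m : ℕ) (w : N → M) :
  push f (fun n => m • w n) = m • push f w := map_nsmul _ m w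

/-- The number of elements of the fibres. -/
def cnt {N K : Type} [Finite N] (f : N → K) : K → ℤ := push f 1

section cnt

variable {N N' K L : Type} [Finite N] [Finite N']

theorem cnt_eq_ncard (f : N → K) (k : K) : cnt f k = ({n | f n = k}.ncard : ℤ) := by
  rw [cnt, push_eq, Set.ncard_eq_toFinset_card']
  simp

theorem push_cnt [Finite K] (f : N → K) (g : K → L) : push g (cnt f) = cnt (g ∘ f) :=
  push_push f g 1

theorem cnt_comp_apply {φ : K → L} (hφ : φ.Injective) (f : N → K) (k : K) :
  cnt (φ ∘ f) (φ k) = cnt f k := push_comp_apply hφ f 1 k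

theorem cnt_sum (f : N ⊕ N' → K) :
  cnt f = cnt (fun n => f (.inl n)) + cnt (fun n => f (.inr n)) := push_sum f 1

theorem cnt_equiv (e : N' ≃ N) (f : N → K) : cnt (f ∘ e) = cnt f := push_equiv e f 1

theorem cnt_nonneg (f : N → K) (k : K) : 0 ≤ cnt f k := by
  rw [cnt_eq_ncard]; positivity

theorem cnt_of_isEmpty [IsEmpty N] (f : N → K) : cnt f = 0 := by
  ext k; exact push_eq_zero _ _ _ fun n => (IsEmpty.false n).elim

theorem cnt_of_injective {f : N → K} (hf : f.Injective) (n : N) : cnt f (f n) = 1 :=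
  push_of_injective hf 1 n

end cnt

theorem cnt_sigma_apply {I : Type} {N K : I → Type} [Finite I]
  [∀ i, Finite (N i)] (f : ∀ i, N i → K i) (i : I) (k : K i) :
  cnt (fun n : Σ i, N i => (⟨n.1, f n.1 n.2⟩ : Σ i, K i)) ⟨i, k⟩ = cnt (f i) k :=
  push_sigma_apply f 1 i k

theorem cnt_fiber {I L : Type} {N K : I → Type} [Finite I] [∀ i, Finite (N i)] [∀ i, Finite (K i)]
  (f : ∀ i, N i → K i) (α : ∀ i, K i → L) : push (fun k : Σ i, K i => α k.1 k.2) (fun k => cnt (f k.1) k.2)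
    = cnt fun n : Σ i, N i => α n.1 (f n.1 n.2) := push_fiber f α fun _ => 1

def ind {C : Type} (V : Set C) : C → ℕ := fun c => if c ∈ V then 1 else 0

theorem push_ind {N K : Type} [Finite N] (f : N → K) (V : Set N) (k : K) :
  push f (ind V) k = {n | n ∈ V ∧ f n = k}.ncard := by
  rw [push_eq, Set.ncard_eq_toFinset_card']
  simp only [ind, ← ite_and]
  simp [and_comm]

/-! ## Evaluation of closed surfaces and neck cutting -/

/-- The value of a closed dotted surface whose components have doubled Euler characteristics `X`
and numbers of dots `δ`. -/
def ev (R : Type) [CommRing R] {K : Type} (X : K → ℤ) (δ : K → ℕ) : R :=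
  if ∀ k, X k = 4 ∧ δ k = 1 then 1 else 0

section cut

variable {R : Type} [CommRing R] [CharP R 2]

theorem cut_one {P K : Type} [Finite P] (π : P → K) (surj : π.Surjective) (u v : P)
  (hπ : ∀ x y, π x = π y ↔ x = y ∨ (x = u ∧ y = v) ∨ (x = v ∧ y = u))
  (X : P → ℤ) (hX : ∀ p, X p ≤ 4) (δ : P → ℕ) :
  ev R X (δ + Pi.single u 1) + ev R X (δ + Pi.single v 1)
    = ev R (push π X - Pi.single (π u) 4) (push π δ) ∧
  ∀ k, (push π X - Pi.single (π u) 4 : K → ℤ) k ≤ 4 := by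
  by_cases huv : u = v
  · subst huv
    have inj : π.Injective := fun x y h => by
      rcases (hπ x y).1 h with h | ⟨rfl, rfl⟩ | ⟨rfl, rfl⟩ <;> simp_all
    constructor
    · rw [CharTwo.add_self_eq_zero, ev, if_neg]
      intro h
      have := (h (π u)).1
      rw [Pi.sub_apply, push_of_injective inj, Pi.single_eq_same] at this
      linarith [hX u]
    · intro k
      obtain ⟨p, rfl⟩ := surj k
      rw [Pi.sub_apply, push_of_injective inj]
      by_cases h : π p = π u
      · rw [h, Pi.single_eq_same]; linarith [hX p]
      · rw [Pi.single_eq_of_ne h]; linarith [hX p]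
  · have huv' : π u = π v := (hπ u v).2 (by simp)
    have key : ∀ {M : Type} [AddCommMonoid M] (w : P → M) (p : P),
        push π w (π p) = if p = u ∨ p = v then w u + w v else w p := by
      intro M _ w p
      rw [push_eq]
      split_ifs with h
      · have : ∀ n, (if π n = π p then w n else 0) =
            (if n = u then w n else 0) + (if n = v then w n else 0) := by
          intro n
          have : π n = π p ↔ n = u ∨ n = v := by
            rw [hπ]; rcases h with rfl | rfl <;> grind
          by_cases h1 : n = u
          · subst h1; simp [this, huv]
          · by_cases h2 : n = v
            · subst h2; simp [this, h1]
            · simp [this, h1, h2]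
        simp only [this, sum_add_distrib, Finset.sum_ite_eq', Finset.mem_univ, if_true]
      · have : ∀ n, (if π n = π p then w n else 0) = (if n = p then w n else 0) := by
          intro n
          have : π n = π p ↔ n = p := by
            rw [hπ]; grind
          simp [this]
        simp [this]
    have hsing : ∀ p, (Pi.single (π u) (4 : ℤ) : K → ℤ) (π p) = if p = u ∨ p = v then 4 else 0 := by
      intro p
      have : π p = π u ↔ p = u ∨ p = v := by rw [hπ]; grind
      rw [Pi.single_apply]; simp [this]
    have hR : (∀ k, (push π X - Pi.single (π u) 4 : K → ℤ) k = 4 ∧ push π δ k = 1) ↔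
        (∀ p, p ≠ u → p ≠ v → X p = 4 ∧ δ p = 1) ∧ X u = 4 ∧ X v = 4 ∧ δ u + δ v = 1 := by
      rw [surj.forall]
      simp only [Pi.sub_apply, key, hsing]
      constructor
      · intro h
        have h1 := h u
        simp at h1
        refine ⟨fun p h1 h2 => by simpa [h1, h2] using h p, ?_, ?_, h1.2⟩ <;>
          linarith [hX u, hX v]
      · rintro ⟨h1, h2, h3, h4⟩ p
        by_cases hp : p = u ∨ p = v
        · simp [hp, h2, h3, h4]
        · push Not at hp
          simpa [hp] using h1 p hp.1 hp.2
    have hL : ∀ a b, a ≠ b → (a = u ∨ a = v) → (b = u ∨ b = v) →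
        ((∀ p, X p = 4 ∧ (δ + Pi.single a 1 : P → ℕ) p = 1) ↔
        (∀ p, p ≠ u → p ≠ v → X p = 4 ∧ δ p = 1) ∧ X u = 4 ∧ X v = 4 ∧ δ a = 0 ∧ δ b = 1) := by
      intro a b hab ha hb
      constructor
      · intro h
        refine ⟨fun p h1 h2 => ?_, (h u).1, (h v).1, ?_, ?_⟩
        · have := h p
          rwa [Pi.add_apply, Pi.single_eq_of_ne, add_zero] at this
          rcases ha with rfl | rfl <;> assumption
        · have := (h a).2
          simpa using this
        · have := (h b).2
          rwa [Pi.add_apply, Pi.single_eq_of_ne hab.symm, add_zero] at this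
      · rintro ⟨h1, h2, h3, h4, h5⟩ p
        by_cases hpa : p = a
        · subst hpa; simp [h4]; grind
        · rw [Pi.add_apply, Pi.single_eq_of_ne hpa, add_zero]
          by_cases hpb : p = b
          · subst hpb; grind
          · exact h1 p (by grind) (by grind)
    constructor
    · simp only [ev, hR, hL u v huv (by simp) (by simp), hL v u (Ne.symm huv) (by simp) (by simp)]
      by_cases hA : (∀ p, p ≠ u → p ≠ v → X p = 4 ∧ δ p = 1) ∧ X u = 4 ∧ X v = 4
      · obtain ⟨h1, h2, h3⟩ := hA
        simp only [eq_true h1, h2, h3, true_and]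
        by_cases h : δ u + δ v = 1
        · rw [if_pos h]
          have : (δ u = 0 ∧ δ v = 1) ∨ (δ u = 1 ∧ δ v = 0) := by omega
          rcases this with ⟨h, h'⟩ | ⟨h, h'⟩ <;> simp [h, h']
        · rw [if_neg h, if_neg (by omega), if_neg (by omega), add_zero]
      · rw [if_neg (by tauto), if_neg (by tauto), if_neg (by tauto), add_zero]
    · intro k
      obtain ⟨p, rfl⟩ := surj k
      rw [Pi.sub_apply, key, hsing]
      split_ifs
      · linarith [hX u, hX v]
      · linarith [hX p]

theorem finsum_set_option {C M : Type} [Finite C] [AddCommMonoid M] (F : Set (Option C) → M) :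
  ∑ᶠ V, F V = ∑ᶠ V : Set C, (F {x | ∃ c ∈ V, some c = x} + F {x | ∀ c, x = some c → c ∈ V}) := by
  have e : ∑ᶠ V, F V = ∑ᶠ p : Prop × (C → Prop), F ((Equiv.piOptionEquivProd (β := fun _ : Option C => Prop)).symm p) :=
    finsum_comp_equiv (Equiv.piOptionEquivProd (β := fun _ : Option C => Prop)).symm (f := F) |>.symm
  rw [e, fsum_eq, Fintype.sum_prod_type, Fintype.univ_Prop,
    Finset.sum_insert (by simp), Finset.sum_singleton, add_comm, ← sum_add_distrib,
    ← fsum_eq]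
  refine finsum_congr fun V => ?_
  congr 2
  · ext x; cases x with
    | none => simp only [Set.mem_ofPred_eq, reduceCtorEq, and_false, exists_false, iff_false]; exact id
    | some c => simp only [Set.mem_ofPred_eq, Option.some.injEq, exists_eq_right]; exact Iff.rfl
  · ext x; cases x with
    | none => simp only [Set.mem_ofPred_eq, reduceCtorEq, false_imp_iff, implies_true, iff_true]; exact trivial
    | some c => simp only [Set.mem_ofPred_eq, Option.some.injEq, forall_eq']; exact Iff.rfl

/-- Neck cutting along the circles `C`; the two sides of `c` lie on the pieces `l c` and `r c`. -/
theorem cut {P : Type} [Finite P] (X : P → ℤ) (hX : ∀ p, X p ≤ 4) {C : Type} [Finite C]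
  (l r : C → P) {K : Type} (π : P → K) (surj : π.Surjective)
  (hπ : ∀ x y, π x = π y ↔ Relation.EqvGen (fun a b => ∃ c, l c = a ∧ r c = b) x y)
  (δ : P → ℕ) :
  (∑ᶠ V : Set C, ev R X (δ + push l (ind Vᶜ) + push r (ind V)))
    = ev R (push π X - 4 • cnt (π ∘ l)) (push π δ) ∧
  ∀ k, (push π X - 4 • cnt (π ∘ l) : K → ℤ) k ≤ 4 := by
  refine Finite.induction_empty_option (P := fun C => ∀ [Finite C] (l r : C → P) {K : Type}
    (π : P → K) (_ : π.Surjective)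
    (_ : ∀ x y, π x = π y ↔ Relation.EqvGen (fun a b => ∃ c, l c = a ∧ r c = b) x y)
    (δ : P → ℕ),
    (∑ᶠ V : Set C, ev R X (δ + push l (ind Vᶜ) + push r (ind V)))
      = ev R (push π X - 4 • cnt (π ∘ l)) (push π δ) ∧
    ∀ k, (push π X - 4 • cnt (π ∘ l) : K → ℤ) k ≤ 4) ?_ ?_ ?_ C l r π surj hπ δ
  · intro C' C e ih _ l r K π surj hπ δ
    have := Finite.of_equiv _ e.symm
    have := ih (l ∘ e) (r ∘ e) π surj (by
      intro x y
      rw [hπ]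
      have : (fun a b => ∃ c, l c = a ∧ r c = b) = (fun a b => ∃ c, (l ∘ e) c = a ∧ (r ∘ e) c = b) := by
        ext a b
        simp [e.surjective.exists]
      rw [this]) δ
    rw [← Function.comp_assoc, cnt_equiv e] at this
    refine ⟨?_, this.2⟩
    rw [← this.1, ← finsum_comp_equiv (Equiv.Set.congr e)]
    refine finsum_congr fun V => ?_
    have h1 : ind (Equiv.Set.congr e V) ∘ e = ind V := by
      ext c; simp [ind]
    have h2 : ind (Equiv.Set.congr e V)ᶜ ∘ e = ind Vᶜ := by
      ext c; simp [ind]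
    rw [← h1, ← h2, push_equiv, push_equiv]
  · intro _ l r K π surj hπ δ
    have inj : π.Injective := fun x y h => by
      rw [hπ] at h
      induction h with
      | rel _ _ h => obtain ⟨c, _⟩ := h; exact c.elim
      | refl => rfl
      | symm _ _ _ h => exact h.symm
      | trans _ _ _ _ _ h h' => exact h.trans h'
    have h0 : (push π X - 4 • cnt (π ∘ l) : K → ℤ) = push π X := by
      rw [cnt_of_isEmpty]; simp
    rw [h0]
    constructor
    · rw [fsum_eq, Fintype.sum_unique]
      have h1 : ∀ f : PEmpty → P, ∀ w : PEmpty → ℕ, push f w = 0 := fun f w => by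
        ext; exact push_eq_zero _ _ _ fun n => n.elim
      rw [h1, h1, add_zero, add_zero, ev, ev]
      congr 1
      rw [surj.forall]
      simp only [push_of_injective inj]
    · rw [surj.forall]
      simpa only [push_of_injective inj] using hX
  · intro C _ ih _ l r K π surj hπ δ
    let ρ : P → P → Prop := fun a b => ∃ c : C, l (some c) = a ∧ r (some c) = b
    let π₀ : P → Quot ρ := Quot.mk ρ
    have hfac : ∀ x y, ρ x y → π x = π y := fun x y ⟨c, h⟩ =>
      (hπ x y).2 (.rel _ _ ⟨some c, h⟩)
    let ψ : Quot ρ → K := Quot.lift π hfac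
    have hψ : ψ ∘ π₀ = π := rfl
    have ih' := fun δ => ih (fun c => l (some c)) (fun c => r (some c)) π₀ Quot.mk_surjective
      (fun x y => Quot.eq) δ
    have hone := fun δ => cut_one (R := R) ψ (Function.Surjective.of_comp (g := π₀) surj)
      (π₀ (l none)) (π₀ (r none)) (by
        intro x y
        obtain ⟨x, rfl⟩ := Quot.mk_surjective x
        obtain ⟨y, rfl⟩ := Quot.mk_surjective y
        constructor
        · intro h
          have h' : π x = π y := h
          rw [hπ] at h'
          clear h
          induction h' with
          | rel a b h =>
            obtain ⟨c, rfl, rfl⟩ := h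
            cases c with
            | none => simp [π₀]
            | some c => exact .inl (Quot.sound ⟨c, rfl, rfl⟩)
          | refl => simp
          | symm _ _ _ h => tauto
          | trans _ _ _ _ _ h h' => grind
        · have h0 : ψ (π₀ (l none)) = ψ (π₀ (r none)) :=
            (hπ _ _).2 (.rel _ _ ⟨none, rfl, rfl⟩)
          rintro (h | ⟨h, h'⟩ | ⟨h, h'⟩)
          · rw [h]
          · rw [h, h', h0]
          · rw [h, h', h0])
      (push π₀ X - 4 • cnt (fun c => π₀ (l (some c)))) (ih' 0).2 δ
    have hXX : push ψ (push π₀ X - 4 • cnt (fun c => π₀ (l (some c))))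
        - Pi.single (ψ (π₀ (l none))) (4 : ℤ) = push π X - 4 • cnt (π ∘ l) := by
      rw [map_sub, push_push, hψ, map_nsmul, push_cnt, sub_sub]
      congr 1
      have : cnt (π ∘ l) = cnt (ψ ∘ fun c => π₀ (l (some c))) + Pi.single (ψ (π₀ (l none))) 1 := by
        ext k
        simp only [cnt, push_eq, Fintype.sum_option, Pi.add_apply, Pi.single_apply]
        rw [add_comm]
        congr 1
        exact if_congr eq_comm rfl rfl
      rw [this, smul_add]
      congr 1
      ext k
      rw [Pi.smul_apply, Pi.single_apply, Pi.single_apply]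
      split_ifs <;> simp
    rw [hXX] at hone
    refine ⟨?_, (hone 0).2⟩
    rw [show push π δ = push ψ (push π₀ δ) by rw [push_push, hψ], ← (hone _).1]
    have e1 : push π₀ δ + Pi.single (π₀ (l none)) 1 = push π₀ (δ + Pi.single (l none) 1) := by
      rw [map_add, push_single]
    have e2 : push π₀ δ + Pi.single (π₀ (r none)) 1 = push π₀ (δ + Pi.single (r none) 1) := by
      rw [map_add, push_single]
    rw [e1, e2]
    have ih1 := fun δ => (ih' δ).1
    simp only [Function.comp_def] at ih1
    rw [← ih1, ← ih1, finsum_set_option, ← finsum_add_distrib (Set.toFinite _) (Set.toFinite _)]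
    have hpush : ∀ (f : Option C → P) (w : Option C → ℕ),
        push f w = push (fun c => f (some c)) (fun c => w (some c)) + Pi.single (f none) (w none) := by
      intro f w
      ext k
      simp only [push_eq, Fintype.sum_option, Pi.add_apply, Pi.single_apply]
      rw [add_comm]
      congr 1
      exact if_congr eq_comm rfl rfl
    refine finsum_congr fun V => ?_
    simp only [hpush l, hpush r]
    have h1 : ind V = fun c => if c ∈ V then 1 else 0 := rfl
    have h2 : ind Vᶜ = fun c => if c ∈ V then 0 else 1 := by ext c; simp [ind]
    congr 2
    · rw [h1, h2]
      simp [ind]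
      abel
    · rw [h1, h2]
      simp [ind]
      abel

end cut

end

section
/-- A dotted cobordism between two finite collections of circles: its set of components `K`, the
components at which the circles lie, the doubled Euler characteristics `X` of the components after
capping all the circles, and the numbers of dots. -/
structure Cob (C C' : Type) where
  K : Type
  [fin : Finite K]
  inn : C → K
  out : C' → K
  X : K → ℤ
  δ : K → ℕ

attribute [instance] Cob.fin

namespace Cob

variable {R : Type} [CommRing R] {C C' C'' D D' : Type}

/-- No component has positive genus defect: the capped components have Euler characteristic at
most two. -/
def Good (G : Cob C C') : Prop := ∀ k, G.X k ≤ 4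

variable [Finite C] [Finite C'] [Finite C''] [Finite D] [Finite D']

/-- Matrix entries of the map induced by a cobordism. -/
def coef (R : Type) [CommRing R] (G : Cob C C') (V : Set C) (U : Set C') : R :=
  ev R G.X (G.δ + push G.inn (ind V) + push G.out (ind Uᶜ))

def L (G : Cob C C') (f : Set C → R) : Set C' → R := fun U => ∑ᶠ V, f V * G.coef R V U

def comp (G : Cob C C') (H : Cob C' C'') : Cob C C'' where
  K := Quot (fun a b : G.K ⊕ H.K => ∃ c, .inl (G.out c) = a ∧ .inr (H.inn c) = b)
  inn c := Quot.mk _ (.inl (G.inn c))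
  out c := Quot.mk _ (.inr (H.out c))
  X := push (Quot.mk _) (Sum.elim G.X H.X) - 4 • cnt (fun c => Quot.mk _ (.inl (G.out c)))
  δ := push (Quot.mk _) (Sum.elim G.δ H.δ)

section comp

variable (G : Cob C C') (H : Cob C' C'')

def compl : G.K → (G.comp H).K := fun k => Quot.mk _ (.inl k)
def compr : H.K → (G.comp H).K := fun k => Quot.mk _ (.inr k)

theorem comp_glue (c : C') : G.compl H (G.out c) = G.compr H (H.inn c) :=
  Quot.sound ⟨c, rfl, rfl⟩

theorem comp_inn : (G.comp H).inn = G.compl H ∘ G.inn := rfl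
theorem comp_out : (G.comp H).out = G.compr H ∘ H.out := rfl

theorem comp_X : (G.comp H).X =
  push (G.compl H) G.X + push (G.compr H) H.X - 4 • cnt (G.compl H ∘ G.out) := by
  change push _ _ - _ = _
  rw [push_sum]; rfl

theorem comp_δ : (G.comp H).δ = push (G.compl H) G.δ + push (G.compr H) H.δ := by
  change push _ _ = _
  rw [push_sum]; rfl

variable {G H}

def compLift {Z : Type} (f : G.K → Z) (g : H.K → Z) (h : ∀ c, f (G.out c) = g (H.inn c)) :
  (G.comp H).K → Z :=
  Quot.lift (Sum.elim f g) (by rintro _ _ ⟨c, rfl, rfl⟩; exact h c)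

theorem comp_ind {p : (G.comp H).K → Prop} (hl : ∀ k, p (G.compl H k))
  (hr : ∀ k, p (G.compr H k)) : ∀ k, p k := by
  rintro ⟨k | k⟩
  exacts [hl k, hr k]

end comp

theorem ev_sum {P Q : Type} (X : P ⊕ Q → ℤ) (δ : P ⊕ Q → ℕ) :
  ev R X δ = ev R (X ∘ .inl) (δ ∘ .inl) * ev R (X ∘ .inr) (δ ∘ .inr) := by
  simp only [ev, Sum.forall, Function.comp, ite_and]
  split_ifs <;> simp_all

theorem Good.comp {G : Cob C C'} {H : Cob C' C''} (hG : G.Good) (hH : H.Good) :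
  (G.comp H).Good :=
  (cut (R := ZMod 2) (Sum.elim G.X H.X) (by rintro (p | p); exacts [hG p, hH p])
    (fun c => Sum.inl (G.out c)) (fun c => Sum.inr (H.inn c)) (Quot.mk _) Quot.mk_surjective
    (fun _ _ => Quot.eq) 0).2

theorem L_comp [CharP R 2] {G : Cob C C'} {H : Cob C' C''} (hG : G.Good) (hH : H.Good)
  (f : Set C → R) : H.L (G.L f) = (G.comp H).L f := by
  ext U
  simp only [L, fsum_eq, Finset.sum_mul]
  rw [sum_comm]
  refine sum_congr rfl fun V _ => ?_
  simp only [mul_assoc, ← Finset.mul_sum]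
  congr 1
  have key := (cut (R := R) (Sum.elim G.X H.X) (by rintro (p | p); exacts [hG p, hH p])
    (fun c => Sum.inl (G.out c)) (fun c => Sum.inr (H.inn c)) (Quot.mk _) Quot.mk_surjective
    (fun _ _ => Quot.eq)
    (Sum.elim (G.δ + push G.inn (ind V)) (H.δ + push H.out (ind Uᶜ)))).1
  have e : push (Quot.mk _ : _ → (G.comp H).K)
      (Sum.elim (G.δ + push G.inn (ind V)) (H.δ + push H.out (ind Uᶜ)))
      = (G.comp H).δ + push (G.comp H).inn (ind V) + push (G.comp H).out (ind Uᶜ) := by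
    rw [push_sum, comp_δ, comp_inn, comp_out, ← push_push, ← push_push]
    change push (G.compl H) (G.δ + _) + push (G.compr H) (H.δ + _) = _
    rw [map_add, map_add]
    abel
  refine Eq.trans ?_ (key.trans (congrArg _ e))
  rw [fsum_eq]
  refine sum_congr rfl fun W _ => ?_
  rw [ev_sum]
  unfold coef
  congr 2
  · ext k
    simp only [Function.comp, Pi.add_apply, Sum.elim_inl, push_inl]
    rw [push_eq_zero _ _ _ (fun n => Sum.inr_ne_inl), add_zero]
  · ext k
    simp only [Function.comp, Pi.add_apply, Sum.elim_inr, push_inr]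
    rw [push_eq_zero _ _ _ (fun n => Sum.inl_ne_inr), add_zero]
    ring

theorem coef_congr {G G' : Cob C C'} (φ : G.K ≃ G'.K) (inn : ∀ c, φ (G.inn c) = G'.inn c)
  (out : ∀ c, φ (G.out c) = G'.out c) (X : ∀ k, G.X k = G'.X (φ k))
  (δ : ∀ k, G.δ k = G'.δ (φ k)) (V : Set C) (U : Set C') : G.coef R V U = G'.coef R V U := by
  unfold coef ev
  rw [φ.surjective.forall]
  have hi : G'.inn = φ ∘ G.inn := funext fun c => (inn c).symm
  have ho : G'.out = φ ∘ G.out := funext fun c => (out c).symm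
  simp only [hi, ho, Pi.add_apply, push_comp_apply φ.injective, X, δ]

theorem L_congr {G G' : Cob C C'} (φ : G.K ≃ G'.K) (inn : ∀ c, φ (G.inn c) = G'.inn c)
  (out : ∀ c, φ (G.out c) = G'.out c) (X : ∀ k, G.X k = G'.X (φ k))
  (δ : ∀ k, G.δ k = G'.δ (φ k)) (f : Set C → R) : G.L f = G'.L f := by
  ext U
  exact finsum_congr fun V => by rw [coef_congr φ inn out X δ]

theorem L_reind (e : C ≃ D) (G : Cob D C') (f : Set D → R) :
  G.L f = Cob.L { G with inn := G.inn ∘ e } (fun V => f (e.symm ⁻¹' V)) := by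
  ext U
  simp only [L]
  rw [← finsum_comp_equiv (Equiv.Set.congr e)]
  refine finsum_congr fun V => ?_
  have h : Equiv.Set.congr e V = e.symm ⁻¹' V := by ext; simp
  rw [h]
  congr 1
  unfold coef
  congr 2
  have : ind (e.symm ⁻¹' V) ∘ e = ind V := by ext c; simp [ind]
  rw [← this]
  simp only
  rw [push_equiv]

abbrev sum (G : Cob C C') (H : Cob D D') : Cob (C ⊕ D) (C' ⊕ D') where
  K := G.K ⊕ H.K
  inn := Sum.map G.inn H.inn
  out := Sum.map G.out H.out
  X := Sum.elim G.X H.X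
  δ := Sum.elim G.δ H.δ

theorem Good.sum {G : Cob C C'} {H : Cob D D'} (hG : G.Good) (hH : H.Good) : (G.sum H).Good := by
  rintro (k | k); exacts [hG k, hH k]

def tens (f : Set C → R) (g : Set D → R) : Set (C ⊕ D) → R :=
  fun V => f (.inl ⁻¹' V) * g (.inr ⁻¹' V)

def setSum : Set (C ⊕ D) ≃ Set C × Set D where
  toFun V := (.inl ⁻¹' V, .inr ⁻¹' V)
  invFun p := {x | Sum.elim p.1 p.2 x}
  left_inv V := by ext (x | x) <;> exact Iff.rfl
  right_inv p := by ext <;> exact Iff.rfl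

theorem coef_sum (G : Cob C C') (H : Cob D D') (V : Set (C ⊕ D)) (U : Set (C' ⊕ D')) :
  (G.sum H).coef R V U
    = G.coef R (.inl ⁻¹' V) (.inl ⁻¹' U) * H.coef R (.inr ⁻¹' V) (.inr ⁻¹' U) := by
  refine (ev_sum (P := G.K) (Q := H.K) _ _).trans ?_
  unfold coef
  congr 2
  · ext k
    change G.δ k + push (Sum.map G.inn H.inn) _ (.inl k) + push (Sum.map G.out H.out) _ (.inl k) = _
    rw [push_map_inl, push_map_inl]
    rfl
  · ext k
    change H.δ k + push (Sum.map G.inn H.inn) _ (.inr k) + push (Sum.map G.out H.out) _ (.inr k) = _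
    rw [push_map_inr, push_map_inr]
    rfl

theorem L_sum (G : Cob C C') (H : Cob D D') (f : Set C → R) (g : Set D → R) :
  tens (G.L f) (H.L g) = (G.sum H).L (tens f g) := by
  ext U
  simp only [tens, L, coef_sum]
  rw [← finsum_comp_equiv setSum.symm, fsum_eq, fsum_eq,
    fsum_eq, Finset.sum_mul_sum, Fintype.sum_prod_type]
  refine sum_congr rfl fun V _ => sum_congr rfl fun W _ => ?_
  have h1 : Sum.inl ⁻¹' (setSum.symm (V, W)) = V := rfl
  have h2 : Sum.inr ⁻¹' (setSum.symm (V, W)) = W := rfl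
  rw [h1, h2]
  ring

section sigma

variable {I : Type} [Finite I] {E E' : I → Type} [∀ i, Finite (E i)] [∀ i, Finite (E' i)]

/-- Disjoint union of a family of cobordisms. -/
abbrev sigma (G : ∀ i, Cob (E i) (E' i)) : Cob (Σ i, E i) (Σ i, E' i) where
  K := Σ i, (G i).K
  inn c := ⟨c.1, (G c.1).inn c.2⟩
  out c := ⟨c.1, (G c.1).out c.2⟩
  X k := (G k.1).X k.2
  δ k := (G k.1).δ k.2

theorem Good.sigma {G : ∀ i, Cob (E i) (E' i)} (hG : ∀ i, (G i).Good) : (Cob.sigma G).Good :=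
  fun k => hG k.1 k.2

def tensor (f : ∀ i, Set (E i) → R) : Set (Σ i, E i) → R := fun V => ∏ᶠ i, f i (Sigma.mk i ⁻¹' V)

theorem ev_sigma {P : I → Type} (X : (Σ i, P i) → ℤ) (δ : (Σ i, P i) → ℕ) :
  ev R X δ = ∏ᶠ i, ev R (fun p => X ⟨i, p⟩) (fun p => δ ⟨i, p⟩) := by
  rw [finprod_eq_prod_of_fintype]
  simp only [ev, Sigma.forall]
  rw [Finset.prod_ite_zero]
  simp

theorem coef_sigma (G : ∀ i, Cob (E i) (E' i)) (V : Set (Σ i, E i)) (U : Set (Σ i, E' i)) :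
  (sigma G).coef R V U = ∏ᶠ i, (G i).coef R (Sigma.mk i ⁻¹' V) (Sigma.mk i ⁻¹' U) := by
  refine (ev_sigma (P := fun i => (G i).K) _ _).trans ?_
  unfold coef
  refine finprod_congr fun i => ?_
  congr 1
  ext k
  change (G i).δ k + push (fun n : Σ i, E i => (⟨n.1, (G n.1).inn n.2⟩ : Σ i, (G i).K)) _ ⟨i, k⟩
    + push (fun n : Σ i, E' i => (⟨n.1, (G n.1).out n.2⟩ : Σ i, (G i).K)) _ ⟨i, k⟩ = _
  rw [push_sigma_apply (fun i => (G i).inn), push_sigma_apply (fun i => (G i).out)]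
  rfl

theorem L_sigma (G : ∀ i, Cob (E i) (E' i)) (f : ∀ i, Set (E i) → R) :
  tensor (fun i => (G i).L (f i)) = (sigma G).L (tensor f) := by
  ext U
  simp only [tensor, L, coef_sigma]
  let e : Set (Σ i, E i) ≃ ∀ i, Set (E i) := Equiv.piCurry (fun _ _ => Prop)
  rw [← finsum_comp_equiv e.symm]
  simp only [finprod_eq_prod_of_fintype]
  rw [fsum_eq]
  simp only [fsum_eq]
  rw [Finset.prod_univ_sum, Fintype.piFinset_univ]
  refine sum_congr rfl fun V _ => ?_
  rw [Finset.prod_mul_distrib]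
  rfl

end sigma

theorem L_one [IsEmpty C] (G : Cob C C') (U : Set C') :
  G.L (1 : Set C → R) U = ev R G.X (G.δ + push G.out (ind Uᶜ)) := by
  rw [L, finsum_eq_single _ ∅ (fun V hV => (hV (Set.eq_empty_of_isEmpty V)).elim)]
  rw [Pi.one_apply, one_mul, coef]
  congr 2
  have : push G.inn (ind ∅) = (0 : G.K → ℕ) := by
    ext k; exact push_eq_zero _ _ _ fun n => (IsEmpty.false n).elim
  rw [this, add_zero]

end Cob

end

section
section linear

variable {V E F : Type} [Finite V] [Finite E] [Finite F]

theorem finrank_le_of_ker_const {M : Type} [AddCommGroup M] [Module (ZMod 2) M]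
  (G : (V → ZMod 2) →ₗ[ZMod 2] M) (h : ∀ g, G g = 0 → ∀ v v', g v = g v') :
  Nat.card V ≤ Module.finrank (ZMod 2) (LinearMap.range G) + 1 := by
  have h1 := G.finrank_range_add_finrank_ker
  rw [Module.finrank_fintype_fun_eq_card, ← Nat.card_eq_fintype_card] at h1
  have h2 : Module.finrank (ZMod 2) (LinearMap.ker G) ≤ 1 := by
    refine (Submodule.finrank_mono (t := Submodule.span (ZMod 2) {fun _ => 1}) ?_).trans
      ((finrank_span_le_card _).trans (by simp))
    intro g hg
    rw [Submodule.mem_span_singleton]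
    by_cases hV : Nonempty V
    · obtain ⟨v⟩ := hV
      exact ⟨g v, funext fun v' => by simp [h g hg v' v]⟩
    · exact ⟨0, funext fun v => (hV ⟨v⟩).elim⟩
  omega

theorem finrank_add_le_of_orthogonal (W W' : Submodule (ZMod 2) (E → ZMod 2))
  (h : ∀ x ∈ W, ∀ y ∈ W', ∑ᶠ e, x e * y e = 0) :
  Module.finrank (ZMod 2) W + Module.finrank (ZMod 2) W' ≤ Nat.card E := by
  let T := (Pi.basisFun (ZMod 2) E).toDualEquiv
  have h1 := Subspace.finrank_add_finrank_dualAnnihilator_eq W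
  rw [Module.finrank_fintype_fun_eq_card, ← Nat.card_eq_fintype_card] at h1
  have h2 : W'.map T.toLinearMap ≤ W.dualAnnihilator := by
    rintro _ ⟨y, hy, rfl⟩
    rw [Submodule.mem_dualAnnihilator]
    intro x hx
    rw [← h x hx y hy, fsum_eq]
    change (Pi.basisFun (ZMod 2) E).toDual y x = _
    have : y = ∑ e, y e • Pi.basisFun (ZMod 2) E e := by
      ext e; simp [Finset.sum_apply, Pi.single_apply]
    conv_lhs => rw [this]
    simp only [map_sum, map_smul, LinearMap.sum_apply, LinearMap.smul_apply, smul_eq_mul]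
    refine sum_congr rfl fun e _ => ?_
    rw [Module.Basis.toDual_apply_right, mul_comm]
    simp
  have h3 := Submodule.finrank_mono h2
  rw [LinearEquiv.finrank_map_eq T W'] at h3
  omega

theorem euler_le (G : (V → ZMod 2) →ₗ[ZMod 2] (E → ZMod 2))
  (Y : (F → ZMod 2) →ₗ[ZMod 2] (E → ZMod 2))
  (orth : ∀ g y, ∑ᶠ e, G g e * Y y e = 0)
  (hG : ∀ g, G g = 0 → ∀ v v', g v = g v') (hY : ∀ y, Y y = 0 → ∀ r r', y r = y r') :
  Nat.card V + Nat.card F ≤ Nat.card E + 2 := by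
  have h1 := finrank_le_of_ker_const G hG
  have h2 := finrank_le_of_ker_const Y hY
  have h3 := finrank_add_le_of_orthogonal (LinearMap.range G) (LinearMap.range Y) (by
    rintro _ ⟨g, rfl⟩ _ ⟨y, rfl⟩; exact orth g y)
  omega

/-- A component `k` of a surface that is made of discs `V`, joined along edges `E`, with
boundary circles `F`. -/
theorem euler_le_component {K : Type} (k : K) (νV : V → K) (νE : E → K) (νF : F → K)
  (G : (V → ZMod 2) →ₗ[ZMod 2] (E → ZMod 2)) (Y : (F → ZMod 2) →ₗ[ZMod 2] (E → ZMod 2))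
  (orth : ∀ g y, ∑ᶠ e, G g e * Y y e = 0)
  (locG : ∀ g, (∀ v, νV v ≠ k → g v = 0) → ∀ e, νE e ≠ k → G g e = 0)
  (hG : ∀ g, (∀ v, νV v ≠ k → g v = 0) → (∀ e, G g e = 0) →
    ∀ v v', νV v = k → νV v' = k → g v = g v')
  (locY : ∀ g, (∀ v, νF v ≠ k → g v = 0) → ∀ e, νE e ≠ k → Y g e = 0)
  (hY : ∀ g, (∀ v, νF v ≠ k → g v = 0) → (∀ e, Y g e = 0) →
    ∀ v v', νF v = k → νF v' = k → g v = g v') :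
  cnt νV k + cnt νF k ≤ cnt νE k + 2 := by
  have hcnt : ∀ {N : Type} [Finite N] (f : N → K), cnt f k = Nat.card {n // f n = k} := by
    intro N _ f
    rw [cnt_eq_ncard]; rfl
  let xV := Function.ExtendByZero.linearMap (ZMod 2) (Subtype.val : {v // νV v = k} → V)
  let xF := Function.ExtendByZero.linearMap (ZMod 2) (Subtype.val : {v // νF v = k} → F)
  let res : (E → ZMod 2) →ₗ[ZMod 2] ({e // νE e = k} → ZMod 2) :=
    LinearMap.funLeft _ _ Subtype.val
  have xV0 : ∀ g v, νV v ≠ k → xV g v = 0 := fun g v hv =>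
    Function.extend_apply' _ _ _ (by rintro ⟨⟨_, h⟩, rfl⟩; exact hv h)
  have xF0 : ∀ g v, νF v ≠ k → xF g v = 0 := fun g v hv =>
    Function.extend_apply' _ _ _ (by rintro ⟨⟨_, h⟩, rfl⟩; exact hv h)
  have xV1 : ∀ g v, xV g v.1 = g v := fun g v =>
    Subtype.val_injective.extend_apply _ _ _
  have xF1 : ∀ g v, xF g v.1 = g v := fun g v =>
    Subtype.val_injective.extend_apply _ _ _
  have key := euler_le (res ∘ₗ G ∘ₗ xV) (res ∘ₗ Y ∘ₗ xF) (by
    intro g y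
    rw [← orth (xV g) (xF y), fsum_eq, fsum_eq]
    have hz : ∀ e, G (xV g) e * Y (xF y) e ≠ 0 → νE e = k := by
      intro e he
      by_contra hk
      exact he (by rw [locG _ (xV0 g) e hk, zero_mul])
    rw [← Finset.sum_filter_of_ne (p := fun e => νE e = k) (fun e _ he => hz e he),
      Finset.sum_subtype (p := fun e => νE e = k) _ (by simp)]
    rfl) (by
    intro g hg v v'
    rw [← xV1 g v, ← xV1 g v']
    refine hG _ (xV0 g) (fun e => ?_) _ _ v.2 v'.2
    by_cases he : νE e = k
    · exact congrFun hg ⟨e, he⟩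
    · exact locG _ (xV0 g) e he) (by
    intro g hg v v'
    rw [← xF1 g v, ← xF1 g v']
    refine hY _ (xF0 g) (fun e => ?_) _ _ v.2 v'.2
    by_cases he : νE e = k
    · exact congrFun hg ⟨e, he⟩
    · exact locY _ (xF0 g) e he)
  rw [hcnt, hcnt, hcnt]
  exact_mod_cast key

end linear

end

section
variable {e o : Type}

theorem sum_mul_push {N K : Type} [Finite N] [Finite K] (f : N → K) (h : K → ZMod 2)
  (w : N → ZMod 2) : ∑ᶠ k, h k * push f w k = ∑ᶠ n, h (f n) * w n := by
  simp only [fsum_eq, push_eq, Finset.mul_sum]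
  rw [sum_comm]
  refine sum_congr rfl fun n _ => ?_
  simp

theorem cnt_le_one {N K : Type} [Finite N] (f : N → K) (k : K) (n : N) (h : ∀ m, f m = k → m = n) :
  cnt f k ≤ 1 := by
  rw [cnt_eq_ncard]
  have : {m | f m = k}.ncard ≤ 1 := by
    rw [Set.ncard_le_one (Set.toFinite _)]
    intro a ha b hb
    rw [h a ha, h b hb]
  exact_mod_cast this

theorem cnt_eq_zero {N K : Type} [Finite N] (f : N → K) (k : K) (h : ∀ m, f m ≠ k) :
  cnt f k = 0 := push_eq_zero _ _ _ h

theorem cnt_bij {N K : Type} [Finite N] {f : N → K} (hf : f.Bijective) (k : K) : cnt f k = 1 := by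
  obtain ⟨n, rfl⟩ := hf.2 k
  exact cnt_of_injective hf.1 n

namespace Flat

def pt (a : Flat e) (p : e) : a.Comp := Quot.mk _ (a.bd p)

/-- Every component has two endpoints or none. -/
def Mfd [Finite e] (a : Flat e) : Prop := ∀ c, cnt a.pt c = 0 ∨ cnt a.pt c = 2

variable [Finite e] {a : Flat e}

theorem Mfd.sum_eq_zero (ha : a.Mfd) (g : a.Comp → ZMod 2) : ∑ᶠ p, g (a.pt p) = 0 := by
  have h := sum_mul_push a.pt g 1
  simp only [Pi.one_apply, mul_one] at h
  rw [← h]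
  refine (finsum_congr fun c => ?_).trans finsum_zero
  have : push a.pt (1 : e → ZMod 2) c = ((cnt a.pt c : ℤ) : ZMod 2) := by
    rw [cnt, push_eq, push_eq]
    push_cast
    simp
  rw [this]
  rcases ha c with h | h <;> rw [h]
  · simp
  · rfl

theorem Mfd.eq_of_push_eq_zero (ha : a.Mfd) (w : e → ZMod 2) {p p' : e} (hp : a.pt p = a.pt p')
  (h : push a.pt w (a.pt p) = 0) : w p = w p' := by
  by_cases hpp : p = p'
  · rw [hpp]
  have h2 : {q | a.pt q = a.pt p}.ncard ≤ 2 := by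
    have := ha (a.pt p)
    rw [cnt_eq_ncard] at this
    omega
  have hset : {q | a.pt q = a.pt p} = {p, p'} := by
    symm
    refine Set.eq_of_subset_of_ncard_le ?_ ?_ (Set.toFinite _)
    · grind
    · simp_all
  rw [push_eq, ← Finset.sum_filter] at h
  have hf : (Finset.univ.filter fun q => a.pt q = a.pt p) = {p, p'} := by grind
  rw [hf, Finset.sum_pair hpp] at h
  exact CharTwo.add_eq_zero.1 h

theorem Mfd.two_mul_arcs (ha : a.Mfd) {K : Type} (f : a.Comp → K) (k : K) :
  2 * ({c | c ∈ a.arcs ∧ f c = k}.ncard : ℤ) = cnt (fun p => f (a.pt p)) k := by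
  have h1 : cnt (fun p => f (a.pt p)) = push f (cnt a.pt) := (push_cnt a.pt f).symm
  rw [h1, push_eq, Set.ncard_eq_toFinset_card', Finset.card_eq_sum_ones]
  push_cast
  rw [Finset.mul_sum, ← Finset.sum_filter]
  have hc : ∀ c, c ∈ a.arcs → cnt a.pt c = 2 := by
    rintro c ⟨p, rfl⟩
    rcases ha (a.pt p) with h | h
    · rw [cnt_eq_ncard] at h
      have : {n | a.pt n = a.pt p} = ∅ := by simp_all [Set.ncard_eq_zero (Set.toFinite _)]
      exact absurd (show p ∈ {n | a.pt n = a.pt p} from rfl) (by simp_all)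
    · exact h
  have hc' : ∀ c, c ∉ a.arcs → cnt a.pt c = 0 := fun c h =>
    cnt_eq_zero _ _ fun p hp => h ⟨p, hp⟩
  rw [← Finset.sum_filter_add_sum_filter_not (Finset.univ.filter fun c => f c = k)
    (fun c => c ∈ a.arcs) (fun c => cnt a.pt c)]
  rw [Finset.sum_eq_zero (s := Finset.filter (fun c => c ∉ a.arcs) _)
    (fun c hx => hc' c (Finset.mem_filter.1 hx).2), add_zero,
    sum_congr rfl (fun c hx => hc c (Finset.mem_filter.1 hx).2)]
  refine sum_congr ?_ fun _ _ => by norm_num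
  ext c
  simp [and_comm]

end Flat

namespace Circ

variable {a b c : Flat e}

def l : a.Comp → Circ a b := Quot.map Sum.inl fun _ _ h => .left h

def r : b.Comp → Circ a b := Quot.map Sum.inr fun _ _ h => .right h

theorem glue (p : e) : (l (a.pt p) : Circ a b) = r (b.pt p) := Quot.sound (.bd p)

def lift {Z : Type} (f : a.Comp → Z) (g : b.Comp → Z) (h : ∀ p, f (a.pt p) = g (b.pt p)) :
  Circ a b → Z :=
  Quot.lift (Sum.elim (fun s => f (Quot.mk _ s)) (fun s => g (Quot.mk _ s))) (by
    rintro _ _ (h' | h' | p)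
    exacts [congrArg f (Quot.sound h'), congrArg g (Quot.sound h'), h p])

@[simp] theorem lift_l {Z : Type} (f : a.Comp → Z) (g : b.Comp → Z) (h) (x : a.Comp) :
  lift f g h (l x) = f x := by
  obtain ⟨s, rfl⟩ := Quot.mk_surjective x; rfl

@[simp] theorem lift_r {Z : Type} (f : a.Comp → Z) (g : b.Comp → Z) (h) (x : b.Comp) :
  lift f g h (r x) = g x := by
  obtain ⟨s, rfl⟩ := Quot.mk_surjective x; rfl

theorem ind {p : Circ a b → Prop} (hl : ∀ x, p (l x)) (hr : ∀ x, p (r x)) : ∀ q, p q := by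
  rintro ⟨s | s⟩
  exacts [hl (Quot.mk _ s), hr (Quot.mk _ s)]

end Circ

/-- The components of a stack of two cobordisms. -/
abbrev StackK (a b c : Flat e) : Type := Quot (stackLink a b c)

namespace StackK

variable {a b c : Flat e}

def na : a.Comp → StackK a b c := Quot.map Sum.inl fun _ _ h => .fst h
def nb : b.Comp → StackK a b c := Quot.map (fun s => .inr (.inl s)) fun _ _ h => .snd h
def nc : c.Comp → StackK a b c := Quot.map (fun s => .inr (.inr s)) fun _ _ h => .trd h

theorem glue₁ (p : e) : (na (a.pt p) : StackK a b c) = nb (b.pt p) := Quot.sound (.bd₁ p)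
theorem glue₂ (p : e) : (nb (b.pt p) : StackK a b c) = nc (c.pt p) := Quot.sound (.bd₂ p)

def lift {Z : Type} (f : a.Comp → Z) (g : b.Comp → Z) (h : c.Comp → Z)
  (h₁ : ∀ p, f (a.pt p) = g (b.pt p)) (h₂ : ∀ p, g (b.pt p) = h (c.pt p)) : StackK a b c → Z :=
  Quot.lift (Sum.elim (fun s => f (Quot.mk _ s)) (Sum.elim (fun s => g (Quot.mk _ s))
    (fun s => h (Quot.mk _ s)))) (by
    rintro _ _ (h' | h' | h' | p | p)
    exacts [congrArg f (Quot.sound h'), congrArg g (Quot.sound h'), congrArg h (Quot.sound h'),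
      h₁ p, h₂ p])

section
variable {Z : Type} (f : a.Comp → Z) (g : b.Comp → Z) (h : c.Comp → Z) (h₁) (h₂)

@[simp] theorem lift_na (x : a.Comp) : lift f g h h₁ h₂ (na x) = f x := by
  obtain ⟨s, rfl⟩ := Quot.mk_surjective x; rfl
@[simp] theorem lift_nb (x : b.Comp) : lift f g h h₁ h₂ (nb x) = g x := by
  obtain ⟨s, rfl⟩ := Quot.mk_surjective x; rfl
@[simp] theorem lift_nc (x : c.Comp) : lift f g h h₁ h₂ (nc x) = h x := by
  obtain ⟨s, rfl⟩ := Quot.mk_surjective x; rfl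
end

theorem ind {p : StackK a b c → Prop} (ha : ∀ x, p (na x)) (hb : ∀ x, p (nb x))
  (hc : ∀ x, p (nc x)) : ∀ q, p q := by
  rintro ⟨s | s | s⟩
  exacts [ha (Quot.mk _ s), hb (Quot.mk _ s), hc (Quot.mk _ s)]

def qab : Circ a b → StackK a b c := Circ.lift na nb glue₁
def qbc : Circ b c → StackK a b c := Circ.lift nb nc glue₂
def qac : Circ a c → StackK a b c := Circ.lift na nc fun p => (glue₁ p).trans (glue₂ p)

@[simp] theorem qab_l (x : a.Comp) : (qab (Circ.l x) : StackK a b c) = na x := Circ.lift_l ..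
@[simp] theorem qab_r (x : b.Comp) : (qab (Circ.r x) : StackK a b c) = nb x := Circ.lift_r ..
@[simp] theorem qbc_l (x : b.Comp) : (qbc (Circ.l x) : StackK a b c) = nb x := Circ.lift_l ..
@[simp] theorem qbc_r (x : c.Comp) : (qbc (Circ.r x) : StackK a b c) = nc x := Circ.lift_r ..
@[simp] theorem qac_l (x : a.Comp) : (qac (Circ.l x) : StackK a b c) = na x := Circ.lift_l ..
@[simp] theorem qac_r (x : c.Comp) : (qac (Circ.r x) : StackK a b c) = nc x := Circ.lift_r ..

end StackK

open StackK

variable [Finite e]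

/-- The cobordism along which morphisms are composed. -/
abbrev stackCob (a b c : Flat e) : Cob (Circ a b ⊕ Circ b c) (Circ a c) where
  K := StackK a b c
  inn := Sum.elim qab qbc
  out := qac
  X := 2 • cnt (qab : Circ a b → StackK a b c) + 2 • cnt (qbc : Circ b c → StackK a b c)
    + 2 • cnt (qac : Circ a c → StackK a b c) - cnt (fun p => (nb (b.pt p) : StackK a b c))
  δ := 0

section good

variable {a b c : Flat e}

theorem stack_isolated_a {x : a.Comp} (hx : ∀ p, a.pt p ≠ x) :
  (∀ x', (na x' : StackK a b c) = na x → x' = x) ∧ (∀ y, (nb y : StackK a b c) ≠ na x) ∧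
  (∀ z, (nc z : StackK a b c) ≠ na x) := by
  let P : StackK a b c → Prop := StackK.lift (· = x) (fun _ => False) (fun _ => False)
    (fun p => by simp [hx p]) (fun _ => rfl)
  have h0 : P (na x) := by simp [P]
  refine ⟨fun x' h => ?_, fun y h => ?_, fun z h => ?_⟩ <;> rw [← h] at h0 <;> simpa [P] using h0

theorem stack_isolated_b {y : b.Comp} (hy : ∀ p, b.pt p ≠ y) :
  (∀ x, (na x : StackK a b c) ≠ nb y) ∧ (∀ y', (nb y' : StackK a b c) = nb y → y' = y) ∧
  (∀ z, (nc z : StackK a b c) ≠ nb y) := by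
  let P : StackK a b c → Prop := StackK.lift (fun _ => False) (· = y) (fun _ => False)
    (fun p => by simp [hy p]) (fun p => by simp [hy p])
  have h0 : P (nb y) := by simp [P]
  refine ⟨fun x' h => ?_, fun y h => ?_, fun z h => ?_⟩ <;> rw [← h] at h0 <;> simpa [P] using h0

theorem stack_isolated_c {z : c.Comp} (hz : ∀ p, c.pt p ≠ z) :
  (∀ x, (na x : StackK a b c) ≠ nc z) ∧ (∀ y, (nb y : StackK a b c) ≠ nc z) ∧
  (∀ z', (nc z' : StackK a b c) = nc z → z' = z) := by
  let P : StackK a b c → Prop := StackK.lift (fun _ => False) (fun _ => False) (· = z)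
    (fun _ => rfl) (fun p => by simp [hz p])
  have h0 : P (nc z) := by simp [P]
  refine ⟨fun x' h => ?_, fun y h => ?_, fun z h => ?_⟩ <;> rw [← h] at h0 <;> simpa [P] using h0

theorem stack_le_of_isolated (k : StackK a b c) (hk : ∀ p, (nb (b.pt p) : StackK a b c) ≠ k) :
  cnt (qab : Circ a b → StackK a b c) k + cnt (qbc : Circ b c → StackK a b c) k
  + cnt (qac : Circ a c → StackK a b c) k ≤ 2 := by
  revert k
  refine StackK.ind (fun x hk => ?_) (fun y hk => ?_) (fun z hk => ?_)
  · obtain ⟨h1, h2, h3⟩ := stack_isolated_a (b := b) (c := c) (x := x)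
      fun p h => hk p (by rw [← glue₁, h])
    have e1 := cnt_le_one (qab : Circ a b → StackK a b c) (na x) (Circ.l x)
      (Circ.ind (fun x' h => by simp_all) (fun y h => (h2 y (by simp_all)).elim))
    have e2 := cnt_eq_zero (qbc : Circ b c → StackK a b c) (na x)
      (Circ.ind (fun y h => h2 y (by simp_all)) (fun z h => (h3 z (by simp_all)).elim))
    have e3 := cnt_le_one (qac : Circ a c → StackK a b c) (na x) (Circ.l x)
      (Circ.ind (fun x' h => by simp_all) (fun y h => (h3 y (by simp_all)).elim))
    linarith
  · obtain ⟨h1, h2, h3⟩ := stack_isolated_b (a := a) (c := c) (y := y)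
      fun p h => hk p (by rw [h])
    have e1 := cnt_le_one (qab : Circ a b → StackK a b c) (nb y) (Circ.r y)
      (Circ.ind (fun y h => (h1 y (by simp_all)).elim) (fun x' h => by simp_all))
    have e2 := cnt_le_one (qbc : Circ b c → StackK a b c) (nb y) (Circ.l y)
      (Circ.ind (fun x' h => by simp_all) (fun y h => (h3 y (by simp_all)).elim))
    have e3 := cnt_eq_zero (qac : Circ a c → StackK a b c) (nb y)
      (Circ.ind (fun y h => h1 y (by simp_all)) (fun z h => (h3 z (by simp_all)).elim))
    linarith
  · obtain ⟨h1, h2, h3⟩ := stack_isolated_c (a := a) (b := b) (z := z)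
      fun p h => hk p (by rw [glue₂, h])
    have e1 := cnt_eq_zero (qab : Circ a b → StackK a b c) (nc z)
      (Circ.ind (fun y h => h1 y (by simp_all)) (fun z h => (h2 z (by simp_all)).elim))
    have e2 := cnt_le_one (qbc : Circ b c → StackK a b c) (nc z) (Circ.r z)
      (Circ.ind (fun y h => (h2 y (by simp_all)).elim) (fun x' h => by simp_all))
    have e3 := cnt_le_one (qac : Circ a c → StackK a b c) (nc z) (Circ.r z)
      (Circ.ind (fun y h => (h1 y (by simp_all)).elim) (fun x' h => by simp_all))
    linarith

theorem stackCob_good (ha : a.Mfd) (hb : b.Mfd) (hc : c.Mfd) : (stackCob a b c).Good := by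
  intro k
  change StackK a b c at k
  change 2 • cnt qab k + 2 • cnt qbc k + 2 • cnt qac k - cnt (fun p => nb (b.pt p)) k ≤ 4
  by_cases hk : ∀ p, (nb (b.pt p) : StackK a b c) ≠ k
  · have := stack_le_of_isolated k hk
    rw [cnt_eq_zero _ _ hk]
    simp only [nsmul_eq_mul]; push_cast; linarith
  · push Not at hk
    obtain ⟨p₀, hp₀⟩ := hk
    have harc : ∀ y, (nb y : StackK a b c) = k → y ∈ b.arcs := by
      intro y hy
      by_contra h
      have := (stack_isolated_b (a := a) (c := c) (y := y) fun p hp => h ⟨p, hp⟩).2.1 (b.pt p₀)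
        (by simp_all)
      exact h ⟨p₀, this⟩
    have hE : 2 * cnt (nb : b.Comp → StackK a b c) k = cnt (fun p => nb (b.pt p)) k := by
      rw [← hb.two_mul_arcs, cnt_eq_ncard]
      congr 4
      ext y
      exact ⟨fun h => ⟨harc y h, h⟩, fun h => h.2⟩
    let G : (Circ a b ⊕ Circ b c → ZMod 2) →ₗ[ZMod 2] (b.Comp → ZMod 2) :=
      { toFun := fun g y => g (.inl (Circ.r y)) + g (.inr (Circ.l y))
        map_add' := fun g g' => by grind [Pi.add_apply]
        map_smul' := fun t g => by ext y; simp [mul_add] }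
    let Y : (Circ a c → ZMod 2) →ₗ[ZMod 2] (b.Comp → ZMod 2) :=
      { toFun := fun y => push b.pt (fun p => y (Circ.l (a.pt p)))
        map_add' := fun g g' => by rw [← map_add]; rfl
        map_smul' := fun t g => by
          ext y; simp [push_eq, Finset.mul_sum] }
    have key := euler_le_component k (Sum.elim qab qbc : Circ a b ⊕ Circ b c → StackK a b c)
      (nb : b.Comp → StackK a b c) (qac : Circ a c → StackK a b c) G Y (by
        intro g y
        change ∑ᶠ z, (fun z => g (.inl (Circ.r z)) + g (.inr (Circ.l z))) z
          * push b.pt (fun p => y (Circ.l (a.pt p))) z = 0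
        rw [sum_mul_push]
        have h1 := ha.sum_eq_zero (fun x => g (.inl (Circ.l x)) * y (Circ.l x))
        have h2 := hc.sum_eq_zero (fun x => g (.inr (Circ.r x)) * y (Circ.r x))
        rw [← add_zero (0 : ZMod 2)]
        nth_rewrite 1 [← h1]
        rw [← h2, ← finsum_add_distrib (Set.toFinite _) (Set.toFinite _)]
        refine finsum_congr fun p => ?_
        rw [← Circ.glue (a := a), Circ.glue (a := b), ← Circ.glue (a := a) (b := c)]
        ring) (by
        intro g hg y hy
        change g _ + g _ = 0
        rw [hg _ (by simp_all), hg _ (by simp_all), add_zero]) (by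
        intro g _ hG
        have hG' : ∀ y, g (.inl (Circ.r y)) = g (.inr (Circ.l y)) := fun y =>
          CharTwo.add_eq_zero.1 (hG y)
        let F : StackK a b c → ZMod 2 := StackK.lift (fun x => g (.inl (Circ.l x)))
          (fun y => g (.inl (Circ.r y))) (fun z => g (.inr (Circ.r z)))
          (fun p => by rw [Circ.glue]) (fun p => by rw [hG', Circ.glue])
        have hF : ∀ v, g v = F (Sum.elim qab qbc v) := by
          rintro (v | v)
          · revert v; exact Circ.ind (by simp [F]) (by simp [F])
          · revert v; exact Circ.ind (by simp [F, hG']) (by simp [F])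
        intro v v' hv hv'
        rw [hF, hF, hv, hv']) (by
        intro g hg y hy
        change push b.pt _ y = 0
        rw [push_apply]
        refine (finsum_congr fun p => ?_).trans finsum_zero
        split_ifs with hp
        · rw [hg]
          rwa [qac_l, glue₁, hp]
        · rfl) (by
        intro g _ hY
        have hY' : ∀ p p', b.pt p = b.pt p' → g (Circ.l (a.pt p)) = g (Circ.l (a.pt p')) :=
          fun p p' h => hb.eq_of_push_eq_zero _ h (hY _)
        let F : StackK a b c → ZMod 2 := StackK.lift (fun x => g (Circ.l x))
          (fun y => if h : ∃ p, b.pt p = y then g (Circ.l (a.pt h.choose)) else 0)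
          (fun z => g (Circ.r z))
          (fun p => by
            have h : ∃ q, b.pt q = b.pt p := ⟨p, rfl⟩
            rw [dif_pos h]
            exact hY' _ _ h.choose_spec.symm)
          (fun p => by
            have h : ∃ q, b.pt q = b.pt p := ⟨p, rfl⟩
            rw [dif_pos h, ← Circ.glue (a := a)]
            exact hY' _ _ h.choose_spec)
        have hF : ∀ v, g v = F (qac v) := Circ.ind (by simp [F]) (by simp [F])
        intro v v' hv hv'
        rw [hF, hF, hv, hv'])
    rw [cnt_sum] at key
    change cnt qab k + cnt qbc k + cnt qac k ≤ _ at key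
    simp only [nsmul_eq_mul]; push_cast; linarith

end good

end

section
variable {e o : Type} {R : Type} [CommRing R]

namespace Cob

variable {C C' C'' C₁ C₁' C₂ C₂' : Type} [Finite C] [Finite C'] [Finite C''] [Finite C₁]
  [Finite C₁'] [Finite C₂] [Finite C₂']

/-- The identity cobordism, a collection of annuli with dots. -/
abbrev ident (C : Type) [Finite C] (δ : C → ℕ) : Cob C C where
  K := C
  inn c := c
  out c := c
  X _ := 4
  δ := δ

theorem ident_good (δ : C → ℕ) : (ident C δ).Good := fun _ => le_rfl

theorem push_ident {K : Type} (α : C → K) : push α (fun _ => (4 : ℤ)) = 4 • cnt α := by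
  rw [cnt, ← map_nsmul]
  congr 1

theorem L_ident (f : Set C → R) : (ident C 0).L f = f := by
  ext U
  rw [L, finsum_eq_single _ U]
  · rw [coef, ev, if_pos, mul_one]
    intro k
    refine ⟨rfl, ?_⟩
    change (0 : ℕ) + push (fun c : C => c) (ind U) k + push (fun c : C => c) (ind Uᶜ) k = 1
    rw [push_id, push_id]
    change C at k
    by_cases h : k ∈ U <;> simp [ind, h]
  · intro V hV
    rw [coef, ev, if_neg, mul_zero]
    intro h
    apply hV
    ext k
    have h' : (0 : ℕ) + push (fun c : C => c) (ind V) k + push (fun c : C => c) (ind Uᶜ) k = 1 :=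
      (h k).2
    rw [push_id, push_id] at h'
    by_cases hV : k ∈ V <;> by_cases hU : k ∈ U <;> simp [ind, hV, hU] at h' ⊢

variable [CharP R 2]

/-- The composition of cobordisms `G` and `H` is any cobordism `T` with the universal property of
the gluing. -/
theorem L_comp_of {G : Cob C C'} {H : Cob C' C''} (hG : G.Good) (hH : H.Good) (T : Cob C C'')
  (α : G.K → T.K) (β : H.K → T.K) (glue : ∀ c, α (G.out c) = β (H.inn c))
  (univ : ∀ (Z : Type) (f : G.K → Z) (g : H.K → Z), (∀ c, f (G.out c) = g (H.inn c)) →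
    ∃ ρ : T.K → Z, (∀ k, ρ (α k) = f k) ∧ ∀ k, ρ (β k) = g k)
  (surj : ∀ p : T.K → Prop, (∀ k, p (α k)) → (∀ k, p (β k)) → ∀ t, p t)
  (inn : ∀ c, T.inn c = α (G.inn c)) (out : ∀ c, T.out c = β (H.out c))
  (X : T.X = push α G.X + push β H.X - 4 • cnt (fun c => α (G.out c)))
  (δ : T.δ = push α G.δ + push β H.δ) (f : Set C → R) :
  T.Good ∧ H.L (G.L f) = T.L f := by
  obtain ⟨ρ, hα, hβ⟩ := univ _ (compl G H) (compr G H) (comp_glue G H)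
  let σ : (G.comp H).K → T.K := compLift α β glue
  have h1 : ∀ k, ρ (σ k) = k := comp_ind hα hβ
  have h2 : ∀ t, σ (ρ t) = t := surj _ (fun k => by rw [hα]; rfl) (fun k => by rw [hβ]; rfl)
  have hσ : σ.Injective := Function.LeftInverse.injective h1
  have hX : ∀ k, (G.comp H).X k = T.X (σ k) := fun k => by
    have e1 : α = σ ∘ compl G H := rfl
    have e2 : β = σ ∘ compr G H := rfl
    have e3 : (fun c => α (G.out c)) = σ ∘ (compl G H ∘ G.out) := rfl
    rw [X, comp_X, e3, e1, e2]
    simp only [Pi.add_apply, Pi.sub_apply, Pi.smul_apply, push_comp_apply hσ, cnt_comp_apply hσ]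
  refine ⟨fun t => ?_, ?_⟩
  · rw [← h2 t, ← hX]
    exact hG.comp hH _
  rw [L_comp hG hH]
  refine L_congr ⟨σ, ρ, h1, h2⟩ (fun c => (inn c).symm) (fun c => (out c).symm) hX
    (fun k => ?_) f
  · change _ = T.δ (σ k)
    have e1 : α = σ ∘ compl G H := rfl
    have e2 : β = σ ∘ compr G H := rfl
    rw [δ, comp_δ, e1, e2]
    simp only [Pi.add_apply, push_comp_apply hσ]

/-- Gluing two cobordisms to the inputs of a third one. -/
theorem L_tens_of {G₁ : Cob C₁ C₁'} {G₂ : Cob C₂ C₂'} {H : Cob (C₁' ⊕ C₂') C''} (h₁ : G₁.Good)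
  (h₂ : G₂.Good) (hH : H.Good) (T : Cob (C₁ ⊕ C₂) C'')
  (α₁ : G₁.K → T.K) (α₂ : G₂.K → T.K) (β : H.K → T.K)
  (glue₁ : ∀ c, α₁ (G₁.out c) = β (H.inn (.inl c)))
  (glue₂ : ∀ c, α₂ (G₂.out c) = β (H.inn (.inr c)))
  (univ : ∀ (Z : Type) (f₁ : G₁.K → Z) (f₂ : G₂.K → Z) (g : H.K → Z),
    (∀ c, f₁ (G₁.out c) = g (H.inn (.inl c))) → (∀ c, f₂ (G₂.out c) = g (H.inn (.inr c))) →
    ∃ ρ : T.K → Z, (∀ k, ρ (α₁ k) = f₁ k) ∧ (∀ k, ρ (α₂ k) = f₂ k) ∧ ∀ k, ρ (β k) = g k)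
  (surj : ∀ p : T.K → Prop, (∀ k, p (α₁ k)) → (∀ k, p (α₂ k)) → (∀ k, p (β k)) → ∀ t, p t)
  (inn₁ : ∀ c, T.inn (.inl c) = α₁ (G₁.inn c)) (inn₂ : ∀ c, T.inn (.inr c) = α₂ (G₂.inn c))
  (out : ∀ c, T.out c = β (H.out c))
  (X : T.X = push α₁ G₁.X + push α₂ G₂.X + push β H.X - 4 • cnt (fun c => α₁ (G₁.out c))
    - 4 • cnt (fun c => α₂ (G₂.out c)))
  (δ : T.δ = push α₁ G₁.δ + push α₂ G₂.δ + push β H.δ) (f : Set C₁ → R) (g : Set C₂ → R) :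
  T.Good ∧ H.L (tens (G₁.L f) (G₂.L g)) = T.L (tens f g) := by
  rw [L_sum]
  refine L_comp_of (h₁.sum h₂) hH T (Sum.elim α₁ α₂) β (by simp_all)
    (fun Z f g h => ?_) (fun p hα hβ => surj p (fun k => hα (.inl k)) (fun k => hα (.inr k)) hβ)
    (by simp_all) out ?_ ?_ _
  · obtain ⟨ρ, h1, h2, h3⟩ := univ Z (fun k => f (.inl k)) (fun k => f (.inr k)) g
      (fun c => h (.inl c)) (fun c => h (.inr c))
    exact ⟨ρ, by simp_all⟩
  · have e1 : push (Sum.elim α₁ α₂) (G₁.sum G₂).X = push α₁ G₁.X + push α₂ G₂.X :=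
      push_sum (N := G₁.K) (N' := G₂.K) _ _
    have e2 : cnt (fun c => Sum.elim α₁ α₂ ((G₁.sum G₂).out c))
        = cnt (fun c => α₁ (G₁.out c)) + cnt (fun c => α₂ (G₂.out c)) := cnt_sum _
    rw [X, e1, e2, smul_add]
    abel
  · have e1 : push (Sum.elim α₁ α₂) (G₁.sum G₂).δ = push α₁ G₁.δ + push α₂ G₂.δ :=
      push_sum (N := G₁.K) (N' := G₂.K) (Sum.elim α₁ α₂) (Sum.elim G₁.δ G₂.δ)
    exact δ.trans (congrArg (· + _) e1.symm)

section family

variable {I : Type} [Finite I] {E E' : I → Type} [∀ i, Finite (E i)] [∀ i, Finite (E' i)]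

/-- Gluing a family of cobordisms to the inputs of another one. -/
theorem L_tensor_of {G : ∀ i, Cob (E i) (E' i)} {H : Cob (Σ i, E' i) C''} (hG : ∀ i, (G i).Good)
  (hH : H.Good) (T : Cob (Σ i, E i) C'')
  (α : ∀ i, (G i).K → T.K) (β : H.K → T.K) (glue : ∀ i c, α i ((G i).out c) = β (H.inn ⟨i, c⟩))
  (univ : ∀ (Z : Type) (f : ∀ i, (G i).K → Z) (g : H.K → Z),
    (∀ i c, f i ((G i).out c) = g (H.inn ⟨i, c⟩)) →
    ∃ ρ : T.K → Z, (∀ i k, ρ (α i k) = f i k) ∧ ∀ k, ρ (β k) = g k)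
  (surj : ∀ p : T.K → Prop, (∀ i k, p (α i k)) → (∀ k, p (β k)) → ∀ t, p t)
  (inn : ∀ i c, T.inn ⟨i, c⟩ = α i ((G i).inn c)) (out : ∀ c, T.out c = β (H.out c))
  (X : T.X = push (fun k : Σ i, (G i).K => α k.1 k.2) (fun k => (G k.1).X k.2) + push β H.X
    - 4 • cnt (fun c : Σ i, E' i => α c.1 ((G c.1).out c.2)))
  (δ : T.δ = push (fun k : Σ i, (G i).K => α k.1 k.2) (fun k => (G k.1).δ k.2) + push β H.δ)
  (f : ∀ i, Set (E i) → R) :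
  T.Good ∧ H.L (tensor fun i => (G i).L (f i)) = T.L (tensor f) := by
  rw [L_sigma]
  refine L_comp_of (Good.sigma hG) hH T (fun k => α k.1 k.2) β (fun c => glue c.1 c.2)
    (fun Z f g h => ?_) (fun p hα hβ => surj p (fun i k => hα ⟨i, k⟩) hβ)
    (fun c => inn c.1 c.2) out X δ _
  obtain ⟨ρ, h1, h2⟩ := univ Z (fun i k => f ⟨i, k⟩) g (fun i c => h ⟨i, c⟩)
  exact ⟨ρ, fun k => h1 k.1 k.2, h2⟩

end family

end Cob

variable [Finite e]

/-- Morphisms with coefficients in `R`. -/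
abbrev RHom (R : Type) (a b : Flat e) : Type := Set (Circ a b) → R

def hcomp {a b c : Flat e} (f : RHom R a b) (g : RHom R b c) : RHom R a c :=
  (stackCob a b c).L (Cob.tens f g)

open StackK Cob

theorem stackCob_X (a b c : Flat e) : (stackCob a b c).X =
  2 • cnt (qab : Circ a b → StackK a b c) + 2 • cnt (qbc : Circ b c → StackK a b c)
  + 2 • cnt (qac : Circ a c → StackK a b c) - cnt (fun p => (nb (b.pt p) : StackK a b c)) := rfl

section assoc

variable {a b c d : Flat e}

inductive chainLink (a b c d : Flat e) : a.Comp ⊕ b.Comp ⊕ c.Comp ⊕ d.Comp →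
  a.Comp ⊕ b.Comp ⊕ c.Comp ⊕ d.Comp → Prop
  | ab (p : e) : chainLink a b c d (.inl (a.pt p)) (.inr (.inl (b.pt p)))
  | bc (p : e) : chainLink a b c d (.inr (.inl (b.pt p))) (.inr (.inr (.inl (c.pt p))))
  | cd (p : e) : chainLink a b c d (.inr (.inr (.inl (c.pt p)))) (.inr (.inr (.inr (d.pt p))))

abbrev ChainK (a b c d : Flat e) : Type := Quot (chainLink a b c d)

namespace ChainK

def na (x : a.Comp) : ChainK a b c d := Quot.mk _ (.inl x)
def nb (x : b.Comp) : ChainK a b c d := Quot.mk _ (.inr (.inl x))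
def nc (x : c.Comp) : ChainK a b c d := Quot.mk _ (.inr (.inr (.inl x)))
def nd (x : d.Comp) : ChainK a b c d := Quot.mk _ (.inr (.inr (.inr x)))

theorem gab (p : e) : (na (a.pt p) : ChainK a b c d) = nb (b.pt p) := Quot.sound (.ab p)
theorem gbc (p : e) : (nb (b.pt p) : ChainK a b c d) = nc (c.pt p) := Quot.sound (.bc p)
theorem gcd (p : e) : (nc (c.pt p) : ChainK a b c d) = nd (d.pt p) := Quot.sound (.cd p)

theorem exists_lift {Z : Type} (fa : a.Comp → Z) (fb : b.Comp → Z) (fc : c.Comp → Z)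
  (fd : d.Comp → Z) (h₁ : ∀ p, fa (a.pt p) = fb (b.pt p)) (h₂ : ∀ p, fb (b.pt p) = fc (c.pt p))
  (h₃ : ∀ p, fc (c.pt p) = fd (d.pt p)) : ∃ ρ : ChainK a b c d → Z,
  (∀ x, ρ (na x) = fa x) ∧ (∀ x, ρ (nb x) = fb x) ∧ (∀ x, ρ (nc x) = fc x) ∧
    ∀ x, ρ (nd x) = fd x :=
  ⟨Quot.lift (Sum.elim fa (Sum.elim fb (Sum.elim fc fd))) (by
    rintro _ _ (p | p | p)
    exacts [h₁ p, h₂ p, h₃ p]), fun _ => rfl, fun _ => rfl, fun _ => rfl, fun _ => rfl⟩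

theorem ind {p : ChainK a b c d → Prop} (ha : ∀ x, p (na x)) (hb : ∀ x, p (nb x))
  (hc : ∀ x, p (nc x)) (hd : ∀ x, p (nd x)) : ∀ q, p q := by
  rintro ⟨s | s | s | s⟩
  exacts [ha s, hb s, hc s, hd s]

@[simp] def qab : Circ a b → ChainK a b c d := Circ.lift na nb gab
@[simp] def qbc : Circ b c → ChainK a b c d := Circ.lift nb nc gbc
@[simp] def qcd : Circ c d → ChainK a b c d := Circ.lift nc nd gcd
@[simp] def qad : Circ a d → ChainK a b c d := Circ.lift na nd fun p => by rw [gab, gbc, gcd]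

end ChainK

theorem Circ.funext {a b : Flat e} {Z : Type} {f g : Circ a b → Z}
  (ha : ∀ x, f (Circ.l x) = g (Circ.l x) := by simp +zetaDelta)
  (hb : ∀ x, f (Circ.r x) = g (Circ.r x) := by simp +zetaDelta) : f = g := _root_.funext (Circ.ind ha hb)

/-- The cobordism that composes three morphisms. -/
abbrev chainCob (a b c d : Flat e) : Cob ((Circ a b ⊕ Circ b c) ⊕ Circ c d) (Circ a d) where
  K := ChainK a b c d
  inn := Sum.elim (Sum.elim ChainK.qab ChainK.qbc) ChainK.qcd
  out := ChainK.qad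
  X := 2 • cnt (ChainK.qab : Circ a b → ChainK a b c d)
    + 2 • cnt (ChainK.qbc : Circ b c → ChainK a b c d)
    + 2 • cnt (ChainK.qcd : Circ c d → ChainK a b c d)
    + 2 • cnt (ChainK.qad : Circ a d → ChainK a b c d)
    - 2 • cnt (fun p => (ChainK.nb (b.pt p) : ChainK a b c d))
  δ := 0

variable [CharP R 2]

theorem hcomp_hcomp_left (ha : a.Mfd) (hb : b.Mfd) (hc : c.Mfd) (hd : d.Mfd) (f : RHom R a b)
  (g : RHom R b c) (h : RHom R c d) :
  hcomp (hcomp f g) h = (chainCob a b c d).L (tens (tens f g) h) := by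
  unfold hcomp
  conv_lhs => rw [← L_ident h]
  let α : StackK a b c → ChainK a b c d := StackK.lift ChainK.na ChainK.nb ChainK.nc
    ChainK.gab ChainK.gbc
  let β : StackK a c d → ChainK a b c d := StackK.lift ChainK.na ChainK.nc ChainK.nd
    (fun p => by rw [ChainK.gab, ChainK.gbc]) ChainK.gcd
  refine (L_tens_of (stackCob_good ha hb hc) (ident_good _) (stackCob_good ha hc hd)
    (chainCob a b c d) α ChainK.qcd β
    (Circ.ind (by simp [α, β]) (by simp [α, β])) (Circ.ind (by simp [α, β]) (by simp [α, β]))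
    (fun Z f₁ f₂ g h1 h2 => ?_) (fun p h1 h2 h3 => ChainK.ind (fun x => ?_) (fun x => ?_)
      (fun x => ?_) (fun x => ?_)) ?_ ?_ (Circ.ind (by simp [β]) (by simp [β])) ?_ ?_ _ _).2
  · obtain ⟨ρ, ha, hb, hc, hd⟩ := ChainK.exists_lift (fun x => f₁ (na x)) (fun x => f₁ (nb x))
      (fun x => f₁ (nc x)) (fun x => g (nc x)) (fun p => congrArg f₁ (glue₁ p))
      (fun p => congrArg f₁ (glue₂ p)) (fun p => by
        have := h1 (Circ.r (c.pt p))
        simp only [qac_r, Sum.elim_inl, qab_r] at this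
        rw [this, glue₂])
    refine ⟨ρ, StackK.ind ?_ ?_ ?_, Circ.ind ?_ ?_, StackK.ind ?_ ?_ ?_⟩ <;> intro x
    iterate 3 simp [α, ha, hb, hc]
    · have := h1 (Circ.r x)
      have h2 := h2 (Circ.l x)
      simp at this h2
      simp [ChainK.qcd, hc, this, h2]
    · simp [ChainK.qcd, hd, h2]
    · have := h1 (Circ.l x)
      simp at this
      simp [β, ha, this]
    · have := h1 (Circ.r x)
      simp at this
      simp [β, hc, this]
    · simp [β, hd]
  · simpa [α] using h1 (na x)
  · simpa [α] using h1 (nb x)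
  · simpa [α] using h1 (nc x)
  · simpa [β] using h3 (nc x)
  · intro q
    rcases q with q | q <;> revert q <;> refine Circ.ind (fun x => ?_) (fun x => ?_) <;>
      simp [α, ChainK.qab, ChainK.qbc]
  · simp
  · have e1 : α ∘ qab = ChainK.qab := Circ.funext
    have e2 : α ∘ qbc = ChainK.qbc := Circ.funext
    have e3 : α ∘ qac = fun q => α (qac q) := rfl
    have e4 : β ∘ qab = fun q => α (qac q) := Circ.funext
    have e5 : β ∘ qbc = ChainK.qcd := Circ.funext
    have e6 : β ∘ qac = ChainK.qad := Circ.funext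
    have e7 : (α ∘ fun p => nb (b.pt p)) = fun p => ChainK.nb (b.pt p) := by rfl
    have e8 : (β ∘ fun p => nb (c.pt p)) = fun p => ChainK.nb (b.pt p) := by
      ext p; simp [β, ChainK.gbc]
    simp only [map_sub, map_add, map_nsmul, push_cnt, push_ident, e1, e2, e3, e4, e5, e6, e7, e8]
    abel
  · simp

theorem hcomp_hcomp_right (ha : a.Mfd) (hb : b.Mfd) (hc : c.Mfd) (hd : d.Mfd) (f : RHom R a b)
  (g : RHom R b c) (h : RHom R c d) :
  hcomp f (hcomp g h) = (chainCob a b c d).L (tens (tens f g) h) := by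
  unfold hcomp
  conv_lhs => rw [← L_ident f]
  rw [L_reind (Equiv.sumAssoc (Circ a b) (Circ b c) (Circ c d)).symm]
  have ef : (fun V => tens (tens f g) h
      ((Equiv.sumAssoc (Circ a b) (Circ b c) (Circ c d)).symm.symm ⁻¹' V))
      = tens f (tens g h) := by
    ext V
    exact mul_assoc _ _ _
  rw [ef]
  let α : StackK b c d → ChainK a b c d := StackK.lift ChainK.nb ChainK.nc ChainK.nd
    ChainK.gbc ChainK.gcd
  let β : StackK a b d → ChainK a b c d := StackK.lift ChainK.na ChainK.nb ChainK.nd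
    ChainK.gab (fun p => by rw [ChainK.gbc, ChainK.gcd])
  refine (L_tens_of (ident_good _) (stackCob_good hb hc hd) (stackCob_good ha hb hd)
    _ ChainK.qab α β
    (Circ.ind (by simp [α, β]) (by simp [α, β])) (Circ.ind (by simp [α, β]) (by simp [α, β]))
    (fun Z f₁ f₂ g h1 h2 => ?_) (fun p h1 h2 h3 => ChainK.ind (fun x => ?_) (fun x => ?_)
      (fun x => ?_) (fun x => ?_)) ?_ ?_ (Circ.ind (by simp [β]) (by simp [β])) ?_ ?_ _ _).2
  · obtain ⟨ρ, ha, hb, hc, hd⟩ := ChainK.exists_lift (fun x => g (na x)) (fun x => f₂ (na x))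
      (fun x => f₂ (nb x)) (fun x => f₂ (nc x)) (fun p => by
        have := h2 (Circ.l (b.pt p))
        simp only [qac_l, Sum.elim_inr, qbc_l] at this
        rw [this, ← glue₁]) (fun p => congrArg f₂ (glue₁ p))
      (fun p => congrArg f₂ (glue₂ p))
    refine ⟨ρ, Circ.ind ?_ ?_, StackK.ind ?_ ?_ ?_, StackK.ind ?_ ?_ ?_⟩ <;> intro x
    · have := h1 (Circ.l x)
      simp at this
      simp [ChainK.qab, ha, this]
    · have := h1 (Circ.r x)
      have h2 := h2 (Circ.l x)
      simp at this h2
      simp [ChainK.qab, hb, this, h2]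
    iterate 3 simp [α, hb, hc, hd]
    · simp [β, ha]
    · have := h2 (Circ.l x)
      simp at this
      simp [β, hb, this]
    · have := h2 (Circ.r x)
      simp at this
      simp [β, hd, this]
  · simpa [β] using h3 (na x)
  · simpa [β] using h3 (nb x)
  · simpa [α] using h2 (nb x)
  · simpa [β] using h3 (nc x)
  · simp
  · intro q
    rcases q with q | q <;> revert q <;> refine Circ.ind (fun x => ?_) (fun x => ?_) <;>
      simp [α, ChainK.qbc, ChainK.qcd]
  · have e1 : α ∘ qab = ChainK.qbc := Circ.funext
    have e2 : α ∘ qbc = ChainK.qcd := Circ.funext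
    have e3 : α ∘ qac = fun q => α (qac q) := rfl
    have e4 : β ∘ qbc = fun q => α (qac q) := Circ.funext
    have e5 : β ∘ qab = ChainK.qab := Circ.funext
    have e6 : β ∘ qac = ChainK.qad := Circ.funext
    have e7 : (α ∘ fun p => nb (c.pt p)) = fun p => ChainK.nb (b.pt p) := by
      ext p; simp [α, ChainK.gbc]
    have e8 : (β ∘ fun p => nb (b.pt p)) = fun p => ChainK.nb (b.pt p) := by rfl
    simp only [map_sub, map_add, map_nsmul, push_cnt, push_ident, e1, e2, e3, e4, e5, e6, e7, e8]
    abel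
  · simp

theorem hcomp_assoc (ha : a.Mfd) (hb : b.Mfd) (hc : c.Mfd) (hd : d.Mfd) (f : RHom R a b)
  (g : RHom R b c) (h : RHom R c d) : hcomp (hcomp f g) h = hcomp f (hcomp g h) := by
  rw [hcomp_hcomp_left ha hb hc hd, hcomp_hcomp_right ha hb hc hd]

end assoc

namespace Cob

variable [CharP R 2] {C₁ C₁' C₂ C₂' C'' : Type} [Finite C₁] [Finite C₁'] [Finite C₂] [Finite C₂']
  [Finite C'']

theorem L_tens_left_of {G : Cob Empty C₁'} {H : Cob (C₁' ⊕ C₂) C''} (hG : G.Good) (hH : H.Good)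
  (T : Cob C₂ C'') (α : G.K → T.K) (β : H.K → T.K)
  (glue : ∀ c, α (G.out c) = β (H.inn (.inl c)))
  (univ : ∀ (Z : Type) (f : G.K → Z) (g : H.K → Z), (∀ c, f (G.out c) = g (H.inn (.inl c))) →
    ∃ ρ : T.K → Z, (∀ k, ρ (α k) = f k) ∧ ∀ k, ρ (β k) = g k)
  (surj : ∀ p : T.K → Prop, (∀ k, p (α k)) → (∀ k, p (β k)) → ∀ t, p t)
  (inn : ∀ c, T.inn c = β (H.inn (.inr c))) (out : ∀ c, T.out c = β (H.out c))
  (X : T.X = push α G.X + push β H.X - 4 • cnt (fun c => α (G.out c)))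
  (δ : T.δ = push α G.δ + push β H.δ) (g : Set C₂ → R) :
  T.Good ∧ H.L (tens (G.L 1) g) = T.L g := by
  rw [L_reind (Equiv.emptySum Empty C₂) T]
  have ef : (fun V => g ((Equiv.emptySum Empty C₂).symm ⁻¹' V)) = tens 1 g := by
    ext V
    exact (one_mul _).symm
  rw [ef]
  conv => enter [2, 1]; rw [← L_ident g]
  refine L_tens_of (R := R) hG (ident_good _) hH { T with inn := T.inn ∘ Equiv.emptySum Empty C₂ } α (fun c => β (H.inn (.inr c))) β glue (fun c => rfl)
    (fun Z f₁ f₂ g h1 h2 => ?_) (fun p h1 h2 h3 => surj p h1 h3) (fun c => c.elim) inn out ?_ ?_ _ _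
  · obtain ⟨ρ, h3, h4⟩ := univ Z f₁ g h1
    exact ⟨ρ, h3, fun k => (h4 _).trans (h2 k).symm, h4⟩
  · refine X.trans ?_
    rw [push_ident]
    abel
  · simp_all

theorem L_tens_right_of {G : Cob Empty C₁'} {H : Cob (C₂ ⊕ C₁') C''} (hG : G.Good) (hH : H.Good)
  (T : Cob C₂ C'') (α : G.K → T.K) (β : H.K → T.K)
  (glue : ∀ c, α (G.out c) = β (H.inn (.inr c)))
  (univ : ∀ (Z : Type) (f : G.K → Z) (g : H.K → Z), (∀ c, f (G.out c) = g (H.inn (.inr c))) →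
    ∃ ρ : T.K → Z, (∀ k, ρ (α k) = f k) ∧ ∀ k, ρ (β k) = g k)
  (surj : ∀ p : T.K → Prop, (∀ k, p (α k)) → (∀ k, p (β k)) → ∀ t, p t)
  (inn : ∀ c, T.inn c = β (H.inn (.inl c))) (out : ∀ c, T.out c = β (H.out c))
  (X : T.X = push α G.X + push β H.X - 4 • cnt (fun c => α (G.out c)))
  (δ : T.δ = push α G.δ + push β H.δ) (g : Set C₂ → R) :
  T.Good ∧ H.L (tens g (G.L 1)) = T.L g := by
  rw [L_reind (Equiv.sumEmpty C₂ Empty) T]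
  have ef : (fun V => g ((Equiv.sumEmpty C₂ Empty).symm ⁻¹' V)) = tens g 1 := by
    ext V
    exact (mul_one _).symm
  rw [ef]
  conv => enter [2, 1]; rw [← L_ident g]
  refine L_tens_of (R := R) (ident_good _) hG hH { T with inn := T.inn ∘ Equiv.sumEmpty C₂ Empty } (fun c => β (H.inn (.inl c))) α β (fun c => rfl) glue
    (fun Z f₁ f₂ g h1 h2 => ?_) (fun p h1 h2 h3 => surj p h2 h3) inn (fun c => c.elim) out ?_ ?_ _ _
  · obtain ⟨ρ, h3, h4⟩ := univ Z f₂ g h2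
    exact ⟨ρ, fun k => (h4 _).trans (h1 k).symm, h3, h4⟩
  · refine X.trans ?_
    rw [push_ident]
    abel
  · simp_all

end Cob

structure FlatIso (a b : Flat e) extends a.Comp ≃ b.Comp where
  map_pt : ∀ p, toEquiv (a.pt p) = b.pt p

namespace FlatIso

variable {a b c : Flat e}

def refl (a : Flat e) : FlatIso a a := ⟨Equiv.refl _, fun _ => rfl⟩

def symm (φ : FlatIso a b) : FlatIso b a :=
  ⟨φ.toEquiv.symm, fun p => by rw [Equiv.symm_apply_eq, φ.map_pt]⟩

theorem mfd (φ : FlatIso a b) (ha : a.Mfd) : b.Mfd := by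
  intro c
  obtain ⟨c, rfl⟩ := φ.toEquiv.surjective c
  have : b.pt = φ.toEquiv ∘ a.pt := _root_.funext fun p => (φ.map_pt p).symm
  rw [this, cnt_comp_apply φ.toEquiv.injective]
  exact ha c

/-- The collapse of the boundary of the dotted cylinder. -/
def proj (φ : FlatIso a b) : Circ a b → b.Comp := Circ.lift φ.toEquiv id φ.map_pt

@[simp] theorem proj_l (φ : FlatIso a b) (x : a.Comp) : φ.proj (Circ.l x) = φ.toEquiv x := Circ.lift_l _ _ _ _
@[simp] theorem proj_r (φ : FlatIso a b) (x : b.Comp) : φ.proj (Circ.r x) = x := Circ.lift_r _ _ _ _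

/-- The cylinder with dots. -/
abbrev cyl (φ : FlatIso a b) (δ : b.Comp → ℕ) : Cob Empty (Circ a b) where
  K := b.Comp
  inn := Empty.elim
  out := φ.proj
  X := cnt b.pt + 2 • cnt φ.proj
  δ := δ

theorem cyl_X (φ : FlatIso a b) (hb : b.Mfd) (δ : b.Comp → ℕ) (y : b.Comp) :
  (φ.cyl δ).X y = 4 := by
  change cnt b.pt y + (2 • cnt φ.proj) y = 4
  rw [Pi.smul_apply, cnt_eq_ncard φ.proj]
  by_cases hy : ∃ p, b.pt p = y
  · obtain ⟨p, rfl⟩ := hy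
    have h1 : cnt b.pt (b.pt p) = 2 := by
      refine (hb _).resolve_left fun h => ?_
      rw [cnt_eq_ncard] at h
      have : p ∈ {n | b.pt n = b.pt p} := rfl
      have h2 := Set.ncard_pos (Set.toFinite _) |>.2 ⟨p, this⟩
      omega
    have h2 : {n | φ.proj n = b.pt p} = {Circ.r (b.pt p)} := by
      ext q
      refine ⟨fun h => ?_, fun h => ?_⟩
      · revert h; revert q
        refine Circ.ind (fun x h => ?_) (fun x h => ?_)
        · have hx : x = a.pt p := φ.toEquiv.injective (
            (φ.proj_l x).symm.trans (Eq.trans (Set.mem_ofPred_eq.mp h) (φ.map_pt p).symm))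
          rw [hx, Circ.glue]; exact Set.mem_singleton _
        · simp_all
      · simp_all
    rw [h1, h2, Set.ncard_singleton]; rfl
  · push Not at hy
    have h1 : cnt b.pt y = 0 := cnt_eq_zero _ _ hy
    have h2 : {n | φ.proj n = y} = {Circ.l (φ.toEquiv.symm y), Circ.r y} := by
      ext q
      refine ⟨fun h => ?_, fun h => ?_⟩
      · revert h; revert q
        refine Circ.ind (fun x h => ?_) (fun x h => ?_)
        · grind [show φ.toEquiv x = y from (φ.proj_l x).symm.trans h, Equiv.symm_apply_apply]
        · simp_all
      · rcases h with h | h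
        · simp_all
        · simp_all
    have h3 : (Circ.l (φ.toEquiv.symm y) : Circ a b) ≠ Circ.r y := by
      intro h
      have := congrArg (Circ.lift (fun x => φ.toEquiv x = y) (fun _ => False)
        (fun p => by simp [φ.map_pt, hy])) h
      rw [Circ.lift_l, Circ.lift_r] at this
      rw [← this]
      exact φ.toEquiv.apply_symm_apply y
    rw [h1, h2, Set.ncard_pair h3]; rfl

theorem cyl_good (φ : FlatIso a b) (hb : b.Mfd) (δ : b.Comp → ℕ) : (φ.cyl δ).Good :=
  fun y => (φ.cyl_X hb δ y).le

/-- Relabelling of the boundary circles along an identification of the sources. -/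
def left (φ : FlatIso a b) (c : Flat e) : Circ a c ≃ Circ b c where
  toFun := Circ.lift (fun x => Circ.l (φ.toEquiv x)) Circ.r fun p => by rw [φ.map_pt, Circ.glue]
  invFun := Circ.lift (fun x => Circ.l (φ.toEquiv.symm x)) Circ.r fun p => by
    rw [← φ.map_pt, Equiv.symm_apply_apply, Circ.glue]
  left_inv := Circ.ind (by simp) (by simp)
  right_inv := Circ.ind (by simp) (by simp)

def right (φ : FlatIso b c) (a : Flat e) : Circ a b ≃ Circ a c where
  toFun := Circ.lift Circ.l (fun x => Circ.r (φ.toEquiv x)) fun p => by rw [φ.map_pt, Circ.glue]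
  invFun := Circ.lift Circ.l (fun x => Circ.r (φ.toEquiv.symm x)) fun p => by
    rw [← φ.map_pt, Equiv.symm_apply_apply, Circ.glue]
  left_inv := Circ.ind (by simp) (by simp)
  right_inv := Circ.ind (by simp) (by simp)

@[simp] theorem left_l (φ : FlatIso a b) (x) : φ.left c (Circ.l x) = Circ.l (φ.toEquiv x) := by simp [left]
@[simp] theorem left_r (φ : FlatIso a b) (x) : φ.left c (Circ.r x) = Circ.r x := by simp [left]
@[simp] theorem right_l (φ : FlatIso b c) (x) : φ.right a (Circ.l x) = Circ.l x := by simp [right]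
@[simp] theorem right_r (φ : FlatIso b c) (x) : φ.right a (Circ.r x) = Circ.r (φ.toEquiv x) := by simp [right]

abbrev leftCob (φ : FlatIso a b) (c : Flat e) (δ : b.Comp → ℕ) : Cob (Circ b c) (Circ a c) where
  K := Circ b c
  inn := id
  out := φ.left c
  X _ := 4
  δ := push Circ.l δ

abbrev rightCob (φ : FlatIso b c) (a : Flat e) (δ : c.Comp → ℕ) :
  Cob (Circ a b) (Circ a c) where
  K := Circ a c
  inn := φ.right a
  out := id
  X _ := 4
  δ := push Circ.r δ

variable [CharP R 2]

theorem hcomp_cyl_left (φ : FlatIso a b) (hb : b.Mfd) (hc : c.Mfd) (δ : b.Comp → ℕ)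
  (f : RHom R b c) : hcomp ((φ.cyl δ).L 1) f = (φ.leftCob c δ).L f := by
  let β : StackK a b c → Circ b c := StackK.lift (fun x => Circ.l (φ.toEquiv x)) Circ.l Circ.r
    (fun p => by rw [φ.map_pt]) Circ.glue
  have ha := φ.symm.mfd hb
  refine (L_tens_left_of (φ.cyl_good hb δ) (stackCob_good ha hb hc) _ Circ.l β
    (Circ.ind (by simp [β]) (by simp [β])) (fun Z f g h => ?_)
    (fun p h1 h2 => Circ.ind h1 fun x => ?_) (Circ.ind (by simp [β]) (by simp [β]))
    (Circ.ind (by simp [β]) (by simp [β])) ?_ ?_ _).2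
  · have hl := fun x => h (Circ.l x)
    have hr := fun x => h (Circ.r x)
    simp only [proj_l, proj_r, Sum.elim_inl, qab_l, qab_r] at hl hr
    refine ⟨Circ.lift f (fun x => g (nc x)) (fun p => by rw [hr, glue₂]), fun k => Circ.lift_l _ _ _ k,
      StackK.ind (fun x => ?_) (fun x => ?_) (fun x => ?_)⟩
    · simp [β, hl]
    · simp [β, hr]
    · simp [β]
  · simpa [β] using h2 (nc x)
  · have e1 : β ∘ qab = fun q => Circ.l (φ.proj q) := Circ.funext
    have e2 : β ∘ qbc = id := Circ.funext
    have e3 : β ∘ qac = φ.left c := Circ.funext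
    have e4 : (β ∘ fun p => nb (b.pt p)) = Circ.l ∘ b.pt := by rfl
    have e5 : Circ.l ∘ φ.proj = fun q => (Circ.l (φ.proj q) : Circ b c) := rfl
    simp only [map_sub, map_add, map_nsmul, push_cnt, e1, e2, e3, e4, e5]
    ext k
    have h1 : cnt (id : Circ b c → Circ b c) k = 1 := cnt_bij Function.bijective_id k
    have h2 : cnt (φ.left c) k = 1 := cnt_bij (φ.left c).bijective k
    simp only [Pi.add_apply, Pi.sub_apply, Pi.smul_apply, h1, h2]
    simp only [nsmul_eq_mul]
    push_cast
    ring
  · simp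

theorem hcomp_cyl_right (φ : FlatIso b c) (ha : a.Mfd) (hc : c.Mfd) (δ : c.Comp → ℕ)
  (f : RHom R a b) : hcomp f ((φ.cyl δ).L 1) = (φ.rightCob a δ).L f := by
  let β : StackK a b c → Circ a c := StackK.lift Circ.l (fun x => Circ.r (φ.toEquiv x)) Circ.r
    (fun p => by rw [φ.map_pt, Circ.glue]) (fun p => by rw [φ.map_pt])
  have hb := φ.symm.mfd hc
  refine (L_tens_right_of (φ.cyl_good hc δ) (stackCob_good ha hb hc) _ Circ.r β
    (Circ.ind (by simp [β]) (by simp [β])) (fun Z f g h => ?_)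
    (fun p h1 h2 => Circ.ind (fun x => ?_) h1) (Circ.ind (by simp [β]) (by simp [β]))
    (Circ.ind (by simp [β]) (by simp [β])) ?_ ?_ _).2
  · have hl := fun x => h (Circ.l x)
    have hr := fun x => h (Circ.r x)
    simp only [proj_l, proj_r, Sum.elim_inr, qbc_l, qbc_r] at hl hr
    refine ⟨Circ.lift (fun x => g (na x)) f (fun p => by simp [hr, glue₂, glue₁]), fun k => Circ.lift_r _ _ _ k,
      StackK.ind (fun x => ?_) (fun x => ?_) (fun x => ?_)⟩
    · simp [β]
    · simp [β, hl]
    · simp [β, hr]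
  · simpa [β] using h2 (na x)
  · have e1 : β ∘ qbc = fun q => Circ.r (φ.proj q) := Circ.funext
    have e2 : β ∘ qac = id := Circ.funext
    have e3 : β ∘ qab = φ.right a := Circ.funext
    have e4 : (β ∘ fun p => nb (b.pt p)) = Circ.r ∘ c.pt := by ext p; simp [β, φ.map_pt]
    have e5 : Circ.r ∘ φ.proj = fun q => (Circ.r (φ.proj q) : Circ a c) := rfl
    simp only [map_sub, map_add, map_nsmul, push_cnt, e1, e2, e3, e4, e5]
    ext k
    have h1 : cnt (id : Circ a c → Circ a c) k = 1 := cnt_bij Function.bijective_id k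
    have h2 : cnt (φ.right a) k = 1 := cnt_bij (φ.right a).bijective k
    simp only [Pi.add_apply, Pi.sub_apply, Pi.smul_apply, h1, h2]
    simp only [nsmul_eq_mul]
    push_cast
    ring
  · simp

end FlatIso

end

section
variable {e o : Type}

theorem quot_exists_and {α Z : Type} {r : α → α → Prop} (f : α → Z) (g : Quot r → Z)
  (h : ∀ s, g (Quot.mk _ s) = f s) (q : Quot r) (k : Z) :
  (∃ s, Quot.mk _ s = q ∧ f s = k) ↔ g q = k := by
  induction q using Quot.ind with | _ s => ?_
  refine ⟨?_, fun hk => ⟨s, rfl, by rw [← h, hk]⟩⟩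
  rintro ⟨t, ht, rfl⟩
  rw [← ht, h]

theorem Surface.toHom_apply {a b : Flat e} (F : Surface a b) [Finite (Circ a b)] {K : Type}
  (ψ : F.K ≃ K) (out : Circ a b → K) (ho : ∀ s, ψ (F.bd s) = out (Quot.mk _ s)) (X : K → ℤ)
  (δ : K → ℕ) (hX : ∀ k, X (ψ k) = 2 * F.χ k + 2 * cnt out (ψ k))
  (hδ : ∀ k, F.dots k = δ (ψ k)) (V : Set (Circ a b)) :
  F.toHom V = ev (ZMod 2) X (δ + push out (ind Vᶜ)) := by
  have hc : ∀ k, F.circles k = {q | out q = ψ k} := fun k => by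
    ext q
    rw [Surface.circles, Set.mem_ofPred_eq, Set.mem_ofPred_eq,
      ← quot_exists_and (fun s => ψ (F.bd s)) out (fun s => (ho s).symm)]
    simp only [ψ.injective.eq_iff]
  unfold Surface.toHom ev
  refine Eq.trans ?_ (if_congr (ψ.surjective.forall (p := fun k => X k = 4 ∧
    (δ + push out (ind Vᶜ)) k = 1)).symm rfl rfl)
  refine if_congr (forall_congr' fun k => ?_) rfl rfl
  rw [hX, cnt_eq_ncard, hδ, hc]
  have e1 : ({q | out q = ψ k} \ V : Set _) = {n | n ∈ Vᶜ ∧ out n = ψ k} := by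
    ext; simp [and_comm]
  rw [Pi.add_apply, push_ind, e1]
  refine and_congr_left' ?_
  constructor <;> intro h <;> linarith

variable [Finite e] [Finite o]

theorem stack_toHom {a b c : Flat e} (hb : b.Mfd) (V : Set (Circ a b)) (W : Set (Circ b c))
  (U : Set (Circ a c)) : (stack a b c V W).toHom U
    = (stackCob a b c).coef (ZMod 2) (Cob.setSum.symm (V, W)) U := by
  have h1 : ∀ s : a.S ⊕ b.S, (StackK.qab (Quot.mk _ s) : StackK a b c)
      = Quot.mk _ (Sum.map id Sum.inl s) := by rintro (s | s) <;> rfl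
  have h2 : ∀ s : b.S ⊕ c.S, (StackK.qbc (Quot.mk _ s) : StackK a b c)
      = Quot.mk _ (Sum.inr s) := by rintro (s | s) <;> rfl
  have h3 : ∀ s : a.S ⊕ c.S, (StackK.qac (Quot.mk _ s) : StackK a b c)
      = Quot.mk _ (Sum.map id Sum.inr s) := by rintro (s | s) <;> rfl
  have h4 : ∀ s : b.S, (StackK.nb (Quot.mk _ s) : StackK a b c)
      = Quot.mk _ (Sum.inr (Sum.inl s)) := fun s => rfl
  have e2 : push (stackCob a b c).inn (ind (Cob.setSum.symm (V, W)))
      = push StackK.qab (ind V) + push StackK.qbc (ind W) := push_sum _ _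
  have hX : ∀ k : StackK a b c, (stackCob a b c).X k
      = 2 * (stack a b c V W).χ k + 2 * cnt (StackK.qac : Circ a c → StackK a b c) k := fun k => by
    have hχ : (stack a b c V W).χ k = cnt (StackK.qab : Circ a b → StackK a b c) k
        + cnt (StackK.qbc : Circ b c → StackK a b c) k
        - {q : b.Comp | q ∈ b.arcs ∧ (StackK.nb q : StackK a b c) = k}.ncard := by
      simp only [cnt_eq_ncard, ← quot_exists_and _ _ h1, ← quot_exists_and _ _ h2,
        ← quot_exists_and _ _ h4]
      rfl
    rw [stackCob_X, hχ]
    simp only [Pi.add_apply, Pi.sub_apply, Pi.smul_apply]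
    rw [← hb.two_mul_arcs (StackK.nb : b.Comp → StackK a b c) k]
    simp only [nsmul_eq_mul]
    push_cast
    ring
  have hδ : ∀ k : StackK a b c, (stack a b c V W).dots k
      = (push StackK.qab (ind V) + push StackK.qbc (ind W) : StackK a b c → ℕ) k := fun k => by
    rw [Pi.add_apply, push_ind, push_ind]
    simp only [← quot_exists_and _ _ h1, ← quot_exists_and _ _ h2]
    rfl
  refine (Surface.toHom_apply (stack a b c V W) (K := StackK a b c) (Equiv.refl _)
    (stackCob a b c).out (fun s => (h3 s).symm) (stackCob a b c).X
    (push StackK.qab (ind V) + push StackK.qbc (ind W)) (fun k => ?_) (fun k => ?_) U).trans ?_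
  · exact hX k
  · exact hδ k
  · unfold Cob.coef
    rw [e2, zero_add]

theorem Hom.comp_eq {a b c : Flat e} (hb : b.Mfd) (f : Hom a b) (g : Hom b c) :
  f.comp g = hcomp (R := ZMod 2) f g := by
  ext U
  simp only [hcomp, Cob.L, Hom.comp]
  rw [← finsum_comp_equiv Cob.setSum.symm]
  simp only [fsum_eq, Finset.sum_apply, Fintype.sum_prod_type]
  refine sum_congr rfl fun V _ => sum_congr rfl fun W _ => ?_
  rw [Pi.smul_apply, smul_eq_mul, stack_toHom hb]
  rfl

section scalars

variable {R S : Type} [CommRing R] [CommRing S] (φ : R →+* S)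

theorem Cob.coef_map {C C' : Type} [Finite C] [Finite C'] (G : Cob C C') (V : Set C) (U : Set C') :
  φ (G.coef R V U) = G.coef S V U := by
  unfold Cob.coef ev
  split_ifs <;> simp

theorem Cob.L_map {C C' : Type} [Finite C] [Finite C'] (G : Cob C C') (f : Set C → R) :
  (fun U => φ (G.L f U)) = G.L fun V => φ (f V) := by
  ext U
  simp only [L, fsum_eq, map_sum, map_mul, coef_map]

theorem hcomp_map {a b c : Flat e} (f : RHom R a b) (g : RHom R b c) :
  (fun U => φ (hcomp f g U)) = hcomp (fun V => φ (f V)) (fun V => φ (g V)) := by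
  unfold hcomp
  rw [Cob.L_map]
  congr 1
  ext V
  exact map_mul φ _ _

end scalars

section linear

variable {R : Type} [CommRing R]

namespace Cob

variable {C C' : Type} [Finite C] [Finite C'] (G : Cob C C')

theorem L_add (f g : Set C → R) : G.L (f + g) = G.L f + G.L g := by
  ext U
  simp only [L, fsum_eq, Pi.add_apply, add_mul, sum_add_distrib]

theorem L_smul (r : R) (f : Set C → R) : G.L (r • f) = r • G.L f := by
  ext U
  simp only [L, fsum_eq, Pi.smul_apply, smul_eq_mul, mul_assoc, Finset.mul_sum]

/-- The map induced by a cobordism as a linear map. -/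
def linear (R : Type) [CommRing R] (G : Cob C C') : (Set C → R) →ₗ[R] (Set C' → R) where
  toFun := G.L
  map_add' := G.L_add
  map_smul' := G.L_smul

theorem linear_apply (f : Set C → R) : G.linear R f = G.L f := rfl

end Cob

variable {a b c : Flat e}

def hcompₗ (R : Type) [CommRing R] (a b c : Flat e) :
  RHom R a b →ₗ[R] RHom R b c →ₗ[R] RHom R a c :=
  LinearMap.mk₂ R hcomp
    (fun f f' g => by
      rw [hcomp, hcomp, hcomp, ← Cob.L_add]; congr 1; ext V; exact add_mul _ _ _)
    (fun r f g => by rw [hcomp, hcomp, ← Cob.L_smul]; congr 1; ext V; exact mul_assoc _ _ _)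
    (fun f g g' => by
      rw [hcomp, hcomp, hcomp, ← Cob.L_add]; congr 1; ext V; exact mul_add _ _ _)
    (fun r f g => by rw [hcomp, hcomp, ← Cob.L_smul]; congr 1; ext V; exact mul_left_comm _ _ _)

theorem hcompₗ_apply (f : RHom R a b) (g : RHom R b c) : hcompₗ R a b c f g = hcomp f g := rfl

theorem hcomp_zero (f : RHom R a b) : hcomp f (0 : RHom R b c) = 0 := map_zero (hcompₗ R a b c f)
theorem zero_hcomp (g : RHom R b c) : hcomp (0 : RHom R a b) g = 0 :=
  LinearMap.map_zero₂ (hcompₗ R a b c) g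
theorem hcomp_add (f : RHom R a b) (g g' : RHom R b c) :
  hcomp f (g + g') = hcomp f g + hcomp f g' := map_add (hcompₗ R a b c f) g g'
theorem add_hcomp (f f' : RHom R a b) (g : RHom R b c) :
  hcomp (f + f') g = hcomp f g + hcomp f' g := LinearMap.map_add₂ (hcompₗ R a b c) f f' g
theorem hcomp_smul (r : R) (f : RHom R a b) (g : RHom R b c) :
  hcomp f (r • g) = r • hcomp f g := map_smul (hcompₗ R a b c f) r g
theorem smul_hcomp (r : R) (f : RHom R a b) (g : RHom R b c) :
  hcomp (r • f) g = r • hcomp f g := LinearMap.map_smul₂ (hcompₗ R a b c) r f g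
theorem hcomp_sum {ι : Type} (s : Finset ι) (f : RHom R a b) (g : ι → RHom R b c) :
  hcomp f (∑ i ∈ s, g i) = ∑ i ∈ s, hcomp f (g i) := map_sum (hcompₗ R a b c f) g s
theorem sum_hcomp {ι : Type} (s : Finset ι) (f : ι → RHom R a b) (g : RHom R b c) :
  hcomp (∑ i ∈ s, f i) g = ∑ i ∈ s, hcomp (f i) g := by
  rw [← hcompₗ_apply, map_sum, LinearMap.sum_apply]
  rfl

end linear

section gluing

variable {I : Type} [Finite I] {E : I → Type} [∀ i, Finite (E i)]

/-- `A` is obtained from the `a i` by gluing them along the arc diagram `D`. -/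
structure IsGlue (D : ArcDiagram E o) (a : ∀ i, Flat (E i)) (A : Flat o) where
  j : ∀ i, (a i).Comp → A.Comp
  s : D.S → A.Comp
  glue : ∀ i p, j i ((a i).pt p) = s (D.bd (.inl ⟨i, p⟩))
  bd : ∀ p, A.pt p = s (D.bd (.inr p))
  univ : ∀ (Z : Type) (f : ∀ i, (a i).Comp → Z) (g : D.S → Z),
    (∀ i p, f i ((a i).pt p) = g (D.bd (.inl ⟨i, p⟩))) →
      ∃ ρ : A.Comp → Z, (∀ i x, ρ (j i x) = f i x) ∧ ∀ t, ρ (s t) = g t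
  ind : ∀ p : A.Comp → Prop, (∀ i x, p (j i x)) → (∀ t, p (s t)) → ∀ x, p x

namespace IsGlue

variable {D : ArcDiagram E o} {a b c : ∀ i, Flat (E i)} {A B C : Flat o}

def lift (G : IsGlue D a A) {Z : Type} (f : ∀ i, (a i).Comp → Z) (g : D.S → Z)
  (h : ∀ i p, f i ((a i).pt p) = g (D.bd (.inl ⟨i, p⟩))) : A.Comp → Z :=
  Classical.choose (G.univ Z f g h)

section
variable (G : IsGlue D a A) {Z : Type} (f : ∀ i, (a i).Comp → Z) (g : D.S → Z)
    (h : ∀ i p, f i ((a i).pt p) = g (D.bd (.inl ⟨i, p⟩)))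
@[simp] theorem lift_j (i x) : G.lift f g h (G.j i x) = f i x :=
  (Classical.choose_spec (G.univ Z f g h)).1 i x
@[simp] theorem lift_s (t) : G.lift f g h (G.s t) = g t :=
  (Classical.choose_spec (G.univ Z f g h)).2 t
end

end IsGlue

variable (D : ArcDiagram E o) (a b : ∀ i, Flat (E i))

inductive phiLink : (Σ i, Circ (a i) (b i)) ⊕ D.S → (Σ i, Circ (a i) (b i)) ⊕ D.S → Prop
  | glue (i : I) (p : E i) :
    phiLink (.inl ⟨i, Circ.l ((a i).pt p)⟩) (.inr (D.bd (.inl ⟨i, p⟩)))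

abbrev PhiK : Type := Quot (phiLink D a b)

namespace PhiK

variable {D a b}

def n (i : I) (q : Circ (a i) (b i)) : PhiK D a b := Quot.mk _ (.inl ⟨i, q⟩)
def s (t : D.S) : PhiK D a b := Quot.mk _ (.inr t)

theorem glue (i : I) (p : E i) :
  (n i (Circ.l ((a i).pt p)) : PhiK D a b) = s (D.bd (.inl ⟨i, p⟩)) := Quot.sound (.glue i p)

def lift {Z : Type} (f : ∀ i, Circ (a i) (b i) → Z) (g : D.S → Z)
  (h : ∀ i p, f i (Circ.l ((a i).pt p)) = g (D.bd (.inl ⟨i, p⟩))) : PhiK D a b → Z :=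
  Quot.lift (Sum.elim (fun q => f q.1 q.2) g) (by rintro _ _ ⟨i, p⟩; exact h i p)

section
variable {Z : Type} (f : ∀ i, Circ (a i) (b i) → Z) (g : D.S → Z)
    (h : ∀ i p, f i (Circ.l ((a i).pt p)) = g (D.bd (.inl ⟨i, p⟩)))
@[simp] theorem lift_n (i q) : lift f g h (n i q) = f i q := rfl
@[simp] theorem lift_s (t) : lift f g h (s t) = g t := rfl
end

theorem ind {p : PhiK D a b → Prop} (hn : ∀ i q, p (n i q)) (hs : ∀ t, p (s t)) : ∀ q, p q := by
  rintro ⟨⟨i, q⟩ | t⟩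
  exacts [hn i q, hs t]

variable {A B : Flat o}

def out (G : IsGlue D a A) (H : IsGlue D b B) : Circ A B → PhiK D a b :=
  Circ.lift (G.lift (fun i x => n i (Circ.l x)) s (fun i p => glue i p))
    (H.lift (fun i x => n i (Circ.r x)) s (fun i p => by rw [← Circ.glue]; exact glue i p))
    fun p => by rw [G.bd, H.bd, IsGlue.lift_s, IsGlue.lift_s]

variable (G : IsGlue D a A) (H : IsGlue D b B)

@[simp] theorem out_l_j (i x) : out G H (Circ.l (G.j i x)) = n i (Circ.l x) := by simp [out]
@[simp] theorem out_r_j (i x) : out G H (Circ.r (H.j i x)) = n i (Circ.r x) := by simp [out]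
@[simp] theorem out_l_s (t) : out G H (Circ.l (G.s t)) = s t := by simp [out]
@[simp] theorem out_r_s (t) : out G H (Circ.r (H.s t)) = s t := by simp [out]

end PhiK

variable {D a b} {A B : Flat o}

/-- The cobordism that glues morphisms along `D`. -/
abbrev phiCob (G : IsGlue D a A) (H : IsGlue D b B) : Cob (Σ i, Circ (a i) (b i)) (Circ A B) where
  K := PhiK D a b
  inn q := PhiK.n q.1 q.2
  out := PhiK.out G H
  X := 2 • cnt (fun q : Σ i, Circ (a i) (b i) => (PhiK.n q.1 q.2 : PhiK D a b))
    - cnt (fun q => (PhiK.s (D.bd (.inl q)) : PhiK D a b))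
    + cnt (fun p => (PhiK.s (D.bd (.inr p)) : PhiK D a b)) + 2 • cnt (PhiK.out G H)
  δ := 0

end gluing

end

section
variable {o : Type} [Finite o] {I : Type} [Finite I] {E : I → Type} [∀ i, Finite (E i)]
  {D : ArcDiagram E o} {a b c : ∀ i, Flat (E i)} {A B C : Flat o}

theorem sum_comp_eq_zero {N K : Type} [Finite N] [Finite K] (f : N → K)
  (hf : ∀ k, cnt f k = 0 ∨ cnt f k = 2) (h : K → ZMod 2) : ∑ᶠ n, h (f n) = 0 := by
  have h1 := sum_mul_push f h 1
  simp only [Pi.one_apply, mul_one] at h1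
  rw [← h1]
  refine finsum_eq_zero_of_forall_eq_zero fun k => ?_
  have h2 : push f (1 : N → ZMod 2) k = ((cnt f k : ℤ) : ZMod 2) := by
    rw [cnt, push_eq, push_eq, Int.cast_sum]
    refine sum_congr rfl fun n _ => ?_
    split_ifs <;> simp
  rw [h2]
  rcases hf k with h0 | h0 <;> rw [h0]
  · simp
  · exact (congrArg (_ * ·) (by decide : ((2 : ℤ) : ZMod 2) = 0)).trans (mul_zero _)

theorem ArcDiagram.WF.cnt (hD : D.WF) (t : D.S) : cnt D.bd t = 0 ∨ cnt D.bd t = 2 := by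
  rw [cnt_eq_ncard]
  rcases hD t with h | h
  · exact .inl (by exact_mod_cast h)
  · exact .inr (by exact_mod_cast h)

section good

variable (G : IsGlue D a A) (H : IsGlue D b B)

theorem PhiK.isolated {t : D.S} (ht : ∀ q, D.bd q ≠ t) :
  (∀ i q, (n i q : PhiK D a b) ≠ s t) ∧ ∀ t', (s t' : PhiK D a b) = s t → t' = t := by
  let p : PhiK D a b → Prop := lift (fun _ _ => False) (fun t' => t' = t) fun i p => by
    simp [ht]
  refine ⟨fun i q h => ?_, fun t' h => ?_⟩
  · have : p (n i q) = p (s t) := congrArg p h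
    simp [p] at this
  · have : p (s t') = p (s t) := congrArg p h
    simpa [p] using this

theorem phiCob_good_of_isolated {t : D.S} (ht : ∀ q, D.bd q ≠ t) :
  (phiCob G H).X (PhiK.s t) ≤ 4 := by
  obtain ⟨h1, h2⟩ := PhiK.isolated (a := a) (b := b) ht
  have e1 : cnt (fun q : Σ i, Circ (a i) (b i) => (PhiK.n q.1 q.2 : PhiK D a b)) (PhiK.s t) = 0 :=
    cnt_eq_zero _ _ fun q => h1 q.1 q.2
  have e2 : cnt (fun q => (PhiK.s (D.bd (.inl q)) : PhiK D a b)) (PhiK.s t) = 0 :=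
    cnt_eq_zero _ _ fun q h => ht _ (h2 _ h)
  have e3 : cnt (fun q => (PhiK.s (D.bd (.inr q)) : PhiK D a b)) (PhiK.s t) = 0 :=
    cnt_eq_zero _ _ fun q h => ht _ (h2 _ h)
  have e4 : cnt (PhiK.out G H) (PhiK.s t) ≤ 2 := by
    rw [cnt_eq_ncard]
    have hs : {q | PhiK.out G H q = PhiK.s t} ⊆ {Circ.l (G.s t), Circ.r (H.s t)} := by
      refine Circ.ind (G.ind _ (fun i x h => ?_) fun t' h => ?_)
        (H.ind _ (fun i x h => ?_) fun t' h => ?_)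
      · exact (h1 _ _ ((PhiK.out_l_j G H i x).symm.trans h)).elim
      · rw [h2 _ ((PhiK.out_l_s G H t').symm.trans h)]; exact Set.mem_insert _ _
      · exact (h1 _ _ ((PhiK.out_r_j G H i x).symm.trans h)).elim
      · rw [h2 _ ((PhiK.out_r_s G H t').symm.trans h)]
        exact Set.mem_insert_of_mem _ (Set.mem_singleton _)
    have := (Set.ncard_le_ncard hs (Set.toFinite _)).trans (Set.ncard_insert_le _ _)
    rw [Set.ncard_singleton] at this
    exact_mod_cast this
  simp only [Pi.add_apply, Pi.sub_apply, Pi.smul_apply, e1, e2, e3]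
  simp only [nsmul_eq_mul]
  push_cast
  linarith

theorem phiCob_good_of_ends (hD : D.WF) (ha : ∀ i, (a i).Mfd) (hb : ∀ i, (b i).Mfd)
  (k : PhiK D a b) (hk : ∀ t, PhiK.s t = k → ∃ q, D.bd q = t) : (phiCob G H).X k ≤ 4 := by
  have two : ∀ x y : ZMod 2, x + y = 0 ↔ x = y := by decide
  have hs : cnt (fun q => (PhiK.s (D.bd (.inl q)) : PhiK D a b)) k
      + cnt (fun q => (PhiK.s (D.bd (.inr q)) : PhiK D a b)) k
      = 2 * cnt (PhiK.s : D.S → PhiK D a b) k := by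
    have e1 := cnt_sum fun q => (PhiK.s (D.bd q) : PhiK D a b)
    have e2 := push_cnt D.bd (PhiK.s : D.S → PhiK D a b)
    rw [← Pi.add_apply, ← e1]
    change cnt (PhiK.s ∘ D.bd) k = _
    rw [← e2, push_eq, cnt, cnt, push_eq PhiK.s, Finset.mul_sum]
    refine sum_congr rfl fun t _ => ?_
    split_ifs with h
    · obtain ⟨q, rfl⟩ := hk t h
      refine (hD.cnt _).resolve_left fun h0 => ?_
      rw [cnt_eq_ncard] at h0
      have := (Set.ncard_pos (Set.toFinite _)).2 ⟨q, show q ∈ {n | D.bd n = D.bd q} from rfl⟩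
      omega
    · rw [mul_zero]
  let Gl : ((Σ i, Circ (a i) (b i)) ⊕ D.S → ZMod 2) →ₗ[ZMod 2] ((Σ i, E i) → ZMod 2) :=
    { toFun := fun g q => g (.inl ⟨q.1, Circ.l ((a q.1).pt q.2)⟩) + g (.inr (D.bd (.inl q)))
      map_add' := fun g g' => by ext q; simp only [Pi.add_apply]; ring
      map_smul' := fun r g => by
        ext q; simp only [Pi.smul_apply, smul_eq_mul, RingHom.id_apply]; ring }
  let Yl : (Circ A B → ZMod 2) →ₗ[ZMod 2] ((Σ i, E i) → ZMod 2) :=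
    { toFun := fun y q => y (Circ.l (G.s (D.bd (.inl q)))) + y (Circ.r (H.s (D.bd (.inl q))))
      map_add' := fun g g' => by ext q; simp only [Pi.add_apply]; ring
      map_smul' := fun r g => by
        ext q; simp only [Pi.smul_apply, smul_eq_mul, RingHom.id_apply]; ring }
  have key := euler_le_component k (Quot.mk (phiLink D a b))
    (fun q : Σ i, E i => (PhiK.s (D.bd (.inl q)) : PhiK D a b)) (PhiK.out G H) Gl Yl ?_ ?_ ?_ ?_ ?_
  · have e : cnt (Quot.mk (phiLink D a b)) = cnt (fun q : Σ i, Circ (a i) (b i) =>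
        (PhiK.n q.1 q.2 : PhiK D a b)) + cnt (PhiK.s : D.S → PhiK D a b) := cnt_sum _
    rw [e] at key
    simp only [Pi.add_apply, Pi.sub_apply, Pi.smul_apply] at key ⊢
    simp only [nsmul_eq_mul]
    push_cast
    linarith
  · intro g y
    have h1 : ∑ᶠ q : Σ i, E i, g (.inl ⟨q.1, Circ.l ((a q.1).pt q.2)⟩)
        * y (Circ.l (G.s (D.bd (.inl q)))) = 0 := by
      rw [fsum_eq, Fintype.sum_sigma]
      refine sum_eq_zero fun i _ => ?_
      rw [← fsum_eq]
      simp only [← G.glue]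
      exact (ha i).sum_eq_zero fun x => g (.inl ⟨i, Circ.l x⟩) * y (Circ.l (G.j i x))
    have h2 : ∑ᶠ q : Σ i, E i, g (.inl ⟨q.1, Circ.l ((a q.1).pt q.2)⟩)
        * y (Circ.r (H.s (D.bd (.inl q)))) = 0 := by
      rw [fsum_eq, Fintype.sum_sigma]
      refine sum_eq_zero fun i _ => ?_
      rw [← fsum_eq]
      simp only [← H.glue, Circ.glue]
      exact (hb i).sum_eq_zero fun x => g (.inl ⟨i, Circ.r x⟩) * y (Circ.r (H.j i x))
    have h3 : ∑ᶠ q : Σ i, E i, g (.inr (D.bd (.inl q))) *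
        (y (Circ.l (G.s (D.bd (.inl q)))) + y (Circ.r (H.s (D.bd (.inl q))))) = 0 := by
      have h := sum_comp_eq_zero D.bd hD.cnt fun t =>
        g (.inr t) * (y (Circ.l (G.s t)) + y (Circ.r (H.s t)))
      rw [fsum_eq, Fintype.sum_sum_type] at h
      rw [fsum_eq, ← h, left_eq_add]
      refine sum_eq_zero fun p _ => ?_
      rw [← G.bd, ← H.bd, Circ.glue, (two _ _).2 rfl, mul_zero]
    rw [fsum_eq] at h1 h2 h3 ⊢
    calc _ = _ := sum_congr rfl fun q _ => ?_
      _ = 0 := (Finset.sum_add_distrib.trans (by rw [sum_add_distrib, h1, h2, h3]; rfl) :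
        ∑ q : Σ i, E i, ((g (.inl ⟨q.1, Circ.l ((a q.1).pt q.2)⟩)
          * y (Circ.l (G.s (D.bd (.inl q)))) + g (.inl ⟨q.1, Circ.l ((a q.1).pt q.2)⟩)
          * y (Circ.r (H.s (D.bd (.inl q))))) + g (.inr (D.bd (.inl q))) *
          (y (Circ.l (G.s (D.bd (.inl q)))) + y (Circ.r (H.s (D.bd (.inl q)))))) = 0)
    simp only [Gl, Yl, LinearMap.coe_mk, AddHom.coe_mk]
    ring
  · intro g hg q hq
    change g _ + g _ = 0
    rw [hg _ hq, hg _ fun h => hq ((PhiK.glue q.1 q.2).symm.trans h), zero_add]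
  · intro g hg h0 v v' hv hv'
    let ψ : PhiK D a b → ZMod 2 := PhiK.lift (fun i q => g (.inl ⟨i, q⟩)) (fun t => g (.inr t))
      fun i p => (two _ _).1 (h0 ⟨i, p⟩)
    have hψ : ∀ v, ψ (Quot.mk _ v) = g v := by rintro (q | t) <;> rfl
    rw [← hψ, ← hψ, hv, hv']
  · intro y hy q hq
    change y _ + y _ = 0
    rw [hy _ (by rwa [PhiK.out_l_s]), hy _ (by rwa [PhiK.out_r_s]), zero_add]
  · intro y hy h0 v v' hv hv'
    have ht : ∀ t, y (Circ.l (G.s t)) = y (Circ.r (H.s t)) := fun t => by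
      by_cases h : (PhiK.s t : PhiK D a b) = k
      · obtain ⟨q | p, rfl⟩ := hk t h
        · exact (two _ _).1 (h0 q)
        · rw [← G.bd, ← H.bd, Circ.glue]
      · rw [hy _ (by rwa [PhiK.out_l_s]), hy _ (by rwa [PhiK.out_r_s])]
    let ψ : PhiK D a b → ZMod 2 := PhiK.lift (fun i => Circ.lift (fun x => y (Circ.l (G.j i x)))
      (fun x => y (Circ.r (H.j i x))) fun p => by rw [G.glue, H.glue, ht])
      (fun t => y (Circ.l (G.s t))) fun i p => by rw [Circ.lift_l, G.glue]
    have hψ : ∀ v, ψ (PhiK.out G H v) = y v := by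
      refine Circ.ind (G.ind _ (fun i x => ?_) fun t => ?_) (H.ind _ (fun i x => ?_) fun t => ?_)
      · simp [ψ]
      · simp [ψ]
      · simp [ψ]
      · simp [ψ, ht]
    rw [← hψ, ← hψ, hv, hv']

theorem phiCob_good (hD : D.WF) (ha : ∀ i, (a i).Mfd) (hb : ∀ i, (b i).Mfd) :
  (phiCob G H).Good := by
  intro k
  by_cases hk : ∃ t, (PhiK.s t : PhiK D a b) = k ∧ ∀ q, D.bd q ≠ t
  · obtain ⟨t, rfl, ht⟩ := hk
    exact phiCob_good_of_isolated G H ht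
  · push Not at hk
    exact phiCob_good_of_ends G H hD ha hb k hk

end good

section surface

variable {R : Type} [CommRing R] [CharP R 2]

theorem phi_surface_of (G : IsGlue D a A) (H : IsGlue D b B) (hD : D.WF) (ha : ∀ i, (a i).Mfd)
  (hb : ∀ i, (b i).Mfd) {S : ∀ i, Cob Empty (Circ (a i) (b i))} (hS : ∀ i, (S i).Good)
  (T : Cob Empty (Circ A B)) (α : ∀ i, (S i).K → T.K) (s : D.S → T.K)
  (glue : ∀ i p, α i ((S i).out (Circ.l ((a i).pt p))) = s (D.bd (.inl ⟨i, p⟩)))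
  (univ : ∀ (Z : Type) (f : ∀ i, (S i).K → Z) (g : D.S → Z),
    (∀ i p, f i ((S i).out (Circ.l ((a i).pt p))) = g (D.bd (.inl ⟨i, p⟩))) →
    ∃ ρ : T.K → Z, (∀ i k, ρ (α i k) = f i k) ∧ ∀ t, ρ (s t) = g t)
  (surj : ∀ p : T.K → Prop, (∀ i k, p (α i k)) → (∀ t, p (s t)) → ∀ t, p t)
  (lj : ∀ i x, T.out (Circ.l (G.j i x)) = α i ((S i).out (Circ.l x)))
  (ls : ∀ t, T.out (Circ.l (G.s t)) = s t)
  (rj : ∀ i x, T.out (Circ.r (H.j i x)) = α i ((S i).out (Circ.r x)))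
  (rs : ∀ t, T.out (Circ.r (H.s t)) = s t)
  (X : T.X = push (fun k : Σ i, (S i).K => α k.1 k.2) (fun k => (S k.1).X k.2)
    - 2 • cnt (fun q : Σ i, Circ (a i) (b i) => α q.1 ((S q.1).out q.2))
    - cnt (fun q => s (D.bd (.inl q))) + cnt (fun q => s (D.bd (.inr q))) + 2 • cnt T.out)
  (δ : T.δ = push (fun k : Σ i, (S i).K => α k.1 k.2) (fun k => (S k.1).δ k.2)) :
  T.Good ∧ (phiCob G H).L (Cob.tensor fun i => (S i).L (1 : Set Empty → R)) = T.L 1 := by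
  let T' : Cob (Σ _ : I, Empty) (Circ A B) := { T with inn := fun c => c.2.elim }
  let β : PhiK D a b → T.K := PhiK.lift (fun i q => α i ((S i).out q)) s glue
  have eβ : ∀ q, β (PhiK.out G H q) = T.out q := by
    refine Circ.ind (G.ind _ (fun i x => ?_) fun t => ?_) (H.ind _ (fun i x => ?_) fun t => ?_)
    · simp [β, lj]
    · simp [β, ls]
    · simp [β, rj]
    · simp [β, rs]
  have key := Cob.L_tensor_of (R := R) hS (phiCob_good G H hD ha hb) T' α β (fun i c => rfl)
    (fun Z f g h => ?_) (fun p h1 h2 => surj p h1 fun t => h2 (PhiK.s t)) (fun i c => c.elim)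
    (fun q => (eβ q).symm) ?_ ?_ (fun _ => 1)
  · refine ⟨key.1, key.2.trans ?_⟩
    have e : Cob.tensor (fun _ => 1) = (1 : Set (Σ _ : I, Empty) → R) := by
      ext V
      exact finprod_eq_one_of_forall_eq_one fun i => rfl
    rw [e]
    have : IsEmpty (Σ _ : I, Empty) := ⟨fun c => c.2.elim⟩
    ext U
    rw [Cob.L_one, Cob.L_one]
  · obtain ⟨ρ, h1, h2⟩ := univ Z f (fun t => g (PhiK.s t)) fun i p => by
      rw [h, ← PhiK.glue]
    refine ⟨ρ, h1, PhiK.ind (fun i q => ?_) fun t => h2 t⟩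
    exact (h1 _ _).trans (h i q)
  · change T.X = _ + push β _ - _
    rw [X]
    simp only [map_sub, map_add, map_nsmul, push_cnt]
    have e1 : β ∘ PhiK.out G H = T.out := funext eβ
    have e2 : (β ∘ fun q : Σ i, Circ (a i) (b i) => PhiK.n q.1 q.2)
        = fun q => α q.1 ((S q.1).out q.2) := rfl
    have e3 : (β ∘ fun q => PhiK.s (D.bd (.inl q))) = fun q => s (D.bd (.inl q)) := rfl
    have e4 : (β ∘ fun q => PhiK.s (D.bd (.inr q))) = fun q => s (D.bd (.inr q)) := rfl
    rw [e1, e2, e3, e4]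
    abel
  · change T.δ = _ + push β 0
    rw [map_zero, add_zero, δ]

end surface

end

section
variable {o : Type} [Finite o] {I : Type} [Finite I] {E : I → Type} [∀ i, Finite (E i)]
  {D : ArcDiagram E o} {a b c : ∀ i, Flat (E i)} {A B C : Flat o}

section interchange

variable (D a b c)

inductive phiStackLink : (Σ i, StackK (a i) (b i) (c i)) ⊕ D.S →
  (Σ i, StackK (a i) (b i) (c i)) ⊕ D.S → Prop
  | glue (i : I) (p : E i) :
    phiStackLink (.inl ⟨i, StackK.nb ((b i).pt p)⟩) (.inr (D.bd (.inl ⟨i, p⟩)))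

abbrev PhiStackK : Type := Quot (phiStackLink D a b c)

variable {D a b c}

namespace PhiStackK

def n (i : I) (q : StackK (a i) (b i) (c i)) : PhiStackK D a b c := Quot.mk _ (.inl ⟨i, q⟩)
def s (t : D.S) : PhiStackK D a b c := Quot.mk _ (.inr t)

theorem glue (i : I) (p : E i) :
  (n i (StackK.nb ((b i).pt p)) : PhiStackK D a b c) = s (D.bd (.inl ⟨i, p⟩)) :=
  Quot.sound (.glue i p)

theorem glue_a (i : I) (p : E i) :
  (n i (StackK.na ((a i).pt p)) : PhiStackK D a b c) = s (D.bd (.inl ⟨i, p⟩)) := by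
  rw [StackK.glue₁, glue]

theorem glue_c (i : I) (p : E i) :
  (n i (StackK.nc ((c i).pt p)) : PhiStackK D a b c) = s (D.bd (.inl ⟨i, p⟩)) := by
  rw [← StackK.glue₂, glue]

theorem exists_lift {Z : Type} (f : ∀ i, StackK (a i) (b i) (c i) → Z) (g : D.S → Z)
  (h : ∀ i p, f i (StackK.nb ((b i).pt p)) = g (D.bd (.inl ⟨i, p⟩))) :
  ∃ ρ : PhiStackK D a b c → Z, (∀ i q, ρ (n i q) = f i q) ∧ ∀ t, ρ (s t) = g t :=
  ⟨Quot.lift (Sum.elim (fun q => f q.1 q.2) g) (by rintro _ _ ⟨i, p⟩; exact h i p),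
    fun _ _ => rfl, fun _ => rfl⟩

theorem ind {p : PhiStackK D a b c → Prop} (hn : ∀ i q, p (n i q)) (hs : ∀ t, p (s t)) :
  ∀ q, p q := by
  rintro ⟨⟨i, q⟩ | t⟩
  exacts [hn i q, hs t]

variable (G : IsGlue D a A) (H : IsGlue D b B) (K : IsGlue D c C)

def fab : PhiK D a b → PhiStackK D a b c := PhiK.lift (fun i q => n i (StackK.qab q)) s
  fun i p => by simp [glue_a]
def fbc : PhiK D b c → PhiStackK D a b c := PhiK.lift (fun i q => n i (StackK.qbc q)) s
  fun i p => by simp [glue]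
def fac : PhiK D a c → PhiStackK D a b c := PhiK.lift (fun i q => n i (StackK.qac q)) s
  fun i p => by simp [glue_a]

def fA : A.Comp → PhiStackK D a b c := G.lift (fun i x => n i (StackK.na x)) s glue_a
def fB : B.Comp → PhiStackK D a b c := H.lift (fun i x => n i (StackK.nb x)) s glue
def fC : C.Comp → PhiStackK D a b c := K.lift (fun i x => n i (StackK.nc x)) s glue_c

theorem fA_pt (p : o) : (fA G (A.pt p) : PhiStackK D a b c) = s (D.bd (.inr p)) := by
  rw [G.bd, fA, IsGlue.lift_s]
theorem fB_pt (p : o) : (fB H (B.pt p) : PhiStackK D a b c) = s (D.bd (.inr p)) := by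
  rw [H.bd, fB, IsGlue.lift_s]
theorem fC_pt (p : o) : (fC K (C.pt p) : PhiStackK D a b c) = s (D.bd (.inr p)) := by
  rw [K.bd, fC, IsGlue.lift_s]

def out : Circ A C → PhiStackK D a b c := Circ.lift (fA G) (fC K) fun p => by rw [fA_pt, fC_pt]

def fstack : StackK A B C → PhiStackK D a b c :=
  StackK.lift (fA G) (fB H) (fC K) (fun p => by rw [fA_pt, fB_pt]) fun p => by rw [fB_pt, fC_pt]

theorem fstack_qac (q) : fstack (a := a) (b := b) (c := c) G H K (StackK.qac q) = out G K q := by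
  revert q
  exact Circ.ind (by simp [fstack, out]) (by simp [fstack, out])

theorem fstack_qab (q) : fstack (a := a) (b := b) (c := c) G H K (StackK.qab q)
  = fab (PhiK.out G H q) := by
  revert q
  refine Circ.ind (G.ind _ (fun i x => ?_) fun t => ?_) (H.ind _ (fun i x => ?_) fun t => ?_) <;>
    simp [fstack, fab, fA, fB]

theorem fstack_qbc (q) : fstack (a := a) (b := b) (c := c) G H K (StackK.qbc q)
  = fbc (PhiK.out H K q) := by
  revert q
  refine Circ.ind (H.ind _ (fun i x => ?_) fun t => ?_) (K.ind _ (fun i x => ?_) fun t => ?_) <;>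
    simp [fstack, fbc, fB, fC]

theorem fac_out (q) : fac (PhiK.out G K q) = (out G K q : PhiStackK D a b c) := by
  revert q
  refine Circ.ind (G.ind _ (fun i x => ?_) fun t => ?_) (K.ind _ (fun i x => ?_) fun t => ?_) <;>
    simp [out, fac, fA, fC]

end PhiStackK

open PhiStackK

abbrev phiStackCob (G : IsGlue D a A) (K : IsGlue D c C) :
  Cob ((Σ i, Circ (a i) (b i)) ⊕ (Σ i, Circ (b i) (c i))) (Circ A C) where
  K := PhiStackK D a b c
  inn := Sum.elim (fun q => n q.1 (StackK.qab q.2)) (fun q => n q.1 (StackK.qbc q.2))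
  out := PhiStackK.out G K
  X := 2 • cnt (fun q : Σ i, Circ (a i) (b i) => (n q.1 (StackK.qab q.2) : PhiStackK D a b c))
    + 2 • cnt (fun q : Σ i, Circ (b i) (c i) => (n q.1 (StackK.qbc q.2) : PhiStackK D a b c))
    - 2 • cnt (fun q => (s (D.bd (.inl q)) : PhiStackK D a b c))
    + cnt (fun p => (s (D.bd (.inr p)) : PhiStackK D a b c))
    + 2 • cnt (PhiStackK.out G K : Circ A C → PhiStackK D a b c)
  δ := 0

variable {R : Type} [CommRing R] [CharP R 2]
variable (hD : D.WF) (ha : ∀ i, (a i).Mfd) (hb : ∀ i, (b i).Mfd) (hc : ∀ i, (c i).Mfd)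
  (hA : A.Mfd) (hB : B.Mfd) (hC : C.Mfd)
variable (G : IsGlue D a A) (H : IsGlue D b B) (K : IsGlue D c C)
include hD ha hb hc hA hB hC

theorem hcomp_phi_eq (f : ∀ i, RHom R (a i) (b i)) (g : ∀ i, RHom R (b i) (c i)) :
  hcomp ((phiCob G H).L (Cob.tensor f)) ((phiCob H K).L (Cob.tensor g))
    = (phiStackCob G K).L (Cob.tens (Cob.tensor f) (Cob.tensor g)) := by
  refine (Cob.L_tens_of (phiCob_good G H hD ha hb) (phiCob_good H K hD hb hc)
    (stackCob_good hA hB hC) (phiStackCob G K) fab fbc (fstack G H K)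
    (fun q => (fstack_qab G H K q).symm) (fun q => (fstack_qbc G H K q).symm)
    (fun Z f₁ f₂ g h1 h2 => ?_) (fun p h1 h2 h3 => PhiStackK.ind (fun i => ?_) fun t => ?_)
    (fun q => rfl) (fun q => rfl) (fun q => (fstack_qac G H K q).symm) ?_ ?_ _ _).2
  · have h3 : ∀ i x, f₁ (PhiK.n i (Circ.r x)) = f₂ (PhiK.n i (Circ.l x)) := fun i x => by
      have e1 := h1 (Circ.r (H.j i x))
      have e2 := h2 (Circ.l (H.j i x))
      simp only [PhiK.out_r_j, PhiK.out_l_j, Sum.elim_inl, Sum.elim_inr, StackK.qab_r,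
        StackK.qbc_l] at e1 e2
      rw [e1, e2]
    have h4 : ∀ t, f₁ (PhiK.s t) = f₂ (PhiK.s t) := fun t => by
      have e1 := h1 (Circ.r (H.s t))
      have e2 := h2 (Circ.l (H.s t))
      simp only [PhiK.out_r_s, PhiK.out_l_s, Sum.elim_inl, Sum.elim_inr, StackK.qab_r,
        StackK.qbc_l] at e1 e2
      rw [e1, e2]
    have hgA : ∀ x, g (StackK.na x) = f₁ (PhiK.out G H (Circ.l x)) := fun x => by
      rw [h1]; simp
    have hgB : ∀ x, g (StackK.nb x) = f₁ (PhiK.out G H (Circ.r x)) := fun x => by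
      rw [h1]; simp
    have hgC : ∀ x, g (StackK.nc x) = f₂ (PhiK.out H K (Circ.r x)) := fun x => by
      rw [h2]; simp
    obtain ⟨ρ, hn, hs⟩ := PhiStackK.exists_lift (D := D)
      (fun i => StackK.lift (fun x => f₁ (PhiK.n i (Circ.l x))) (fun x => f₁ (PhiK.n i (Circ.r x)))
        (fun x => f₂ (PhiK.n i (Circ.r x))) (fun p => by rw [Circ.glue])
        (fun p => by rw [h3, Circ.glue])) (fun t => f₁ (PhiK.s t)) fun i p => by
          rw [StackK.lift_nb, ← Circ.glue, PhiK.glue]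
    refine ⟨ρ, PhiK.ind (fun i => Circ.ind (fun x => ?_) fun x => ?_) fun t => ?_,
      PhiK.ind (fun i => Circ.ind (fun x => ?_) fun x => ?_) fun t => ?_,
      StackK.ind (G.ind _ (fun i x => ?_) fun t => ?_) (H.ind _ (fun i x => ?_) fun t => ?_)
        (K.ind _ (fun i x => ?_) fun t => ?_)⟩
    · simp [fab, hn]
    · simp [fab, hn]
    · simp [fab, hs]
    · simp [fbc, hn, h3]
    · simp [fbc, hn]
    · simp [fbc, hs, h4]
    · simp [fstack, fA, hn, hgA]
    · simp [fstack, fA, hs, hgA]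
    · simp [fstack, fB, hn, hgB]
    · simp [fstack, fB, hs, hgB]
    · simp [fstack, fC, hn, hgC]
    · simp [fstack, fC, hs, hgC, h4]
  · refine StackK.ind (fun x => ?_) (fun x => ?_) (fun x => ?_)
    · simpa [fab] using h1 (PhiK.n i (Circ.l x))
    · simpa [fab] using h1 (PhiK.n i (Circ.r x))
    · simpa [fbc] using h2 (PhiK.n i (Circ.r x))
  · exact h1 (PhiK.s t)
  · simp only [map_sub, map_add, map_nsmul, push_cnt, Function.comp_def, fstack_qab, fstack_qbc, fstack_qac]
    simp only [fab, fbc, PhiK.lift_n, PhiK.lift_s, fstack, StackK.lift_nb, fB_pt]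
    abel
  · simp

theorem phi_hcomp_eq (f : ∀ i, RHom R (a i) (b i)) (g : ∀ i, RHom R (b i) (c i)) :
  (phiCob G K).L (Cob.tensor fun i => hcomp (f i) (g i))
    = (phiStackCob G K).L (Cob.tens (Cob.tensor f) (Cob.tensor g)) := by
  rw [Cob.L_reind (Equiv.sigmaSumDistrib (fun i => Circ (a i) (b i)) (fun i => Circ (b i) (c i)))]
  have ef : (fun V => Cob.tens (Cob.tensor f) (Cob.tensor g) ((Equiv.sigmaSumDistrib
      (fun i => Circ (a i) (b i)) (fun i => Circ (b i) (c i))).symm ⁻¹' V))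
      = Cob.tensor fun i => Cob.tens (f i) (g i) := by
    ext V
    exact (finprod_mul_distrib (Set.toFinite _) (Set.toFinite _)).symm
  rw [ef]
  refine (Cob.L_tensor_of (fun i => stackCob_good (ha i) (hb i) (hc i)) (phiCob_good G K hD ha hc)
    _ (fun i => PhiStackK.n i) fac (fun i q => rfl)
    (fun Z f g h1 => ?_) (fun p h1 h2 => PhiStackK.ind h1 fun t => h2 (PhiK.s t)) ?_
    (fun q => (fac_out G K q).symm) ?_ ?_ _).2
  · obtain ⟨ρ, hn, hs⟩ := PhiStackK.exists_lift (D := D) f (fun t => g (PhiK.s t)) fun i p => by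
      have : f i (StackK.qac (Circ.l ((a i).pt p))) = g (PhiK.n i (Circ.l ((a i).pt p))) :=
        h1 i (Circ.l ((a i).pt p))
      rw [StackK.qac_l] at this
      rw [← StackK.glue₁, this]
      exact congrArg g (PhiK.glue i p)
    refine ⟨ρ, hn, PhiK.ind (fun i q => ?_) fun t => ?_⟩
    · exact (hn _ _).trans (h1 i q)
    · exact hs t
  · rintro i (q | q) <;> rfl
  · simp only [Pi.add_apply, Pi.sub_apply, Pi.smul_apply, push_fun_add, push_fun_sub, push_fun_nsmul]
    rw [cnt_fiber fun i => (StackK.qab : _ → StackK (a i) (b i) (c i)),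
      cnt_fiber fun i => (StackK.qbc : _ → StackK (a i) (b i) (c i)),
      cnt_fiber fun i => (StackK.qac : _ → StackK (a i) (b i) (c i)),
      cnt_fiber fun i (p : E i) => (StackK.nb ((b i).pt p) : StackK (a i) (b i) (c i))]
    simp only [map_sub, map_add, map_nsmul, push_cnt, Function.comp_def, fac_out]
    simp only [fac, PhiK.lift_n, PhiK.lift_s, glue]
    abel
  · simp only [map_zero, add_zero]
    exact (map_zero (push _)).symm

theorem hcomp_phi (f : ∀ i, RHom R (a i) (b i)) (g : ∀ i, RHom R (b i) (c i)) :
  hcomp ((phiCob G H).L (Cob.tensor f)) ((phiCob H K).L (Cob.tensor g))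
    = (phiCob G K).L (Cob.tensor fun i => hcomp (f i) (g i)) := by
  rw [hcomp_phi_eq hD ha hb hc hA hB hC, phi_hcomp_eq hD ha hb hc hA hB hC]

end interchange

end

section
variable {h e : Type} [Finite h] [Finite e]

theorem push_bool {N : Bool → Type} [∀ i, Finite (N i)] {K M : Type} [AddCommMonoid M]
  (f : ∀ i, N i → K) (w : ∀ i, N i → M) :
  push (fun n : Σ i, N i => f n.1 n.2) (fun n => w n.1 n.2)
    = push (f false) (w false) + push (f true) (w true) := by
  ext k
  rw [Pi.add_apply, push_eq, push_eq, push_eq, Fintype.sum_sigma,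
    Fintype.sum_bool, add_comm]

theorem cnt_bool {N : Bool → Type} [∀ i, Finite (N i)] {K : Type} (f : ∀ i, N i → K) :
  cnt (fun n : Σ i, N i => f n.1 n.2) = cnt (f false) + cnt (f true) := push_bool f fun _ => 1

@[simp] theorem FlatIso.refl_proj_l (F : Flat e) (x : F.Comp) :
  (FlatIso.refl F).proj (Circ.l x) = x := FlatIso.proj_l _ x

@[simp] theorem FlatIso.refl_toEquiv (F : Flat e) (x : F.Comp) :
  (FlatIso.refl F).toEquiv x = x := rfl

abbrev fillE (h e : Type) : Bool → Type
  | false => h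
  | true => h ⊕ e

instance : ∀ i, Finite (fillE h e i)
  | false => inferInstanceAs (Finite h)
  | true => inferInstanceAs (Finite (h ⊕ e))

variable (h e) in
/-- The arc diagram that describes the filling of a hole. -/
abbrev fillD : ArcDiagram (fillE h e) e where
  S := h ⊕ e
  bd
    | .inl ⟨false, q⟩ => .inl q
    | .inl ⟨true, p⟩ => p
    | .inr p => .inr p

abbrev fillF (a : Flat h) (F : Flat (h ⊕ e)) : ∀ i, Flat (fillE h e i)
  | false => a
  | true => F

theorem fillD_wf : (fillD h e).WF := by
  rintro (q | p)
  · right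
    have : (fillD h e).bd ⁻¹' {.inl q} = {.inl ⟨false, q⟩, .inl ⟨true, .inl q⟩} := by
      ext x
      rcases x with ⟨_ | _, x⟩ | x
      · simp [fillD]
      · rcases x with x | x <;> simp [fillD]
      · simp [fillD]
    rw [this, Set.ncard_pair]
    simp
  · right
    have : (fillD h e).bd ⁻¹' {.inr p} = {.inl ⟨true, .inr p⟩, .inr p} := by
      ext x
      rcases x with ⟨_ | _, x⟩ | x
      · simp [fillD]
      · rcases x with x | x <;> simp [fillD]
      · simp [fillD]
    rw [this, Set.ncard_pair]
    simp

section ext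

variable (a b : Flat h) (F : Flat (h ⊕ e))

inductive extKLink : Circ a b ⊕ F.Comp → Circ a b ⊕ F.Comp → Prop
  | glue (q : h) : extKLink (.inl (Circ.l (a.pt q))) (.inr (F.pt (.inl q)))

abbrev ExtK : Type := Quot (extKLink a b F)

variable {a b F}

namespace ExtK

def n (q : Circ a b) : ExtK a b F := Quot.mk _ (.inl q)
def f (x : F.Comp) : ExtK a b F := Quot.mk _ (.inr x)

theorem glue (q : h) : (n (Circ.l (a.pt q)) : ExtK a b F) = f (F.pt (.inl q)) :=
  Quot.sound (.glue q)

theorem glue_r (q : h) : (n (Circ.r (b.pt q)) : ExtK a b F) = f (F.pt (.inl q)) := by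
  rw [← Circ.glue, glue]

def lift {Z : Type} (fn : Circ a b → Z) (ff : F.Comp → Z)
  (h : ∀ q, fn (Circ.l (a.pt q)) = ff (F.pt (.inl q))) : ExtK a b F → Z :=
  Quot.lift (Sum.elim fn ff) (by rintro _ _ ⟨q⟩; exact h q)

section
variable {Z : Type} (fn : Circ a b → Z) (ff : F.Comp → Z)
    (h : ∀ q, fn (Circ.l (a.pt q)) = ff (F.pt (.inl q)))
@[simp] theorem lift_n (q) : lift fn ff h (n q) = fn q := rfl
@[simp] theorem lift_f (x) : lift fn ff h (f x) = ff x := rfl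
end

theorem ind {p : ExtK a b F → Prop} (hn : ∀ q, p (n q)) (hf : ∀ x, p (f x)) : ∀ q, p q := by
  rintro ⟨q | x⟩
  exacts [hn q, hf x]

variable {A B : Flat e} (G : IsGlue (fillD h e) (fillF a F) A) (H : IsGlue (fillD h e) (fillF b F) B)

def outA : A.Comp → ExtK a b F := G.lift
  (fun | false => fun x => n (Circ.l x) | true => f) (fun t => f (F.pt t))
  (by rintro (_ | _) p; exacts [glue p, rfl])

def outB : B.Comp → ExtK a b F := H.lift
  (fun | false => fun x => n (Circ.r x) | true => f) (fun t => f (F.pt t))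
  (by rintro (_ | _) p; exacts [glue_r p, rfl])

@[simp] theorem outA_false (x : a.Comp) : (outA G (G.j false x) : ExtK a b F) = n (Circ.l x) :=
  G.lift_j _ _ _ false x
@[simp] theorem outA_true (x : F.Comp) : (outA G (G.j true x) : ExtK a b F) = f x :=
  G.lift_j _ _ _ true x
@[simp] theorem outA_s (t) : (outA G (G.s t) : ExtK a b F) = f (F.pt t) := G.lift_s _ _ _ t
@[simp] theorem outB_false (x : b.Comp) : (outB H (H.j false x) : ExtK a b F) = n (Circ.r x) :=
  H.lift_j _ _ _ false x
@[simp] theorem outB_true (x : F.Comp) : (outB H (H.j true x) : ExtK a b F) = f x :=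
  H.lift_j _ _ _ true x
@[simp] theorem outB_s (t) : (outB H (H.s t) : ExtK a b F) = f (F.pt t) := H.lift_s _ _ _ t

def out : Circ A B → ExtK a b F := Circ.lift (outA G) (outB H) fun p => by
  rw [G.bd, H.bd, outA_s, outB_s]

@[simp] theorem out_l (x) : out G H (Circ.l x) = outA G x := by simp [out]
@[simp] theorem out_r (x) : out G H (Circ.r x) = outB H x := by simp [out]

end ExtK

variable {A B : Flat e} (G : IsGlue (fillD h e) (fillF a F) A) (H : IsGlue (fillD h e) (fillF b F) B)

/-- The cobordism that extends a morphism from `a` to `b` by the identity of `F`. -/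
abbrev extCob : Cob (Circ a b) (Circ A B) where
  K := ExtK a b F
  inn := ExtK.n
  out := ExtK.out G H
  X := 2 • cnt (ExtK.n : Circ a b → ExtK a b F) + cnt (fun p => (ExtK.f (F.pt p) : ExtK a b F))
    - 2 • cnt (fun q => (ExtK.f (F.pt (.inl q)) : ExtK a b F)) + 2 • cnt (ExtK.out G H)
  δ := 0

variable {R : Type} [CommRing R] [CharP R 2]

/-- A morphism in the hole and a morphism outside. -/
abbrev pair {a b : Flat h} {F F' : Flat (h ⊕ e)} (φ : RHom R a b) (ψ : RHom R F F') :
  ∀ i, RHom R (fillF a F i) (fillF b F' i)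
  | false => φ
  | true => ψ

abbrev extIn (C : Type) : Bool → Type
  | false => C
  | true => Empty

instance {C : Type} [Finite C] : ∀ i, Finite (extIn C i)
  | false => inferInstanceAs (Finite C)
  | true => inferInstanceAs (Finite Empty)

def extEquiv (C : Type) : (Σ i, extIn C i) ≃ C where
  toFun
    | ⟨false, q⟩ => q
    | ⟨true, q⟩ => q.elim
  invFun q := ⟨false, q⟩
  left_inv := by rintro ⟨_ | _, q⟩; exacts [rfl, q.elim]
  right_inv _ := rfl

abbrev extFam (F : Flat (h ⊕ e)) (a b : Flat h) :
  ∀ i, Cob (extIn (Circ a b) i) (Circ (fillF a F i) (fillF b F i))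
  | false => Cob.ident (Circ a b) 0
  | true => (FlatIso.refl F).cyl 0

abbrev extArg {C : Type} (φ : Set C → R) : ∀ i, Set (extIn C i) → R
  | false => φ
  | true => 1

theorem tensor_bool {N : Bool → Type} [∀ i, Finite (N i)] (f : ∀ i, Set (N i) → R)
  (V : Set (Σ i, N i)) :
  Cob.tensor f V = f false (Sigma.mk false ⁻¹' V) * f true (Sigma.mk true ⁻¹' V) := by
  rw [Cob.tensor, finprod_eq_prod_of_fintype, Fintype.prod_bool, mul_comm]

theorem extCob_eq (ha : a.Mfd) (hb : b.Mfd) (hF : F.Mfd) (φ : RHom R a b) :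
  (extCob G H).Good ∧ (phiCob G H).L (Cob.tensor (pair φ (((FlatIso.refl F).cyl 0).L 1)))
    = (extCob G H).L φ := by
  rw [Cob.L_reind (extEquiv (Circ a b)) (extCob G H)]
  have ef : (fun V => φ ((extEquiv (Circ a b)).symm ⁻¹' V)) = Cob.tensor (extArg φ) := by
    ext V
    rw [tensor_bool]
    exact (mul_one _).symm
  have eg : pair φ (((FlatIso.refl F).cyl 0).L 1) = fun i => (extFam F a b i).L (extArg φ i) := by
    ext1 i
    cases i
    · exact (Cob.L_ident φ).symm
    · rfl
  rw [ef, eg]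
  have haF : ∀ i, (fillF a F i).Mfd := by rintro (_ | _); exacts [ha, hF]
  have hbF : ∀ i, (fillF b F i).Mfd := by rintro (_ | _); exacts [hb, hF]
  let α : ∀ i, (extFam F a b i).K → ExtK a b F := fun | false => ExtK.n | true => ExtK.f
  have hβ : ∀ p, (ExtK.f ((FlatIso.refl F).proj (Circ.l (F.pt p))) : ExtK a b F)
      = ExtK.f (F.pt p) := fun p => congrArg ExtK.f ((FlatIso.refl F).proj_l (F.pt p))
  let β : PhiK (fillD h e) (fillF a F) (fillF b F) → ExtK a b F := PhiK.lift
    (fun | false => ExtK.n | true => fun q => ExtK.f ((FlatIso.refl F).proj q))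
    (fun t => ExtK.f (F.pt t)) (by rintro (_ | _) p; exacts [ExtK.glue p, hβ p])
  have hout : ∀ q, ExtK.out G H q = β (PhiK.out G H q) := by
    refine Circ.ind (G.ind _ ?_ fun t => ?_) (H.ind _ ?_ fun t => ?_)
    any_goals rintro (_ | _) x
    all_goals simp [β]
  refine Cob.L_tensor_of (R := R) (by rintro (_ | _); exacts [Cob.ident_good _, FlatIso.cyl_good _ hF _])
    (phiCob_good G H fillD_wf haF hbF) { extCob G H with inn := (extCob G H).inn ∘ extEquiv _ }
    α β (by rintro (_ | _) c <;> rfl) (fun Z f g h1 => ?_) (fun p h1 h2 => ?_)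
    ?_ ?_ ?_ ?_ _
  · refine ⟨ExtK.lift (f false) (f true) fun q => ?_, ?_, PhiK.ind ?_ fun t => ?_⟩
    · have e1 := h1 false (Circ.l (a.pt q))
      have e2 := h1 true (Circ.l (F.pt (.inl q)))
      have e3 : f true ((FlatIso.refl F).proj (Circ.l (F.pt (.inl q)))) = g _ := e2
      rw [FlatIso.refl_proj_l] at e3
      exact e1.trans ((congrArg g ((PhiK.glue false q).trans
        (PhiK.glue (D := fillD h e) (a := fillF a F) (b := fillF b F) true (Sum.inl q)).symm)).trans
        e3.symm)
    · rintro (_ | _) k <;> rfl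
    · rintro (_ | _) q
      · exact h1 false q
      · exact h1 true q
    · have e2 := h1 true (Circ.l (F.pt t))
      have e3 : f true ((FlatIso.refl F).proj (Circ.l (F.pt t))) = g _ := e2
      rw [FlatIso.refl_proj_l] at e3
      exact e3.trans (congrArg g (PhiK.glue (D := fillD h e) (a := fillF a F) (b := fillF b F) true t))
  · exact ExtK.ind (h1 false) (h1 true)
  · rintro (_ | _) c
    · rfl
    · exact c.elim
  · exact hout
  · change (extCob G H).X = _
    have e1 := push_bool α (fun i => (extFam F a b i).X)
    have e2 := cnt_bool (N := fun i => Circ (fillF a F i) (fillF b F i))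
      (fun i c => α i ((extFam F a b i).out c))
    have e3 : push (α false) (extFam F a b false).X = 4 • cnt (α false) := Cob.push_ident _
    have e4 : β ∘ PhiK.out G H = ExtK.out G H := funext fun q => (hout q).symm
    have e5 := cnt_bool (N := fun i => Circ (fillF a F i) (fillF b F i))
      (fun i q => β (PhiK.n i q))
    have e6 := cnt_bool (N := fillE h e) (fun i q => β (PhiK.s ((fillD h e).bd (.inl ⟨i, q⟩))))
    have e7 : cnt (fun p => (ExtK.f (F.pt p) : ExtK a b F))
      = cnt (fun p => (ExtK.f (F.pt (.inl p)) : ExtK a b F))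
        + cnt (fun p => (ExtK.f (F.pt (.inr p)) : ExtK a b F)) := cnt_sum _
    have e8 : push (α true) (extFam F a b true).X
      = cnt (fun p => (ExtK.f (F.pt p) : ExtK a b F))
        + 2 • cnt (fun q => (ExtK.f ((FlatIso.refl F).proj q) : ExtK a b F)) := by
      change push ExtK.f (cnt F.pt + 2 • cnt (FlatIso.refl F).proj) = _
      rw [map_add, map_nsmul, push_cnt, push_cnt]
      rfl
    rw [e1, e2, e3, e8]
    simp only [map_sub, map_add, map_nsmul, push_cnt, e4]
    change _ = _ + (2 • cnt (fun q : Σ i, Circ (fillF a F i) (fillF b F i) => β (PhiK.n q.1 q.2))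
      - cnt (fun q : Σ i, fillE h e i => β (PhiK.s ((fillD h e).bd (.inl ⟨q.1, q.2⟩))))
      + cnt (fun p => (ExtK.f (F.pt (.inr p)) : ExtK a b F)) + _) - _
    rw [e5, e6]
    change _ = (4 • cnt (ExtK.n : Circ a b → ExtK a b F) + (cnt (fun p => (ExtK.f (F.pt p) : ExtK a b F))
        + 2 • cnt (fun q => (ExtK.f ((FlatIso.refl F).proj q) : ExtK a b F)))) +
      (2 • (cnt (ExtK.n : Circ a b → ExtK a b F)
        + cnt (fun q => (ExtK.f ((FlatIso.refl F).proj q) : ExtK a b F)))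
      - (cnt (fun p => (ExtK.f (F.pt (.inl p)) : ExtK a b F))
        + cnt (fun p => (ExtK.f (F.pt p) : ExtK a b F)))
      + cnt (fun p => (ExtK.f (F.pt (.inr p)) : ExtK a b F)) + 2 • cnt (ExtK.out G H))
      - 4 • (cnt (ExtK.n : Circ a b → ExtK a b F)
        + cnt (fun q => (ExtK.f ((FlatIso.refl F).proj q) : ExtK a b F)))
    rw [e7]
    abel
  · change 0 = _
    have e1 := push_bool α (fun i => (extFam F a b i).δ)
    rw [e1]
    change 0 = push (α false) 0 + push (α true) 0 + push β 0
    simp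

end ext

end

section
section collapse

variable {I : Type} {i₀ : I} {N : I → Type} (hN : ∀ i, i ≠ i₀ → IsEmpty (N i))

def collapse (i : I) (q : N i) : N i₀ := if h : i = i₀ then h ▸ q else ((hN i h).false q).elim

@[simp] theorem collapse_self (q : N i₀) : collapse hN i₀ q = q := dif_pos rfl

include hN in
theorem collapse_ind {P : ∀ i, N i → Prop} (h : ∀ q, P i₀ q) : ∀ i q, P i q := by
  intro i q
  by_cases hi : i = i₀
  · subst hi; exact h q
  · exact ((hN i hi).false q).elim

def collapseEquiv : (Σ i, N i) ≃ N i₀ where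
  toFun q := collapse hN q.1 q.2
  invFun q := ⟨i₀, q⟩
  left_inv := fun ⟨i, q⟩ => collapse_ind hN (P := fun i q =>
    (⟨i₀, collapse hN i q⟩ : Σ i, N i) = ⟨i, q⟩) (fun q => by rw [collapse_self]) i q
  right_inv := collapse_self hN

end collapse

theorem tensor_collapse {R : Type} [CommRing R] {I : Type} [Finite I] {i₀ : I} {N : I → Type}
  (hN : ∀ i, i ≠ i₀ → IsEmpty (N i)) [∀ i, Finite (N i)]
  (φ : ∀ i, Set (N i) → R) (hφ : ∀ i, i ≠ i₀ → φ i = 1) :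
  (fun V => φ i₀ ((collapseEquiv hN).symm ⁻¹' V)) = Cob.tensor φ := by
  ext V
  rw [Cob.tensor, finprod_eq_single _ i₀ fun i hi => by rw [hφ i hi]; rfl]
  rfl

section outside

variable {o : Type} [Finite o] {I : Type} [Finite I] {h E : I → Type} [∀ i, Finite (h i)]
  [∀ i, Finite (E i)] {D : ArcDiagram E o} {i₀ : I}

/-- `Fo` is obtained from the outsides `F i` by gluing along `D`. -/
structure IsOutside (D : ArcDiagram E o) (i₀ : I) (F : ∀ i, Flat (h i ⊕ E i))
  (Fo : Flat (h i₀ ⊕ o)) where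
  j : ∀ i, (F i).Comp → Fo.Comp
  s : D.S → Fo.Comp
  glue : ∀ i p, j i ((F i).pt (.inr p)) = s (D.bd (.inl ⟨i, p⟩))
  bd_inl : ∀ q, Fo.pt (.inl q) = j i₀ ((F i₀).pt (.inl q))
  bd_inr : ∀ p, Fo.pt (.inr p) = s (D.bd (.inr p))
  univ : ∀ (Z : Type) (f : ∀ i, (F i).Comp → Z) (g : D.S → Z),
    (∀ i p, f i ((F i).pt (.inr p)) = g (D.bd (.inl ⟨i, p⟩))) →
      ∃ ρ : Fo.Comp → Z, (∀ i x, ρ (j i x) = f i x) ∧ ∀ t, ρ (s t) = g t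
  ind : ∀ p : Fo.Comp → Prop, (∀ i x, p (j i x)) → (∀ t, p (s t)) → ∀ x, p x

variable {F : ∀ i, Flat (h i ⊕ E i)} {Fo : Flat (h i₀ ⊕ o)} (O : IsOutside D i₀ F Fo)

/-- The two ways to describe the tangle with a hole glued along `D` agree. -/
structure IsOutside.Compat {a : ∀ i, Flat (h i)} {A : ∀ i, Flat (E i)} {AA : Flat o}
  (Gi : ∀ i, IsGlue (fillD (h i) (E i)) (fillF (a i) (F i)) (A i)) (G : IsGlue D A AA)
  (G' : IsGlue (fillD (h i₀) o) (fillF (a i₀) Fo) AA) : Prop where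
  hole : ∀ x, G.j i₀ ((Gi i₀).j false x) = G'.j false x
  part : ∀ i x, G.j i ((Gi i).j true x) = G'.j true (O.j i x)
  arc : ∀ t, G.s t = G'.j true (O.s t)

variable {a b : ∀ i, Flat (h i)} {A B : ∀ i, Flat (E i)} {AA BB : Flat o}
  {Gi : ∀ i, IsGlue (fillD (h i) (E i)) (fillF (a i) (F i)) (A i)} {G : IsGlue D A AA}
  {G' : IsGlue (fillD (h i₀) o) (fillF (a i₀) Fo) AA}
  {Hi : ∀ i, IsGlue (fillD (h i) (E i)) (fillF (b i) (F i)) (B i)} {H : IsGlue D B BB}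
  {H' : IsGlue (fillD (h i₀) o) (fillF (b i₀) Fo) BB}
  {R : Type} [CommRing R] [CharP R 2]

theorem phi_ext (hD : D.WF) (ha : ∀ i, (a i).Mfd) (hb : ∀ i, (b i).Mfd) (hF : ∀ i, (F i).Mfd)
  (hA : ∀ i, (A i).Mfd) (hB : ∀ i, (B i).Mfd)
  (cG : O.Compat Gi G G') (cH : O.Compat Hi H H') (hh : ∀ i, i ≠ i₀ → IsEmpty (h i))
  (hab : ∀ i, i ≠ i₀ → IsEmpty (Circ (a i) (b i))) (φ : ∀ i, RHom R (a i) (b i))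
  (hφ : ∀ i, i ≠ i₀ → φ i = 1) :
  (phiCob G H).L (Cob.tensor fun i => (extCob (Gi i) (Hi i)).L (φ i))
    = (extCob G' H').L (φ i₀) := by
  rw [Cob.L_reind (collapseEquiv (N := fun i => Circ (a i) (b i)) hab), tensor_collapse (N := fun i => Circ (a i) (b i)) hab φ hφ]
  let α : ∀ i, ExtK (a i) (b i) (F i) → ExtK (a i₀) (b i₀) Fo := fun i =>
    ExtK.lift (fun q => ExtK.n (collapse (N := fun i => Circ (a i) (b i)) hab i q)) (fun x => ExtK.f (O.j i x)) <|
      collapse_ind hh (P := fun i q => ExtK.n (collapse (N := fun i => Circ (a i) (b i)) hab i (Circ.l ((a i).pt q)))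
        = ExtK.f (O.j i ((F i).pt (.inl q)))) (fun q => by
          rw [collapse_self, ExtK.glue, O.bd_inl]) i
  have αf : ∀ i x, α i (ExtK.f x) = ExtK.f (O.j i x) := fun i x => rfl
  have αn : ∀ q, α i₀ (ExtK.n q) = ExtK.n q := fun q => by
    change ExtK.n (collapse (N := fun i => Circ (a i) (b i)) hab i₀ q) = _
    rw [collapse_self]
  have hβ : ∀ i p, α i (ExtK.out (Gi i) (Hi i) (Circ.l ((A i).pt p)))
      = ExtK.f (O.s (D.bd (.inl ⟨i, p⟩))) := fun i p => by
    rw [(Gi i).bd, ExtK.out_l, ExtK.outA_s, αf, O.glue]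
  let β : PhiK D A B → ExtK (a i₀) (b i₀) Fo :=
    PhiK.lift (fun i q => α i (ExtK.out (Gi i) (Hi i) q)) (fun t => ExtK.f (O.s t)) hβ
  have hout : ∀ q, ExtK.out G' H' q = β (PhiK.out G H q) := by
    have ha' : ∀ i, i ≠ i₀ → IsEmpty (a i).Comp := fun i hi =>
      ⟨fun x => (hab i hi).false (Circ.l x)⟩
    have hb' : ∀ i, i ≠ i₀ → IsEmpty (b i).Comp := fun i hi =>
      ⟨fun x => (hab i hi).false (Circ.r x)⟩
    have htA : ∀ i x, ExtK.out G' H' (Circ.l (G.j i ((Gi i).j true x)))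
        = β (PhiK.out G H (Circ.l (G.j i ((Gi i).j true x)))) := fun i x => by
      rw [PhiK.out_l_j, cG.part]
      simp [β, αf]
    have htB : ∀ i x, ExtK.out G' H' (Circ.r (H.j i ((Hi i).j true x)))
        = β (PhiK.out G H (Circ.r (H.j i ((Hi i).j true x)))) := fun i x => by
      rw [PhiK.out_r_j, cH.part]
      simp [β, αf]
    have gA : ∀ i t, (Gi i).s t = (Gi i).j true ((F i).pt t) := fun i t =>
      ((Gi i).glue true t).symm
    have gB : ∀ i t, (Hi i).s t = (Hi i).j true ((F i).pt t) := fun i t =>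
      ((Hi i).glue true t).symm
    refine Circ.ind (G.ind _ (fun i => (Gi i).ind _ ?_ fun t => ?_) fun t => ?_)
      (H.ind _ (fun i => (Hi i).ind _ ?_ fun t => ?_) fun t => ?_)
    · rintro (_ | _) x
      · refine collapse_ind ha' (P := fun i x => ExtK.out G' H' (Circ.l (G.j i ((Gi i).j false x)))
          = β (PhiK.out G H (Circ.l (G.j i ((Gi i).j false x))))) (fun x => ?_) i x
        rw [PhiK.out_l_j, cG.hole]
        simp [β, αn]
      · exact htA i x
    · rw [gA]; exact htA i _
    · rw [PhiK.out_l_s, cG.arc]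
      simp [β]
    · rintro (_ | _) x
      · refine collapse_ind hb' (P := fun i x => ExtK.out G' H' (Circ.r (H.j i ((Hi i).j false x)))
          = β (PhiK.out G H (Circ.r (H.j i ((Hi i).j false x))))) (fun x => ?_) i x
        rw [PhiK.out_r_j, cH.hole]
        simp [β, αn]
      · exact htB i x
    · rw [gB]; exact htB i _
    · rw [PhiK.out_r_s, cH.arc]
      simp [β]
  refine (Cob.L_tensor_of (fun i => (extCob_eq (Gi i) (Hi i) (R := R) (ha i) (hb i) (hF i) 0).1)
    (phiCob_good G H hD hA hB) { extCob G' H' with inn := (extCob G' H').inn ∘ collapseEquiv (N := fun i => Circ (a i) (b i)) hab }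
    α β (fun i c => rfl) (fun Z f g h1 => ?_) (fun p h1 h2 => ?_) (fun i c => rfl)
    hout ?_ ?_ _).2
  · have hf : ∀ i p, f i (ExtK.f ((F i).pt (.inr p))) = g (PhiK.s (D.bd (.inl ⟨i, p⟩))) :=
      fun i p => by
        rw [← PhiK.glue, ← ExtK.outA_s (Gi i), ← ExtK.out_l (Gi i) (Hi i), ← (Gi i).bd]
        exact h1 i (Circ.l ((A i).pt p))
    obtain ⟨ρ, h2, h3⟩ := O.univ Z (fun i x => f i (ExtK.f x)) (fun t => g (PhiK.s t)) hf
    let r : ExtK (a i₀) (b i₀) Fo → Z := ExtK.lift (fun q => f i₀ (ExtK.n q)) ρ fun q => by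
      rw [O.bd_inl, h2, ExtK.glue]
    have hr : ∀ i k, r (α i k) = f i k := by
      intro i
      refine ExtK.ind (fun q => ?_) (fun x => ?_)
      · refine collapse_ind (N := fun i => Circ (a i) (b i)) hab (P := fun i q => r (α i (ExtK.n q)) = f i (ExtK.n q))
          (fun q => ?_) i q
        rw [αn]; rfl
      · rw [αf]; exact h2 i x
    refine ⟨r, hr, PhiK.ind (fun i q => (hr _ _).trans (h1 i q)) h3⟩
  · refine ExtK.ind (fun q => ?_) (O.ind _ (fun i x => ?_) fun t => ?_)
    · rw [← αn]; exact h1 _ _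
    · exact h1 i (ExtK.f x)
    · exact h2 (PhiK.s t)
  · change (extCob G' H').X = _
    have e1 : cnt (fun q : Σ i, Circ (a i) (b i) => α q.1 (ExtK.n q.2))
        = cnt (ExtK.n : Circ (a i₀) (b i₀) → ExtK (a i₀) (b i₀) Fo) :=
      cnt_equiv (collapseEquiv (N := fun i => Circ (a i) (b i)) hab)
        (ExtK.n : Circ (a i₀) (b i₀) → ExtK (a i₀) (b i₀) Fo)
    have e2 : cnt (fun p : Σ i, h i ⊕ E i => α p.1 (ExtK.f ((F p.1).pt p.2)))
        = cnt (fun p : Σ i, h i => α p.1 (ExtK.f ((F p.1).pt (.inl p.2))))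
          + cnt (fun p : Σ i, E i => α p.1 (ExtK.f ((F p.1).pt (.inr p.2)))) := by
      rw [← cnt_equiv (Equiv.sigmaSumDistrib h E).symm, cnt_sum]
      rfl
    have e3 : cnt (fun p : Σ i, h i => α p.1 (ExtK.f ((F p.1).pt (.inl p.2))))
        = cnt (fun q => (ExtK.f (Fo.pt (.inl q)) : ExtK (a i₀) (b i₀) Fo)) := by
      rw [← cnt_equiv (collapseEquiv hh).symm]
      congr 1
      ext q
      exact congrArg ExtK.f (O.bd_inl q).symm
    have e4 : (fun p : Σ i, E i => α p.1 (ExtK.f ((F p.1).pt (.inr p.2))))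
        = fun q => ExtK.f (O.s (D.bd (.inl q))) := by
      ext ⟨i, p⟩
      exact congrArg ExtK.f (O.glue i p)
    have e5 : cnt (fun p => (ExtK.f (Fo.pt p) : ExtK (a i₀) (b i₀) Fo))
        = cnt (fun q => (ExtK.f (Fo.pt (.inl q)) : ExtK (a i₀) (b i₀) Fo))
          + cnt (fun q => (ExtK.f (Fo.pt (.inr q)) : ExtK (a i₀) (b i₀) Fo)) := cnt_sum _
    have e6 : (fun q => (ExtK.f (Fo.pt (.inr q)) : ExtK (a i₀) (b i₀) Fo))
        = fun p => ExtK.f (O.s (D.bd (.inr p))) := by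
      ext p
      exact congrArg ExtK.f (O.bd_inr p)
    have e7 : β ∘ PhiK.out G H = ExtK.out G' H' := funext fun q => (hout q).symm
    simp only [Pi.add_apply, Pi.sub_apply, Pi.smul_apply, push_fun_add, push_fun_sub, push_fun_nsmul]
    rw [cnt_fiber fun i => (ExtK.n : Circ (a i) (b i) → ExtK (a i) (b i) (F i)),
      cnt_fiber fun i p => (ExtK.f ((F i).pt p) : ExtK (a i) (b i) (F i)),
      cnt_fiber fun i q => (ExtK.f ((F i).pt (.inl q)) : ExtK (a i) (b i) (F i)),
      cnt_fiber fun i => ExtK.out (Gi i) (Hi i)]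
    simp only [map_sub, map_add, map_nsmul, push_cnt, e7]
    simp only [Function.comp_def, β, PhiK.lift_n, PhiK.lift_s, e1, e2, e3, e4, e5, e6]
    abel
  · simp only [map_zero, add_zero]
    exact (map_zero (push _)).symm

end outside

end

section
variable {e o U : Type} [Finite e] [Finite o]

section mfd

theorem push_nonneg {N K : Type} [Finite N] (f : N → K) {w : N → ℤ} (hw : ∀ n, 0 ≤ w n) (k : K) :
  0 ≤ push f w k := by
  rw [push_eq]
  exact Finset.sum_nonneg fun n _ => by split_ifs <;> simp [hw]

/-- A connected finite graph has at least as many edges as vertices, minus one. -/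
theorem cnt_le_of_connected {S J K : Type} [Finite S] [Finite J] (q : S → K) (l l' : J → S)
  (hq : ∀ j, q (l j) = q (l' j))
  (lift : ∀ f : S → ZMod 2, (∀ j, f (l j) = f (l' j)) → ∃ ρ : K → ZMod 2, ∀ s, ρ (q s) = f s)
  (k : K) : cnt q k ≤ cnt (fun j => q (l j)) k + 1 := by
  have two : ∀ x y : ZMod 2, x + y = 0 ↔ x = y := by decide
  let G : ({s // q s = k} → ZMod 2) →ₗ[ZMod 2] ({j // q (l j) = k} → ZMod 2) :=
    { toFun := fun g j => g ⟨l j, j.2⟩ + g ⟨l' j, (hq j).symm.trans j.2⟩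
      map_add' := fun g g' => by ext q; simp only [Pi.add_apply]; ring
      map_smul' := fun r g => by
        ext q; simp only [Pi.smul_apply, smul_eq_mul, RingHom.id_apply]; ring }
  have h1 := finrank_le_of_ker_const G fun g hg v v' => by
    obtain ⟨ψ, hψ⟩ := lift (fun s => if hs : q s = k then g ⟨s, hs⟩ else 0) fun j => by
      by_cases hs : q (l j) = k
      · have hs' := (hq j).symm.trans hs
        rw [dif_pos hs, dif_pos hs']
        exact (two _ _).1 (congrFun hg ⟨j, hs⟩)
      · have hs' : ¬ q (l' j) = k := fun hk => hs ((hq j).trans hk)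
        rw [dif_neg hs, dif_neg hs']
    have hψ' : ∀ v : {s // q s = k}, ψ k = g v := fun v =>
      (congrArg ψ v.2).symm.trans ((hψ v).trans (dif_pos v.2))
    rw [← hψ' v, ← hψ' v']
  have h2 := (LinearMap.range G).finrank_le
  rw [Module.finrank_pi, ← Nat.card_eq_fintype_card] at h2
  rw [cnt_eq_ncard, cnt_eq_ncard, ← Nat.card_coe_set_eq, ← Nat.card_coe_set_eq]
  exact_mod_cast h1.trans (Nat.add_le_add_right h2 1)

namespace Tangle

variable (T : Tangle e U) (ε : T.C → Bool)

def cmp (s : T.S) : (T.res ε).Comp := Quot.mk _ s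

variable {T ε} in
theorem cmp_eq {s t : T.S} (h : T.resLink ε s t) : T.cmp ε s = T.cmp ε t := Quot.sound h

variable {T ε} in
theorem cmp_ind {p : (T.res ε).Comp → Prop} (h : ∀ s, p (T.cmp ε s)) : ∀ x, p x := Quot.ind h

variable {T ε} in
def cmpLift {Z : Type} (f : T.S → Z) (h : ∀ s t, T.resLink ε s t → f s = f t) :
  (T.res ε).Comp → Z := Quot.lift f h

/-- The labels at the four legs of a smoothed crossing agree along the arcs of the smoothing. -/
def Joined {Z : Type} : Bool → (Fin 4 → Z) → Prop
  | false, v => v 0 = v 1 ∧ v 2 = v 3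
  | true, v => v 1 = v 2 ∧ v 3 = v 0

structure Respects {Z : Type} (f : T.S → Z) : Prop where
  pt : ∀ p, f (T.pt p 0) = f (T.pt p 1)
  cr : ∀ c, Joined (ε c) fun k => f (T.cr c k)

variable {T ε} in
theorem Respects.eq {Z : Type} {f : T.S → Z} (h : T.Respects ε f) {s t : T.S}
  (hst : T.resLink ε s t) : f s = f t := by
  rcases hst with p | ⟨c, hc⟩ | ⟨c, hc⟩ | ⟨c, hc⟩ | ⟨c, hc⟩
  · exact h.pt p
  all_goals have := h.cr c; rw [hc] at this
  exacts [this.1, this.2, this.1, this.2]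

variable {T ε} in
theorem respects_of {Z : Type} {f : T.S → Z} (h : ∀ s t, T.resLink ε s t → f s = f t) :
  T.Respects ε f where
  pt p := h _ _ (.pt p)
  cr c := by
    cases hc : ε c
    · exact ⟨h _ _ (.zero₁ c hc), h _ _ (.zero₂ c hc)⟩
    · exact ⟨h _ _ (.one₁ c hc), h _ _ (.one₂ c hc)⟩

theorem respects_cmp : T.Respects ε (T.cmp ε) := respects_of fun _ _ => cmp_eq

variable {T ε} in
theorem Respects.strand {Z : Type} {f : T.S → Z} (h : T.Respects ε f) {s t : T.S}
  (hst : T.SameStrand s t) : f s = f t := by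
  induction hst with
  | rel _ _ h' => obtain ⟨p, _⟩ := h'; exact h.pt p
  | refl => rfl
  | symm _ _ _ ih => exact ih.symm
  | trans _ _ _ _ _ ih ih' => exact ih.trans ih'

def joint : T.P ⊕ T.C × Bool → T.S × T.S
  | .inl p => (T.pt p 0, T.pt p 1)
  | .inr (c, false) => bif ε c then (T.cr c 1, T.cr c 2) else (T.cr c 0, T.cr c 1)
  | .inr (c, true) => bif ε c then (T.cr c 3, T.cr c 0) else (T.cr c 2, T.cr c 3)

theorem resLink_joint (j) : T.resLink ε (T.joint ε j).1 (T.joint ε j).2 := by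
  rcases j with p | ⟨c, _ | _⟩
  · exact .pt p
  · cases h : ε c <;> simp only [joint, h, cond_true, cond_false]
    exacts [.zero₁ c h, .one₁ c h]
  · cases h : ε c <;> simp only [joint, h, cond_true, cond_false]
    exacts [.zero₂ c h, .one₂ c h]

theorem exists_joint (s t) (h : T.resLink ε s t) :
  ∃ j, (T.joint ε j).1 = s ∧ (T.joint ε j).2 = t := by
  rcases h with p | ⟨c, h⟩ | ⟨c, h⟩ | ⟨c, h⟩ | ⟨c, h⟩
  · exact ⟨.inl p, rfl, rfl⟩
  · exact ⟨.inr (c, false), by simp [joint, h], by simp [joint, h]⟩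
  · exact ⟨.inr (c, true), by simp [joint, h], by simp [joint, h]⟩
  · exact ⟨.inr (c, false), by simp [joint, h], by simp [joint, h]⟩
  · exact ⟨.inr (c, true), by simp [joint, h], by simp [joint, h]⟩

theorem cnt_ends (k : (T.res ε).Comp) :
  cnt (fun x => T.cmp ε (T.ends x)) k
    = 2 * cnt (fun j => T.cmp ε (T.joint ε j).1) k
      + cnt (T.res ε).pt k := by
  rw [cnt_sum, cnt_sum, cnt_sum (fun j => T.cmp ε (T.joint ε j).1)]
  simp only [Pi.add_apply]
  have e1 : cnt (fun x => T.cmp ε (T.ends (.inl x))) k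
      = 2 * cnt (fun j => T.cmp ε (T.joint ε (.inr j)).1) k := by
    rw [cnt, cnt, push_eq, push_eq, Fintype.sum_prod_type,
      Fintype.sum_prod_type, Finset.mul_sum]
    refine sum_congr rfl fun c _ => ?_
    rw [Fin.sum_univ_four, Fintype.sum_bool]
    have hf : T.cmp ε (T.joint ε (.inr (c, false))).1
      = T.cmp ε (T.joint ε (.inr (c, false))).2 := cmp_eq (T.resLink_joint ε _)
    have ht : T.cmp ε (T.joint ε (.inr (c, true))).1
      = T.cmp ε (T.joint ε (.inr (c, true))).2 := cmp_eq (T.resLink_joint ε _)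
    change (if T.cmp ε (T.cr c 0) = k then (1 : ℤ) else 0)
      + (if T.cmp ε (T.cr c 1) = k then (1 : ℤ) else 0)
      + (if T.cmp ε (T.cr c 2) = k then (1 : ℤ) else 0)
      + (if T.cmp ε (T.cr c 3) = k then (1 : ℤ) else 0)
      = 2 * ((if T.cmp ε (T.joint ε (.inr (c, true))).1 = k then (1 : ℤ) else 0)
        + (if T.cmp ε (T.joint ε (.inr (c, false))).1 = k then (1 : ℤ) else 0))
    cases h : ε c
    · simp only [joint, h, cond_false] at hf ht ⊢
      rw [← hf, ← ht]
      ring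
    · simp only [joint, h, cond_true] at hf ht ⊢
      rw [← hf, ht]
      ring
  have e2 : cnt (fun x => T.cmp ε (T.ends (.inr (.inl x)))) k
      = 2 * cnt (fun j => T.cmp ε (T.joint ε (.inl j)).1) k := by
    rw [cnt, cnt, push_eq, push_eq, Fintype.sum_prod_type, Finset.mul_sum]
    refine sum_congr rfl fun p _ => ?_
    have hp : T.cmp ε (T.pt p 0) = T.cmp ε (T.pt p 1) := cmp_eq (.pt p)
    rw [Fin.sum_univ_two]
    change (if T.cmp ε (T.pt p 0) = k then (1 : ℤ) else 0)
      + (if T.cmp ε (T.pt p 1) = k then (1 : ℤ) else 0)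
      = 2 * (if T.cmp ε (T.pt p 0) = k then (1 : ℤ) else 0)
    rw [← hp]
    ring
  have e3 : cnt (fun x => T.cmp ε (T.ends (.inr (.inr x)))) k
      = cnt (T.res ε).pt k := rfl
  rw [e1, e2, e3]
  ring

/-- The resolutions of a tangle are manifolds. -/
theorem WF.mfd {T : Tangle e U} (hT : T.WF) (ε : T.C → Bool) : (T.res ε).Mfd := by
  intro k
  have h1 := cnt_le_of_connected (T.cmp ε) (fun j => (T.joint ε j).1) (fun j => (T.joint ε j).2)
    (fun j => cmp_eq (T.resLink_joint ε j)) (fun f hf => ⟨cmpLift f fun s t hst => by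
      obtain ⟨j, rfl, rfl⟩ := T.exists_joint ε s t hst
      exact hf j, fun s => rfl⟩) k
  have h2 := T.cnt_ends ε k
  let w : T.S → ℤ := fun s => if cnt T.ends s = 0 then 0 else 1
  have hw : cnt T.ends = 2 • w := by
    ext s
    have hs : cnt T.ends s = 0 ∨ cnt T.ends s = 2 := by
      rw [cnt_eq_ncard]
      rcases hT s with h | h
      · exact .inl (by exact_mod_cast h)
      · exact .inr (by exact_mod_cast h)
    simp only [w, Pi.smul_apply]
    rcases hs with h | h <;> simp [h]
  have h3 : cnt (fun x => T.cmp ε (T.ends x)) k = 2 * push (T.cmp ε) w k := by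
    have := congrFun (push_cnt T.ends (T.cmp ε)) k
    rw [hw, map_nsmul, Pi.smul_apply] at this
    refine Eq.trans this.symm ?_
    simp
  have h4 : push (T.cmp ε) w k ≤ cnt (T.cmp ε) k := by
    have h5 := push_nonneg (T.cmp ε) (w := 1 - w)
      (fun s => by simp only [w, Pi.sub_apply, Pi.one_apply]; split_ifs <;> simp) k
    rw [map_sub] at h5
    exact sub_nonneg.1 h5
  have h6 := cnt_nonneg (T.res ε).pt k
  omega

end Tangle

end mfd

section trCob

variable (T : Tangle e U) (ε ε' : T.C → Bool)

abbrev TrK : Type := Quot fun s t => T.resLink ε s t ∨ T.resLink ε' s t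

variable {T ε ε'}

namespace TrK

def mk (s : T.S) : TrK T ε ε' := Quot.mk _ s
def l : (T.res ε).Comp → TrK T ε ε' := Tangle.cmpLift mk fun _ _ h => Quot.sound (.inl h)
def r : (T.res ε').Comp → TrK T ε ε' := Tangle.cmpLift mk fun _ _ h => Quot.sound (.inr h)

theorem glue (p : e) : (l ((T.res ε).pt p) : TrK T ε ε') = r ((T.res ε').pt p) := rfl

def out : Circ (T.res ε) (T.res ε') → TrK T ε ε' := Circ.lift l r glue

@[simp] theorem out_l (x) : (out (Circ.l x) : TrK T ε ε') = l x := by simp [out]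
@[simp] theorem out_r (x) : (out (Circ.r x) : TrK T ε ε') = r x := by simp [out]

theorem ind {p : TrK T ε ε' → Prop} (h : ∀ s, p (mk s)) : ∀ k, p k := by
  rintro ⟨s⟩; exact h s

end TrK

variable (T ε ε') in
/-- The cylinder over the resolution `ε`, with bands `β` and dots `δ`, as a cobordism to the
resolution `ε'`. -/
abbrev trCob (β : T.S → ℤ) (δ : T.S → ℕ) : Cob Empty (Circ (T.res ε) (T.res ε')) where
  K := TrK T ε ε'
  inn := Empty.elim
  out := TrK.out
  X := cnt (fun p => (TrK.mk (T.bd p) : TrK T ε ε')) - 2 • push TrK.mk β + 2 • cnt TrK.out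
  δ := push TrK.mk δ

end trCob

section glue

variable {I : Type} [Finite I] {E : I → Type} [∀ i, Finite (E i)]

/-- `A` is obtained from the tangles `T i` by gluing along `D`. -/
structure TGlue (D : ArcDiagram E o) (T : ∀ i, Tangle (E i) U) (A : Tangle o U) where
  κ : (Σ i, (T i).C) ≃ A.C
  σ : ∀ i, (T i).S → A.S
  τ : D.S → A.S
  surj : ∀ s, (∃ i s', A.SameStrand (σ i s') s) ∨ ∃ t, A.SameStrand (τ t) s
  link : ∀ ε i, (T i).Respects (fun c => ε (κ ⟨i, c⟩)) fun s => A.cmp ε (σ i s)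
  glue : ∀ ε i p, A.cmp ε (σ i ((T i).bd p)) = A.cmp ε (τ (D.bd (.inl ⟨i, p⟩)))
  bd : ∀ ε p, A.cmp ε (A.bd p) = A.cmp ε (τ (D.bd (.inr p)))
  univ : ∀ (ε : A.C → Bool) (Z : Type) (f : ∀ i, (T i).S → Z) (g : D.S → Z),
    (∀ i, (T i).Respects (fun c => ε (κ ⟨i, c⟩)) (f i)) →
    (∀ i p, f i ((T i).bd p) = g (D.bd (.inl ⟨i, p⟩))) →
    ∃ ρ : A.S → Z, A.Respects ε ρ ∧ (∀ i s, ρ (σ i s) = f i s) ∧ ∀ t, ρ (τ t) = g t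
  cr : ∀ i c, (∀ k, A.SameStrand (σ i ((T i).cr c k)) (A.cr (κ ⟨i, c⟩) k)) ∨
    ∀ k, A.SameStrand (σ i ((T i).cr c k)) (A.cr (κ ⟨i, c⟩) (k + 2))
  pt : ∀ (ε : A.C → Bool) (M : Type) [AddCommMonoid M] (F : (A.res ε).Comp → U → M),
    ∑ᶠ p, (A.col p).elim 0 (F (A.cmp ε (A.pt p 0)))
      = ∑ᶠ i, ∑ᶠ p, ((T i).col p).elim 0 (F (A.cmp ε (σ i ((T i).pt p 0))))

namespace TGlue

variable {D : ArcDiagram E o} {T : ∀ i, Tangle (E i) U} {A : Tangle o U} (G : TGlue D T A)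

/-- The restriction of a resolution to a part. -/
def part (ε : A.C → Bool) (i : I) : (T i).C → Bool := fun c => ε (G.κ ⟨i, c⟩)

def res (ε : A.C → Bool) : IsGlue D (fun i => (T i).res (G.part ε i)) (A.res ε) where
  j i := Tangle.cmpLift (fun s => A.cmp ε (G.σ i s)) fun _ _ => (G.link ε i).eq
  s t := A.cmp ε (G.τ t)
  glue := G.glue ε
  bd := G.bd ε
  univ Z f g h := by
    obtain ⟨ρ, h1, h2, h3⟩ := G.univ ε Z (fun i s => f i ((T i).cmp _ s)) g
      (fun i => Tangle.respects_of fun s t hst => congrArg (f i) (Tangle.cmp_eq hst)) h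
    exact ⟨Tangle.cmpLift ρ fun _ _ => h1.eq, fun i => Tangle.cmp_ind (h2 i), h3⟩
  ind p hj hs := Tangle.cmp_ind fun s => by
    rcases G.surj s with ⟨i, s', h⟩ | ⟨t, h⟩
    · rw [← (A.respects_cmp ε).strand h]
      exact hj i ((T i).cmp _ s')
    · rw [← (A.respects_cmp ε).strand h]
      exact hs t

variable {R : Type} [CommRing R] [CharP R 2]

theorem trCob_phi (hD : D.WF) (ε ε' : A.C → Bool)
  (hT : ∀ i, ((T i).res (G.part ε i)).Mfd) (hT' : ∀ i, ((T i).res (G.part ε' i)).Mfd) (β : ∀ i, (T i).S → ℤ)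
  (δ : ∀ i, (T i).S → ℕ)
  (good : ∀ i, (trCob (T i) (G.part ε i) (G.part ε' i) (β i) (δ i)).Good) :
  (trCob A ε ε' (push (fun s : Σ i, (T i).S => G.σ s.1 s.2) fun s => β s.1 s.2)
      (push (fun s : Σ i, (T i).S => G.σ s.1 s.2) fun s => δ s.1 s.2)).Good ∧
    (phiCob (G.res ε) (G.res ε')).L (Cob.tensor fun i =>
        (trCob (T i) (G.part ε i) (G.part ε' i) (β i) (δ i)).L (1 : Set Empty → R))
      = (trCob A ε ε' (push (fun s : Σ i, (T i).S => G.σ s.1 s.2) fun s => β s.1 s.2)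
        (push (fun s : Σ i, (T i).S => G.σ s.1 s.2) fun s => δ s.1 s.2)).L 1 := by
  let α : ∀ i, TrK (T i) (G.part ε i) (G.part ε' i) → TrK A ε ε' := fun i =>
    Quot.lift (fun s => TrK.mk (G.σ i s)) (by
      rintro s t (h | h)
      · exact congrArg TrK.l ((G.link ε i).eq h)
      · exact congrArg TrK.r ((G.link ε' i).eq h))
  have αl : ∀ i x, α i (TrK.l x) = TrK.l ((G.res ε).j i x) := fun i => Tangle.cmp_ind fun s => rfl
  have αr : ∀ i x, α i (TrK.r x) = TrK.r ((G.res ε').j i x) := fun i => Tangle.cmp_ind fun s => rfl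
  have hglue : ∀ i p, (TrK.mk (G.σ i ((T i).bd p)) : TrK A ε ε')
      = TrK.mk (G.τ (D.bd (.inl ⟨i, p⟩))) := fun i p => congrArg TrK.l (G.glue ε i p)
  refine phi_surface_of (R := R) (G.res ε) (G.res ε') hD hT hT' good _ α (fun t => TrK.mk (G.τ t)) (fun i p => ?_)
    (fun Z f g h => ?_) (fun p h1 h2 => ?_) (fun i x => ?_) (fun t => ?_) (fun i x => ?_)
    (fun t => ?_) ?_ ?_
  · exact (congrArg (α i) (TrK.out_l (((T i).res (G.part ε i)).pt p))).trans (hglue i p)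
  · have hg : ∀ i p, f i (TrK.mk ((T i).bd p)) = g (D.bd (.inl ⟨i, p⟩)) := fun i p =>
      (congrArg (f i) (TrK.out_l (((T i).res (G.part ε i)).pt p))).symm.trans (h i p)
    obtain ⟨ρ, h1, h2, h3⟩ := G.univ ε Z (fun i s => f i (TrK.mk s)) g
      (fun i => Tangle.respects_of fun s t hst => congrArg (f i) (Quot.sound (.inl hst))) hg
    obtain ⟨ρ', h1', h2', h3'⟩ := G.univ ε' Z (fun i s => f i (TrK.mk s)) g
      (fun i => Tangle.respects_of fun s t hst => congrArg (f i) (Quot.sound (.inr hst))) hg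
    have hρ : ρ = ρ' := by
      ext s
      rcases G.surj s with ⟨i, s', h⟩ | ⟨t, h⟩
      · rw [← h1.strand h, ← h1'.strand h, h2, h2']
      · rw [← h1.strand h, ← h1'.strand h, h3, h3']
    subst hρ
    refine ⟨Quot.lift ρ ?_, fun i => TrK.ind (h2 i), h3⟩
    rintro s t (h | h)
    exacts [h1.eq h, h1'.eq h]
  · refine TrK.ind fun s => ?_
    rcases G.surj s with ⟨i, s', h⟩ | ⟨t, h⟩
    · rw [← show (TrK.mk _ : TrK A ε ε') = TrK.mk s from
        congrArg TrK.l ((A.respects_cmp ε).strand h)]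
      exact h1 i (TrK.mk s')
    · rw [← show (TrK.mk _ : TrK A ε ε') = TrK.mk s from
        congrArg TrK.l ((A.respects_cmp ε).strand h)]
      exact h2 t
  · exact (TrK.out_l ((G.res ε).j i x)).trans ((αl i x).symm.trans (congrArg (α i) (TrK.out_l x).symm))
  · exact TrK.out_l ((G.res ε).s t)
  · exact (TrK.out_r ((G.res ε').j i x)).trans ((αr i x).symm.trans (congrArg (α i) (TrK.out_r x).symm))
  · exact TrK.out_r ((G.res ε').s t)
  · have e1 : (fun p : Σ i, E i => α p.1 (TrK.mk ((T p.1).bd p.2)))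
        = fun q => TrK.mk (G.τ (D.bd (.inl q))) := funext fun q => hglue q.1 q.2
    have e2 : (fun p => (TrK.mk (A.bd p) : TrK A ε ε')) = fun p => TrK.mk (G.τ (D.bd (.inr p))) :=
      funext fun p => congrArg TrK.l (G.bd ε p)
    have e3 : (fun s : Σ i, (T i).S => α s.1 (TrK.mk s.2)) = fun s => TrK.mk (G.σ s.1 s.2) := rfl
    change cnt (fun p => (TrK.mk (A.bd p) : TrK A ε ε')) - 2 • _ + _ = _
    rw [e2]
    simp only [Pi.add_apply, Pi.sub_apply, Pi.smul_apply, push_fun_add, push_fun_sub, push_fun_nsmul]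
    rw [cnt_fiber fun i p => (TrK.mk ((T i).bd p) : TrK (T i) (G.part ε i) (G.part ε' i)),
      push_fiber fun i => (TrK.mk : _ → TrK (T i) (G.part ε i) (G.part ε' i)),
      cnt_fiber fun i => (TrK.out : _ → TrK (T i) (G.part ε i) (G.part ε' i))]
    simp only [map_sub, map_add, map_nsmul, push_cnt, push_push]
    simp only [Function.comp_def, e1, e3]
    abel
  · change push TrK.mk (push _ _) = _
    rw [push_fiber fun i => (TrK.mk : _ → TrK (T i) (G.part ε i) (G.part ε' i)), push_push]
    rfl

end TGlue

end glue

end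

section
variable {e o U : Type} [Finite e] [Finite o]

theorem push_const {N K M : Type} [AddCommMonoid M] [Fintype N] (x : K) (w : N → M) :
  push (fun _ => x) w = Pi.single x (∑ n, w n) := by
  ext k
  rw [push_eq]
  by_cases h : x = k
  · subst h; simp
  · simp [h]

theorem cnt_const {N K : Type} [Fintype N] (x : K) :
  cnt (fun _ : N => x) = Pi.single x (Fintype.card N : ℤ) := by
  rw [cnt, push_const]
  simp

theorem exists_half {N V K : Type} [Finite N] [Finite V] {f : N → V}
  (hf : ∀ v, cnt f v = 0 ∨ cnt f v = 2) (q : V → K) (k : K) :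
  ∃ m : ℤ, cnt (fun n => q (f n)) k = 2 * m ∧ m ≤ cnt q k := by
  let w : V → ℤ := fun v => if cnt f v = 0 then 0 else 1
  have hw : cnt f = 2 • w := by
    ext v
    simp only [w, Pi.smul_apply]
    rcases hf v with h | h <;> simp [h]
  refine ⟨push q w k, ?_, ?_⟩
  · have := congrFun (push_cnt f q) k
    rw [hw, map_nsmul, Pi.smul_apply] at this
    refine Eq.trans this.symm ?_
    simp
  · have h5 := push_nonneg q (w := 1 - w)
      (fun s => by simp only [w, Pi.sub_apply, Pi.one_apply]; split_ifs <;> simp) k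
    rw [map_sub] at h5
    exact sub_nonneg.1 h5

section glue

variable {I : Type} [Finite I] {E : I → Type} [∀ i, Finite (E i)] {D : ArcDiagram E o}
  {a : ∀ i, Flat (E i)} {A : Flat o}

/-- Manifolds glued along an arc diagram are a manifold. -/
theorem IsGlue.mfd (G : IsGlue D a A) (hD : D.WF) (ha : ∀ i, (a i).Mfd) : A.Mfd := by
  intro k
  let q : (Σ i, (a i).Comp) ⊕ D.S → A.Comp := Sum.elim (fun x => G.j x.1 x.2) G.s
  have h1 := cnt_le_of_connected q (fun p : Σ i, E i => .inl ⟨p.1, (a p.1).pt p.2⟩)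
    (fun p => .inr (D.bd (.inl p))) (fun p => G.glue p.1 p.2) (fun f hf => by
      obtain ⟨ρ, h2, h3⟩ := G.univ _ (fun i x => f (.inl ⟨i, x⟩)) (fun t => f (.inr t))
        fun i p => hf ⟨i, p⟩
      refine ⟨ρ, ?_⟩
      rintro (⟨i, x⟩ | t)
      exacts [h2 i x, h3 t]) k
  have hin : ∀ v : Σ i, (a i).Comp, cnt (fun p : Σ i, E i =>
      (⟨p.1, (a p.1).pt p.2⟩ : Σ i, (a i).Comp)) v = 0 ∨ cnt (fun p : Σ i, E i =>
      (⟨p.1, (a p.1).pt p.2⟩ : Σ i, (a i).Comp)) v = 2 := by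
    rintro ⟨i, x⟩
    rw [cnt_sigma_apply (fun i => (a i).pt)]
    exact ha i x
  obtain ⟨m₁, h2, h3⟩ := exists_half hin (fun x => G.j x.1 x.2) k
  obtain ⟨m₂, h4, h5⟩ := exists_half hD.cnt G.s k
  have e1 : cnt q k = cnt (fun x : Σ i, (a i).Comp => G.j x.1 x.2) k + cnt G.s k :=
    congrFun (cnt_sum q) k
  have e2 : cnt (fun n => G.s (D.bd n)) k
      = cnt (fun p : Σ i, E i => q (.inl ⟨p.1, (a p.1).pt p.2⟩)) k + cnt A.pt k := by
    have e3 : (fun p : Σ i, E i => q (.inl ⟨p.1, (a p.1).pt p.2⟩))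
        = fun p => G.s (D.bd (.inl p)) := funext fun p => G.glue p.1 p.2
    have e4 : A.pt = fun p => G.s (D.bd (.inr p)) := funext G.bd
    rw [e3, e4]
    exact congrFun (cnt_sum fun n => G.s (D.bd n)) k
  have e3 : cnt (fun p : Σ i, E i => q (.inl ⟨p.1, (a p.1).pt p.2⟩)) k = 2 * m₁ := h2
  have h6 := cnt_nonneg A.pt k
  omega

end glue

section ident

variable (T : Tangle e U) (ε : T.C → Bool)

def TrK.self : TrK T ε ε ≃ (T.res ε).Comp where
  toFun := Quot.lift (T.cmp ε) (by rintro s t (h | h) <;> exact Tangle.cmp_eq h)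
  invFun := TrK.l
  left_inv := TrK.ind fun _ => rfl
  right_inv := Tangle.cmp_ind fun _ => rfl

variable {T ε}

theorem TrK.self_out (q : Circ (T.res ε) (T.res ε)) :
  TrK.self T ε (TrK.out q) = (FlatIso.refl (T.res ε)).proj q := by
  revert q
  refine Circ.ind (fun x => ?_) (fun x => ?_)
  · refine (congrArg _ (TrK.out_l x)).trans (Eq.trans ?_ (FlatIso.proj_l _ x).symm)
    exact Tangle.cmp_ind (p := fun x => TrK.self T ε (TrK.l x) = (FlatIso.refl (T.res ε)).toEquiv x)
      (fun _ => rfl) x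
  · refine (congrArg _ (TrK.out_r x)).trans (Eq.trans ?_ (FlatIso.proj_r _ x).symm)
    exact Tangle.cmp_ind (p := fun x => TrK.self T ε (TrK.r x) = x) (fun _ => rfl) x

theorem trCob_self_X (δ : T.S → ℕ) (k : TrK T ε ε) :
  (trCob T ε ε 0 δ).X k
    = ((FlatIso.refl (T.res ε)).cyl (push (T.cmp ε) δ)).X (TrK.self T ε k) := by
  have e1 : (T.res ε).pt = TrK.self T ε ∘ fun p => TrK.mk (T.bd p) := rfl
  have e2 : (FlatIso.refl (T.res ε)).proj = TrK.self T ε ∘ TrK.out :=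
    funext fun q => (TrK.self_out q).symm
  change (cnt (fun p => (TrK.mk (T.bd p) : TrK T ε ε))
    - 2 • push (TrK.mk : T.S → TrK T ε ε) (0 : T.S → ℤ) + 2 • cnt TrK.out : TrK T ε ε → ℤ) k
    = (cnt (T.res ε).pt + 2 • cnt (FlatIso.refl (T.res ε)).proj) (TrK.self T ε k)
  rw [map_zero, smul_zero, sub_zero, e1, e2]
  simp only [Pi.add_apply, Pi.smul_apply, cnt_comp_apply (TrK.self T ε).injective]

theorem trCob_self {R : Type} [CommRing R] (δ : T.S → ℕ) (f : Set Empty → R) :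
  (trCob T ε ε 0 δ).L f = ((FlatIso.refl (T.res ε)).cyl (push (T.cmp ε) δ)).L f := by
  refine Cob.L_congr (TrK.self T ε) (fun c => c.elim) TrK.self_out (trCob_self_X δ) (fun k => ?_) f
  have e1 : T.cmp ε = TrK.self T ε ∘ TrK.mk := rfl
  change push TrK.mk δ k = push (T.cmp ε) δ (TrK.self T ε k)
  rw [e1]
  exact (push_comp_apply (TrK.self T ε).injective TrK.mk δ k).symm

theorem trCob_self_good (hM : (T.res ε).Mfd) (δ : T.S → ℕ) : (trCob T ε ε 0 δ).Good := fun k =>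
  (trCob_self_X δ k).trans_le ((FlatIso.refl (T.res ε)).cyl_good hM _ _)

end ident

section crossing

abbrev xres (b : Bool) : Flat (Fin 4) where
  S := Fin 4
  link s t := if b then s = 1 ∧ t = 2 ∨ s = 3 ∧ t = 0 else s = 0 ∧ t = 1 ∨ s = 2 ∧ t = 3
  bd := id

theorem xres_lift {Z : Type} {b : Bool} {f : Fin 4 → Z} (h : Tangle.Joined b f) (s t : Fin 4)
  (hst : (xres b).link s t) : f s = f t := by
  cases b
  · rcases (hst : s = 0 ∧ t = 1 ∨ s = 2 ∧ t = 3) with ⟨rfl, rfl⟩ | ⟨rfl, rfl⟩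
    exacts [h.1, h.2]
  · rcases (hst : s = 1 ∧ t = 2 ∨ s = 3 ∧ t = 0) with ⟨rfl, rfl⟩ | ⟨rfl, rfl⟩
    exacts [h.1, h.2]

theorem xres_joined {Z : Type} (b : Bool) (f : (xres b).Comp → Z) :
  Tangle.Joined b fun k => f (Quot.mk _ k) := by
  cases b
  · exact ⟨congrArg f (Quot.sound (.inl ⟨rfl, rfl⟩)), congrArg f (Quot.sound (.inr ⟨rfl, rfl⟩))⟩
  · exact ⟨congrArg f (Quot.sound (.inl ⟨rfl, rfl⟩)), congrArg f (Quot.sound (.inr ⟨rfl, rfl⟩))⟩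

theorem joined_const {Z : Type} {f : Fin 4 → Z} (h : Tangle.Joined false f)
  (h' : Tangle.Joined true f) (k : Fin 4) : f k = f 0 := by
  obtain ⟨h1, h2⟩ := h
  obtain ⟨h3, h4⟩ := h'
  fin_cases k
  · rfl
  · exact h1.symm
  · exact h2.trans h4
  · exact h4

theorem xres_mfd (b : Bool) : (xres b).Mfd := by
  let g : (xres b).Comp → Fin 2 := Quot.lift (fun k => if b then ![0, 1, 1, 0] k else ![0, 0, 1, 1] k)
    (xres_lift (b := b) (by cases b <;> exact ⟨rfl, rfl⟩))
  let r : Fin 2 → (xres b).Comp := fun j => Quot.mk _ (if b then ![0, 1] j else ![0, 2] j)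
  have hj := xres_joined b (fun x => x)
  have hr : ∀ x, r (g x) = x := by
    rintro ⟨k⟩
    cases b <;> fin_cases k
    exacts [rfl, hj.1, rfl, hj.2, rfl, rfl, hj.1, hj.2.symm]
  have hg : g.Injective := Function.LeftInverse.injective hr
  intro c
  right
  rw [← cnt_comp_apply hg, cnt_eq_ncard]
  have key : ∀ j : Fin 2, {n | (g ∘ (xres b).pt) n = j}.ncard = 2 := by
    intro j
    have : {n | (g ∘ (xres b).pt) n = j}
        = ↑(Finset.univ.filter fun k : Fin 4 => (if b then ![0, 1, 1, 0] k else ![0, 0, 1, 1] k) = j) := by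
      ext k; simp [g, Flat.pt]
    rw [this, Set.ncard_coe_finset]
    cases b <;> fin_cases j <;> rfl
  exact_mod_cast key (g c)

theorem circ_xres_eq (q : Circ (xres false) (xres true)) :
  q = Circ.l (Quot.mk (xres false).link (0 : Fin 4)) := by
  have h1 := xres_joined false (fun x => (Circ.l x : Circ (xres false) (xres true)))
  have h2 := xres_joined true (fun x => (Circ.r x : Circ (xres false) (xres true)))
  have h3 : ∀ k : Fin 4, (Circ.l (Quot.mk _ k) : Circ (xres false) (xres true))
      = Circ.r (Quot.mk _ k) := fun k => Circ.glue k
  simp only [← h3] at h2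
  have h4 := joined_const h1 h2
  revert q
  refine Circ.ind ?_ ?_
  · rintro ⟨k⟩; exact h4 k
  · rintro ⟨k⟩; exact (h3 k).symm.trans (h4 k)

namespace Tangle

variable (T : Tangle e U) (c : T.C)

abbrev cut : Tangle (Fin 4 ⊕ e) U where
  S := T.S
  C := {c' : T.C // c' ≠ c}
  P := T.P
  cr c' := T.cr c'.1
  pt := T.pt
  col := T.col
  bd := Sum.elim (T.cr c) T.bd

variable {T}

theorem WF.cut (hT : T.WF) (c : T.C) : (T.cut c).WF := by
  let f : ({c' : T.C // c' ≠ c} × Fin 4) ⊕ (T.P × Fin 2) ⊕ (Fin 4 ⊕ e) →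
      (T.C × Fin 4) ⊕ (T.P × Fin 2) ⊕ e
    | .inl x => .inl (x.1.1, x.2)
    | .inr (.inl x) => .inr (.inl x)
    | .inr (.inr (.inl k)) => .inl (c, k)
    | .inr (.inr (.inr p)) => .inr (.inr p)
  have hf : f.Injective := by
    rintro (⟨⟨x, hx⟩, i⟩ | x | x | x) (⟨⟨y, hy⟩, j⟩ | y | y | y) h <;> simp [f] at h ⊢ <;>
      first | exact h | (exact absurd h.1 hx) | (exact absurd h.1.symm hy)
  have hs : f.Surjective := by
    rintro (⟨x, i⟩ | x | x)
    · by_cases hx : x = c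
      · exact ⟨.inr (.inr (.inl i)), by simp [f, hx]⟩
      · exact ⟨.inl (⟨x, hx⟩, i), rfl⟩
    · exact ⟨.inr (.inl x), rfl⟩
    · exact ⟨.inr (.inr (.inr x)), rfl⟩
  have he : (T.cut c).ends = T.ends ∘ f := by
    ext x
    rcases x with x | x | x | x <;> rfl
  intro s
  rw [he, Set.preimage_comp, Set.ncard_preimage_of_injective_subset_range hf
    (by rw [hs.range_eq]; exact Set.subset_univ _)]
  exact hT s

theorem Respects.cut {ε : T.C → Bool} {Z : Type} {f : T.S → Z} (h : T.Respects ε f) (c : T.C) :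
  (T.cut c).Respects (fun c' => ε c'.1) f := ⟨h.pt, fun c' => h.cr c'.1⟩

abbrev cutD (c : T.C) (η : (T.cut c).C → Bool) : ArcDiagram (fun _ : Unit => Fin 4) e where
  S := ((T.cut c).res η).Comp
  bd := Sum.elim (fun k => ((T.cut c).res η).pt (.inl k.2)) fun p => ((T.cut c).res η).pt (.inr p)

theorem cutD_wf (hT : T.WF) (c : T.C) (η : (T.cut c).C → Bool) : (cutD c η).WF := by
  intro k
  let f : (Σ _ : Unit, Fin 4) ⊕ e → Fin 4 ⊕ e := Sum.map (fun k => k.2) id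
  have hb : f.Bijective := by
    refine ⟨?_, ?_⟩
    · rintro (⟨_, x⟩ | x) (⟨_, y⟩ | y) h <;> simp [f] at h ⊢ <;> exact h
    · rintro (x | x)
      exacts [⟨.inl ⟨(), x⟩, rfl⟩, ⟨.inr x, rfl⟩]
  have he : (cutD c η).bd = ((T.cut c).res η).pt ∘ f := by
    ext x
    rcases x with x | x <;> rfl
  have h := (hT.cut c).mfd η k
  rw [cnt_eq_ncard] at h
  rw [he, Set.preimage_comp, Set.ncard_preimage_of_injective_subset_range hb.1
    (by rw [hb.2.range_eq]; exact Set.subset_univ _)]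
  rcases h with h | h
  · exact .inl (by exact_mod_cast h)
  · exact .inr (by exact_mod_cast h)

theorem Joined.of_eq {Z : Type} {b : Bool} {f g : Fin 4 → Z} (h : Joined b f) (hfg : ∀ k, f k = g k) :
  Joined b g := by rwa [← funext hfg]

/-- A resolution is glued from the smoothing of a crossing and the complement. -/
def cutGlue (c : T.C) (η : (T.cut c).C → Bool) (ε : T.C → Bool) (hε : ∀ c', ε c'.1 = η c') (b : Bool)
  (hb : ε c = b) : IsGlue (cutD c η) (fun _ => xres b) (T.res ε) where
  j _ := Quot.lift (fun k => T.cmp ε (T.cr c k)) (xres_lift (hb ▸ (T.respects_cmp ε).cr c))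
  s := cmpLift (T.cmp ε) fun _ _ h => ((funext hε : (fun c' : (T.cut c).C => ε c'.1) = η) ▸
    (T.respects_cmp ε).cut c).eq h
  glue _ _ := rfl
  bd _ := rfl
  univ Z f g h := by
    have hr : T.Respects ε fun s => g ((T.cut c).cmp η s) := by
      refine ⟨fun p => congrArg g (((T.cut c).respects_cmp η).pt p), fun c' => ?_⟩
      by_cases hc : c' = c
      · subst hc
        have h2 := xres_joined b (f ())
        rw [hb]
        exact h2.of_eq (h ())
      · have h2 := ((T.cut c).respects_cmp η).cr ⟨c', hc⟩
        rw [← hε] at h2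
        revert h2
        cases ε c'
        · exact fun h2 => ⟨congrArg g h2.1, congrArg g h2.2⟩
        · exact fun h2 => ⟨congrArg g h2.1, congrArg g h2.2⟩
    refine ⟨cmpLift _ fun _ _ => hr.eq, ?_, cmp_ind fun s => rfl⟩
    rintro ⟨⟩ ⟨k⟩
    exact (h () k).symm
  ind p _ hs := cmp_ind fun s => hs ((T.cut c).cmp η s)

end Tangle

theorem saddle_good {T : Tangle e U} (hT : T.WF) (c : T.C) {ε ε' : T.C → Bool} (h0 : ε c = false)
  (h1 : ε' = update ε c true) : (trCob T ε ε' (Pi.single (T.cr c 0) 1) 0).Good := by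
  let η : (T.cut c).C → Bool := fun c' => ε c'.1
  have hε' : ∀ c' : (T.cut c).C, ε' c'.1 = η c' := fun c' => by
    rw [h1, update_of_ne c'.2]
  have h1c : ε' c = true := by rw [h1, update_self]
  let G := Tangle.cutGlue c η ε (fun _ => rfl) false h0
  let H := Tangle.cutGlue c η ε' hε' true h1c
  let S : Cob Empty (Circ (xres false) (xres true)) :=
    { K := Unit, inn := Empty.elim, out := fun _ => (), X := fun _ => 4, δ := fun _ => 0 }
  have hjl : Tangle.Joined false fun k => (TrK.mk (T.cr c k) : TrK T ε ε') := by
    have := (T.respects_cmp ε).cr c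
    rw [h0] at this
    exact ⟨congrArg TrK.l this.1, congrArg TrK.l this.2⟩
  have hjr : Tangle.Joined true fun k => (TrK.mk (T.cr c k) : TrK T ε ε') := by
    have := (T.respects_cmp ε').cr c
    rw [h1c] at this
    exact ⟨congrArg TrK.r this.1, congrArg TrK.r this.2⟩
  have hj : ∀ k, (TrK.mk (T.cr c k) : TrK T ε ε') = TrK.mk (T.cr c 0) := joined_const hjl hjr
  have hcut : (T.cut c).Respects η fun s => (TrK.mk s : TrK T ε ε') :=
    (Tangle.respects_of (T := T) (ε := ε) fun _ _ h => Quot.sound (.inl h)).cut c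
  let s : (Tangle.cutD c η).S → TrK T ε ε' := Tangle.cmpLift _ fun _ _ => hcut.eq
  refine (phi_surface_of (R := ZMod 2) G H (Tangle.cutD_wf hT c η) (fun _ => xres_mfd false)
    (fun _ => xres_mfd true) (S := fun _ => S) (fun _ _ => le_rfl) (trCob T ε ε' (Pi.single (T.cr c 0) 1) 0)
    (fun _ _ => TrK.mk (T.cr c 0)) s (fun _ k => (hj k).symm) (fun Z f g h => ?_)
    (fun p _ h2 => TrK.ind fun t => h2 ((T.cut c).cmp η t)) (fun _ x => ?_) (fun x => ?_)
    (fun _ x => ?_) (fun x => ?_) ?_ ?_).1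
  · have hg : ∀ k, g ((T.cut c).cmp η (T.cr c k)) = f () () := fun k => (h () k).symm
    obtain ⟨ρ, -, h3⟩ := G.univ Z (fun _ _ => f () ()) g h
    obtain ⟨ρ', -, h3'⟩ := H.univ Z (fun _ _ => f () ()) g h
    refine ⟨Quot.lift (fun s => g ((T.cut c).cmp η s)) ?_, ?_, Tangle.cmp_ind fun s => rfl⟩
    · rintro s t (hst | hst)
      · refine (h3 ((T.cut c).cmp η s)).symm.trans (Eq.trans ?_ (h3 ((T.cut c).cmp η t)))
        exact congrArg ρ (Tangle.cmp_eq hst)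
      · refine (h3' ((T.cut c).cmp η s)).symm.trans (Eq.trans ?_ (h3' ((T.cut c).cmp η t)))
        exact congrArg ρ' (Tangle.cmp_eq hst)
    · rintro ⟨⟩ ⟨⟩
      exact hg 0
  · refine (TrK.out_l (G.j () x)).trans ?_
    obtain ⟨k⟩ := x
    exact hj k
  · refine (TrK.out_l (G.s x)).trans ?_
    exact Tangle.cmp_ind (p := fun x => TrK.l (G.s x) = s x) (fun _ => rfl) x
  · refine (TrK.out_r (H.j () x)).trans ?_
    obtain ⟨k⟩ := x
    exact hj k
  · refine (TrK.out_r (H.s x)).trans ?_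
    exact Tangle.cmp_ind (p := fun x => TrK.r (H.s x) = s x) (fun _ => rfl) x
  · have : Unique (Circ (xres false) (xres true)) := ⟨⟨Circ.l (Quot.mk (xres false).link (0 : Fin 4))⟩, circ_xres_eq⟩
    have e1 : (fun q : Σ _ : Unit, Fin 4 => s ((Tangle.cutD c η).bd (.inl q)))
        = fun _ => TrK.mk (T.cr c 0) := funext fun q => hj q.2
    have e2 : (fun p => s ((Tangle.cutD c η).bd (.inr p))) = fun p => TrK.mk (T.bd p) := rfl
    rw [e1, e2]
    change _ = push (fun _ : Σ _ : Unit, Unit => (TrK.mk (T.cr c 0) : TrK T ε ε')) (fun _ => (4 : ℤ))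
      - 2 • cnt (fun _ : Σ _ : Unit, Circ (xres false) (xres true) => _) - _ + _ + _
    rw [push_const, cnt_const, cnt_const]
    change _ - 2 • push TrK.mk (Pi.single (T.cr c 0) 1) + _ = _
    rw [push_single]
    simp only [Finset.sum_const, Finset.card_univ, Fintype.card_sigma,
      Finset.univ_unique, Fintype.card_fin, Fintype.card_unique]
    ext k
    simp only [Pi.add_apply, Pi.sub_apply, Pi.smul_apply, Pi.single_apply]
    split_ifs
    · norm_num
      ring
    · norm_num
  · change push TrK.mk 0 = push _ 0
    rw [map_zero, map_zero]

end crossing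

end

section
variable {e o U : Type} [Finite e] [Finite o]

section tmat

variable {R : Type} [CommRing R] {T T₁ T₂ T₃ : Tangle e U}

abbrev TMat (R : Type) (T T' : Tangle e U) : Type :=
  ∀ (ε : T.C → Bool) (ε' : T'.C → Bool), RHom R (T.res ε) (T'.res ε')

namespace TMat

def mul (M : TMat R T T₁) (N : TMat R T₁ T₂) : TMat R T T₂ := fun ε ε'' =>
  ∑ᶠ ε', hcomp (M ε ε') (N ε' ε'')

theorem mul_apply [Fintype (T₁.C → Bool)] (M : TMat R T T₁) (N : TMat R T₁ T₂) (ε ε'') :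
  mul M N ε ε'' = ∑ ε', hcomp (M ε ε') (N ε' ε'') := fsum_eq _

theorem mul_add (M : TMat R T T₁) (N N' : TMat R T₁ T₂) : mul M (N + N') = mul M N + mul M N' := by
  ext1 ε; ext1 ε''
  rw [Pi.add_apply, Pi.add_apply, mul_apply, mul_apply, mul_apply, ← sum_add_distrib]
  exact sum_congr rfl fun ε' _ => hcomp_add _ _ _

theorem add_mul (M M' : TMat R T T₁) (N : TMat R T₁ T₂) : mul (M + M') N = mul M N + mul M' N := by
  ext1 ε; ext1 ε''
  rw [Pi.add_apply, Pi.add_apply, mul_apply, mul_apply, mul_apply, ← sum_add_distrib]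
  exact sum_congr rfl fun ε' _ => add_hcomp _ _ _

theorem smul_mul (r : R) (M : TMat R T T₁) (N : TMat R T₁ T₂) : mul (r • M) N = r • mul M N := by
  ext1 ε; ext1 ε''
  rw [Pi.smul_apply, Pi.smul_apply, mul_apply, mul_apply, Finset.smul_sum]
  exact sum_congr rfl fun ε' _ => smul_hcomp _ _ _

theorem mul_smul (r : R) (M : TMat R T T₁) (N : TMat R T₁ T₂) : mul M (r • N) = r • mul M N := by
  ext1 ε; ext1 ε''
  rw [Pi.smul_apply, Pi.smul_apply, mul_apply, mul_apply, Finset.smul_sum]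
  exact sum_congr rfl fun ε' _ => hcomp_smul _ _ _

def mulₗ (R : Type) [CommRing R] (T T₁ T₂ : Tangle e U) :
  TMat R T T₁ →ₗ[R] TMat R T₁ T₂ →ₗ[R] TMat R T T₂ :=
  LinearMap.mk₂ R mul add_mul smul_mul mul_add mul_smul

theorem mulₗ_apply (M : TMat R T T₁) (N : TMat R T₁ T₂) : mulₗ R T T₁ T₂ M N = mul M N := rfl

theorem mul_sum {ι : Type} (s : Finset ι) (M : TMat R T T₁) (N : ι → TMat R T₁ T₂) :
  mul M (∑ i ∈ s, N i) = ∑ i ∈ s, mul M (N i) := map_sum (mulₗ R T T₁ T₂ M) N s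

theorem sum_mul {ι : Type} (s : Finset ι) (M : ι → TMat R T T₁) (N : TMat R T₁ T₂) :
  mul (∑ i ∈ s, M i) N = ∑ i ∈ s, mul (M i) N := by
  rw [← mulₗ_apply, map_sum, LinearMap.sum_apply]
  rfl

theorem mul_zero (M : TMat R T T₁) : mul M (0 : TMat R T₁ T₂) = 0 := map_zero (mulₗ R T T₁ T₂ M)
theorem zero_mul (N : TMat R T₁ T₂) : mul (0 : TMat R T T₁) N = 0 :=
  LinearMap.map_zero₂ (mulₗ R T T₁ T₂) N

end TMat

/-- The resolutions are manifolds, and the saddles have genus zero. -/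
structure Tangle.Nice (T : Tangle e U) : Prop where
  mfd : ∀ ε, (T.res ε).Mfd
  sad : ∀ c ε ε', ε c = false → ε' = update ε c true →
    (trCob T ε ε' (Pi.single (T.cr c 0) 1) 0).Good

theorem Tangle.WF.nice {T : Tangle e U} (hT : T.WF) : T.Nice :=
  ⟨hT.mfd, fun c _ _ => saddle_good hT c⟩

variable [CharP R 2]

theorem TMat.mul_assoc (h : T.Nice) (h₁ : T₁.Nice) (h₂ : T₂.Nice) (h₃ : T₃.Nice)
  (L : TMat R T T₁) (M : TMat R T₁ T₂) (N : TMat R T₂ T₃) :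
  mul (mul L M) N = mul L (mul M N) := by
  ext1 ε; ext1 ε'
  simp only [mul_apply, hcomp_sum, sum_hcomp]
  rw [sum_comm]
  refine sum_congr rfl fun ε₁ _ => sum_congr rfl fun ε₂ _ => ?_
  exact hcomp_assoc (h.mfd _) (h₁.mfd _) (h₂.mfd _) (h₃.mfd _) _ _ _

section trace

def tr (R : Type) [CommRing R] (T : Tangle e U) (P : (T.C → Bool) → (T.C → Bool) → Prop)
  (β : T.S → ℤ) (δ : T.S → ℕ) : TMat R T T := fun ε ε' =>
  if P ε ε' then (trCob T ε ε' β δ).L 1 else 0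

variable (R T) in
def dots (δ : T.S → ℕ) : TMat R T T := tr R T (· = ·) 0 δ

variable (R T) in
def tone : TMat R T T := dots R T 0

variable (T) in
/-- `ε'` is obtained from `ε` by changing the smoothing of the crossing `c` from `0` to `1`. -/
def Tangle.Edge (c : T.C) (ε ε' : T.C → Bool) : Prop :=
  ε c = false ∧ ε' = update ε c true

variable (R T) in
def sad (c : T.C) : TMat R T T := tr R T (T.Edge c) (Pi.single (T.cr c 0) 1) 0

variable (T) in
/-- The differential together with the basepoint actions with weights `ξ`. -/
def diff (ξ : U → R) : TMat R T T :=
  ∑ᶠ c, sad R T c + ∑ᶠ p, (T.col p).elim 0 fun u => ξ u • dots R T (Pi.single (T.pt p 0) 1)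

theorem leftCob_zero {a b c : Flat e} (φ : FlatIso a b) (f : RHom R b c) :
  (φ.leftCob c 0).L f = fun V => f ((φ.left c).symm ⁻¹' V) := by
  rw [Cob.L_reind (φ.left c).symm.symm]
  refine Eq.trans ?_ (Cob.L_ident _)
  refine Cob.L_congr (φ.left c).symm (fun q => ?_) (fun q => ?_) (fun _ => rfl) (fun q => ?_) _
  · simp
  · simp
  · simp

theorem rightCob_zero {a b c : Flat e} (φ : FlatIso b c) (f : RHom R a b) :
  (φ.rightCob a 0).L f = fun V => f (φ.right a ⁻¹' V) := by
  rw [Cob.L_reind (φ.right a).symm]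
  refine Eq.trans ?_ (Cob.L_ident _)
  refine Cob.L_congr (G := { φ.rightCob a 0 with inn := (φ.rightCob a 0).inn ∘ (φ.right a).symm })
    (G' := Cob.ident (Circ a c) 0) (Equiv.refl _) (fun q => ?_) (fun q => rfl) (fun _ => rfl)
    (fun q => ?_) _
  · simp
  · simp

theorem leftCob_refl {a c : Flat e} (f : RHom R a c) : ((FlatIso.refl a).leftCob c 0).L f = f := by
  rw [leftCob_zero]
  have : ∀ q, (FlatIso.refl a).left c q = q := Circ.ind (fun x => FlatIso.left_l _ x) (fun x => FlatIso.left_r _ x)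
  have h : (FlatIso.refl a).left c = Equiv.refl _ := Equiv.ext this
  rw [h]
  rfl

theorem rightCob_refl {a b : Flat e} (f : RHom R a b) : ((FlatIso.refl b).rightCob a 0).L f = f := by
  rw [rightCob_zero]
  have : ∀ q, (FlatIso.refl b).right a q = q := Circ.ind (fun x => FlatIso.right_l _ x) (fun x => FlatIso.right_r _ x)
  have h : (FlatIso.refl b).right a = Equiv.refl _ := Equiv.ext this
  rw [h]
  rfl

theorem dots_self {T : Tangle e U} (δ : T.S → ℕ) (ε : T.C → Bool) :
  dots R T δ ε ε = ((FlatIso.refl (T.res ε)).cyl (push (T.cmp ε) δ)).L 1 :=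
  (if_pos rfl).trans (trCob_self δ 1)

theorem dots_ne {T : Tangle e U} (δ : T.S → ℕ) {ε ε' : T.C → Bool} (h : ε ≠ ε') :
  dots R T δ ε ε' = 0 := if_neg h

theorem tone_self {T : Tangle e U} (ε : T.C → Bool) :
  tone R T ε ε = ((FlatIso.refl (T.res ε)).cyl 0).L 1 := by
  rw [tone, dots_self, map_zero]

theorem TMat.one_mul (h : T.Nice) (h₁ : T₁.Nice) (M : TMat R T T₁) : mul (tone R T) M = M := by
  ext1 ε; ext1 ε'
  rw [mul, finsum_eq_single _ ε]
  · rw [tone_self, FlatIso.hcomp_cyl_left _ (h.mfd ε) (h₁.mfd ε'), leftCob_refl]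
  · intro η hη
    rw [tone, dots_ne _ hη.symm, zero_hcomp]

theorem TMat.mul_one (h : T.Nice) (h₁ : T₁.Nice) (M : TMat R T T₁) : mul M (tone R T₁) = M := by
  ext1 ε; ext1 ε'
  rw [mul, finsum_eq_single _ ε']
  · rw [tone_self, FlatIso.hcomp_cyl_right _ (h.mfd ε) (h₁.mfd ε'), rightCob_refl]
  · intro η hη
    rw [tone, dots_ne _ hη, hcomp_zero]

end trace

end tmat

section phi

variable {I : Type} [Finite I] {E : I → Type} [∀ i, Finite (E i)] {D : ArcDiagram E o}
  {R : Type} [CommRing R]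

/-- The product of functions in independent variables as a multilinear map. -/
def tensorₘ (R : Type) [CommRing R] (N : I → Type) :
  MultilinearMap R (fun i => Set (N i) → R) (Set (Σ i, N i) → R) :=
  MultilinearMap.pi fun V => (MultilinearMap.mkPiAlgebra R I R).compLinearMap
    fun i => LinearMap.proj (Sigma.mk i ⁻¹' V)

theorem tensorₘ_apply (N : I → Type) (f : ∀ i, Set (N i) → R) :
  tensorₘ R N f = Cob.tensor f := by
  ext V
  rw [Cob.tensor, finprod_eq_prod_of_fintype]
  simp [tensorₘ]

variable {T T₁ T₂ : ∀ i, Tangle (E i) U} {A A₁ A₂ : Tangle o U} (G : TGlue D T A)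
  (G₁ : TGlue D T₁ A₁) (G₂ : TGlue D T₂ A₂)

def phi : MultilinearMap R (fun i => TMat R (T i) (T₁ i)) (TMat R A A₁) :=
  MultilinearMap.pi fun ε => MultilinearMap.pi fun ε' =>
    ((phiCob (G.res ε) (G₁.res ε')).linear R).compMultilinearMap
      ((tensorₘ R fun i => Circ ((T i).res (G.part ε i)) ((T₁ i).res (G₁.part ε' i))).compLinearMap
        fun i => LinearMap.proj (R := R) (φ := fun η => RHom R ((T i).res (G.part ε i)) ((T₁ i).res η))
          (G₁.part ε' i) ∘ₗ LinearMap.proj (R := R)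
            (φ := fun η => ∀ η', RHom R ((T i).res η) ((T₁ i).res η')) (G.part ε i))

theorem phi_apply (M : ∀ i, TMat R (T i) (T₁ i)) (ε ε') :
  phi G G₁ M ε ε' = (phiCob (G.res ε) (G₁.res ε')).L
    (Cob.tensor fun i => M i (G.part ε i) (G₁.part ε' i)) := by
  rw [← tensorₘ_apply]
  rfl

namespace TGlue

/-- Resolutions of a glued tangle are families of resolutions of the parts. -/
def parts : (A.C → Bool) ≃ ∀ i, (T i).C → Bool :=
  (Equiv.arrowCongr G.κ.symm (Equiv.refl _)).trans (Equiv.piCurry fun _ _ => Bool)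

theorem mk_cr {ε ε' : A.C → Bool} {i} {c : (T i).C} (h : A.Edge (G.κ ⟨i, c⟩) ε ε') (k : Fin 4) :
  (TrK.mk (G.σ i ((T i).cr c k)) : TrK A ε ε') = TrK.mk (A.cr (G.κ ⟨i, c⟩) 0) := by
  have h1 : ε' (G.κ ⟨i, c⟩) = true := by rw [h.2, update_self]
  have hl : Tangle.Joined false fun k => (TrK.mk (A.cr (G.κ ⟨i, c⟩) k) : TrK A ε ε') := by
    have := (A.respects_cmp ε).cr (G.κ ⟨i, c⟩)
    rw [h.1] at this
    exact ⟨congrArg TrK.l this.1, congrArg TrK.l this.2⟩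
  have hr : Tangle.Joined true fun k => (TrK.mk (A.cr (G.κ ⟨i, c⟩) k) : TrK A ε ε') := by
    have := (A.respects_cmp ε').cr (G.κ ⟨i, c⟩)
    rw [h1] at this
    exact ⟨congrArg TrK.r this.1, congrArg TrK.r this.2⟩
  have hj := joined_const hl hr
  rcases G.cr i c with hs | hs
  · exact (congrArg TrK.l ((A.respects_cmp ε).strand (hs k))).trans (hj k)
  · exact (congrArg TrK.l ((A.respects_cmp ε).strand (hs k))).trans (hj (k + 2))

theorem part_eq_iff (ε ε' : A.C → Bool) : (∀ i, G.part ε i = G.part ε' i) ↔ ε = ε' := by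
  rw [← G.parts.injective.eq_iff, funext_iff]
  rfl

theorem edge_iff (ε ε' : A.C → Bool) (i) (c : (T i).C) :
  (∀ j, update (fun j => (· = · : ((T j).C → Bool) → ((T j).C → Bool) → Prop)) i
    ((T i).Edge c) j (G.part ε j) (G.part ε' j)) ↔ A.Edge (G.κ ⟨i, c⟩) ε ε' := by
  constructor
  · intro h
    have hi := h i
    rw [update_self] at hi
    refine ⟨hi.1, ?_⟩
    ext x
    obtain ⟨⟨j, c'⟩, rfl⟩ := G.κ.surjective x
    by_cases hj : j = i
    · subst hj
      have h2 := congrFun hi.2 c'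
      by_cases hc : c' = c
      · subst hc
        rw [update_self] at h2 ⊢
        exact h2
      · rw [update_of_ne hc] at h2
        rw [update_of_ne (by simp [hc])]
        exact h2
    · have h2 := h j
      rw [update_of_ne hj] at h2
      rw [update_of_ne (fun h3 => hj (congrArg Sigma.fst (G.κ.injective h3)))]
      exact (congrFun h2 c').symm
  · rintro ⟨h1, rfl⟩ j
    by_cases hj : j = i
    · subst hj
      rw [update_self]
      refine ⟨h1, ?_⟩
      ext c'
      by_cases hc : c' = c
      · subst hc
        rw [update_self]
        exact update_self _ _ _
      · rw [update_of_ne hc]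
        exact update_of_ne (by simp [hc]) _ _
    · rw [update_of_ne hj]
      ext c'
      exact (update_of_ne (fun h3 => hj (congrArg Sigma.fst (G.κ.injective h3))) _ _).symm

theorem push_update {M : Type} [AddCommMonoid M] (i) (s : (T i).S) (w : M) :
  push (fun s : Σ i, (T i).S => G.σ s.1 s.2)
    (fun t => update (fun j => (0 : (T j).S → M)) i (Pi.single s w) t.1 t.2)
    = Pi.single (G.σ i s) w := by
  have : (fun t : Σ i, (T i).S => update (fun j => (0 : (T j).S → M)) i (Pi.single s w) t.1 t.2)
      = Pi.single (⟨i, s⟩ : Σ i, (T i).S) w := by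
    ext ⟨j, t⟩
    by_cases hj : j = i
    · subst hj
      simp only [update_self]
      by_cases ht : t = s
      · simp_all
      · simp_all
    · simp_all
  rw [this]
  convert push_single (fun s : Σ i, (T i).S => G.σ s.1 s.2) ⟨i, s⟩ w

theorem phi_tr [CharP R 2] (hD : D.WF) (hT : ∀ i, (T i).Nice)
  (P : ∀ i, ((T i).C → Bool) → ((T i).C → Bool) → Prop) (β : ∀ i, (T i).S → ℤ)
  (δ : ∀ i, (T i).S → ℕ)
  (good : ∀ i ε ε', P i ε ε' → (trCob (T i) ε ε' (β i) (δ i)).Good) :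
  phi G G (fun i => tr R (T i) (P i) (β i) (δ i))
    = tr R A (fun ε ε' => ∀ i, P i (G.part ε i) (G.part ε' i))
      (push (fun s : Σ i, (T i).S => G.σ s.1 s.2) fun s => β s.1 s.2)
      (push (fun s : Σ i, (T i).S => G.σ s.1 s.2) fun s => δ s.1 s.2) := by
  ext1 ε; ext1 ε'
  rw [phi_apply, tr]
  split_ifs with h
  · rw [← (G.trCob_phi hD ε ε' (fun i => (hT i).mfd _) (fun i => (hT i).mfd _) β δ
      fun i => good i _ _ (h i)).2]
    congr 2
    ext1 i
    exact if_pos (h i)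
  · push Not at h
    obtain ⟨i, hi⟩ := h
    rw [← tensorₘ_apply, (tensorₘ R _).map_coord_zero i (if_neg hi), ← Cob.linear_apply, map_zero]

theorem good_update (hT : ∀ i, (T i).Nice) (i) (c : (T i).C) (j) (ε ε' : (T j).C → Bool)
  (h : update (fun j => (· = · : ((T j).C → Bool) → ((T j).C → Bool) → Prop)) i
    ((T i).Edge c) j ε ε') : (trCob (T j) ε ε'
      (update (fun j => (0 : (T j).S → ℤ)) i (Pi.single ((T i).cr c 0) 1) j) 0).Good := by
  by_cases hj : j = i
  · subst hj
    rw [update_self] at h ⊢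
    exact (hT j).sad c ε ε' h.1 h.2
  · rw [update_of_ne hj] at h ⊢
    subst h
    exact trCob_self_good ((hT j).mfd _) 0

theorem trCob_sad {ε ε' : A.C → Bool} {i} {c : (T i).C} (h : A.Edge (G.κ ⟨i, c⟩) ε ε') :
  trCob A ε ε' (push (fun s : Σ i, (T i).S => G.σ s.1 s.2) fun s => update
      (fun j => (0 : (T j).S → ℤ)) i (Pi.single ((T i).cr c 0) 1) s.1 s.2)
    (push (fun s : Σ i, (T i).S => G.σ s.1 s.2) fun _ => 0)
    = trCob A ε ε' (Pi.single (A.cr (G.κ ⟨i, c⟩) 0) 1) 0 := by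
  simp [G.push_update, push_single, G.mk_cr h, show (fun _ : Σ i, (T i).S => (0 : ℕ)) = 0 from rfl, map_zero]

theorem nice (G : TGlue D T A) (hD : D.WF) (hT : ∀ i, (T i).Nice) : A.Nice where
  mfd ε := (G.res ε).mfd hD fun i => (hT i).mfd _
  sad x ε ε' h0 h1 := by
    obtain ⟨⟨i, c⟩, rfl⟩ := G.κ.surjective x
    rw [← G.trCob_sad ⟨h0, h1⟩]
    exact (G.trCob_phi (R := ZMod 2) hD ε ε' (fun i => (hT i).mfd _) (fun i => (hT i).mfd _) _ _
      fun j => good_update hT i c j _ _ ((G.edge_iff ε ε' i c).2 ⟨h0, h1⟩ j)).1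

theorem phi_sad [CharP R 2] (hD : D.WF) (hT : ∀ i, (T i).Nice) (i) (c : (T i).C) :
  phi G G (update (fun j => tone R (T j)) i (sad R (T i) c))
    = sad R A (G.κ ⟨i, c⟩) := by
  have e1 : update (fun j => tone R (T j)) i (sad R (T i) c)
      = fun j => tr R (T j) (update
          (fun j => (· = · : ((T j).C → Bool) → ((T j).C → Bool) → Prop)) i ((T i).Edge c) j)
        (update (fun j => (0 : (T j).S → ℤ)) i (Pi.single ((T i).cr c 0) 1) j) 0 := by
    ext1 j
    by_cases hj : j = i
    · subst hj
      simp only [update_self, sad]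
    · simp only [update_of_ne hj]
      rfl
  rw [e1, G.phi_tr hD hT _ _ _ (good_update hT i c)]
  ext1 ε; ext1 ε'
  unfold sad tr
  by_cases h : A.Edge (G.κ ⟨i, c⟩) ε ε'
  · simp [if_pos h, if_pos ((G.edge_iff ε ε' i c).2 h), G.trCob_sad h]
  · rw [if_neg h, if_neg fun h' => h ((G.edge_iff ε ε' i c).1 h')]

theorem phi_dots [CharP R 2] (hD : D.WF) (hT : ∀ i, (T i).Nice) (δ : ∀ i, (T i).S → ℕ) :
  phi G G (fun i => dots R (T i) (δ i))
    = dots R A (push (fun s : Σ i, (T i).S => G.σ s.1 s.2) fun s => δ s.1 s.2) := by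
  unfold dots
  rw [G.phi_tr hD hT _ _ _ fun i ε ε' h => h ▸ trCob_self_good ((hT i).mfd _) _]
  have e1 : (fun ε ε' => ∀ i, G.part ε i = G.part ε' i) = (· = ·) := by simp [G.part_eq_iff]
  rw [e1]
  congr 1
  exact map_zero _

theorem phi_tone [CharP R 2] (hD : D.WF) (hT : ∀ i, (T i).Nice) :
  phi G G (fun i => tone R (T i)) = tone R A := by
  refine (G.phi_dots hD hT fun _ => 0).trans ?_
  exact congrArg (dots R A) (map_zero _)

theorem phi_dot [CharP R 2] (hD : D.WF) (hT : ∀ i, (T i).Nice) (i) (s : (T i).S) :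
  phi G G (update (fun j => tone R (T j)) i (dots R (T i) (Pi.single s 1)))
    = dots R A (Pi.single (G.σ i s) 1) := by
  rw [← G.push_update i s, ← G.phi_dots hD hT]
  congr 1
  ext1 j
  by_cases hj : j = i
  · grind
  · simp only [update_of_ne hj]
    rfl

theorem diff_eq [CharP R 2] (hD : D.WF) (hT : ∀ i, (T i).Nice) (ξ : U → R) :
  diff A ξ = ∑ᶠ i, phi G G (update (fun j => tone R (T j)) i (diff (T i) ξ)) := by
  have key : ∀ i, phi G G (update (fun j => tone R (T j)) i (diff (T i) ξ))
      = ∑ c, sad R A (G.κ ⟨i, c⟩) + ∑ p, ((T i).col p).elim 0 fun u =>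
        ξ u • dots R A (Pi.single (G.σ i ((T i).pt p 0)) 1) := fun i => by
    have e1 : ∀ x, phi G G (update (fun j => tone R (T j)) i x)
        = (phi G G).toLinearMap (fun j => tone R (T j)) i x := fun x => rfl
    rw [e1, diff, map_add, fsum_eq, fsum_eq, map_sum, map_sum]
    refine congrArg₂ (· + ·) (sum_congr rfl fun c _ => ?_)
      (sum_congr rfl fun p _ => ?_)
    · rw [← e1, G.phi_sad hD hT]
    · cases (T i).col p with
      | none => exact map_zero _
      | some u => exact (map_smul _ _ _).trans (congrArg (ξ u • ·) (G.phi_dot hD hT i _))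
  rw [diff]
  simp only [fsum_eq, key, sum_add_distrib]
  refine congrArg₂ (· + ·) ?_ ?_
  · rw [← Equiv.sum_comp G.κ, Fintype.sum_sigma]
  · ext1 ε; ext1 ε'
    simp only [Finset.sum_apply]
    by_cases h : ε = ε'
    · subst h
      have hF : ∀ (x : Option U) (s : A.S), (x.elim 0 fun u => ξ u • dots R A (Pi.single s 1)) ε ε
          = x.elim 0 fun u => ξ u •
            ((FlatIso.refl (A.res ε)).cyl (Pi.single (A.cmp ε s) 1)).L (1 : Set Empty → R) := by
        intro x s
        cases x with
        | none => rfl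
        | some u =>
          change ξ u • dots R A (Pi.single s 1) ε ε = ξ u • _
          rw [dots_self, push_single]
      have h := G.pt ε (RHom R (A.res ε) (A.res ε)) fun x u => ξ u •
            ((FlatIso.refl (A.res ε)).cyl (Pi.single x 1)).L (1 : Set Empty → R)
      simp only [fsum_eq] at h
      simp only [hF]
      exact h
    · have hF : ∀ (x : Option U) (s : A.S),
          (x.elim 0 fun u => ξ u • dots R A (Pi.single s 1)) ε ε' = 0 := by
        intro x s
        cases x with
        | none => rfl
        | some u =>
          change ξ u • dots R A (Pi.single s 1) ε ε' = 0
          rw [dots_ne _ h, smul_zero]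
      simp only [hF, Finset.sum_const_zero]

end TGlue

variable [CharP R 2]

theorem phi_mul (hD : D.WF) (hT : ∀ i, (T i).Nice) (hT₁ : ∀ i, (T₁ i).Nice)
  (hT₂ : ∀ i, (T₂ i).Nice) (hA : A.Nice) (hA₁ : A₁.Nice) (hA₂ : A₂.Nice)
  (M : ∀ i, TMat R (T i) (T₁ i)) (N : ∀ i, TMat R (T₁ i) (T₂ i)) :
  TMat.mul (phi G G₁ M) (phi G₁ G₂ N) = phi G G₂ fun i => TMat.mul (M i) (N i) := by
  ext1 ε; ext1 ε''
  rw [TMat.mul_apply, phi_apply, ← tensorₘ_apply]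
  have e1 : (fun i => TMat.mul (M i) (N i) (G.part ε i) (G₂.part ε'' i))
      = fun i => ∑ η, hcomp (M i (G.part ε i) η) (N i η (G₂.part ε'' i)) :=
    funext fun i => TMat.mul_apply _ _ _ _
  rw [e1, MultilinearMap.map_sum, ← Cob.linear_apply, map_sum, ← Equiv.sum_comp G₁.parts]
  refine sum_congr rfl fun ε' _ => ?_
  rw [phi_apply, phi_apply, hcomp_phi hD (fun i => (hT i).mfd _) (fun i => (hT₁ i).mfd _)
    (fun i => (hT₂ i).mfd _) (hA.mfd _) (hA₁.mfd _) (hA₂.mfd _), tensorₘ_apply]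
  rfl

end phi

end

section
open TMat (mul)

variable {e o h U : Type} [Finite e] [Finite o] [Finite h]

section closed

variable {R : Type} [CommRing R] {T T₁ T₂ : Tangle e U}

def Closed (ξ : U → R) (M : TMat R T T₁) : Prop :=
  mul (diff T ξ) M = mul M (diff T₁ ξ)

def THomotopic (ξ : U → R) (M N : TMat R T T₁) : Prop :=
  ∃ H, M - N = mul H (diff T₁ ξ) + mul (diff T ξ) H

theorem THomotopic.refl (ξ : U → R) (M : TMat R T T₁) : THomotopic ξ M M :=
  ⟨0, by rw [sub_self, TMat.zero_mul, TMat.mul_zero, add_zero]⟩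

theorem THomotopic.trans {ξ : U → R} {L M N : TMat R T T₁} (h : THomotopic ξ L M)
  (h' : THomotopic ξ M N) : THomotopic ξ L N := by
  obtain ⟨H, hH⟩ := h
  obtain ⟨H', hH'⟩ := h'
  refine ⟨H + H', ?_⟩
  rw [TMat.add_mul, TMat.mul_add, ← sub_add_sub_cancel, hH, hH']
  abel

variable [CharP R 2]

theorem Closed.mul {ξ : U → R} (h : T.Nice) (h₁ : T₁.Nice) (h₂ : T₂.Nice) {M : TMat R T T₁}
  {N : TMat R T₁ T₂} (hM : Closed ξ M) (hN : Closed ξ N) : Closed ξ (mul M N) := by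
  unfold Closed at *
  rw [← TMat.mul_assoc h h h₁ h₂, hM, TMat.mul_assoc h h₁ h₁ h₂, hN, ← TMat.mul_assoc h h₁ h₂ h₂]

theorem Closed.one (ξ : U → R) (h : T.Nice) : Closed ξ (tone R T) := by
  unfold Closed
  rw [TMat.one_mul h h, TMat.mul_one h h]

end closed

section phi

variable {I : Type} [Finite I] {E : I → Type} [∀ i, Finite (E i)] {D : ArcDiagram E o}
  {R : Type} [CommRing R] [CharP R 2] {T T₁ : ∀ i, Tangle (E i) U} {A A₁ : Tangle o U}
  (G : TGlue D T A) (G₁ : TGlue D T₁ A₁)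

theorem diff_mul_phi (hD : D.WF) (hT : ∀ i, (T i).Nice) (hT₁ : ∀ i, (T₁ i).Nice) (ξ : U → R)
  (f : ∀ i, TMat R (T i) (T₁ i)) : mul (diff A ξ) (phi G G₁ f)
    = ∑ᶠ i, phi G G₁ (update f i (mul (diff (T i) ξ) (f i))) := by
  rw [G.diff_eq hD hT, fsum_eq, fsum_eq, TMat.sum_mul]
  refine sum_congr rfl fun i _ => ?_
  rw [phi_mul G G G₁ hD hT hT hT₁ (G.nice hD hT) (G.nice hD hT) (G₁.nice hD hT₁)]
  congr 1
  ext1 j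
  by_cases hj : j = i
  · subst hj
    simp only [update_self]
  · simp only [update_of_ne hj]
    exact TMat.one_mul (hT j) (hT₁ j) (f j)

theorem phi_mul_diff (hD : D.WF) (hT : ∀ i, (T i).Nice) (hT₁ : ∀ i, (T₁ i).Nice) (ξ : U → R)
  (f : ∀ i, TMat R (T i) (T₁ i)) : mul (phi G G₁ f) (diff A₁ ξ)
    = ∑ᶠ i, phi G G₁ (update f i (mul (f i) (diff (T₁ i) ξ))) := by
  rw [G₁.diff_eq hD hT₁, fsum_eq, fsum_eq, TMat.mul_sum]
  refine sum_congr rfl fun i _ => ?_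
  rw [phi_mul G G₁ G₁ hD hT hT₁ hT₁ (G.nice hD hT) (G₁.nice hD hT₁) (G₁.nice hD hT₁)]
  congr 1
  ext1 j
  by_cases hj : j = i
  · subst hj
    simp only [update_self]
  · simp only [update_of_ne hj]
    exact TMat.mul_one (hT j) (hT₁ j) (f j)

theorem phi_closed (hD : D.WF) (hT : ∀ i, (T i).Nice) (hT₁ : ∀ i, (T₁ i).Nice) {ξ : U → R}
  {f : ∀ i, TMat R (T i) (T₁ i)} (hf : ∀ i, Closed ξ (f i)) : Closed ξ (phi G G₁ f) := by
  unfold Closed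
  rw [diff_mul_phi G G₁ hD hT hT₁, phi_mul_diff G G₁ hD hT hT₁]
  exact finsum_congr fun i => by rw [hf i]

theorem phi_homotopic_update (hD : D.WF) (hT : ∀ i, (T i).Nice) (hT₁ : ∀ i, (T₁ i).Nice)
  {ξ : U → R} {f : ∀ i, TMat R (T i) (T₁ i)} (hf : ∀ i, Closed ξ (f i)) (i : I)
  {g : TMat R (T i) (T₁ i)} (hg : THomotopic ξ (f i) g) :
  THomotopic ξ (phi G G₁ f) (phi G G₁ (update f i g)) := by
  obtain ⟨H, hH⟩ := hg
  refine ⟨phi G G₁ (update f i H), ?_⟩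
  rw [diff_mul_phi G G₁ hD hT hT₁, phi_mul_diff G G₁ hD hT hT₁, fsum_eq,
    fsum_eq, ← sum_add_distrib, sum_eq_single i]
  · have e1 : f = update f i (f i) := (Function.update_eq_self i f).symm
    conv_lhs => enter [1]; rw [e1]
    rw [Function.update_idem, Function.update_idem, update_self,
      ← MultilinearMap.map_update_sub, hH, MultilinearMap.map_update_add]
  · intro j _ hj
    rw [update_of_ne hj, hf j]
    ext1 ε; ext1 ε'; ext1 V
    exact CharTwo.add_self_eq_zero _
  · intro h
    exact (h (Finset.mem_univ i)).elim

theorem phi_homotopic (hD : D.WF) (hT : ∀ i, (T i).Nice) (hT₁ : ∀ i, (T₁ i).Nice)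
  {ξ : U → R} {f g : ∀ i, TMat R (T i) (T₁ i)} (hf : ∀ i, Closed ξ (f i))
  (hg : ∀ i, Closed ξ (g i)) (hfg : ∀ i, THomotopic ξ (f i) (g i)) :
  THomotopic ξ (phi G G₁ f) (phi G G₁ g) := by
  suffices h : ∀ s : Finset I, THomotopic ξ (phi G G₁ f) (phi G G₁ (s.piecewise g f)) by
    simpa using h Finset.univ
  intro s
  induction s using Finset.induction_on with
  | empty => rw [Finset.piecewise_empty]; exact .refl _ _
  | insert i s hi ih =>
    rw [Finset.piecewise_insert]
    refine ih.trans (phi_homotopic_update G G₁ hD hT hT₁ (fun j => ?_) i ?_)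
    · by_cases hj : j ∈ s
      · rw [Finset.piecewise_eq_of_mem _ _ _ hj]; exact hg j
      · rw [Finset.piecewise_eq_of_notMem _ _ _ hj]; exact hf j
    · rw [Finset.piecewise_eq_of_notMem _ _ _ hi]; exact hfg i

end phi

section glue

variable {I : Type} [Finite I] {E : I → Type} [∀ i, Finite (E i)]

theorem finsum_sum_type {P Q M : Type} [Finite P] [Finite Q] [AddCommMonoid M] (f : P ⊕ Q → M) :
  ∑ᶠ x, f x = ∑ᶠ p, f (.inl p) + ∑ᶠ q, f (.inr q) := by
  simp only [fsum_eq, Fintype.sum_sum_type]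

theorem finsum_sigma_type {P : I → Type} {M : Type} [∀ i, Finite (P i)] [AddCommMonoid M]
  (f : (Σ i, P i) → M) : ∑ᶠ x, f x = ∑ᶠ i, ∑ᶠ p, f ⟨i, p⟩ := by
  simp only [fsum_eq, Fintype.sum_sigma]

theorem finsum_bool {M : Type} [AddCommMonoid M] (f : Bool → M) :
  ∑ᶠ i, f i = f false + f true := by
  rw [fsum_eq, Fintype.sum_bool, add_comm]

def glueT (D : ArcDiagram E o) (T : ∀ i, Tangle (E i) U) : TGlue D T (D.glue T) where
  κ := Equiv.refl _
  σ i s := .inl ⟨i, s⟩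
  τ t := .inr t
  surj := by
    rintro (⟨i, s⟩ | t)
    exacts [.inl ⟨i, s, .refl _⟩, .inr ⟨t, .refl _⟩]
  link ε i := ⟨fun p => ((D.glue T).respects_cmp ε).pt (.inl ⟨i, p⟩),
    fun c => ((D.glue T).respects_cmp ε).cr ⟨i, c⟩⟩
  glue ε i p := ((D.glue T).respects_cmp ε).pt (.inr ⟨i, p⟩)
  bd ε p := rfl
  univ ε Z f g hf h := by
    refine ⟨Sum.elim (fun s => f s.1 s.2) g, ⟨?_, fun c => (hf c.1).cr c.2⟩, fun _ _ => rfl,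
      fun _ => rfl⟩
    rintro (p | p)
    exacts [(hf p.1).pt p.2, h p.1 p.2]
  cr i c := .inl fun k => .refl _
  pt ε M _ F := by
    refine (finsum_sum_type _).trans ?_
    rw [finsum_sigma_type]
    refine (congrArg (_ + ·) ?_).trans (add_zero _)
    exact finsum_eq_zero_of_forall_eq_zero fun _ => rfl

abbrev fillT (L : Tangle h U) (E : Tangle (h ⊕ e) U) : ∀ i, Tangle (fillE h e i) U
  | false => L
  | true => E

def fillG (L : Tangle h U) (E : Tangle (h ⊕ e) U) : TGlue (fillD h e) (fillT L E) (E.fill L) where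
  κ :=
    { toFun := fun | ⟨false, c⟩ => .inl c | ⟨true, c⟩ => .inr c
      invFun := Sum.elim (fun c => ⟨false, c⟩) (fun c => ⟨true, c⟩)
      left_inv := by rintro ⟨_ | _, c⟩ <;> rfl
      right_inv := by rintro (c | c) <;> rfl }
  σ := fun | false => .inl | true => .inr
  τ t := .inr (E.bd t)
  surj := by
    rintro (s | s)
    exacts [.inl ⟨false, s, .refl _⟩, .inl ⟨true, s, .refl _⟩]
  link ε := fun
    | false => ⟨fun p => ((E.fill L).respects_cmp ε).pt (.inl (.inl p)),
        fun c => ((E.fill L).respects_cmp ε).cr (.inl c)⟩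
    | true => ⟨fun p => ((E.fill L).respects_cmp ε).pt (.inl (.inr p)),
        fun c => ((E.fill L).respects_cmp ε).cr (.inr c)⟩
  glue ε := fun
    | false => fun q => ((E.fill L).respects_cmp ε).pt (.inr q)
    | true => fun _ => rfl
  bd ε p := rfl
  univ ε Z f g hf h := by
    refine ⟨Sum.elim (f false) (f true), ⟨?_, ?_⟩, ?_, h true⟩
    · rintro ((p | p) | q)
      exacts [(hf false).pt p, (hf true).pt p, (h false q).trans (h true (.inl q)).symm]
    · rintro (c | c)
      exacts [(hf false).cr c, (hf true).cr c]
    · rintro (_ | _) s <;> rfl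
  cr := fun
    | false => fun c => .inl fun k => .refl _
    | true => fun c => .inl fun k => .refl _
  pt ε M _ F := by
    refine (finsum_sum_type _).trans ?_
    refine (congrArg₂ (· + ·) (finsum_sum_type _)
      (finsum_eq_zero_of_forall_eq_zero fun _ => rfl)).trans ?_
    refine Eq.trans ?_ (finsum_bool _).symm
    exact add_zero _

theorem phi_heq {D : ArcDiagram E o} {a a' b b' : ∀ i, Flat (E i)} {A B : Flat o} {R : Type}
  [CommRing R] (ha : ∀ i, a i = a' i) (hb : ∀ i, b i = b' i) (G : IsGlue D a A)
  (G' : IsGlue D a' A) (H : IsGlue D b B) (H' : IsGlue D b' B) (hG : ∀ i, HEq (G.j i) (G'.j i))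
  (hGs : G.s = G'.s) (hH : ∀ i, HEq (H.j i) (H'.j i)) (hHs : H.s = H'.s)
  (M : ∀ i, RHom R (a i) (b i)) (M' : ∀ i, RHom R (a' i) (b' i)) (hM : ∀ i, HEq (M i) (M' i)) :
  (phiCob G H).L (Cob.tensor M) = (phiCob G' H').L (Cob.tensor M') := by
  obtain rfl : a = a' := funext ha
  obtain rfl : b = b' := funext hb
  obtain rfl : M = M' := funext fun i => eq_of_heq (hM i)
  have h1 : G.j = G'.j := funext fun i => eq_of_heq (hG i)
  have h2 : H.j = H'.j := funext fun i => eq_of_heq (hH i)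
  obtain rfl : G = G' := by
    cases G; cases G'; subst h1 hGs; rfl
  obtain rfl : H = H' := by
    cases H; cases H'; subst h2 hHs; rfl
  rfl

end glue

section fill

variable (L L' : Tangle h U) (E : Tangle (h ⊕ e) U)

/-- The resolutions of a filled tangle are glued from resolutions of the parts. -/
def fillRes (ζ : L.C → Bool) (η : E.C → Bool) (ε : (E.fill L).C → Bool) (hζ : ∀ c, ε (.inl c) = ζ c)
  (hη : ∀ c, ε (.inr c) = η c) :
  IsGlue (fillD h e) (fillF (L.res ζ) (E.res η)) ((E.fill L).res ε) where
  j := fun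
    | false => Tangle.cmpLift (fun s => (E.fill L).cmp ε (.inl s))
        fun _ _ => ((funext hζ : (fun c => ε (.inl c)) = ζ) ▸ (fillG L E).link ε false).eq
    | true => Tangle.cmpLift (fun s => (E.fill L).cmp ε (.inr s))
        fun _ _ => ((funext hη : (fun c => ε (.inr c)) = η) ▸ (fillG L E).link ε true).eq
  s t := (E.fill L).cmp ε (.inr (E.bd t))
  glue := fun
    | false => fun q => (fillG L E).glue ε false q
    | true => fun q => (fillG L E).glue ε true q
  bd p := rfl
  univ := by
    obtain rfl : (fun c => ε (.inl c)) = ζ := funext hζ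
    obtain rfl : (fun c => ε (.inr c)) = η := funext hη
    intro Z f g h
    obtain ⟨ρ, h1, h2⟩ := ((fillG L E).res ε).univ Z (fun | false => f false | true => f true) g
      (by rintro (_ | _); exacts [h false, h true])
    refine ⟨ρ, ?_, h2⟩
    rintro (_ | _) x
    exacts [h1 false x, h1 true x]
  ind := by
    obtain rfl : (fun c => ε (.inl c)) = ζ := funext hζ
    obtain rfl : (fun c => ε (.inr c)) = η := funext hη
    intro p hj hs
    refine ((fillG L E).res ε).ind p ?_ hs
    rintro (_ | _) x
    exacts [hj false x, hj true x]

variable {L L' E}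

theorem fill_res_eq {ζ : L.C → Bool} {η : E.C → Bool} {ε : (E.fill L).C → Bool}
  (hζ : ∀ c, ε (.inl c) = ζ c) (hη : ∀ c, ε (.inr c) = η c) (i) :
  (fillT L E i).res ((fillG L E).part ε i) = fillF (L.res ζ) (E.res η) i := by
  obtain rfl : (fun c => ε (.inl c)) = ζ := funext hζ
  obtain rfl : (fun c => ε (.inr c)) = η := funext hη
  cases i <;> rfl

theorem fill_j_heq {ζ : L.C → Bool} {η : E.C → Bool} {ε : (E.fill L).C → Bool}
  (hζ : ∀ c, ε (.inl c) = ζ c) (hη : ∀ c, ε (.inr c) = η c) (i) :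
  HEq (((fillG L E).res ε).j i) ((fillRes L E ζ η ε hζ hη).j i) := by
  obtain rfl : (fun c => ε (.inl c)) = ζ := funext hζ
  obtain rfl : (fun c => ε (.inr c)) = η := funext hη
  cases i <;> rfl

variable {R : Type} [CommRing R]

abbrev pairM (φ : TMat R L L') : ∀ i, TMat R (fillT L E i) (fillT L' E i)
  | false => φ
  | true => tone R E

/-- The map which is `φ` in the hole and the identity outside. -/
def fillR (E : Tangle (h ⊕ e) U) (φ : TMat R L L') : TMat R (E.fill L) (E.fill L') := fun ε ε' =>
  if hc : ∀ c, ε (.inr c) = ε' (.inr c) then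
    (extCob (fillRes L E _ (fun c => ε (.inr c)) ε (fun _ => rfl) fun _ => rfl)
      (fillRes L' E _ (fun c => ε (.inr c)) ε' (fun _ => rfl) fun c => (hc c).symm)).L
      (φ (fun c => ε (.inl c)) (fun c => ε' (.inl c)))
  else 0

theorem fillR_apply (φ : TMat R L L') {ζ : L.C → Bool} {ζ' : L'.C → Bool} {η : E.C → Bool}
  {ε : (E.fill L).C → Bool} {ε' : (E.fill L').C → Bool} (hζ : ∀ c, ε (.inl c) = ζ c)
  (hη : ∀ c, ε (.inr c) = η c) (hζ' : ∀ c, ε' (.inl c) = ζ' c) (hη' : ∀ c, ε' (.inr c) = η c) :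
  fillR E φ ε ε' = (extCob (fillRes L E ζ η ε hζ hη) (fillRes L' E ζ' η ε' hζ' hη')).L (φ ζ ζ') := by
  obtain rfl : (fun c => ε (.inl c)) = ζ := funext hζ
  obtain rfl : (fun c => ε (.inr c)) = η := funext hη
  obtain rfl : (fun c => ε' (.inl c)) = ζ' := funext hζ'
  exact dif_pos fun c => (hη' c).symm

theorem fillR_ne (φ : TMat R L L') {ε : (E.fill L).C → Bool} {ε' : (E.fill L').C → Bool}
  (h : ¬ ∀ c, ε (.inr c) = ε' (.inr c)) : fillR E φ ε ε' = 0 := dif_neg h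

variable [CharP R 2]

theorem phi_pairM (hL : L.Nice) (hL' : L'.Nice) (hE : E.Nice) (φ : TMat R L L') :
  phi (fillG L E) (fillG L' E) (pairM φ) = fillR E φ := by
  ext1 ε; ext1 ε'
  rw [phi_apply]
  by_cases hc : ∀ c, ε (.inr c) = ε' (.inr c)
  · rw [fillR_apply φ (fun _ => rfl) (fun _ => rfl) (fun _ => rfl) fun c => (hc c).symm,
      ← (extCob_eq _ _ (hL.mfd _) (hL'.mfd _) (hE.mfd _) _).2]
    refine phi_heq (fill_res_eq (fun _ => rfl) fun _ => rfl)
      (fill_res_eq (fun _ => rfl) fun c => (hc c).symm) _ _ _ _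
      (fill_j_heq (fun _ => rfl) fun _ => rfl) rfl
      (fill_j_heq (fun _ => rfl) fun c => (hc c).symm) rfl _ _ ?_
    have key : ∀ η η' : E.C → Bool, η' = η →
        HEq (tone R E η η') (((FlatIso.refl (E.res η)).cyl 0).L (1 : Set Empty → R)) := by
      rintro η _ rfl
      exact heq_of_eq (tone_self _)
    rintro (_ | _)
    · rfl
    · exact key _ _ (funext fun c => (hc c).symm)
  · rw [fillR_ne φ hc, ← tensorₘ_apply, (tensorₘ R _).map_coord_zero true, ← Cob.linear_apply,
      map_zero]
    exact dots_ne _ fun h => hc fun c => congrFun h c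

theorem fillR_closed (hL : L.Nice) (hL' : L'.Nice) (hE : E.Nice) {ξ : U → R} {φ : TMat R L L'}
  (hφ : Closed ξ φ) : Closed ξ (fillR E φ) := by
  rw [← phi_pairM hL hL' hE]
  refine phi_closed _ _ fillD_wf ?_ ?_ ?_
  · rintro (_ | _); exacts [hL, hE]
  · rintro (_ | _); exacts [hL', hE]
  · rintro (_ | _); exacts [hφ, Closed.one ξ hE]

theorem fill_nice (hL : L.Nice) (hE : E.Nice) : (E.fill L).Nice :=
  (fillG L E).nice fillD_wf (by rintro (_ | _); exacts [hL, hE])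

end fill

end

section
section outside

variable {o U : Type} [Finite o] {I : Type} [Finite I] {h E : I → Type} [∀ i, Finite (h i)]
  [∀ i, Finite (E i)] (D : ArcDiagram E o) (i₀ : I) (F : ∀ i, Tangle (h i ⊕ E i) U)

/-- The outsides `F i` of holes, glued along `D`; only the hole of `F i₀` is kept. -/
def outT : Tangle (h i₀ ⊕ o) U where
  S := (Σ i, (F i).S) ⊕ D.S
  C := Σ i, (F i).C
  P := (Σ i, (F i).P) ⊕ (Σ i, E i)
  cr c k := .inl ⟨c.1, (F c.1).cr c.2 k⟩
  pt := Sum.elim (fun p k => .inl ⟨p.1, (F p.1).pt p.2 k⟩)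
    (fun q => ![.inl ⟨q.1, (F q.1).bd (.inr q.2)⟩, .inr (D.bd (.inl q))])
  col := Sum.elim (fun p => (F p.1).col p.2) (fun _ => none)
  bd := Sum.elim (fun q => .inl ⟨i₀, (F i₀).bd (.inl q)⟩) (fun q => .inr (D.bd (.inr q)))

def outRes (η : ∀ i, (F i).C → Bool) :
  IsOutside D i₀ (fun i => (F i).res (η i)) ((outT D i₀ F).res fun c => η c.1 c.2) where
  j i := Tangle.cmpLift (fun s => (outT D i₀ F).cmp _ (.inl ⟨i, s⟩)) fun _ _ =>
    Tangle.Respects.eq (f := fun s => (outT D i₀ F).cmp (fun c => η c.1 c.2) (.inl ⟨i, s⟩)) ⟨fun p => ((outT D i₀ F).respects_cmp _).pt (.inl ⟨i, p⟩),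
      fun c => ((outT D i₀ F).respects_cmp fun c => η c.1 c.2).cr ⟨i, c⟩⟩
  s t := (outT D i₀ F).cmp _ (.inr t)
  glue i p := ((outT D i₀ F).respects_cmp _).pt (.inr ⟨i, p⟩)
  bd_inl _ := rfl
  bd_inr _ := rfl
  univ Z f g hfg := by
    have hf : ∀ i, (F i).Respects (η i) fun s => f i ((F i).cmp _ s) := fun i =>
      Tangle.respects_of fun _ _ hst => congrArg (f i) (Tangle.cmp_eq hst)
    have hr : (outT D i₀ F).Respects (fun c => η c.1 c.2)
        (Sum.elim (fun s => f s.1 ((F s.1).cmp _ s.2)) g) := by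
      refine ⟨?_, fun c => (hf c.1).cr c.2⟩
      rintro (p | p)
      exacts [(hf p.1).pt p.2, hfg p.1 p.2]
    exact ⟨Tangle.cmpLift _ fun _ _ => hr.eq, fun i => Tangle.cmp_ind fun _ => rfl, fun _ => rfl⟩
  ind p hj hs := Tangle.cmp_ind (by
    rintro (⟨i, s⟩ | t)
    exacts [hj i ((F i).cmp _ s), hs t])

variable {i₀} (L : ∀ i, Tangle (h i) U)

structure OnlyAt (i₀ : I) (L : ∀ i, Tangle (h i) U) : Prop where
  S : ∀ i, i ≠ i₀ → IsEmpty (L i).S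
  C : ∀ i, i ≠ i₀ → IsEmpty (L i).C
  P : ∀ i, i ≠ i₀ → IsEmpty (L i).P
  h : ∀ i, i ≠ i₀ → IsEmpty (h i)

variable {L} (hL : OnlyAt i₀ L)

def mixσ (i : I) : ((F i).fill (L i)).S → ((outT D i₀ F).fill (L i₀)).S :=
  Sum.elim (fun s => .inl (collapse hL.S i s)) fun s => .inr (.inl ⟨i, s⟩)

/-- The outside of the `i₀`-th hole, filled, is glued from the filled tangles. -/
def mixT : TGlue D (fun i => (F i).fill (L i)) ((outT D i₀ F).fill (L i₀)) where
  κ := (Equiv.sigmaSumDistrib _ _).trans (Equiv.sumCongr (collapseEquiv hL.C) (Equiv.refl _))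
  σ := mixσ D F hL
  τ t := .inr (.inr t)
  surj := by
    rintro (s | ⟨i, s⟩ | t)
    · refine .inl ⟨i₀, .inl s, ?_⟩
      change Tangle.SameStrand ((outT D i₀ F).fill (L i₀)) (.inl (collapse hL.S i₀ s)) (.inl s)
      rw [collapse_self]
      exact .refl _
    · exact .inl ⟨i, .inr s, .refl _⟩
    · exact .inr ⟨t, .refl _⟩
  link ε i := by
    have hr := ((outT D i₀ F).fill (L i₀)).respects_cmp ε
    refine ⟨?_, ?_⟩
    · rintro ((p | p) | q)
      · refine collapse_ind hL.P (P := fun i p => Tangle.cmp _ ε (mixσ D F hL i (.inl ((L i).pt p 0)))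
          = Tangle.cmp _ ε (mixσ D F hL i (.inl ((L i).pt p 1)))) (fun p => ?_) i p
        change Tangle.cmp _ ε (.inl (collapse hL.S i₀ _)) = Tangle.cmp _ ε (.inl (collapse hL.S i₀ _))
        rw [collapse_self, collapse_self]
        exact hr.pt (.inl (.inl p))
      · exact hr.pt (.inl (.inr (.inl ⟨i, p⟩)))
      · refine collapse_ind hL.h (P := fun i q => Tangle.cmp _ ε (mixσ D F hL i (.inl ((L i).bd q)))
          = Tangle.cmp _ ε (mixσ D F hL i (.inr ((F i).bd (.inl q))))) (fun q => ?_) i q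
        change Tangle.cmp _ ε (.inl (collapse hL.S i₀ _)) = _
        rw [collapse_self]
        exact hr.pt (.inr q)
    · rintro (c | c)
      · refine collapse_ind hL.C (P := fun i c => Tangle.Joined (ε (.inl (collapse hL.C i c)))
          fun k => Tangle.cmp _ ε (mixσ D F hL i (.inl ((L i).cr c k)))) (fun c => ?_) i c
        change Tangle.Joined _ fun k => Tangle.cmp _ ε (.inl (collapse hL.S i₀ _))
        simp only [collapse_self]
        exact hr.cr (.inl c)
      · exact hr.cr (.inr ⟨i, c⟩)
  glue ε i p := (((outT D i₀ F).fill (L i₀)).respects_cmp ε).pt (.inl (.inr (.inr ⟨i, p⟩)))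
  bd ε p := rfl
  univ ε Z f g hf hfg := by
    refine ⟨Sum.elim (fun s => f i₀ (.inl s)) (Sum.elim (fun s => f s.1 (.inr s.2)) g),
      ⟨?_, ?_⟩, ?_, fun _ => rfl⟩
    · rintro ((p | p | p) | q)
      · exact (hf i₀).pt (.inl (.inl p))
      · exact (hf p.1).pt (.inl (.inr p.2))
      · exact hfg p.1 p.2
      · exact (hf i₀).pt (.inr q)
    · rintro (c | c)
      · have h1 := (hf i₀).cr (.inl c)
        change Tangle.Joined (ε (.inl (collapse hL.C i₀ c))) _ at h1
        rw [collapse_self] at h1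
        exact h1
      · exact (hf c.1).cr (.inr c.2)
    · rintro i (s | s)
      · refine collapse_ind hL.S (P := fun i s => f i₀ (.inl (collapse hL.S i s)) = f i (.inl s))
          (fun s => ?_) i s
        rw [collapse_self]
      · rfl
  cr i c := .inl <| by
    rcases c with c | c
    · refine collapse_ind hL.C (P := fun i c => ∀ k, Tangle.SameStrand ((outT D i₀ F).fill (L i₀))
        (.inl (collapse hL.S i ((L i).cr c k))) (.inl ((L i₀).cr (collapse hL.C i c) k)))
        (fun c k => ?_) i c
      rw [collapse_self, collapse_self]
      exact .refl _
    · exact fun k => .refl _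
  pt ε M _ Fn := by
    let A := (outT D i₀ F).fill (L i₀)
    have e1 : ∀ i, ∑ᶠ p : ((F i).fill (L i)).P, (((F i).fill (L i)).col p).elim 0
          (Fn (A.cmp ε (mixσ D F hL i (((F i).fill (L i)).pt p 0))))
        = ∑ᶠ p : (L i).P, ((L i).col p).elim 0 (Fn (A.cmp ε (.inl (collapse hL.S i ((L i).pt p 0)))))
          + ∑ᶠ p : (F i).P, ((F i).col p).elim 0 (Fn (A.cmp ε (.inr (.inl ⟨i, (F i).pt p 0⟩)))) :=
      fun i => by
        refine (finsum_sum_type _).trans ?_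
        refine (congrArg₂ (· + ·) (finsum_sum_type _)
          (finsum_eq_zero_of_forall_eq_zero fun _ => rfl)).trans ?_
        exact add_zero _
    refine Eq.trans ?_ (finsum_congr e1).symm
    have e2 : ∑ᶠ i, ∑ᶠ p : (L i).P, ((L i).col p).elim 0
        (Fn (A.cmp ε (.inl (collapse hL.S i ((L i).pt p 0)))))
        = ∑ᶠ p : (L i₀).P, ((L i₀).col p).elim 0 (Fn (A.cmp ε (.inl ((L i₀).pt p 0)))) := by
      rw [finsum_eq_single _ i₀ fun i hi => ?_]
      · simp only [collapse_self]
      · have := hL.P i hi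
        exact finsum_of_isEmpty _
    rw [finsum_add_distrib (Set.toFinite _) (Set.toFinite _), e2,
      ← finsum_sigma_type fun p : Σ i, (F i).P => ((F p.1).col p.2).elim 0
        (Fn (A.cmp ε (.inr (.inl ⟨p.1, (F p.1).pt p.2 0⟩))))]
    refine (finsum_sum_type _).trans ?_
    refine (congrArg₂ (· + ·) (finsum_sum_type _)
          (finsum_eq_zero_of_forall_eq_zero fun _ => rfl)).trans ?_
    refine (add_zero _).trans (congrArg (_ + ·) ?_)
    refine (finsum_sum_type _).trans ?_
    exact (congrArg (_ + ·) (finsum_eq_zero_of_forall_eq_zero fun _ => rfl)).trans (add_zero _)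

variable {F} {L' : ∀ i, Tangle (h i) U} (hL' : OnlyAt i₀ L')
  {R : Type} [CommRing R] [CharP R 2]

theorem mixT_compat (ε : ((outT D i₀ F).fill (L i₀)).C → Bool) (η : ∀ i, (F i).C → Bool)
  (hη : ∀ i c, ε (.inr ⟨i, c⟩) = η i c) :
  (outRes D i₀ F η).Compat
    (fun i => fillRes (L i) (F i) (fun c => ε (.inl (collapse hL.C i c))) (η i)
      ((mixT D F hL).part ε i) (fun _ => rfl) (hη i)) ((mixT D F hL).res ε)
    (fillRes (L i₀) (outT D i₀ F) (fun c => ε (.inl (collapse hL.C i₀ c))) (fun c => η c.1 c.2) ε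
      (fun c => by rw [collapse_self]) fun c => hη c.1 c.2) where
  hole := Tangle.cmp_ind fun s => by
    change Tangle.cmp _ ε (.inl (collapse hL.S i₀ s)) = Tangle.cmp _ ε (.inl s)
    rw [collapse_self]
  part i := Tangle.cmp_ind fun s => rfl
  arc t := rfl

/-- Gluing maps that are the identity outside of the `i₀`-th hole. -/
theorem phi_fillR (hD : D.WF) (nF : ∀ i, (F i).Nice) (nL : ∀ i, (L i).Nice)
  (nL' : ∀ i, (L' i).Nice) (φ : ∀ i, TMat R (L i) (L' i))
  (hφ : ∀ i, i ≠ i₀ → φ i = fun _ _ => 1) :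
  phi (mixT D F hL) (mixT D F hL') (fun i => fillR (F i) (φ i))
    = fillR (outT D i₀ F) (φ i₀) := by
  ext1 ε; ext1 ε'
  rw [phi_apply]
  by_cases hc : ∀ c : Σ i, (F i).C, ε (.inr c) = ε' (.inr c)
  · have hη' : ∀ i c, ε' (.inr ⟨i, c⟩) = ε (.inr ⟨i, c⟩) := fun i c => (hc ⟨i, c⟩).symm
    have e1 : (fun i => fillR (F i) (φ i) ((mixT D F hL).part ε i) ((mixT D F hL').part ε' i))
        = fun i => (extCob (fillRes (L i) (F i) (fun c => ε (.inl (collapse hL.C i c)))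
            (fun c => ε (.inr ⟨i, c⟩)) ((mixT D F hL).part ε i) (fun _ => rfl) fun _ => rfl)
          (fillRes (L' i) (F i) (fun c => ε' (.inl (collapse hL'.C i c)))
            (fun c => ε (.inr ⟨i, c⟩)) ((mixT D F hL').part ε' i) (fun _ => rfl) (hη' i))).L
          (φ i (fun c => ε (.inl (collapse hL.C i c))) fun c => ε' (.inl (collapse hL'.C i c))) :=
      funext fun i => fillR_apply (φ i) (fun _ => rfl) (fun _ => rfl) (fun _ => rfl) (hη' i)
    rw [e1, phi_ext (outRes D i₀ F fun i c => ε (.inr ⟨i, c⟩)) hD (fun i => (nL i).mfd _)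
      (fun i => (nL' i).mfd _) (fun i => (nF i).mfd _) (fun i => (fill_nice (nL i) (nF i)).mfd _)
      (fun i => (fill_nice (nL' i) (nF i)).mfd _)
      (mixT_compat D hL ε (fun i c => ε (.inr ⟨i, c⟩)) fun _ _ => rfl)
      (mixT_compat D hL' ε' (fun i c => ε (.inr ⟨i, c⟩)) hη') hL.h ?_ _ ?_]
    · exact (fillR_apply (φ i₀) _ _ _ _).symm
    · intro i hi
      have h1 := hL.S i hi
      have h2 := hL'.S i hi
      exact ⟨Circ.ind (fun x => Tangle.cmp_ind (p := fun _ => False) h1.false x)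
        (fun x => Tangle.cmp_ind (p := fun _ => False) h2.false x)⟩
    · intro i hi
      rw [hφ i hi]
  · rw [fillR_ne _ hc]
    push Not at hc
    obtain ⟨⟨i, c⟩, hic⟩ := hc
    rw [← tensorₘ_apply, (tensorₘ R _).map_coord_zero i (fillR_ne _ fun h => hic (h c)),
      ← Cob.linear_apply, map_zero]

end outside

end

section
variable {e o h U : Type} [Finite e] [Finite o] [Finite h]

section cyl

variable {I : Type} [Finite I] {E : I → Type} [∀ i, Finite (E i)] {D : ArcDiagram E o}
  {a b : ∀ i, Flat (E i)} {A B : Flat o}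

theorem FlatIso.glue_compat (φ : ∀ i, FlatIso (a i) (b i)) (H : IsGlue D b B) (i p) :
  H.j i ((φ i).toEquiv ((a i).pt p)) = H.s (D.bd (.inl ⟨i, p⟩)) := by
  rw [(φ i).map_pt, H.glue]

/-- Identifications of the parts induce an identification of the glued tangles. -/
def FlatIso.glue (φ : ∀ i, FlatIso (a i) (b i)) (G : IsGlue D a A) (H : IsGlue D b B) :
  FlatIso A B where
  toFun := G.lift (fun i x => H.j i ((φ i).toEquiv x)) H.s (FlatIso.glue_compat φ H)
  invFun := H.lift (fun i x => G.j i ((φ i).toEquiv.symm x)) G.s fun i p => by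
    rw [← (φ i).map_pt, Equiv.symm_apply_apply, G.glue]
  left_inv := G.ind _ (fun i x => by simp) fun t => by simp
  right_inv := H.ind _ (fun i x => by simp) fun t => by simp
  map_pt p := (congrArg _ (G.bd p)).trans ((G.lift_s (fun i x => H.j i ((φ i).toEquiv x)) H.s
    (FlatIso.glue_compat φ H) _).trans (H.bd p).symm)

theorem FlatIso.glue_j (φ : ∀ i, FlatIso (a i) (b i)) (G : IsGlue D a A) (H : IsGlue D b B) (i x) :
  (FlatIso.glue φ G H).toEquiv (G.j i x) = H.j i ((φ i).toEquiv x) :=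
  G.lift_j (fun i x => H.j i ((φ i).toEquiv x)) H.s (FlatIso.glue_compat φ H) i x

theorem FlatIso.glue_s (φ : ∀ i, FlatIso (a i) (b i)) (G : IsGlue D a A) (H : IsGlue D b B) (t) :
  (FlatIso.glue φ G H).toEquiv (G.s t) = H.s t :=
  G.lift_s (fun i x => H.j i ((φ i).toEquiv x)) H.s (FlatIso.glue_compat φ H) t

variable {R : Type} [CommRing R] [CharP R 2]

theorem phi_cyl (hD : D.WF) (φ : ∀ i, FlatIso (a i) (b i)) (hb : ∀ i, (b i).Mfd)
  (G : IsGlue D a A) (H : IsGlue D b B) (ψ : FlatIso A B)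
  (hj : ∀ i x, ψ.toEquiv (G.j i x) = H.j i ((φ i).toEquiv x)) (hs : ∀ t, ψ.toEquiv (G.s t) = H.s t) :
  (phiCob G H).L (Cob.tensor fun i => ((φ i).cyl 0).L (1 : Set Empty → R)) = (ψ.cyl 0).L 1 := by
  have hg : ∀ i p, H.j i ((φ i).proj (Circ.l ((a i).pt p))) = H.s (D.bd (.inl ⟨i, p⟩)) :=
    fun i p => by rw [(φ i).proj_l, (φ i).map_pt, H.glue]
  refine (phi_surface_of G H hD (fun i => (φ i).symm.mfd (hb i)) hb
    (fun i => (φ i).cyl_good (hb i) 0) (ψ.cyl 0) H.j H.s hg (fun Z f g h => ?_) H.ind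
    (fun i x => ?_) (fun t => ?_) (fun i x => ?_) (fun t => ?_) ?_ ?_).2
  · refine H.univ Z f g fun i p => ?_
    rw [← h i p, ← (φ i).map_pt]
    exact congrArg (f i) ((φ i).proj_l _).symm
  · exact (ψ.proj_l _).trans ((hj i x).trans (congrArg (H.j i) ((φ i).proj_l x).symm))
  · exact (ψ.proj_l _).trans (hs t)
  · exact (ψ.proj_r _).trans (congrArg (H.j i) ((φ i).proj_r x).symm)
  · exact ψ.proj_r _
  · have e1 : (fun p : Σ i, E i => H.j p.1 ((b p.1).pt p.2)) = fun q => H.s (D.bd (.inl q)) :=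
      funext fun q => H.glue q.1 q.2
    have e2 : B.pt = fun p => H.s (D.bd (.inr p)) := funext H.bd
    change cnt B.pt + _ = _
    simp only [e2, Pi.add_apply, Pi.smul_apply, push_fun_add, push_fun_nsmul]
    rw [cnt_fiber fun i => (b i).pt, cnt_fiber fun i => (φ i).proj]
    simp only [e1]
    abel
  · exact (map_zero (push fun k : Σ i, (b i).Comp => H.j k.1 k.2)).symm

end cyl

/-! ## Frozen cobordisms -/

section trace

theorem trace_cyl {a b : Flat e} (ha : a.Mfd) (φ : FlatIso a b) (r : a.S → b.S → Prop)
  (h1 : ∀ s t, r s t → φ.toEquiv (Quot.mk _ s) = Quot.mk _ t)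
  (h2 : ∀ x : a.Comp, ∃ s t, r s t ∧ Quot.mk _ s = x) :
  (trace a b r ∅ ∅).toHom = (φ.cyl 0).L (1 : Set Empty → ZMod 2) := by
  let f : Quot (traceLink a b r) → b.Comp :=
    Quot.lift (Sum.elim (fun s => φ.toEquiv (Quot.mk _ s)) (Quot.mk _)) (by
      rintro _ _ (h | h | h)
      exacts [congrArg φ.toEquiv (Quot.sound h), Quot.sound h, h1 _ _ h])
  let g : b.Comp → Quot (traceLink a b r) := Quot.map Sum.inr fun _ _ h => .right h
  have hl : ∀ s : a.S, g (φ.toEquiv (Quot.mk _ s)) = Quot.mk _ (.inl s) := fun s => by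
    obtain ⟨s', t, hst, hs⟩ := h2 (Quot.mk _ s)
    rw [← hs, h1 _ _ hst]
    have e1 : (Quot.map Sum.inl fun _ _ h => .left h : a.Comp → Quot (traceLink a b r)) (Quot.mk _ s')
      = (Quot.map Sum.inl fun _ _ h => .left h : a.Comp → Quot (traceLink a b r)) (Quot.mk _ s) :=
      congrArg _ hs
    exact (Quot.sound (.rel hst)).symm.trans e1
  let ψ : Quot (traceLink a b r) ≃ b.Comp :=
    ⟨f, g, by rintro ⟨s | s⟩; exacts [hl s, rfl], by rintro ⟨s⟩; rfl⟩
  ext V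
  rw [Cob.L_one]
  refine Surface.toHom_apply (trace a b r ∅ ∅) ψ φ.proj ?_ (φ.cyl 0).X 0 (fun k => ?_)
    (fun k => ?_) V
  · rintro (s | s)
    exacts [(φ.proj_l (Quot.mk _ s)).symm, (φ.proj_r (Quot.mk _ s)).symm]
  · have e1 := ha.two_mul_arcs φ.toEquiv (ψ k)
    have e2 : (fun p => φ.toEquiv (a.pt p)) = b.pt := funext φ.map_pt
    have e3 : ∀ q : a.Comp, (∃ s, Quot.mk _ s = q ∧
        (Quot.mk _ (Sum.inl s) : Quot (traceLink a b r)) = k) ↔ φ.toEquiv q = ψ k := fun q => by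
      refine (quot_exists_and (fun s => (Quot.mk _ (Sum.inl s) : Quot (traceLink a b r)))
        (Quot.map Sum.inl fun _ _ h => .left h) (fun _ => rfl) q k).trans ?_
      refine ψ.injective.eq_iff.symm.trans ?_
      obtain ⟨s, rfl⟩ := Quot.mk_surjective q
      rfl
    change (cnt b.pt + 2 • cnt φ.proj) (ψ k) = _
    rw [Pi.add_apply, Pi.smul_apply, ← e2, ← e1]
    simp only [trace, e3]
    simp
    rfl
  · simp [trace]

variable (T : Tangle e U) (ε ε' : T.C → Bool)

theorem trace_eq (hT : (T.res ε).Mfd) (bands δ : Set T.S) :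
  (trace (T.res ε) (T.res ε') Eq bands δ).toHom
    = (trCob T ε ε' (fun s => ind bands s) (ind δ)).L (1 : Set Empty → ZMod 2) := by
  let f : Quot (traceLink (T.res ε) (T.res ε') Eq) → TrK T ε ε' :=
    Quot.lift (Sum.elim TrK.mk TrK.mk) (by
      rintro _ _ (h | h | h)
      exacts [Quot.sound (.inl h), Quot.sound (.inr h), congrArg TrK.mk h])
  let g : TrK T ε ε' → Quot (traceLink (T.res ε) (T.res ε') Eq) :=
    Quot.lift (fun s => Quot.mk _ (.inl s)) (by
      rintro s t (h | h)
      · exact Quot.sound (.left h)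
      · exact (Quot.sound (.rel rfl)).trans ((Quot.sound (.right h)).trans (Quot.sound (.rel rfl)).symm))
  let ψ : Quot (traceLink (T.res ε) (T.res ε') Eq) ≃ TrK T ε ε' :=
    ⟨f, g, by rintro ⟨s | s⟩; exacts [rfl, Quot.sound (.rel rfl)], by rintro ⟨s⟩; rfl⟩
  have hψ : ∀ s : T.S, ψ (Quot.mk _ (.inl s)) = TrK.mk s := fun _ => rfl
  have e4 : ∀ k, (fun s : T.S => (Quot.mk _ (Sum.inl s) : Quot (traceLink (T.res ε) (T.res ε') Eq)) = k)
      = fun s => (TrK.mk s : TrK T ε ε') = ψ k := fun k => by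
    ext s
    rw [← hψ, ψ.injective.eq_iff]
  ext V
  rw [Cob.L_one]
  refine Surface.toHom_apply _ ψ TrK.out ?_ (trCob T ε ε' (fun s => ind bands s) (ind δ)).X
    (push TrK.mk (ind δ)) (fun k => ?_) (fun k => ?_) V
  · rintro (s | s)
    exacts [(TrK.out_l (T.cmp ε s)).symm, (TrK.out_r (T.cmp ε' s)).symm]
  · have e1 := hT.two_mul_arcs (TrK.l : _ → TrK T ε ε') (ψ k)
    have e3 : ∀ q : (T.res ε).Comp, (∃ s, Quot.mk _ s = q ∧
        (Quot.mk _ (Sum.inl s) : Quot (traceLink (T.res ε) (T.res ε') Eq)) = k)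
          ↔ TrK.l q = ψ k := fun q => by
      refine (quot_exists_and
        (fun s => (Quot.mk _ (Sum.inl s) : Quot (traceLink (T.res ε) (T.res ε') Eq)))
        (Quot.map Sum.inl fun _ _ h => .left h) (fun _ => rfl) q k).trans ?_
      refine ψ.injective.eq_iff.symm.trans ?_
      obtain ⟨s, rfl⟩ := Quot.mk_surjective q
      rfl
    have e5 : ((push TrK.mk (ind bands) (ψ k) : ℕ) : ℤ)
        = push (TrK.mk : T.S → TrK T ε ε') (fun s => (ind bands s : ℤ)) (ψ k) := by
      rw [push_eq, push_eq, Nat.cast_sum]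
      exact sum_congr rfl fun s _ => by split_ifs <;> simp
    change (cnt (fun p => (TrK.l ((T.res ε).pt p) : TrK T ε ε')) - 2 • push TrK.mk _
      + 2 • cnt TrK.out : TrK T ε ε' → ℤ) (ψ k) = _
    simp only [Pi.add_apply, Pi.sub_apply, Pi.smul_apply]
    rw [← e1, ← e5, push_ind]
    have e6 := congrFun (e4 k)
    simp only [trace, e3]
    change _ = 2 * ((_ : ℤ) - (Set.ncard {s : T.S | s ∈ bands ∧
      (Quot.mk _ (Sum.inl s) : Quot (traceLink (T.res ε) (T.res ε') Eq)) = k} : ℤ)) + _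
    simp only [e6, nsmul_eq_mul]
    push_cast
    rw [mul_sub]
    rfl
  · rw [push_ind]
    have e6 := congrFun (e4 k)
    change Set.ncard {s : T.S | s ∈ δ ∧
      (Quot.mk _ (Sum.inl s) : Quot (traceLink (T.res ε) (T.res ε') Eq)) = k} = _
    simp only [e6]
    rfl

end trace

section iso

variable (e) in
abbrev idD : ArcDiagram (fun _ : Unit => e) e where
  S := e
  bd := Sum.elim (fun p => p.2) id

theorem idD_wf : (idD e).WF := by
  intro p
  right
  have : (idD e).bd ⁻¹' {p} = {.inl ⟨(), p⟩, .inr p} := by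
    ext x
    rcases x with ⟨⟨⟩, x⟩ | x <;> simp
  rw [this, Set.ncard_pair]
  simp

abbrev TIso (T T' : Tangle e U) : Type := TGlue (idD e) (fun _ => T) T'

theorem finsum_unit {M : Type} [AddCommMonoid M] (f : Unit → M) : ∑ᶠ i, f i = f () := by
  rw [fsum_eq, Fintype.sum_unique]

namespace TIso

def refl (T : Tangle e U) : TIso T T where
  κ := ⟨fun c => c.2, fun c => ⟨(), c⟩, fun _ => rfl, fun _ => rfl⟩
  σ _ s := s
  τ := T.bd
  surj s := .inl ⟨(), s, .refl _⟩
  link ε _ := T.respects_cmp ε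
  glue _ _ _ := rfl
  bd _ _ := rfl
  univ _ _ f _ hf h := ⟨f (), hf (), fun _ _ => rfl, fun t => h () t⟩
  cr _ _ := .inl fun _ => .refl _
  pt ε _ _ F := (finsum_unit fun _ => ∑ᶠ p, (T.col p).elim 0 (F (T.cmp ε (T.pt p 0)))).symm

variable {T T' : Tangle e U} (R : Type) [CommRing R] [CharP R 2] (G : TIso T T')

def iso {ε : T.C → Bool} {ε' : T'.C → Bool} (hε : ∀ c, ε' (G.κ ⟨(), c⟩) = ε c) :
  FlatIso (T.res ε) (T'.res ε') :=
  FlatIso.glue (D := idD e) (fun _ => FlatIso.refl (T.res ε)) ((refl T).res ε)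
    ((funext hε : (fun c => ε' (G.κ ⟨(), c⟩)) = ε) ▸ G.res ε')

theorem iso_cmp {ε : T.C → Bool} {ε' : T'.C → Bool} (hε : ∀ c, ε' (G.κ ⟨(), c⟩) = ε c) (s : T.S) :
  (G.iso hε).toEquiv (T.cmp ε s) = T'.cmp ε' (G.σ () s) := by
  obtain rfl : (fun c => ε' (G.κ ⟨(), c⟩)) = ε := funext hε
  exact FlatIso.glue_j (D := idD e) (fun _ => FlatIso.refl (T.res fun c => ε' (G.κ ⟨(), c⟩)))
    ((refl T).res fun c => ε' (G.κ ⟨(), c⟩)) (G.res ε') ()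
    (T.cmp _ s)

/-- The map of cubes of resolutions induced by an identification. -/
def cyl : TMat R T T' := phi (refl T) G fun _ => tone R T

theorem cyl_closed (hT : T.Nice) {ξ : U → R} : Closed ξ (cyl R G) :=
  phi_closed _ _ idD_wf (fun _ => hT) (fun _ => hT) fun _ => Closed.one ξ hT

theorem cyl_eq (hT : T.Nice) {ε : T.C → Bool} {ε' : T'.C → Bool}
  (hε : ∀ c, ε' (G.κ ⟨(), c⟩) = ε c) : cyl R G ε ε' = ((G.iso hε).cyl 0).L 1 := by
  obtain rfl : (fun c => ε' (G.κ ⟨(), c⟩)) = ε := funext hε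
  rw [cyl, phi_apply]
  refine Eq.trans ?_ (phi_cyl idD_wf (fun _ => FlatIso.refl (T.res fun c => ε' (G.κ ⟨(), c⟩)))
    (fun _ => hT.mfd _) ((refl T).res fun c => ε' (G.κ ⟨(), c⟩)) (G.res ε') (G.iso fun _ => rfl) (fun _ => Tangle.cmp_ind fun s => ?_) fun t => ?_)
  · congr 2
    ext1 i
    exact tone_self (T := T) _
  · exact G.iso_cmp (fun _ => rfl) s
  · exact FlatIso.glue_s (D := idD e) (fun _ => FlatIso.refl (T.res fun c => ε' (G.κ ⟨(), c⟩)))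
      ((refl T).res fun c => ε' (G.κ ⟨(), c⟩)) (G.res ε') t

theorem cyl_ne {ε : T.C → Bool} {ε' : T'.C → Bool} (hε : ¬ ∀ c, ε' (G.κ ⟨(), c⟩) = ε c) :
  cyl R G ε ε' = 0 := by
  rw [cyl, phi_apply, ← tensorₘ_apply, (tensorₘ R _).map_coord_zero (), ← Cob.linear_apply, map_zero]
  exact dots_ne _ fun h => hε fun c => (congrFun h c).symm

end TIso

end iso

end

section
variable {e o h U : Type} [Finite e] [Finite o] [Finite h]

theorem Tangle.Joined.rotate {Z : Type} {b : Bool} {v : Fin 4 → Z}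
  (h : Tangle.Joined b fun k => v (k + 2)) : Tangle.Joined b v := by
  cases b
  · exact ⟨h.2, h.1⟩
  · exact ⟨h.2, h.1⟩

theorem Tangle.Joined.rotate' {Z : Type} {b : Bool} {v : Fin 4 → Z}
  (h : Tangle.Joined b v) : Tangle.Joined b fun k => v (k + 2) := by
  cases b
  · exact ⟨h.2, h.1⟩
  · exact ⟨h.2, h.1⟩

theorem finsum_col {P M : Type} [AddCommMonoid M] (col : P → Option U) (F : P → U → M) :
  ∑ᶠ p, (col p).elim 0 (F p) = ∑ᶠ p : {p // col p ≠ none}, (col p).elim 0 (F p) := by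
  refine Eq.trans ?_ (finsum_set_coe_eq_finsum_mem (f := fun p => (col p).elim 0 (F p))
    {p | col p ≠ none}).symm
  refine finsum_congr fun p => ?_
  by_cases h : col p = none
  · simp [h]
  · simp [h]

namespace Corr

variable {T T' : Tangle e U} {f : Corr T T'}

theorem Strand.right {s : T.S} {s' t' : T'.S} (h : f.Strand s s') (h' : T'.SameStrand s' t') :
  f.Strand s t' := by
  obtain ⟨a, b, h1, h2, h3⟩ := h
  exact ⟨a, b, h1, h2, h3.trans _ _ _ h'⟩

namespace IsIso

variable (hf : f.IsIso)
include hf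

theorem strand_iff {s t : T.S} {s' t' : T'.S} (hs : f.Strand s s') (ht : f.Strand t t') :
  T.SameStrand s t ↔ T'.SameStrand s' t' := by
  obtain ⟨a, b, h1, h2, h3⟩ := hs
  obtain ⟨c, d, h4, h5, h6⟩ := ht
  have := hf.s_iff _ _ _ _ h2 h5
  constructor
  · intro h
    exact (h3.symm.trans _ _ _ (this.1 ((h1.symm.trans _ _ _ h).trans _ _ _ h4))).trans _ _ _ h6
  · intro h
    exact (h1.trans _ _ _ (this.2 ((h3.trans _ _ _ h).trans _ _ _ h6.symm))).trans _ _ _ h4.symm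

/-- Labels which agree along the identification respect the same resolutions. -/
theorem respects {Z : Type} {g : T.S → Z} {g' : T'.S → Z} (hg : ∀ s s', f.Strand s s' → g s = g' s')
  {ε : T.C → Bool} {ε' : T'.C → Bool} (hε : ∀ c c', f.c c c' → ε c = ε' c') :
  T.Respects ε g ↔ T'.Respects ε' g' := by
  obtain ⟨σ, hσ⟩ := hf.pt
  constructor
  · refine fun h => ⟨fun p => ?_, fun c' => ?_⟩
    · by_cases hp : T'.col p = none
      · obtain ⟨s, hs⟩ := hf.s_right (T'.pt p 0)
        rw [← hg _ _ hs, hg _ _ (hs.right (.rel _ _ ⟨p, hp⟩))]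
      · obtain ⟨q, hq⟩ := σ.surjective ⟨p, hp⟩
        obtain rfl : (σ q).1 = p := congrArg Subtype.val hq
        rcases (hσ q).2 with h' | h'
        · rw [← hg _ _ (h' 0), ← hg _ _ (h' 1), h.pt]
        · exact (hg _ _ (h' 1)).symm.trans ((h.pt _).symm.trans (hg _ _ (h' 0)))
    · obtain ⟨c, hc, -⟩ := hf.cr_right c'
      rw [← hε _ _ hc]
      rcases hf.cr _ _ hc with h' | h'
      · simpa only [hg _ _ (h' _)] using h.cr c
      · refine Tangle.Joined.rotate ?_
        simpa only [hg _ _ (h' _)] using h.cr c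
  · refine fun h => ⟨fun p => ?_, fun c => ?_⟩
    · by_cases hp : T.col p = none
      · obtain ⟨s, hs⟩ := hf.s_left (T.pt p 0)
        obtain ⟨t, ht⟩ := hf.s_left (T.pt p 1)
        rw [hg _ _ hs, hg _ _ ht]
        exact h.strand ((hf.strand_iff hs ht).1 (.rel _ _ ⟨p, hp⟩))
      · rcases (hσ ⟨p, hp⟩).2 with h' | h'
        · rw [hg _ _ (h' 0), hg _ _ (h' 1), h.pt]
        · rw [hg _ _ (h' 1), hg _ _ (h' 0)]
          exact (h.pt _).symm
    · obtain ⟨c', hc, -⟩ := hf.cr_left c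
      rw [hε _ _ hc]
      rcases hf.cr _ _ hc with h' | h'
      · simpa only [hg _ _ (h' _)] using h.cr c'
      · simp only [hg _ _ (h' _)]
        exact (h.cr c').rotate'

def crossing : T.C ≃ T'.C where
  toFun c := (hf.cr_left c).choose
  invFun c := (hf.cr_right c).choose
  left_inv c := ((hf.cr_right _).unique (hf.cr_right _).choose_spec.1
    (hf.cr_left c).choose_spec.1)
  right_inv c := ((hf.cr_left _).unique (hf.cr_left _).choose_spec.1
    (hf.cr_right c).choose_spec.1)

theorem crossing_spec (c) : f.c c (hf.crossing c) := (hf.cr_left c).choose_spec.1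

theorem crossing_eq {c c'} (h : f.c c c') : hf.crossing c = c' :=
  (hf.cr_left c).unique (hf.crossing_spec c) h

def seg (s : T.S) : T'.S := (hf.s_left s).choose

theorem seg_spec (s) : f.Strand s (hf.seg s) := (hf.s_left s).choose_spec

theorem seg_strand {s s'} (h : f.Strand s s') : T'.SameStrand (hf.seg s) s' :=
  (hf.strand_iff (hf.seg_spec s) h).1 (.refl _)

theorem cmp_seg {s s'} (h : f.Strand s s') (ε) : T'.cmp ε (hf.seg s) = T'.cmp ε s' :=
  (T'.respects_cmp ε).strand (hf.seg_strand h)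

/-- A planar isotopy is an identification. -/
def toTIso : TIso T T' where
  κ := ⟨fun c => hf.crossing c.2, fun c => ⟨(), hf.crossing.symm c⟩, fun _ => by simp,
    fun _ => by simp⟩
  σ _ := hf.seg
  τ := T'.bd
  surj s := by
    obtain ⟨t, ht⟩ := hf.s_right s
    exact .inl ⟨(), t, hf.seg_strand ht⟩
  link ε _ := (hf.respects (fun s s' h => hf.cmp_seg h ε) fun _ _ h =>
    congrArg ε (hf.crossing_eq h)).2 (T'.respects_cmp ε)
  glue ε _ p := hf.cmp_seg (hf.bd p) ε
  bd _ _ := rfl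
  univ ε Z g k hg h := by
    have h1 : ∀ s s', f.Strand s s' → g () s = g () (hf.s_right s').choose := fun s s' hs =>
      (hg ()).strand ((hf.strand_iff hs (hf.s_right s').choose_spec).2 (.refl _))
    exact ⟨fun s' => g () (hf.s_right s').choose,
      (hf.respects h1 fun c c' h => congrArg ε (hf.crossing_eq h)).1 (hg ()),
      fun _ s => (h1 _ _ (hf.seg_spec s)).symm, fun t => (h1 _ _ (hf.bd t)).symm.trans (h () t)⟩
  cr _ c := by
    rcases hf.cr _ _ (hf.crossing_spec c) with h | h
    · exact .inl fun k => hf.seg_strand (h k)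
    · exact .inr fun k => hf.seg_strand (h k)
  pt ε M _ F := by
    rw [finsum_unit fun _ => _]
    obtain ⟨σ, hσ⟩ := hf.pt
    rw [finsum_col T'.col, finsum_col T.col, ← finsum_comp_equiv σ]
    refine finsum_congr fun p => ?_
    rw [(hσ p).1]
    rcases (hσ p).2 with h | h
    · rw [hf.cmp_seg (h 0)]
    · rw [hf.cmp_seg (h 0), (T'.respects_cmp ε).pt]
      rfl

theorem exists_cmp (s : T.S) (ε) : ∃ t t', f.s t t' ∧ T.cmp ε t = T.cmp ε s := by
  obtain ⟨s', t, t', h1, h2, h3⟩ := hf.s_left s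
  exact ⟨t, t', h2, (T.respects_cmp ε).strand h1.symm⟩

theorem cmp_iso {ε : T.C → Bool} {ε' : T'.C → Bool}
  (hε : ∀ c, ε' (hf.toTIso.κ ⟨(), c⟩) = ε c) {s s'} (h : f.s s s') :
  (hf.toTIso.iso hε).toEquiv (T.cmp ε s) = T'.cmp ε' s' :=
  (hf.toTIso.iso_cmp hε s).trans (hf.cmp_seg ⟨s, s', .refl _, h, .refl _⟩ ε')

theorem forall_crossing (ε : T.C → Bool) (ε' : T'.C → Bool) :
  (∀ c c', f.c c c' → ε c = ε' c') ↔ ∀ c, ε' (hf.crossing c) = ε c :=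
  ⟨fun h c => (h _ _ (hf.crossing_spec c)).symm,
    fun h c _ hc => (h c).symm.trans (congrArg ε' (hf.crossing_eq hc))⟩

attribute [-instance] fintypeOfFinite in
theorem cyl_eq (hT : T.Nice) : f.cyl = hf.toTIso.cyl (ZMod 2) := by
  funext (ε : T.C → Bool) (ε' : T'.C → Bool)
  change (if ∀ c c', f.c c c' → ε c = ε' c'
    then (trace (T.res ε) (T'.res ε') f.s ∅ ∅).toHom else 0) = _
  split_ifs with h
  · rw [hf.forall_crossing] at h
    rw [hf.toTIso.cyl_eq _ hT h]
    refine trace_cyl (hT.mfd ε) _ _ (fun s t => hf.cmp_iso h) (Tangle.cmp_ind fun s => ?_)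
    obtain ⟨t, t', h1, h2⟩ := hf.exists_cmp s ε
    exact ⟨t, t', h1, h2⟩
  · rw [hf.forall_crossing] at h
    exact (hf.toTIso.cyl_ne _ h).symm

end IsIso

end Corr

end

section
variable {o U : Type} [Finite o] {I : Type} [Finite I] {E : I → Type} [∀ i, Finite (E i)]
  {D : ArcDiagram E o}

section

variable {T T' T₂ T₂' : ∀ i, Tangle (E i) U} {A A' : Tangle o U} {R : Type} [CommRing R] [CharP R 2]

theorem phi_eq_zero (G : TGlue D T A) (G₁ : TGlue D T' A') (M : ∀ i, TMat R (T i) (T' i))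
  {ε ε'} (i : I) (h : M i (G.part ε i) (G₁.part ε' i) = 0) : phi G G₁ M ε ε' = 0 := by
  rw [phi_apply, ← tensorₘ_apply, (tensorₘ R _).map_coord_zero i h, ← Cob.linear_apply, map_zero]

attribute [-instance] fintypeOfFinite in
theorem phi_corr (hD : D.WF) (G : TGlue D T A) (H : TGlue D T' A') (hT : ∀ i, (T i).Nice)
  (hT' : ∀ i, (T' i).Nice) (hA : A.Nice) {f : ∀ i, Corr (T i) (T' i)} (hf : ∀ i, (f i).IsIso)
  (g : Corr A A') (hc : ∀ x y, g.c x y ↔ ∃ i c c', (f i).c c c' ∧ x = G.κ ⟨i, c⟩ ∧ y = H.κ ⟨i, c'⟩)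
  (hs : ∀ x y, g.s x y ↔ (∃ i s s', (f i).s s s' ∧ x = G.σ i s ∧ y = H.σ i s') ∨
    ∃ t, x = G.τ t ∧ y = H.τ t) :
  g.cyl = phi (R := ZMod 2) G H (fun i => (f i).cyl) := by
  funext (ε : A.C → Bool) (ε' : A'.C → Bool)
  change (if ∀ c c', g.c c c' → ε c = ε' c'
    then (trace (A.res ε) (A'.res ε') g.s ∅ ∅).toHom else 0) = _
  split_ifs with h
  · have hε : ∀ i c, H.part ε' i ((hf i).crossing c) = G.part ε i c := fun i c =>
      (h _ _ ((hc _ _).2 ⟨i, c, _, (hf i).crossing_spec c, rfl, rfl⟩)).symm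
    let φ : ∀ i, FlatIso ((T i).res (G.part ε i)) ((T' i).res (H.part ε' i)) :=
      fun i => (hf i).toTIso.iso (hε i)
    have e1 : ∀ i, (f i).cyl (G.part ε i) (H.part ε' i) = ((φ i).cyl 0).L 1 := fun i => by
      rw [(hf i).cyl_eq (hT i)]
      exact (hf i).toTIso.cyl_eq _ (hT i) (hε i)
    have e2 : phi (R := ZMod 2) G H (fun i => (f i).cyl) ε ε'
        = (phiCob (G.res ε) (H.res ε')).L (Cob.tensor fun i => ((φ i).cyl 0).L 1) :=
      (phi_apply _ _ _ _ _).trans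
        (congrArg (fun w => (phiCob (G.res ε) (H.res ε')).L (Cob.tensor w)) (funext e1))
    refine Eq.trans ?_ e2.symm
    let ψ := FlatIso.glue φ (G.res ε) (H.res ε')
    have h1 : ∀ i s s', (f i).s s s' →
        ψ.toEquiv (A.cmp ε (G.σ i s)) = A'.cmp ε' (H.σ i s') := fun i s s' hss =>
      (FlatIso.glue_j φ (G.res ε) (H.res ε') i ((T i).cmp _ s)).trans
        (congrArg ((H.res ε').j i) ((hf i).cmp_iso (hε i) hss))
    refine (trace_cyl (hA.mfd ε) ψ g.s (fun x y hxy => ?_) ?_).trans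
      (phi_cyl hD φ (fun i => (hT' i).mfd _) (G.res ε) (H.res ε') ψ
      (FlatIso.glue_j φ (G.res ε) (H.res ε')) (FlatIso.glue_s φ (G.res ε) (H.res ε'))).symm
    · obtain ⟨i, s, s', hss, rfl, rfl⟩ | ⟨t, rfl, rfl⟩ := (hs x y).1 hxy
      · exact h1 i s s' hss
      · exact FlatIso.glue_s φ (G.res ε) (H.res ε') t
    · refine (G.res ε).ind _ (fun i => Tangle.cmp_ind fun s => ?_) fun t =>
        ⟨G.τ t, H.τ t, (hs _ _).2 (.inr ⟨t, rfl, rfl⟩), rfl⟩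
      obtain ⟨t, t', h2, h3⟩ := (hf i).exists_cmp s (G.part ε i)
      exact ⟨G.σ i t, H.σ i t', (hs _ _).2 (.inl ⟨i, t, t', h2, rfl, rfl⟩),
        congrArg ((G.res ε).j i) h3⟩
  · push Not at h
    obtain ⟨x, y, hxy, hne⟩ := h
    obtain ⟨i, c, c', hcc, rfl, rfl⟩ := (hc _ _).1 hxy
    exact (phi_eq_zero G H _ i (if_neg fun h => hne (h c c' hcc))).symm

end

section step

variable {T T' : ∀ i, Tangle (E i) U} (i₀ : I) (m : ∀ i, Step (T i) (T' i))
  (iso : ∀ i, i ≠ i₀ → (m i).kind = .iso)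

include iso

theorem onlyAt_src : OnlyAt i₀ fun i => (m i).kind.src where
  S i hi := by rw [iso i hi]; exact Fin.isEmpty
  C i hi := by rw [iso i hi]; exact Fin.isEmpty
  P i hi := by rw [iso i hi]; exact Fin.isEmpty
  h i hi := by rw [iso i hi]; exact Fin.isEmpty

theorem onlyAt_tgt : OnlyAt i₀ fun i => (m i).kind.tgt where
  S i hi := by rw [iso i hi]; exact Fin.isEmpty
  C i hi := by rw [iso i hi]; exact Fin.isEmpty
  P i hi := by rw [iso i hi]; exact Fin.isEmpty
  h i hi := by rw [iso i hi]; exact Fin.isEmpty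

theorem glueStep_before (hD : D.WF) (hm : ∀ i, (m i).IsElementary) (hT : ∀ i, (T i).Nice)
  (hT' : ∀ i, ((m i).E.fill (m i).kind.src).Nice) :
  (D.glueStep i₀ m).before.cyl = phi (R := ZMod 2) (glueT D T)
    (mixT D (fun i => (m i).E) (onlyAt_src i₀ m iso)) (fun i => (m i).before.cyl) := by
  have hL := onlyAt_src i₀ m iso
  refine phi_corr hD _ _ hT hT' ((glueT D T).nice hD hT) (fun i => (hm i).before) _
    (fun x y => ⟨?_, ?_⟩) fun x y => ⟨?_, ?_⟩
  · rintro (h | h)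
    · exact ⟨i₀, _, _, h, rfl, congrArg Sum.inl (collapse_self hL.C _).symm⟩
    · exact ⟨_, _, _, h, rfl, rfl⟩
  · rintro ⟨i, c, c' | c', h, rfl, rfl⟩
    · refine collapse_ind hL.C (P := fun i c' => ∀ c, (m i).before.c c (.inl c') →
        ArcDiagram.beforeC D i₀ m ⟨i, c⟩ (.inl (collapse hL.C i c'))) (fun c' c h => ?_) i c' c h
      rw [collapse_self]
      exact .hole h
    · exact .part h
  · rintro (h | h | t)
    · exact .inl ⟨i₀, _, _, h, rfl, congrArg Sum.inl (collapse_self hL.S _).symm⟩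
    · exact .inl ⟨_, _, _, h, rfl, rfl⟩
    · exact .inr ⟨t, rfl, rfl⟩
  · rintro (⟨i, c, c' | c', h, rfl, rfl⟩ | ⟨t, rfl, rfl⟩)
    · refine collapse_ind hL.S (P := fun i c' => ∀ c, (m i).before.s c (.inl c') →
        ArcDiagram.beforeS D i₀ m (.inl ⟨i, c⟩) (.inl (collapse hL.S i c'))) (fun c' c h => ?_) i c' c h
      rw [collapse_self]
      exact .hole h
    · exact .part h
    · exact .arc t

theorem glueStep_after (hD : D.WF) (hm : ∀ i, (m i).IsElementary)
  (hT : ∀ i, ((m i).E.fill (m i).kind.tgt).Nice) (hT' : ∀ i, (T' i).Nice) :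
  (D.glueStep i₀ m).after.cyl = phi (R := ZMod 2)
    (mixT D (fun i => (m i).E) (onlyAt_tgt i₀ m iso)) (glueT D T') (fun i => (m i).after.cyl) := by
  have hL := onlyAt_tgt i₀ m iso
  refine phi_corr hD _ _ hT hT' ((mixT D (fun i => (m i).E) hL).nice hD hT) (fun i => (hm i).after) _
    (fun x y => ⟨?_, ?_⟩) fun x y => ⟨?_, ?_⟩
  · rintro (h | h)
    · exact ⟨i₀, _, _, h, congrArg Sum.inl (collapse_self hL.C _).symm, rfl⟩
    · exact ⟨_, _, _, h, rfl, rfl⟩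
  · rintro ⟨i, c | c, c', h, rfl, rfl⟩
    · refine collapse_ind hL.C (P := fun i c => ∀ c', (m i).after.c (.inl c) c' →
        ArcDiagram.afterC D i₀ m (.inl (collapse hL.C i c)) ⟨i, c'⟩) (fun c' c h => ?_) i c c' h
      rw [collapse_self]
      exact .hole h
    · exact .part h
  · rintro (h | h | t)
    · exact .inl ⟨i₀, _, _, h, congrArg Sum.inl (collapse_self hL.S _).symm, rfl⟩
    · exact .inl ⟨_, _, _, h, rfl, rfl⟩
    · exact .inr ⟨t, rfl, rfl⟩
  · rintro (⟨i, c | c, c', h, rfl, rfl⟩ | ⟨t, rfl, rfl⟩)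
    · refine collapse_ind hL.S (P := fun i c => ∀ c', (m i).after.s (.inl c) c' →
        ArcDiagram.afterS D i₀ m (.inl (collapse hL.S i c)) (.inl ⟨i, c'⟩)) (fun c' c h => ?_) i c c' h
      rw [collapse_self]
      exact .hole h
    · exact .part h
    · exact .arc t

end step

end

section
variable {e h U : Type} [Finite e] [Finite h]

section fill

theorem extSurface_toHom {a b : Flat h} {F : Flat (h ⊕ e)} {A B : Flat e} (hm : F.Mfd)
  (G : IsGlue (fillD h e) (fillF a F) A) (H : IsGlue (fillD h e) (fillF b F) B)
  (f : A.S → a.S ⊕ F.S) (g : B.S → b.S ⊕ F.S)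
  (hf : ∀ s, (ExtK.outA G (Quot.mk _ s) : ExtK a b F) = Sum.elim
    (fun s => ExtK.n (Circ.l (Quot.mk _ s))) (fun s => ExtK.f (Quot.mk _ s)) (f s))
  (hg : ∀ s, (ExtK.outB H (Quot.mk _ s) : ExtK a b F) = Sum.elim
    (fun s => ExtK.n (Circ.r (Quot.mk _ s))) (fun s => ExtK.f (Quot.mk _ s)) (g s))
  (V : Set (Circ a b)) (W : Set (Circ A B)) :
  (extSurface F a b V A B f g).toHom W = (extCob G H).coef (ZMod 2) V W := by
  let ψ : Quot (extLink F a b) ≃ ExtK a b F :=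
    { toFun := Quot.lift (Sum.elim (fun s => ExtK.n (Quot.mk _ s)) fun s => ExtK.f (Quot.mk _ s)) (by
        rintro _ _ (h | h | q)
        exacts [congrArg ExtK.n (Quot.sound h), congrArg ExtK.f (Quot.sound h), ExtK.glue q])
      invFun := ExtK.lift (Quot.map Sum.inl fun _ _ h => .inner h)
        (Quot.map Sum.inr fun _ _ h => .outer h) fun q => Quot.sound (.glue q)
      left_inv := by rintro ⟨s | s⟩ <;> rfl
      right_inv := ExtK.ind (by rintro ⟨s⟩; rfl) (by rintro ⟨s⟩; rfl) }
  have hn : ∀ (k : Quot (extLink F a b)) (q : Circ a b), (∃ s, Quot.mk _ s = q ∧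
      (Quot.mk _ (Sum.inl s) : Quot (extLink F a b)) = k) ↔ ExtK.n q = ψ k := fun k q => by
    refine (quot_exists_and (fun s => (Quot.mk _ (Sum.inl s) : Quot (extLink F a b)))
      (Quot.map Sum.inl fun _ _ h => .inner h) (fun _ => rfl) q k).trans ?_
    refine ψ.injective.eq_iff.symm.trans ?_
    obtain ⟨s, rfl⟩ := Quot.mk_surjective q
    rfl
  have hF : ∀ (k : Quot (extLink F a b)) (q : F.Comp), (∃ s, Quot.mk _ s = q ∧
      (Quot.mk _ (Sum.inr s) : Quot (extLink F a b)) = k) ↔ ExtK.f q = ψ k := fun k q => by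
    refine (quot_exists_and (fun s => (Quot.mk _ (Sum.inr s) : Quot (extLink F a b)))
      (Quot.map Sum.inr fun _ _ h => .outer h) (fun _ => rfl) q k).trans ?_
    refine ψ.injective.eq_iff.symm.trans ?_
    obtain ⟨s, rfl⟩ := Quot.mk_surjective q
    rfl
  have hh : ∀ (k : Quot (extLink F a b)) (q : h),
      (Quot.mk _ (Sum.inl (Sum.inl (a.bd q))) : Quot (extLink F a b)) = k
        ↔ (ExtK.f (F.pt (.inl q)) : ExtK a b F) = ψ k := fun k q => by
    rw [← ψ.injective.eq_iff]
    exact Eq.congr_left (ExtK.glue q)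
  have hX : ∀ k : Quot (extLink F a b), (extCob G H).X (ψ k)
      = 2 * (extSurface F a b V A B f g).χ k + 2 * cnt (ExtK.out G H) (ψ k) := fun k => by
    have e1 := hm.two_mul_arcs (ExtK.f : _ → ExtK a b F) (ψ k)
    simp only [extSurface, hn, hF, hh, Pi.add_apply, Pi.sub_apply, Pi.smul_apply]
    simp only [nsmul_eq_mul]
    rw [← e1, cnt_eq_ncard ExtK.n, cnt_eq_ncard fun q => ExtK.f (F.pt (.inl q))]
    push_cast
    ring
  have hδ : ∀ k : Quot (extLink F a b), (extSurface F a b V A B f g).dots k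
      = push ExtK.n (ind V) (ψ k) := fun k => by
    simp only [extSurface, push_ind, hn]
  refine (Surface.toHom_apply _ ψ (ExtK.out G H) ?_ (extCob G H).X (push ExtK.n (ind V)) hX hδ
    W).trans ?_
  · rintro (s | s)
    · refine Eq.trans ?_ ((ExtK.out_l G H _).trans (hf s)).symm
      change ψ (Quot.mk _ (Sum.map Sum.inl id (f s))) = _
      rcases f s with s | s <;> rfl
    · refine Eq.trans ?_ ((ExtK.out_r G H _).trans (hg s)).symm
      change ψ (Quot.mk _ (Sum.map Sum.inr id (g s))) = _
      rcases g s with s | s <;> rfl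
  · unfold Cob.coef
    rw [zero_add]

variable {E : Tangle (h ⊕ e) U} {L L' : Tangle h U} (hE : E.Nice)

include hE

attribute [-instance] fintypeOfFinite in
theorem fillMap_eq (φ : Mat L.cube L'.cube) : fillMap E L L' φ = fillR (R := ZMod 2) E φ := by
  funext (ε : (E.fill L).C → Bool) (ε' : (E.fill L').C → Bool)
  change (if ∀ c : E.C, ε (.inr c) = ε' (.inr c) then
    ∑ᶠ V : Set (Circ (L.res fun c => ε (.inl c)) (L'.res fun c => ε' (.inl c))),
      φ (fun c => ε (.inl c)) (fun c => ε' (.inl c)) V •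
        (extSurface (E.res fun c => ε (.inr c)) _ _ V
          ((E.fill L).res ε) ((E.fill L').res ε') (fun s => s) (fun s => s)).toHom
    else 0) = _
  split_ifs with hc
  · refine Eq.trans ?_ (dif_pos hc).symm
    funext W
    have := Fintype.ofFinite (Set (Circ (L.res fun c => ε (.inl c)) (L'.res fun c => ε' (.inl c))))
    refine (congrFun (fsum_eq _) W).trans ((Finset.sum_apply _ _ _).trans
      (Eq.trans ?_ (fsum_eq _).symm))
    refine sum_congr rfl fun V _ => ?_
    exact congrArg (φ _ _ V * ·) (extSurface_toHom (hE.mfd _) _ _ _ _ (by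
      rintro (s | s)
      exacts [ExtK.outA_false _ (L.cmp _ s), ExtK.outA_true _ (E.cmp _ s)]) (by
      rintro (s | s)
      exacts [ExtK.outB_false _ (L'.cmp _ s), ExtK.outB_true _ (E.cmp _ s)]) V W)
  · exact (fillR_ne _ hc).symm

end fill

section cube

variable {T T' T'' : Tangle e U}

theorem ind_empty {S : Type} : ind (∅ : Set S) = 0 := by
  ext s
  simp [ind]

theorem ind_singleton {S : Type} (s : S) : ind ({s} : Set S) = Pi.single s 1 := by
  ext t
  simp [ind, Pi.single_apply]

attribute [-instance] fintypeOfFinite in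
theorem matOne_eq (hT : T.Nice) : Mat.one T.cube = tone (ZMod 2) T := by
  funext (ε : T.C → Bool) (ε' : T.C → Bool)
  by_cases h : ε = ε'
  · subst h
    refine (dif_pos rfl).trans ((trace_eq T ε ε (hT.mfd ε) ∅ ∅).trans ?_)
    refine Eq.trans ?_ (if_pos rfl).symm
    rw [ind_empty]
    congr 2
  · exact (dif_neg h).trans (dots_ne _ h).symm

attribute [-instance] fintypeOfFinite in
theorem dot_eq (hT : T.Nice) (s : T.S) : T.dot s = dots (ZMod 2) T (Pi.single s 1) := by
  funext (ε : T.C → Bool) (ε' : T.C → Bool)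
  refine if_congr Iff.rfl ((trace_eq T ε ε' (hT.mfd ε) ∅ {s}).trans ?_) rfl
  rw [ind_empty, ind_singleton]
  congr 2

theorem CBN_d (hT : T.Nice) (X : Finset U) : (T.CBN X).d = ∑ᶠ c, sad (ZMod 2) T c := by
  funext (ε : T.C → Bool) (ε' : T.C → Bool)
  rw [fsum_eq, Finset.sum_apply, Finset.sum_apply]
  refine (fsum_eq _).trans (sum_congr rfl fun c _ => ?_)
  refine if_congr Iff.rfl ((trace_eq T ε ε' (hT.mfd ε) {T.cr c 0} ∅).trans ?_) rfl
  rw [ind_empty, ind_singleton]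
  congr 2
  ext s
  simp [Pi.single_apply]

theorem CBN_act (hT : T.Nice) (X : Finset U) (x : X) : (T.CBN X).act x
  = ∑ᶠ p, if T.col p = some x.1 then dots (ZMod 2) T (Pi.single (T.pt p 0) 1) else 0 := by
  refine finsum_congr fun p => ?_
  split_ifs
  · exact dot_eq hT _
  · rfl

end cube

end

section
open TMat (mul)

variable {e U : Type} [Finite e]

section dotAt

variable {R : Type} [CommRing R] {C : Type}

/-- The effect of putting a dot on the disc at `q`. -/
def dotAt (q : C) (f : Set C → R) : Set C → R := fun V => if q ∈ V then f (V \ {q}) else 0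

theorem dotAt_comm (p q : C) (f : Set C → R) : dotAt p (dotAt q f) = dotAt q (dotAt p f) := by
  ext V
  by_cases h : p = q
  · rw [h]
  have h' : q ≠ p := fun h' => h h'.symm
  by_cases hp : p ∈ V <;> by_cases hq : q ∈ V <;> simp [dotAt, hp, hq, h, h', Set.sdiff_sdiff_comm]

theorem dotAt_sq (q : C) (f : Set C → R) : dotAt q (dotAt q f) = 0 := by
  ext V
  simp [dotAt]

variable [Finite C]

theorem dotAt_L {N : Type} [Finite N] (G : Cob Empty N) (q : N) :
  dotAt q (G.L (1 : Set Empty → R)) = { G with δ := G.δ + Pi.single (G.out q) 1 }.L 1 := by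
  ext V
  rw [dotAt, Cob.L_one, Cob.L_one]
  have e1 : q ∈ V → ind (V \ {q})ᶜ = ind Vᶜ + (Pi.single q 1 : N → ℕ) := fun hq => by
    ext s
    by_cases hs : s = q
    · subst hs; simp [ind, hq]
    · simp [ind, hs]
  split_ifs with h
  · rw [e1 h, map_add, push_single, add_assoc, add_comm (push _ _)]
  · refine (if_neg fun hk => ?_).symm
    have h1 := (hk (G.out q)).2
    have h2 : ind Vᶜ = ind (Vᶜ \ {q}) + (Pi.single q 1 : N → ℕ) := by
      ext s
      by_cases hs : s = q
      · subst hs; simp [ind, h]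
      · simp [ind, hs]
    change (G.δ + Pi.single (G.out q) 1 + push G.out (ind Vᶜ) : G.K → ℕ) (G.out q) = 1 at h1
    rw [h2, map_add, push_single] at h1
    simp only [Pi.add_apply, Pi.single_eq_same] at h1
    omega

abbrev dotCob (q : C) : Cob C C where
  K := C
  inn := id
  out := id
  X _ := 4
  δ := Pi.single q 1

attribute [-instance] fintypeOfFinite in
theorem dotCob_coef (q : C) (V W : Set C) :
  (dotCob q).coef R W V = if q ∈ V ∧ W = V \ {q} then 1 else 0 := by
  have hid : ∀ w : C → ℕ, push (id : C → C) w = w := push_id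
  unfold Cob.coef ev
  refine if_congr ?_ rfl rfl
  simp only [true_and, hid, Pi.add_apply]
  constructor
  · intro h
    have hq := h q
    simp only [Pi.single_eq_same, ind, Set.mem_compl_iff] at hq
    refine ⟨by_contra fun hV => by simp [hV] at hq, ?_⟩
    ext s
    have hs := h s
    by_cases e : s = q
    · subst e
      by_cases hW : s ∈ W <;> by_cases hV : s ∈ V <;> simp [hW, hV] at hq ⊢
    · simp only [Pi.single_apply, e, if_false, ind, Set.mem_compl_iff] at hs
      by_cases hW : s ∈ W <;> by_cases hV : s ∈ V <;> simp [hW, hV, e] at hs ⊢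
  · rintro ⟨hq, rfl⟩ s
    by_cases e : s = q
    · subst e; simp [ind, hq]
    · by_cases hV : s ∈ V <;> simp [ind, e, hV]

theorem dotCob_L (q : C) (f : Set C → R) : (dotCob q).L f = dotAt q f := by
  ext V
  rw [Cob.L, fsum_eq, dotAt]
  simp only [dotCob_coef]
  split_ifs with h
  · rw [sum_eq_single (V \ {q})]
    · simp [h]
    · intro W _ hW; simp [hW]
    · simp
  · simp [h]

end dotAt

section dots

variable {R : Type} [CommRing R] [CharP R 2] {T T' : Tangle e U}

theorem mul_dots (hT : T.Nice) (hT' : T'.Nice) (M : TMat R T T') (s : T'.S) (ε ε') :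
  mul M (dots R T' (Pi.single s 1)) ε ε' = dotAt (Circ.r (T'.cmp ε' s)) (M ε ε') := by
  rw [mul, finsum_eq_single _ ε']
  · rw [dots_self, FlatIso.hcomp_cyl_right _ (hT.mfd ε) (hT'.mfd ε'), ← dotCob_L]
    have : ∀ q, (FlatIso.refl (T'.res ε')).right (T.res ε) q = q :=
      Circ.ind (fun x => FlatIso.right_l _ x) (fun x => FlatIso.right_r _ x)
    refine Cob.L_congr (G := (FlatIso.refl (T'.res ε')).rightCob (T.res ε) _)
      (G' := dotCob _) (Equiv.refl _) this (fun _ => rfl) (fun _ => rfl) (fun k => ?_) _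
    refine congrFun (?_ : push Circ.r (push (T'.cmp ε') (Pi.single s 1)) = _) k
    rw [push_single, push_single]
  · intro η hη
    rw [dots_ne _ hη, hcomp_zero]

theorem dots_mul (hT : T.Nice) (hT' : T'.Nice) (M : TMat R T T') (s : T.S) (ε ε') :
  mul (dots R T (Pi.single s 1)) M ε ε' = dotAt (Circ.l (T.cmp ε s)) (M ε ε') := by
  rw [mul, finsum_eq_single _ ε]
  · rw [dots_self, FlatIso.hcomp_cyl_left _ (hT.mfd ε) (hT'.mfd ε'), ← dotCob_L]
    have : ∀ q, (FlatIso.refl (T.res ε)).left (T'.res ε') q = q :=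
      Circ.ind (fun x => FlatIso.left_l _ x) (fun x => FlatIso.left_r _ x)
    refine Cob.L_congr (G := (FlatIso.refl (T.res ε)).leftCob (T'.res ε') _)
      (G' := dotCob _) (Equiv.refl _) (fun _ => rfl) this (fun _ => rfl) (fun k => ?_) _
    refine congrFun (?_ : push Circ.l (push (T.cmp ε) (Pi.single s 1)) = _) k
    rw [push_single, push_single]
  · intro η hη
    rw [dots_ne _ hη.symm, zero_hcomp]

theorem dotAt_zero {C : Type} (q : C) : dotAt q (0 : Set C → R) = 0 := by
  ext V
  simp [dotAt]

theorem dots_comm_tr (hT : T.Nice) (P : (T.C → Bool) → (T.C → Bool) → Prop) (β : T.S → ℤ)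
  (δ : T.S → ℕ) (s : T.S) : mul (dots R T (Pi.single s 1)) (tr R T P β δ)
    = mul (tr R T P β δ) (dots R T (Pi.single s 1)) := by
  ext1 ε; ext1 ε'
  rw [dots_mul hT hT, mul_dots hT hT, tr]
  split_ifs
  · rw [dotAt_L, dotAt_L]
    congr 4
  · rw [dotAt_zero, dotAt_zero]

theorem mul_dots_comm (hT : T.Nice) (hT' : T'.Nice) (M : TMat R T T') (s t : T'.S) :
  mul (mul M (dots R T' (Pi.single s 1))) (dots R T' (Pi.single t 1))
    = mul (mul M (dots R T' (Pi.single t 1))) (dots R T' (Pi.single s 1)) := by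
  ext1 ε; ext1 ε'
  simp only [mul_dots hT hT']
  rw [dotAt_comm]

theorem mul_dots_sq (hT : T.Nice) (hT' : T'.Nice) (M : TMat R T T') (s : T'.S) :
  mul (mul M (dots R T' (Pi.single s 1))) (dots R T' (Pi.single s 1)) = 0 := by
  ext1 ε; ext1 ε'
  simp only [mul_dots hT hT']
  rw [dotAt_sq]
  rfl

end dots

section map

variable {R S S' : Type} [CommRing R] [CommRing S] [CommRing S'] (ψ : R →+* S)
  {T T' T'' : Tangle e U}

def TMat.map (M : TMat R T T') : TMat S T T' := fun ε ε' V => ψ (M ε ε' V)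

namespace TMat

theorem map_add (M N : TMat R T T') : map ψ (M + N) = map ψ M + map ψ N := by
  funext ε ε' V
  exact _root_.map_add ψ _ _

theorem map_zero : map ψ (0 : TMat R T T') = 0 := by
  funext ε ε' V
  exact _root_.map_zero ψ

theorem map_sub (M N : TMat R T T') : map ψ (M - N) = map ψ M - map ψ N := by
  funext ε ε' V
  exact _root_.map_sub ψ _ _

theorem map_smul (r : R) (M : TMat R T T') : map ψ (r • M) = ψ r • map ψ M := by
  funext ε ε' V
  exact _root_.map_mul ψ _ _

theorem map_sum {ι : Type} (s : Finset ι) (M : ι → TMat R T T') :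
  map ψ (∑ i ∈ s, M i) = ∑ i ∈ s, map ψ (M i) := by
  induction s using Finset.induction_on with
  | empty => exact map_zero ψ
  | insert a s ha ih => rw [Finset.sum_insert ha, Finset.sum_insert ha, map_add, ih]

theorem map_finsum {ι : Type} [Finite ι] (M : ι → TMat R T T') :
  map ψ (∑ᶠ i, M i) = ∑ᶠ i, map ψ (M i) := by
  rw [fsum_eq, fsum_eq, map_sum]

theorem map_mul (M : TMat R T T') (N : TMat R T' T'') :
  map ψ (mul M N) = mul (map ψ M) (map ψ N) := by
  funext ε ε'' V
  change ψ (mul M N ε ε'' V) = _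
  rw [mul_apply, mul_apply, Finset.sum_apply, Finset.sum_apply, _root_.map_sum]
  exact sum_congr rfl fun ε' _ => congrFun (hcomp_map ψ _ _) V

end TMat

theorem map_tr (P β δ) : TMat.map ψ (tr R T P β δ) = tr S T P β δ := by
  funext ε ε' V
  change ψ (tr R T P β δ ε ε' V) = _
  unfold tr
  split_ifs
  · refine (congrFun (Cob.L_map ψ _ _) V).trans ?_
    congr 1
    funext W
    exact _root_.map_one ψ
  · exact _root_.map_zero ψ

theorem map_diff (ξ : U → R) : TMat.map ψ (diff T ξ) = diff T (fun u => ψ (ξ u)) := by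
  unfold diff
  rw [TMat.map_add, TMat.map_finsum, TMat.map_finsum]
  refine congrArg₂ (· + ·) (finsum_congr fun c => map_tr ψ _ _ _) (finsum_congr fun p => ?_)
  rcases T.col p with _ | u
  · exact TMat.map_zero ψ
  · exact (TMat.map_smul ψ _ _).trans (congrArg _ (map_tr ψ _ _ _))

theorem diff_congr {ξ ξ' : U → R} (h : ∀ p, ∀ u ∈ T.col p, ξ u = ξ' u) : diff T ξ = diff T ξ' := by
  unfold diff
  refine congrArg _ (finsum_congr fun p => ?_)
  rcases hc : T.col p with _ | u
  · rfl
  · simp only [Option.elim, h p u hc]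

theorem map_fillR {h : Type} [Finite h] {E : Tangle (h ⊕ e) U} {L L' : Tangle h U}
  (φ : TMat R L L') : TMat.map ψ (fillR E φ) = fillR E (TMat.map ψ φ) := by
  funext ε ε' V
  change ψ (fillR E φ ε ε' V) = _
  by_cases hc : ∀ c, ε (.inr c) = ε' (.inr c)
  · rw [fillR, dif_pos hc, fillR, dif_pos hc]
    exact congrFun (Cob.L_map ψ _ _) V
  · rw [fillR_ne _ hc, fillR_ne _ hc]
    exact _root_.map_zero ψ

end map

section map

variable {R S : Type} [CommRing R] [CommRing S] (ψ : R →+* S) {o I : Type} [Finite o] [Finite I]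
  {E : I → Type} [∀ i, Finite (E i)] {D : ArcDiagram E o} {T T' : ∀ i, Tangle (E i) U}
  {A A' : Tangle o U}

theorem map_phi (G : TGlue D T A) (G' : TGlue D T' A') (M : ∀ i, TMat R (T i) (T' i)) :
  TMat.map ψ (phi G G' M) = phi G G' fun i => TMat.map ψ (M i) := by
  funext ε ε' V
  change ψ (phi G G' M ε ε' V) = _
  rw [phi_apply, phi_apply]
  refine (congrFun (Cob.L_map ψ _ _) V).trans ?_
  congr 1
  funext W
  rw [Cob.tensor, Cob.tensor, finprod_eq_prod_of_fintype, finprod_eq_prod_of_fintype, map_prod]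
  rfl

theorem map_cyl {T T' : Tangle o U} (G : TIso T T') :
  TMat.map ψ (G.cyl R) = G.cyl S := by
  unfold TIso.cyl
  rw [map_phi]
  congr 1
  funext i
  exact map_tr ψ _ _ _

end map

end

section
variable {e U : Type} [Finite e]

/-! ## Commuting operators of square zero -/

section square

variable {A : Type} [Ring A] (hA : ∀ a : A, a + a = 0)

include hA

theorem sum_sq_eq_zero {ι : Type} (s : Finset ι) (r : ι → A) (hr : ∀ i j, Commute (r i) (r j))
  (h0 : ∀ i, r i * r i = 0) : (∑ i ∈ s, r i) * ∑ i ∈ s, r i = 0 := by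
  induction s using Finset.induction_on with
  | empty => simp
  | insert a s ha ih =>
    rw [Finset.sum_insert ha, add_mul, mul_add, mul_add, h0, ih,
      (Commute.sum_right s r (r a) fun i _ => hr a i).eq, zero_add, add_zero, hA]

end square

section operators

variable {X V : Type} [Fintype X] [AddCommGroup V] [Module (ZMod 2) V]
  (r : X → Module.End (ZMod 2) V) (hr : ∀ x y, Commute (r x) (r y))

/-- The action of a squarefree monomial. -/
def monomialAct (Z : Finset X) : Module.End (ZMod 2) V :=
  Z.noncommProd r fun x _ y _ _ => hr x y

theorem monomialAct_insert {x : X} {Z : Finset X} (hx : x ∉ Z) :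
  monomialAct r hr (insert x Z) = r x * monomialAct r hr Z :=
  Finset.noncommProd_insert_of_notMem _ _ _ _ hx

theorem commute_monomialAct (f : Module.End (ZMod 2) V) (hf : ∀ x, Commute f (r x)) (Z : Finset X) :
  Commute f (monomialAct r hr Z) :=
  Finset.noncommProd_commute _ _ _ _ fun x _ => hf x

variable (h0 : ∀ x, r x * r x = 0)
include h0

theorem mul_monomialAct_of_mem {x : X} {Z : Finset X} (hx : x ∈ Z) :
  r x * monomialAct r hr Z = 0 := by
  rw [← Finset.insert_erase hx, monomialAct_insert _ _ (Finset.notMem_erase x Z), ← mul_assoc, h0,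
    zero_mul]

theorem sum_monomialAct_erase (x : X) (Φ : Finset X → V) :
  ∑ Z, (if x ∈ Z then monomialAct r hr Z (Φ (Z.erase x)) else 0)
    = r x (∑ Z, monomialAct r hr Z (Φ Z)) := by
  rw [map_sum, ← Finset.sum_filter, ← Finset.sum_filter_add_sum_filter_not Finset.univ (x ∈ ·)
    fun Z => r x (monomialAct r hr Z (Φ Z))]
  have e0 : ∑ Z with x ∈ Z, r x (monomialAct r hr Z (Φ Z)) = 0 := sum_eq_zero fun Z hZ =>
    LinearMap.congr_fun (mul_monomialAct_of_mem r hr h0 (Finset.mem_filter.1 hZ).2) _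
  rw [e0, zero_add]
  · refine Finset.sum_nbij' (fun Z => Z.erase x) (fun Z => insert x Z) ?_ ?_ ?_ ?_ ?_
    · intro Z _; simp
    · intro Z _; simp
    · intro Z hZ; exact Finset.insert_erase (Finset.mem_filter.1 hZ).2
    · intro Z hZ; exact Finset.erase_insert (Finset.mem_filter.1 hZ).2
    · intro Z hZ
      have := monomialAct_insert r hr (Finset.notMem_erase x Z)
      rw [Finset.insert_erase (Finset.mem_filter.1 hZ).2] at this
      rw [this]
      rfl

end operators

section block

variable {X : Type} [Fintype X] {T T' T'' : Tangle e U}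

abbrev FMat (X : Type) [Fintype X] (T T' : Tangle e U) : Type := Mat (T.cube.free X) (T'.cube.free X)

/-- Matrices with polynomial coefficients. -/
abbrev PMat (X : Type) (T T' : Tangle e U) : Type := TMat (MvPolynomial X (ZMod 2)) T T'

def block (K : FMat X T T') (a b : Finset X × (X → ℕ)) :
  TMat (ZMod 2) T T' := fun ε ε' => K (ε, a) (ε', b)

theorem block_ext {K K' : FMat X T T'}
  (h : ∀ a b, block K a b = block K' a b) : K = K' := by
  funext ⟨ε, a⟩ ⟨ε', b⟩
  exact congrFun (congrFun (h a b) ε) ε'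

theorem finsum_prod_eq {α β M : Type} [AddCommMonoid M] [Fintype α] (s : Finset β) (f : α × β → M)
  (hs : ∀ p, p.2 ∉ s → f p = 0) : ∑ᶠ p, f p = ∑ b ∈ s, ∑ a, f (a, b) := by
  rw [finsum_eq_sum_of_support_subset (s := Finset.univ ×ˢ s), Finset.sum_product_right]
  intro p hp
  rw [Finset.coe_product, Set.mem_prod]
  exact ⟨Finset.mem_coe.2 (Finset.mem_univ _), by_contra fun hb => hp (hs p hb)⟩

theorem block_comp (hT' : T'.Nice) (K : FMat X T T')
  (K' : FMat X T' T'') (a c) (s : Finset (Finset X × (X → ℕ)))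
  (hs : ∀ b ∉ s, block K a b = 0 ∨ block K' b c = 0) :
  block (K.comp K') a c = ∑ b ∈ s, TMat.mul (block K a b) (block K' b c) := by
  funext (ε : T.C → Bool) (ε'' : T''.C → Bool)
  have e1 : ∀ j : (T'.C → Bool) × Finset X × (X → ℕ),
      (K (ε, a) j).comp (K' j (ε'', c)) = hcomp (R := ZMod 2) (block K a j.2 ε j.1)
        (block K' j.2 c j.1 ε'') := fun j => Hom.comp_eq (hT'.mfd j.1) _ _
  rw [Finset.sum_apply, Finset.sum_apply]
  refine (finsum_congr e1).trans ((finsum_prod_eq s _ fun j hj => ?_).trans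
    (sum_congr rfl fun b _ => (fsum_eq fun ε' =>
      hcomp (block K a b ε ε') (block K' b c ε' ε'')).symm))
  rcases hs j.2 hj with h | h
  · rw [h]; exact zero_hcomp _
  · rw [h]; exact hcomp_zero _

/-- Composition with a matrix whose `a`-th row is finite. -/
theorem block_comp_left (hT' : T'.Nice) (K : FMat X T T')
  (K' : FMat X T' T'') (a c) {τ : Type} (t : Finset τ)
  (g : τ → Finset X × (X → ℕ)) (M : τ → TMat (ZMod 2) T T')
  (hK : ∀ b, block K a b = ∑ i ∈ t, if b = g i then M i else 0) :
  block (K.comp K') a c = ∑ i ∈ t, TMat.mul (M i) (block K' (g i) c) := by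
  rw [block_comp hT' K K' a c (t.image g)]
  · simp only [hK, TMat.sum_mul]
    rw [sum_comm]
    refine sum_congr rfl fun i hi => ?_
    rw [sum_eq_single (g i)]
    · rw [if_pos rfl]
    · intro b _ hb
      rw [if_neg hb, TMat.zero_mul]
    · exact fun h => (h (Finset.mem_image_of_mem g hi)).elim
  · intro b hb
    left
    rw [hK]
    exact sum_eq_zero fun i hi => if_neg fun h =>
      hb (Finset.mem_image.2 ⟨i, hi, h.symm⟩)

/-- Composition with a matrix whose `c`-th column is finite. -/
theorem block_comp_right (hT' : T'.Nice) (K : FMat X T T')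
  (K' : FMat X T' T'') (a c) {τ : Type} (t : Finset τ)
  (g : τ → Finset X × (X → ℕ)) (M : τ → TMat (ZMod 2) T' T'')
  (hK : ∀ b, block K' b c = ∑ i ∈ t, if b = g i then M i else 0) :
  block (K.comp K') a c = ∑ i ∈ t, TMat.mul (block K a (g i)) (M i) := by
  rw [block_comp hT' K K' a c (t.image g)]
  · simp only [hK, TMat.mul_sum]
    rw [sum_comm]
    refine sum_congr rfl fun i hi => ?_
    rw [sum_eq_single (g i)]
    · rw [if_pos rfl]
    · intro b _ hb
      rw [if_neg hb, TMat.mul_zero]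
    · exact fun h => (h (Finset.mem_image_of_mem g hi)).elim
  · intro b hb
    right
    rw [hK]
    exact sum_eq_zero fun i hi => if_neg fun h =>
      hb (Finset.mem_image.2 ⟨i, hi, h.symm⟩)

theorem block_tens (M : TMat (ZMod 2) T T') (r : Finset X → Finset X → ZMod 2)
  (ξ : (X → ℕ) → (X → ℕ) → ZMod 2) (a b) :
  block (Mat.tens (A := T.cube) (B := T'.cube) M r ξ) a b = (r a.1 b.1 * ξ a.2 b.2) • M := rfl

end block

end

section
variable {e U : Type} [Finite e]

open MvPolynomial

section coefficient

variable {X : Type} [Fintype X] {T T' T'' : Tangle e U}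

theorem coeff_L {σ C C' : Type} [Finite C] [Finite C'] (G : Cob C C')
  (f : Set C → MvPolynomial σ (ZMod 2)) (m : σ →₀ ℕ) (V : Set C') :
  coeff m (G.L f V) = G.L (fun W => coeff m (f W)) V := by
  rw [Cob.L, Cob.L, fsum_eq, fsum_eq, coeff_sum]
  refine sum_congr rfl fun W _ => ?_
  rw [← Cob.coef_map (MvPolynomial.C : ZMod 2 →+* MvPolynomial σ (ZMod 2)), mul_comm, coeff_C_mul, mul_comm]

theorem coeff_hcomp {σ : Type} {a b c : Flat e} (f : RHom (MvPolynomial σ (ZMod 2)) a b)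
  (g : RHom (MvPolynomial σ (ZMod 2)) b c) (m : σ →₀ ℕ) (V : Set (Circ a c)) :
  coeff m (hcomp f g V) = ∑ x ∈ Finset.HasAntidiagonal.antidiagonal m,
    hcomp (R := ZMod 2) (fun W => coeff x.1 (f W)) (fun W => coeff x.2 (g W)) V := by
  rw [hcomp, coeff_L]
  simp only [hcomp, Cob.L, fsum_eq]
  rw [sum_comm]
  refine sum_congr rfl fun W _ => ?_
  rw [← Finset.sum_mul]
  congr 1
  exact coeff_mul _ _ _

def coM (m : X → ℕ) (M : PMat X T T') : TMat (ZMod 2) T T' :=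
  fun ε ε' V => coeff (Finsupp.equivFunOnFinite.symm m) (M ε ε' V)

theorem coM_ext {M N : PMat X T T'} (h : ∀ m, coM m M = coM m N) : M = N := by
  funext ε ε' V
  refine MvPolynomial.ext _ _ fun m => ?_
  have := congrFun (congrFun (congrFun (h m) ε) ε') V
  simpa only [coM, Finsupp.equivFunOnFinite_symm_coe] using this

theorem coM_add (m : X → ℕ) (M N : PMat X T T') :
  coM m (M + N) = coM m M + coM m N := by
  funext ε ε' V
  exact coeff_add _ _ _

theorem coM_sub (m : X → ℕ) (M N : PMat X T T') :
  coM m (M - N) = coM m M - coM m N := by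
  funext ε ε' V
  exact coeff_sub _ _ _ _

theorem coM_zero (m : X → ℕ) : coM m (0 : PMat X T T') = 0 := by
  funext ε ε' V
  exact coeff_zero _

theorem coM_sum {ι : Type} (m : X → ℕ) (s : Finset ι) (M : ι → PMat X T T') :
  coM m (∑ i ∈ s, M i) = ∑ i ∈ s, coM m (M i) := by
  induction s using Finset.induction_on with
  | empty => exact coM_zero m
  | insert a s ha ih => rw [Finset.sum_insert ha, Finset.sum_insert ha, coM_add, ih]

theorem coM_map (m : X → ℕ) (M : TMat (ZMod 2) T T') :
  coM m (TMat.map C M) = if m = 0 then M else 0 := by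
  funext ε ε' V
  refine (coeff_C _ _).trans ?_
  by_cases h : m = 0
  · subst h
    rw [if_pos rfl, if_pos]
    ext x
    rfl
  · rw [if_neg h, if_neg]
    · rfl
    · intro h'
      exact h (funext fun x => (DFunLike.congr_fun h' x).symm)

theorem coM_X_smul (m : X → ℕ) (x : X) (M : PMat X T T') :
  coM m ((MvPolynomial.X x : MvPolynomial X (ZMod 2)) • M)
    = if m x ≠ 0 then coM (m - Pi.single x 1) M else 0 := by
  funext ε ε' V
  refine (coeff_X_mul' _ _ _).trans ?_
  by_cases h : m x = 0
  · rw [if_neg (not_not.2 h), if_neg]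
    · rfl
    · simpa using h
  · rw [if_pos h, if_pos]
    · refine congrArg (fun n => coeff n _) ?_
      ext y
      simp [Finsupp.single_apply, Pi.single_apply, eq_comm]
    · simpa using h

theorem coM_mul (n n' : X → ℕ) (h : n' ≤ n) (M : PMat X T T')
  (N : PMat X T' T'') : coM (n - n') (TMat.mul M N)
    = ∑ k ∈ Finset.Icc n' n, TMat.mul (coM (n - k) M) (coM (k - n') N) := by
  funext ε ε'' V
  rw [Finset.sum_apply, Finset.sum_apply, Finset.sum_apply]
  change coeff _ (TMat.mul M N ε ε'' V) = _
  simp only [TMat.mul_apply, Finset.sum_apply]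
  rw [coeff_sum, sum_comm]
  refine sum_congr rfl fun ε' _ => ?_
  rw [coeff_hcomp]
  refine Finset.sum_bij' (fun x _ => n' + ⇑x.2) (fun k _ => (Finsupp.equivFunOnFinite.symm (n - k),
    Finsupp.equivFunOnFinite.symm (k - n'))) ?_ ?_ ?_ ?_ ?_
  · intro x hx
    rw [Finset.HasAntidiagonal.mem_antidiagonal] at hx
    refine Finset.mem_Icc.2 ⟨fun y => Nat.le_add_right _ _, fun y => ?_⟩
    have h1 : x.1 y + x.2 y = n y - n' y := DFunLike.congr_fun hx y
    have h2 : n' y ≤ n y := h y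
    change n' y + x.2 y ≤ n y
    omega
  · intro k hk
    rw [Finset.mem_Icc] at hk
    rw [Finset.HasAntidiagonal.mem_antidiagonal]
    ext y
    have h1 : n' y ≤ k y := hk.1 y
    have h2 : k y ≤ n y := hk.2 y
    change n y - k y + (k y - n' y) = n y - n' y
    omega
  · intro x hx
    rw [Finset.HasAntidiagonal.mem_antidiagonal] at hx
    refine Prod.ext ?_ ?_
    · ext y
      have h1 : x.1 y + x.2 y = n y - n' y := DFunLike.congr_fun hx y
      change n y - (n' y + x.2 y) = x.1 y
      omega
    · ext y
      simp
  · intro k hk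
    rw [Finset.mem_Icc] at hk
    ext y
    have h1 : n' y ≤ k y := hk.1 y
    change n' y + (k y - n' y) = k y
    omega
  · intro x hx
    rw [Finset.HasAntidiagonal.mem_antidiagonal] at hx
    have e1 : x.1 = Finsupp.equivFunOnFinite.symm (n - (n' + ⇑x.2)) := by
      ext y
      have h1 : x.1 y + x.2 y = n y - n' y := DFunLike.congr_fun hx y
      change x.1 y = n y - (n' y + x.2 y)
      omega
    have e2 : x.2 = Finsupp.equivFunOnFinite.symm (n' + ⇑x.2 - n') := by
      ext y
      simp
    unfold coM
    rw [← e1, ← e2]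

/-- A polynomial matrix as a matrix between the free resolutions. -/
def toFree (M : PMat X T T') : FMat X T T' :=
  fun a b => if a.2.1 = b.2.1 ∧ b.2.2 ≤ a.2.2 then coM (a.2.2 - b.2.2) M a.1 b.1 else 0

theorem block_toFree (M : PMat X T T') (a b) :
  block (toFree M) a b = if a.1 = b.1 ∧ b.2 ≤ a.2 then coM (a.2 - b.2) M else 0 := by
  funext (ε : T.C → Bool) (ε' : T'.C → Bool)
  change (if a.1 = b.1 ∧ b.2 ≤ a.2 then coM (a.2 - b.2) M ε ε' else 0) = _
  split_ifs <;> rfl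

theorem block_toFree_row (M : PMat X T T') (a b) :
  block (toFree M) a b = ∑ k ∈ Finset.Icc 0 a.2, if b = (a.1, k) then coM (a.2 - k) M else 0 := by
  obtain ⟨Z, n⟩ := a
  obtain ⟨Z', n'⟩ := b
  rw [block_toFree]
  simp only [Prod.mk.injEq]
  split_ifs with h
  · obtain ⟨rfl, h⟩ := h
    rw [sum_eq_single n']
    · simp
    · intro k _ hk
      rw [if_neg fun h => hk h.2.symm]
    · exact fun h' => (h' (Finset.mem_Icc.2 ⟨fun _ => Nat.zero_le _, h⟩)).elim
  · refine (sum_eq_zero fun k hk => if_neg ?_).symm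
    rintro ⟨rfl, rfl⟩
    exact h ⟨rfl, (Finset.mem_Icc.1 hk).2⟩

theorem toFree_mul (hT' : T'.Nice) (M : PMat X T T')
  (N : PMat X T' T'') :
  (toFree M).comp (toFree N) = toFree (TMat.mul M N) := by
  refine block_ext fun a c => ?_
  rw [block_comp_left hT' _ _ a c (Finset.Icc 0 a.2) (fun k => (a.1, k)) _ (block_toFree_row M a),
    block_toFree]
  simp only [block_toFree]
  split_ifs with h
  · rw [coM_mul _ _ h.2]
    symm
    refine Finset.sum_subset_zero_on_sdiff (Finset.Icc_subset_Icc_left fun _ => Nat.zero_le _)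
      (fun k hk => ?_) fun k hk => ?_
    · rw [Finset.mem_sdiff, Finset.mem_Icc, Finset.mem_Icc] at hk
      rw [if_neg fun h' => hk.2 ⟨h'.2, hk.1.2⟩, TMat.mul_zero]
    · rw [if_pos ⟨h.1, (Finset.mem_Icc.1 hk).1⟩]
  · refine sum_eq_zero fun k hk => ?_
    rw [if_neg, TMat.mul_zero]
    exact fun h' => h ⟨h'.1, h'.2.trans (Finset.mem_Icc.1 hk).2⟩

theorem toFree_add (M N : PMat X T T') :
  toFree (M + N) = toFree M + toFree N := by
  refine block_ext fun a b => ?_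
  change block (toFree (M + N)) a b = block (toFree M) a b + block (toFree N) a b
  simp only [block_toFree]
  split_ifs
  · exact coM_add _ _ _
  · exact (add_zero _).symm

theorem toFree_sub (M N : PMat X T T') :
  toFree (M - N) = toFree M - toFree N := by
  refine block_ext fun a b => ?_
  change block (toFree (M - N)) a b = block (toFree M) a b - block (toFree N) a b
  simp only [block_toFree]
  split_ifs
  · exact coM_sub _ _ _
  · exact (sub_zero _).symm

theorem toFree_map (M : TMat (ZMod 2) T T') :
  Mat.tens (A := T.cube) (B := T'.cube) M unitMat unitMat = toFree (X := X) (TMat.map C M) := by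
  refine block_ext fun a b => ?_
  rw [block_tens, block_toFree, coM_map]
  obtain ⟨Z, n⟩ := a
  obtain ⟨Z', n'⟩ := b
  simp only [unitMat]
  by_cases hZ : Z = Z'
  · by_cases hn : n = n'
    · simp [hZ, hn]
    · rw [if_neg hn, mul_zero, zero_smul]
      split_ifs with h1 h2
      · exact (hn (le_antisymm (tsub_eq_zero_iff_le.1 h2) h1.2)).elim
      · rfl
      · rfl
  · simp [hZ]

theorem toFree_X_smul (x : X) (M : TMat (ZMod 2) T T') :
  Mat.tens (A := T.cube) (B := T'.cube) M unitMat (mulXi x)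
    = toFree ((MvPolynomial.X x : MvPolynomial X (ZMod 2)) • TMat.map C M) := by
  refine block_ext fun a b => ?_
  rw [block_tens, block_toFree, coM_X_smul, coM_map]
  obtain ⟨Z, n⟩ := a
  obtain ⟨Z', n'⟩ := b
  simp only [unitMat, mulXi]
  by_cases hZ : Z = Z'
  · by_cases hn : n = n' + Pi.single x 1
    · subst hn
      have h1 : n' ≤ n' + Pi.single x 1 := le_self_add
      simp [hZ, h1]
    · rw [if_neg hn, mul_zero, zero_smul]
      split_ifs with h1 h2 h3
      · refine (hn ?_).elim
        ext y
        have h4 := congrFun h3 y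
        have h5 := h1.2 y
        by_cases hy : y = x
        · subst hy
          simp at h2 h4 ⊢
          omega
        · simp [hy] at h4 h5 ⊢
          omega
      all_goals rfl
  · simp [hZ]

end coefficient

end

section
variable {e U : Type} [Finite e]

open MvPolynomial

section resolution

variable {X : Type} [Fintype X] {T T' T'' : Tangle e U} (d : TMat (ZMod 2) T T)
  (act : X → TMat (ZMod 2) T T)

/-- The differential of the free resolution of a cube with differential `d` and the given action. -/
def resD : FMat X T T :=
  Mat.tens (A := T.cube) (B := T.cube) d unitMat unitMat
    + ∑ x : X, (Mat.tens (A := T.cube) (B := T.cube) (act x) unitMat (mulXi x)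
      + Mat.tens (A := T.cube) (B := T.cube) (tone (ZMod 2) T) (mulR x) (mulXi x))

variable (T) in
def resAct (x : X) : FMat X T T :=
  Mat.tens (A := T.cube) (B := T.cube) (tone (ZMod 2) T) (mulR x) unitMat

/-- The differential together with the action with polynomial weights. -/
def polyD : PMat X T T := TMat.map C d
  + ∑ x : X, (MvPolynomial.X x : MvPolynomial X (ZMod 2)) • TMat.map C (act x)

theorem ite_mul_smul (P Q : Prop) [Decidable P] [Decidable Q] [Decidable (P ∧ Q)] (M : TMat (ZMod 2) T T) : ((if P then (1 : ZMod 2) else 0) *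
  (if Q then 1 else 0)) • M = if P ∧ Q then M else 0 := by
  by_cases hP : P <;> by_cases hQ : Q <;> simp [hP, hQ]

theorem block_d (a b : Finset X × (X → ℕ)) : block (resD d act) a b
  = (if a.1 = b.1 ∧ a.2 = b.2 then d else 0)
    + ∑ x : X, ((if a.1 = b.1 ∧ a.2 = b.2 + Pi.single x 1 then act x else 0)
      + if (x ∉ a.1 ∧ b.1 = insert x a.1) ∧ a.2 = b.2 + Pi.single x 1 then tone (ZMod 2) T else 0) := by
  have e3 : ∀ (s : Finset X) (K : X → FMat X T T),
      block (∑ x ∈ s, K x) a b = ∑ x ∈ s, block (K x) a b := fun s K => by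
    induction s using Finset.induction_on with
    | empty => rfl
    | insert x s hx ih => rw [Finset.sum_insert hx, Finset.sum_insert hx, ← ih]; rfl
  have e1 : ∀ M : TMat (ZMod 2) T T, block (Mat.tens (A := T.cube) (B := T.cube) M unitMat unitMat) a b
      = if a.1 = b.1 ∧ a.2 = b.2 then M else 0 := fun M => by
    refine (block_tens _ _ _ a b).trans ?_
    unfold unitMat
    convert ite_mul_smul (a.1 = b.1) (a.2 = b.2) M
  have e2 : ∀ (M : TMat (ZMod 2) T T) (x : X),
      block (Mat.tens (A := T.cube) (B := T.cube) M unitMat (mulXi x)) a b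
      = if a.1 = b.1 ∧ a.2 = b.2 + Pi.single x 1 then M else 0 := fun M x => by
    refine (block_tens _ _ _ a b).trans ?_
    unfold unitMat mulXi
    convert ite_mul_smul (a.1 = b.1) (a.2 = b.2 + Pi.single x 1) M
  have e4 : ∀ (M : TMat (ZMod 2) T T) (x : X),
      block (Mat.tens (A := T.cube) (B := T.cube) M (mulR x) (mulXi x)) a b
      = if (x ∉ a.1 ∧ b.1 = insert x a.1) ∧ a.2 = b.2 + Pi.single x 1 then M else 0 := fun M x => by
    refine (block_tens _ _ _ a b).trans ?_
    unfold mulR mulXi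
    convert ite_mul_smul (x ∉ a.1 ∧ b.1 = insert x a.1) (a.2 = b.2 + Pi.single x 1) M
  unfold resD
  refine congrArg₂ (· + ·) (e1 d) ((e3 Finset.univ _).trans (sum_congr rfl fun x _ => ?_))
  exact congrArg₂ (· + ·) (e2 (act x) x) (e4 _ x)

theorem block_act (x : X) (a b : Finset X × (X → ℕ)) :
  block (resAct T x) a b
    = if (x ∉ a.1 ∧ b.1 = insert x a.1) ∧ a.2 = b.2 then tone (ZMod 2) T else 0 := by
  refine (block_tens _ _ _ a b).trans ?_
  unfold mulR unitMat
  convert ite_mul_smul (x ∉ a.1 ∧ b.1 = insert x a.1) (a.2 = b.2) (tone (ZMod 2) T)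

theorem eq_add_single_iff {n k : X → ℕ} {x : X} :
  n = k + Pi.single x 1 ↔ n x ≠ 0 ∧ k = n - Pi.single x 1 := by
  constructor
  · rintro rfl
    refine ⟨by simp, ?_⟩
    ext y
    simp
  · rintro ⟨h, rfl⟩
    ext y
    by_cases hy : y = x
    · subst hy
      simp
      omega
    · simp [hy]

theorem block_d_row (a b : Finset X × (X → ℕ)) : block (resD d act) a b
  = ∑ i : Unit ⊕ X ⊕ X, if b = Sum.elim (fun _ => a) (Sum.elim (fun x => (a.1, a.2 - Pi.single x 1))
    fun x => (insert x a.1, a.2 - Pi.single x 1)) i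
    then Sum.elim (fun _ => d) (Sum.elim (fun x => if a.2 x ≠ 0 then act x else 0)
      fun x => if a.2 x ≠ 0 ∧ x ∉ a.1 then tone (ZMod 2) T else 0) i else 0 := by
  obtain ⟨Z, n⟩ := a
  obtain ⟨Z', n'⟩ := b
  rw [block_d, Fintype.sum_sum_type, Fintype.sum_sum_type, sum_add_distrib]
  simp only [Sum.elim_inl, Sum.elim_inr, Prod.mk.injEq, eq_add_single_iff, Finset.univ_unique,
    Finset.sum_singleton, ← ite_and]
  refine congrArg₂ (· + ·) ?_ (congrArg₂ (· + ·) ?_ ?_)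
  · exact if_congr (by simp only [eq_comm]) rfl rfl
  · refine sum_congr rfl fun x _ => ?_
    exact if_congr (by rw [eq_comm (a := Z)]; tauto) rfl rfl
  · refine sum_congr rfl fun x _ => ?_
    exact if_congr (by tauto) rfl rfl

theorem insert_eq_iff {Z Z' : Finset X} {x : X} :
  (x ∉ Z ∧ Z' = insert x Z) ↔ x ∈ Z' ∧ Z = Z'.erase x := by
  constructor
  · rintro ⟨h, rfl⟩
    exact ⟨Finset.mem_insert_self _ _, (Finset.erase_insert h).symm⟩
  · rintro ⟨h, rfl⟩
    exact ⟨Finset.notMem_erase _ _, (Finset.insert_erase h).symm⟩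

theorem block_d_col (a b : Finset X × (X → ℕ)) : block (resD d act) a b
  = ∑ i : Unit ⊕ X ⊕ X, if a = Sum.elim (fun _ => b) (Sum.elim (fun x => (b.1, b.2 + Pi.single x 1))
    fun x => (b.1.erase x, b.2 + Pi.single x 1)) i
    then Sum.elim (fun _ => d) (Sum.elim (fun x => act x)
      fun x => if x ∈ b.1 then tone (ZMod 2) T else 0) i else 0 := by
  obtain ⟨Z, n⟩ := a
  obtain ⟨Z', n'⟩ := b
  rw [block_d, Fintype.sum_sum_type, Fintype.sum_sum_type, sum_add_distrib]
  simp only [Sum.elim_inl, Sum.elim_inr, Prod.mk.injEq, insert_eq_iff, Finset.univ_unique,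
    Finset.sum_singleton, ← ite_and]
  refine congrArg₂ (· + ·) rfl (congrArg₂ (· + ·) rfl ?_)
  refine sum_congr rfl fun x _ => ?_
  exact if_congr (by tauto) rfl rfl

theorem block_act_row (x : X) (a b : Finset X × (X → ℕ)) :
  block (resAct T x) a b
    = ∑ _i : Unit, if b = (insert x a.1, a.2) then if x ∉ a.1 then tone (ZMod 2) T else 0 else 0 := by
  obtain ⟨Z, n⟩ := a
  obtain ⟨Z', n'⟩ := b
  rw [block_act, Finset.univ_unique, Finset.sum_singleton, ← ite_and]
  exact if_congr (by rw [Prod.mk.injEq, eq_comm (a := n)]; tauto) rfl rfl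

theorem block_act_col (x : X) (a b : Finset X × (X → ℕ)) :
  block (resAct T x) a b
    = ∑ _i : Unit, if a = (b.1.erase x, b.2) then if x ∈ b.1 then tone (ZMod 2) T else 0 else 0 := by
  obtain ⟨Z, n⟩ := a
  obtain ⟨Z', n'⟩ := b
  rw [block_act, Finset.univ_unique, Finset.sum_singleton, ← ite_and]
  exact if_congr (by rw [Prod.mk.injEq, insert_eq_iff]; tauto) rfl rfl

end resolution

section weight

variable (X : Finset U) {T T' T'' : Tangle e U}

def weight (X : Finset U) (u : U) : MvPolynomial X (ZMod 2) :=
  if h : u ∈ X then MvPolynomial.X ⟨u, h⟩ else 0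

variable (T) in
/-- The differential of the cube of resolutions. -/
def cubeD : TMat (ZMod 2) T T := ∑ᶠ c, sad (ZMod 2) T c

variable (T) in
def cubeAct (u : U) : TMat (ZMod 2) T T :=
  ∑ᶠ p, if T.col p = some u then dots (ZMod 2) T (Pi.single (T.pt p 0) 1) else 0

variable (T) in
theorem diff_weight : diff T (weight X) = polyD (cubeD T) fun x : X => cubeAct T x.1 := by
  unfold diff polyD cubeD cubeAct
  refine congrArg₂ (· + ·) ?_ ?_
  · rw [TMat.map_finsum]
    exact finsum_congr fun c => (map_tr C _ _ _).symm
  · simp only [TMat.map_finsum]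
    simp only [fsum_eq, Finset.smul_sum]
    rw [sum_comm]
    refine sum_congr rfl fun p _ => ?_
    rcases hc : T.col p with _ | u
    · refine (sum_eq_zero fun x _ => ?_).symm
      rw [if_neg (by simp), TMat.map_zero, smul_zero]
    · by_cases hu : u ∈ X
      · rw [sum_eq_single ⟨u, hu⟩]
        · rw [if_pos rfl]
          change weight X u • _ = _
          rw [weight, dif_pos hu]
          exact congrArg _ (map_tr C _ _ _).symm
        · intro x _ hx
          rw [if_neg fun h => hx (Subtype.ext (Option.some_injective _ h).symm), TMat.map_zero, smul_zero]
        · simp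
      · rw [sum_eq_zero fun x _ => ?_]
        · change weight X u • _ = _
          rw [weight, dif_neg hu, zero_smul]
        · rw [if_neg fun h => hu (by rw [Option.some.inj h]; exact x.2), TMat.map_zero, smul_zero]

theorem DBN_d (hT : T.Nice) : (T.DBN X).d = resD (cubeD T) fun x : X => cubeAct T x.1 := by
  unfold resD cubeD cubeAct
  rw [← CBN_d hT X, ← matOne_eq hT, ← funext (CBN_act hT X)]
  rfl

theorem DBN_act (hT : T.Nice) (x : X) : (T.DBN X).act x = resAct T x := by
  unfold resAct
  rw [← matOne_eq hT]
  rfl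

end weight

end

section
open TMat (mul)

variable {e U : Type} [Finite e]

open MvPolynomial

section transfer

variable {X : Type} [Fintype X] {T T' : Tangle e U}

theorem TMat.add_self (M : TMat (ZMod 2) T T') : M + M = 0 := by
  funext ε ε' V
  exact CharTwo.add_self_eq_zero _

theorem coM_mul_map (m : X → ℕ) (h : PMat X T T') (A : TMat (ZMod 2) T' T') :
  coM m (mul h (TMat.map C A)) = mul (coM m h) A := by
  have := coM_mul m 0 (fun _ => Nat.zero_le _) h (TMat.map C A)
  rw [tsub_zero] at this
  rw [this, sum_eq_single 0]
  · rw [tsub_zero, tsub_zero, coM_map, if_pos rfl]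
  · intro k _ hk
    rw [tsub_zero, coM_map, if_neg hk, TMat.mul_zero]
  · exact fun h => (h (Finset.mem_Icc.2 ⟨le_rfl, fun _ => Nat.zero_le _⟩)).elim

theorem coM_map_mul (m : X → ℕ) (h : PMat X T T') (A : TMat (ZMod 2) T T) :
  coM m (mul (TMat.map C A) h) = mul A (coM m h) := by
  have := coM_mul m 0 (fun _ => Nat.zero_le _) (TMat.map C A) h
  rw [tsub_zero] at this
  rw [this, sum_eq_single m]
  · rw [tsub_self, tsub_zero, coM_map, if_pos rfl]
  · intro k hk hkm
    rw [coM_map, if_neg, TMat.zero_mul]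
    exact fun h => hkm (le_antisymm (Finset.mem_Icc.1 hk).2 (tsub_eq_zero_iff_le.1 h))
  · exact fun h => (h (Finset.mem_Icc.2 ⟨fun _ => Nat.zero_le _, le_rfl⟩)).elim

variable (d : TMat (ZMod 2) T T) (d' : TMat (ZMod 2) T' T') (act : X → TMat (ZMod 2) T T)
  (act' : X → TMat (ZMod 2) T' T')

theorem coM_mul_polyD (m : X → ℕ) (h : PMat X T T') :
  coM m (mul h (polyD d' act')) = mul (coM m h) d'
    + ∑ x, if m x ≠ 0 then mul (coM (m - Pi.single x 1) h) (act' x) else 0 := by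
  rw [polyD, TMat.mul_add, coM_add, coM_mul_map, TMat.mul_sum, coM_sum]
  refine congrArg₂ _ rfl (sum_congr rfl fun x _ => ?_)
  rw [TMat.mul_smul, coM_X_smul, coM_mul_map]

theorem coM_polyD_mul (m : X → ℕ) (h : PMat X T T') :
  coM m (mul (polyD d act) h) = mul d (coM m h)
    + ∑ x, if m x ≠ 0 then mul (act x) (coM (m - Pi.single x 1) h) else 0 := by
  rw [polyD, TMat.add_mul, coM_add, coM_map_mul, TMat.sum_mul, coM_sum]
  refine congrArg₂ _ rfl (sum_congr rfl fun x _ => ?_)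
  rw [TMat.smul_mul, coM_X_smul, coM_map_mul]

/-! ### Blocks of products with the differential and the action -/

variable {d d' act act'}

theorem block_mul_resD (hT : T.Nice) (hT' : T'.Nice) (K : FMat X T T') (a c) :
  block (K.comp (resD d' act')) a c = mul (block K a c) d'
    + (∑ x, mul (block K a (c.1, c.2 + Pi.single x 1)) (act' x)
      + ∑ x, if x ∈ c.1 then block K a (c.1.erase x, c.2 + Pi.single x 1) else 0) := by
  rw [block_comp_right hT' _ _ a c _ _ _ fun b => block_d_col d' act' b c, Fintype.sum_sum_type,
    Fintype.sum_sum_type]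
  refine congrArg₂ _ (by simp) (congrArg₂ _ rfl (sum_congr rfl fun x _ => ?_))
  simp only [Sum.elim_inr]
  split_ifs
  · exact TMat.mul_one hT hT' _
  · exact TMat.mul_zero _

theorem block_resD_mul (hT : T.Nice) (hT' : T'.Nice) (K : FMat X T T') (a c) :
  block ((resD d act).comp K) a c = mul d (block K a c)
    + (∑ x, (if a.2 x ≠ 0 then mul (act x) (block K (a.1, a.2 - Pi.single x 1) c) else 0)
      + ∑ x, if a.2 x ≠ 0 ∧ x ∉ a.1 then block K (insert x a.1, a.2 - Pi.single x 1) c else 0) := by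
  rw [block_comp_left hT _ _ a c _ _ _ fun b => block_d_row d act a b, Fintype.sum_sum_type,
    Fintype.sum_sum_type]
  refine congrArg₂ _ (by simp) (congrArg₂ _ (sum_congr rfl fun x _ => ?_)
    (sum_congr rfl fun x _ => ?_))
  · simp only [Sum.elim_inr, Sum.elim_inl]
    split_ifs
    · rfl
    · exact TMat.zero_mul _
  · simp only [Sum.elim_inr]
    split_ifs
    · exact TMat.one_mul hT hT' _
    · exact TMat.zero_mul _

theorem block_mul_resAct (hT : T.Nice) (hT' : T'.Nice) (K : FMat X T T') (x : X) (a c) :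
  block (K.comp (resAct T' x)) a c = if x ∈ c.1 then block K a (c.1.erase x, c.2) else 0 := by
  rw [block_comp_right hT' _ _ a c _ _ _ fun b => block_act_col x b c, Finset.univ_unique,
    Finset.sum_singleton]
  split_ifs
  · exact TMat.mul_one hT hT' _
  · exact TMat.mul_zero _

theorem block_resAct_mul (hT : T.Nice) (hT' : T'.Nice) (K : FMat X T T')
  (x : X) (a c) :
  block ((resAct T x).comp K) a c = if x ∉ a.1 then block K (insert x a.1, a.2) c else 0 := by
  rw [block_comp_left hT _ _ a c _ _ _ fun b => block_act_row x a b, Finset.univ_unique,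
    Finset.sum_singleton]
  split_ifs
  · exact TMat.zero_mul _
  · exact TMat.one_mul hT hT' _

/-! ### Homotopies of the free resolutions and polynomial homotopies -/

/-- Homotopies between the free resolutions of cubes. -/
def ResHomotopic (d : TMat (ZMod 2) T T) (d' : TMat (ZMod 2) T' T') (act : X → TMat (ZMod 2) T T)
  (act' : X → TMat (ZMod 2) T' T') (f : FMat X T T') : Prop :=
  ∃ H : FMat X T T', H.Bounded ∧
    (∀ x, (resAct T x).comp H = H.comp (resAct T' x)) ∧
    f = H.comp (resD d' act') + (resD d act).comp H

theorem toFree_linear (hT : T.Nice) (hT' : T'.Nice) (h : PMat X T T') (x : X) :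
  (resAct T x).comp (toFree h) = (toFree h).comp (resAct T' x) := by
  refine block_ext fun a c => ?_
  rw [block_mul_resAct hT hT', block_resAct_mul hT hT', block_toFree, block_toFree]
  simp only [← ite_and]
  refine if_congr ?_ rfl rfl
  have := insert_eq_iff (Z := a.1) (Z' := c.1) (x := x)
  rw [eq_comm (a := insert x a.1), ← and_assoc, this, and_assoc]

theorem toFree_bounded (h : PMat X T T') :
  Mat.Bounded (A := T.cube.free X) (B := T'.cube.free X) (toFree h) := by
  have hb : ∃ B, ∀ ε ε' V, (h ε ε' V).totalDegree ≤ B := by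
    have h1 : ∀ ε ε', ∃ B, ∀ V, (h ε ε' V).totalDegree ≤ B := fun ε ε' => by
      obtain ⟨B, hB⟩ := (Set.finite_range fun V => (h ε ε' V).totalDegree).bddAbove
      exact ⟨B, fun V => hB ⟨V, rfl⟩⟩
    choose B hB using h1
    obtain ⟨B', hB'⟩ := (Set.finite_range fun p : (T.C → Bool) × (T'.C → Bool) => B p.1 p.2).bddAbove
    exact ⟨B', fun ε ε' V => (hB ε ε' V).trans (hB' ⟨(ε, ε'), rfl⟩)⟩
  obtain ⟨B, hB⟩ := hb
  refine ⟨Nat.card T.C + Nat.card T'.C + B, ?_⟩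
  rintro ⟨ε, Z, n⟩ ⟨ε', Z', n'⟩ hne
  have h0 : (if Z = Z' ∧ n' ≤ n then coM (n - n') h ε ε' else 0) ≠ 0 := hne
  by_cases hZ : Z = Z' ∧ n' ≤ n
  · rw [if_pos hZ] at h0
    obtain ⟨V, hV⟩ := Function.ne_iff.1 h0
    have h1 := (le_totalDegree (mem_support_iff.2 hV)).trans (hB ε ε' V)
    rw [Finsupp.sum_fintype _ _ fun _ => rfl] at h1
    have h2 : ∑ x, (n x : ℤ) = ∑ x, (n' x : ℤ) + ((∑ x, (n x - n' x) : ℕ) : ℤ) := by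
      rw [Nat.cast_sum, ← sum_add_distrib]
      refine sum_congr rfl fun x _ => ?_
      have := hZ.2 x
      push_cast [this]
      ring
    have h3 : ((∑ x, (n x - n' x) : ℕ) : ℤ) ≤ B := by exact_mod_cast h1
    have h4 := Set.ncard_le_card {c | ε c = true}
    have h5 := Set.ncard_le_card {c | ε' c = true}
    change |(({c | ε' c = true}.ncard : ℤ) - ∑ x, (n' x : ℤ)) - (({c | ε c = true}.ncard : ℤ) - ∑ x, (n x : ℤ))| ≤ _
    rw [abs_le]
    constructor <;> omega
  · exact (h0 (if_neg hZ)).elim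

variable (d d' act act') in
theorem toFree_homotopy (hT : T.Nice) (hT' : T'.Nice) (h : PMat X T T') :
  (toFree h).comp (resD d' act') + (resD d act).comp (toFree h)
    = toFree (mul h (polyD d' act') + mul (polyD d act) h) := by
  refine block_ext fun a c => ?_
  change block ((toFree h).comp (resD d' act')) a c + block ((resD d act).comp (toFree h)) a c = _
  rw [block_mul_resD hT hT', block_resD_mul hT hT', block_toFree _ a c]
  obtain ⟨Z, n⟩ := a
  obtain ⟨Z', n'⟩ := c
  simp only [block_toFree]
  have e0 : ∀ x, n' + Pi.single x 1 ≤ n ↔ n' ≤ n ∧ (n - n') x ≠ 0 := fun x => by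
    constructor
    · intro h
      have := h x
      refine ⟨le_self_add.trans h, ?_⟩
      simp at this ⊢
      omega
    · rintro ⟨h, h1⟩ y
      have := h y
      by_cases hy : y = x
      · subst hy
        simp at h1 ⊢
        omega
      · simpa [hy] using this
  have e1 : ∀ x, (n x ≠ 0 ∧ n' ≤ n - Pi.single x 1) ↔ n' + Pi.single x 1 ≤ n := fun x => by
    constructor
    · rintro ⟨h, h1⟩ y
      have := h1 y
      by_cases hy : y = x
      · subst hy
        simp at this ⊢
        omega
      · simpa [hy] using this
    · intro h
      refine ⟨?_, fun y => ?_⟩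
      · have := h x
        simp at this
        omega
      · have := h y
        by_cases hy : y = x
        · subst hy
          simp at this ⊢
          omega
        · simpa [hy] using this
  have e3 : ∑ x, (if x ∈ Z' then if Z = Z'.erase x ∧ n' + Pi.single x 1 ≤ n
        then coM (n - (n' + Pi.single x 1)) h else 0 else 0)
      = ∑ x, if n x ≠ 0 ∧ x ∉ Z then if insert x Z = Z' ∧ n' ≤ n - Pi.single x 1
        then coM (n - Pi.single x 1 - n') h else 0 else 0 := by
    refine sum_congr rfl fun x _ => ?_
    simp only [← ite_and]
    rw [tsub_tsub, add_comm n' (Pi.single x 1)]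
    refine if_congr ?_ rfl rfl
    have h1 := insert_eq_iff (Z := Z) (Z' := Z') (x := x)
    have h2 := e1 x
    rw [add_comm n'] at h2
    rw [eq_comm (a := insert x Z)]
    tauto
  rw [e3, add_add_add_comm, add_add_add_comm (∑ x, _), TMat.add_self, add_zero]
  by_cases hZ : Z = Z' ∧ n' ≤ n
  · rw [if_pos hZ, if_pos hZ, coM_add, coM_mul_polyD, coM_polyD_mul, add_add_add_comm]
    refine congrArg₂ _ (congrArg₂ _ rfl ?_) (congrArg₂ _ rfl ?_)
    · refine sum_congr rfl fun x _ => ?_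
      rw [tsub_tsub]
      by_cases hx : (n - n') x ≠ 0
      · rw [if_pos hx, if_pos ⟨hZ.1, (e0 x).2 ⟨hZ.2, hx⟩⟩]
      · rw [if_neg hx, if_neg fun h => hx ((e0 x).1 h.2).2, TMat.zero_mul]
    · refine sum_congr rfl fun x _ => ?_
      rw [tsub_tsub, tsub_tsub, add_comm n']
      by_cases hx : (n - n') x ≠ 0
      · have := (e1 x).2 ((e0 x).2 ⟨hZ.2, hx⟩)
        rw [if_pos hx, if_pos this.1, if_pos ⟨hZ.1, this.2⟩]
      · rw [if_neg hx]
        by_cases h1 : n x ≠ 0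
        · rw [if_pos h1, if_neg fun h2 => hx ((e0 x).1 ((e1 x).1 ⟨h1, h2.2⟩)).2, TMat.mul_zero]
        · rw [if_neg h1]
  · have e4 : ∀ x, mul (if Z = Z' ∧ n' + Pi.single x 1 ≤ n then coM (n - (n' + Pi.single x 1)) h
        else 0) (act' x) = 0 := fun x => by
      rw [if_neg fun h => hZ ⟨h.1, ((e0 x).1 h.2).1⟩, TMat.zero_mul]
    have e5 : ∀ x, (if n x ≠ 0 then mul (act x) (if Z = Z' ∧ n' ≤ n - Pi.single x 1
        then coM (n - Pi.single x 1 - n') h else 0) else 0) = 0 := fun x => by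
      by_cases h1 : n x ≠ 0
      · rw [if_pos h1, if_neg fun h2 => hZ ⟨h2.1, ((e0 x).1 ((e1 x).1 ⟨h1, h2.2⟩)).1⟩, TMat.mul_zero]
      · rw [if_neg h1]
    simp only [e4, e5, if_neg hZ, TMat.zero_mul, TMat.mul_zero, add_zero, Finset.sum_const_zero]

theorem resHomotopic_toFree (hT : T.Nice) (hT' : T'.Nice) (h : PMat X T T') :
  ResHomotopic d d' act act' (toFree (mul h (polyD d' act') + mul (polyD d act) h)) :=
  ⟨toFree h, toFree_bounded h, toFree_linear hT hT' h, (toFree_homotopy d d' act act' hT hT' h).symm⟩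

/-! ### Extracting a polynomial matrix from a linear map -/

def mulRight (A : TMat (ZMod 2) T' T') : Module.End (ZMod 2) (TMat (ZMod 2) T T') :=
  (TMat.mulₗ (ZMod 2) T T' T').flip A

def mulLeft (A : TMat (ZMod 2) T T) : Module.End (ZMod 2) (TMat (ZMod 2) T T') :=
  TMat.mulₗ (ZMod 2) T T T' A

variable (hr : ∀ x y, Commute (mulRight (T := T) (act' x)) (mulRight (act' y)))

/-- The image of `1 ⊗ ξ^{-m}` in the coefficient of `ξ^0`, in which `R_X` acts through `act'`. -/
def extract (K : FMat X T T') (m : X → ℕ) : TMat (ZMod 2) T T' :=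
  ∑ Z, monomialAct (fun x => mulRight (act' x)) hr Z (block K (∅, m) (Z, 0))

theorem extract_add (K K' : FMat X T T') (m : X → ℕ) :
  extract hr (K + K') m = extract hr K m + extract hr K' m := by
  unfold extract
  rw [← sum_add_distrib]
  exact sum_congr rfl fun Z _ => map_add _ (block K (∅, m) (Z, 0)) (block K' (∅, m) (Z, 0))

theorem extract_toFree (M : PMat X T T') (m : X → ℕ) :
  extract hr (toFree M) m = coM m M := by
  rw [extract, sum_eq_single ∅]
  · rw [block_toFree, if_pos ⟨rfl, fun _ => Nat.zero_le _⟩]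
    exact congrArg (fun n => coM n M) (tsub_zero m)
  · intro Z _ hZ
    rw [block_toFree, if_neg fun h => hZ h.1.symm, map_zero]
  · exact fun h => (h (Finset.mem_univ _)).elim

theorem extract_eq_zero (K : FMat X T T') (m : X → ℕ)
  (h : ∀ Z, block K (∅, m) (Z, 0) = 0) : extract hr K m = 0 :=
  sum_eq_zero fun Z _ => by rw [h, map_zero]

theorem extract_mul_resD (hT : T.Nice) (hT' : T'.Nice) (h0 : ∀ x, mulRight (T := T) (act' x) * mulRight (act' x) = 0)
  (hd : ∀ x, Commute (mulRight (T := T) d') (mulRight (act' x)))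
  (K : FMat X T T') (m : X → ℕ) :
  extract hr (K.comp (resD d' act')) m = mul (extract hr K m) d' := by
  have e1 : ∀ (A : TMat (ZMod 2) T' T') (hA : ∀ x, Commute (mulRight (T := T) A) (mulRight (act' x)))
      (f : Finset X → TMat (ZMod 2) T T'),
      ∑ Z, monomialAct (fun x => mulRight (act' x)) hr Z (mul (f Z) A)
        = mul (∑ Z, monomialAct (fun x => mulRight (act' x)) hr Z (f Z)) A := fun A hA f => by
    rw [TMat.sum_mul]
    exact sum_congr rfl fun Z _ =>
      (LinearMap.congr_fun (commute_monomialAct _ hr (mulRight A) hA Z).eq (f Z)).symm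
  unfold extract
  simp only [block_mul_resD hT hT', map_add, map_sum, sum_add_distrib]
  rw [e1 d' hd]
  refine (congrArg₂ _ rfl ((congrArg₂ _ sum_comm sum_comm).trans ?_)).trans (add_zero _)
  rw [← sum_add_distrib]
  refine sum_eq_zero fun x _ => ?_
  have e2 := sum_monomialAct_erase _ hr h0 x fun Z => block K (∅, m) (Z, 0 + Pi.single x 1)
  simp only [apply_ite (monomialAct _ hr _), map_zero]
  rw [e2, e1 (act' x) fun y => hr x y]
  exact TMat.add_self _

theorem extract_resD_mul (hT : T.Nice) (hT' : T'.Nice) (h0 : ∀ x, mulRight (T := T) (act' x) * mulRight (act' x) = 0)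
  (K : FMat X T T') (hK : ∀ x, (resAct T x).comp K = K.comp (resAct T' x))
  (m : X → ℕ) :
  extract hr ((resD d act).comp K) m = mul d (extract hr K m)
    + (∑ x, (if m x ≠ 0 then mul (act x) (extract hr K (m - Pi.single x 1)) else 0)
      + ∑ x, if m x ≠ 0 then mul (extract hr K (m - Pi.single x 1)) (act' x) else 0) := by
  have e1 : ∀ (A : TMat (ZMod 2) T T) (f : Finset X → TMat (ZMod 2) T T'),
      ∑ Z, monomialAct (fun x => mulRight (act' x)) hr Z (mul A (f Z))
        = mul A (∑ Z, monomialAct (fun x => mulRight (act' x)) hr Z (f Z)) := fun A f => by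
    rw [TMat.mul_sum]
    refine sum_congr rfl fun Z _ =>
      (LinearMap.congr_fun (commute_monomialAct _ hr (mulLeft A) (fun x => ?_) Z).eq (f Z)).symm
    exact LinearMap.ext fun M => (TMat.mul_assoc hT hT hT' hT' A M (act' x)).symm
  have e2 : ∀ n x Z, block K (insert x ∅, n) (Z, 0)
      = if x ∈ Z then block K (∅, n) (Z.erase x, 0) else 0 := fun n x Z => by
    have := congrArg (fun L => block L (∅, n) (Z, 0)) (hK x)
    simp only [block_mul_resAct hT hT', block_resAct_mul hT hT'] at this
    rwa [if_pos (Finset.notMem_empty x)] at this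
  unfold extract
  simp only [block_resD_mul hT hT', map_add, map_sum, sum_add_distrib]
  rw [e1 d]
  refine congrArg₂ _ rfl (congrArg₂ _ ?_ ?_)
  · rw [sum_comm]
    refine sum_congr rfl fun x _ => ?_
    by_cases hx : m x ≠ 0
    · simp only [if_pos hx]
      exact e1 _ _
    · simp only [if_neg hx, map_zero, Finset.sum_const_zero]
  · rw [sum_comm]
    refine sum_congr rfl fun x _ => ?_
    by_cases hx : m x ≠ 0
    · simp only [if_pos hx, if_pos (show m x ≠ 0 ∧ x ∉ (∅ : Finset X) from ⟨hx, Finset.notMem_empty x⟩), e2]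
      have e3 := sum_monomialAct_erase _ hr h0 x fun Z => block K (∅, m - Pi.single x 1) (Z, 0)
      simp only [apply_ite (monomialAct _ hr _), map_zero]
      exact e3
    · simp only [if_neg hx, if_neg (show ¬ (m x ≠ 0 ∧ x ∉ (∅ : Finset X)) from fun h => hx h.1), map_zero,
        Finset.sum_const_zero]

theorem Mat.Bounded.exists_extract {K : FMat X T T'} (hK : K.Bounded) :
  ∃ h : PMat X T T', ∀ m, coM m h = extract hr K m := by
  obtain ⟨N, hN⟩ := hK
  set B : ℕ := N.toNat + Nat.card T.C
  have h1 : ∀ m, ¬ m ≤ (fun _ => B) → extract hr K m = 0 := fun m hm => by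
    obtain ⟨y, hy⟩ := not_forall.1 hm
    refine extract_eq_zero hr K m fun Z => ?_
    funext (ε : T.C → Bool) (ε' : T'.C → Bool)
    by_contra hne
    have h2 := hN (ε, ∅, m) (ε', Z, 0) hne
    change |(({c | ε' c = true}.ncard : ℤ) - ∑ x : X, ((0 : ℕ) : ℤ)) - (({c | ε c = true}.ncard : ℤ) - ∑ x, (m x : ℤ))| ≤ N at h2
    have h3 : ((m y : ℕ) : ℤ) ≤ ∑ x, (m x : ℤ) :=
      Finset.single_le_sum (f := fun x => (m x : ℤ)) (fun x _ => Int.natCast_nonneg _) (Finset.mem_univ y)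
    have h4 := Set.ncard_le_card {c | ε c = true}
    have h5 := le_abs_self ((({c | ε' c = true}.ncard : ℤ) - ∑ x : X, ((0 : ℕ) : ℤ)) - (({c | ε c = true}.ncard : ℤ) - ∑ x, (m x : ℤ)))
    simp only [Nat.cast_zero, Finset.sum_const_zero] at h2 h5
    have h6 := Int.self_le_toNat N
    replace hy : B < m y := not_le.1 hy
    change N.toNat + Nat.card T.C < m y at hy
    omega
  refine ⟨fun ε ε' V => ∑ m ∈ Finset.Icc 0 (fun _ => B),
    monomial (Finsupp.equivFunOnFinite.symm m) (extract hr K m ε ε' V), fun m => ?_⟩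
  funext ε ε' V
  refine (coeff_sum _ _ _).trans ?_
  simp only [coeff_monomial, EmbeddingLike.apply_eq_iff_eq, Finset.sum_ite_eq']
  split_ifs with h
  · rfl
  · rw [h1 m fun h' => h (Finset.mem_Icc.2 ⟨fun _ => Nat.zero_le _, h'⟩)]
    rfl

theorem ResHomotopic.exists_poly (hT : T.Nice) (hT' : T'.Nice)
  (hr : ∀ x y, Commute (mulRight (T := T) (act' x)) (mulRight (act' y)))
  (h0 : ∀ x, mulRight (T := T) (act' x) * mulRight (act' x) = 0)
  (hd : ∀ x, Commute (mulRight (T := T) d') (mulRight (act' x)))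
  {f : PMat X T T'} (h : ResHomotopic d d' act act' (toFree f)) :
  ∃ h, f = mul h (polyD d' act') + mul (polyD d act) h := by
  obtain ⟨H, hb, hl, hf⟩ := h
  obtain ⟨h, hh⟩ := Mat.Bounded.exists_extract hr hb
  refine ⟨h, coM_ext fun m => ?_⟩
  rw [← extract_toFree hr, hf]
  refine (extract_add hr (H.comp (resD d' act')) ((resD d act).comp H) m).trans ?_
  rw [extract_mul_resD hr hT hT' h0 hd, extract_resD_mul hr hT hT' h0 H hl, coM_add, coM_mul_polyD,
    coM_polyD_mul]
  simp only [hh]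
  abel

end transfer

end

section
open TMat (mul)

variable {U : Type}

/-- The segments at the ends of the segments of a table. -/
def tableEnds {n s c p : ℕ} (cr : Fin c → Fin 4 → Fin s) (pt : Fin p → Fin 2 → Fin s)
  (bd : Fin n → Fin s) : (Fin c × Fin 4) ⊕ (Fin p × Fin 2) ⊕ Fin n → Fin s
  | .inl (c, i) => cr c i
  | .inr (.inl (p, i)) => pt p i
  | .inr (.inr q) => bd q

theorem table_wf {n s c p : ℕ} (cr : Fin c → Fin 4 → Fin s) (pt : Fin p → Fin 2 → Fin s)
  (col : Fin p → Option U) (bd : Fin n → Fin s)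
  (h : ∀ s, (Finset.univ.filter fun x => tableEnds cr pt bd x = s).card = 0 ∨
    (Finset.univ.filter fun x => tableEnds cr pt bd x = s).card = 2) :
  (table s cr pt col bd).WF := fun (t : Fin s) => by
  have e : (tableEnds cr pt bd ⁻¹' {t}).ncard
      = (Finset.univ.filter fun x => tableEnds cr pt bd x = t).card := by
    rw [← Set.ncard_coe_finset]
    congr 1
    ext x
    rw [Finset.mem_coe, Finset.mem_filter]
    exact ⟨fun h => ⟨Finset.mem_univ _, h⟩, fun h => h.2⟩
  have e' : (table s cr pt col bd).ends = tableEnds cr pt bd := by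
    funext x
    rcases x with ⟨_, _⟩ | ⟨_, _⟩ | _ <;> rfl
  rw [e']
  refine e ▸ ?_
  convert h t

namespace Kind

theorem arc_wf : (arc : Tangle (Fin 2) U).WF := table_wf _ _ _ _ (by decide)

theorem kink_wf : ∀ v, (kink v : Tangle (Fin 2) U).WF
  | false => table_wf _ _ _ _ (by decide)
  | true => table_wf _ _ _ _ (by decide)

theorem arcs_wf : (arcs : Tangle (Fin 4) U).WF := table_wf _ _ _ _ (by decide)

theorem bigon_wf : (bigon : Tangle (Fin 4) U).WF := table_wf _ _ _ _ (by decide)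

theorem triangle_wf : ∀ v, (triangle v : Tangle (Fin 6) U).WF
  | false => table_wf _ _ _ _ (by decide)
  | true => table_wf _ _ _ _ (by decide)

theorem triangle'_wf : ∀ v, (triangle' v : Tangle (Fin 6) U).WF
  | false => table_wf _ _ _ _ (by decide)
  | true => table_wf _ _ _ _ (by decide)

theorem twoPoints_wf (x y : U) : (twoPoints x y).WF := table_wf _ _ _ _ (by decide)

theorem leg_wf (x : U) (k : Fin 4) : (leg x k).WF := table_wf _ _ _ _ (by revert k; decide)

theorem src_wf : ∀ k : Kind U, k.src.WF
  | iso | birth | death | saddle => table_wf _ _ _ _ (by decide)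
  | r1 _ | cup _ => arc_wf
  | r1' v => kink_wf v
  | r2 => arcs_wf
  | r2' => bigon_wf
  | r3 v => triangle_wf v
  | cap x => twoPoints_wf x x
  | swap x y => twoPoints_wf x y
  | slide x v => leg_wf x (if v then 1 else 0)

theorem tgt_wf : ∀ k : Kind U, k.tgt.WF
  | iso | birth | death | saddle => table_wf _ _ _ _ (by decide)
  | r1' _ | cap _ => arc_wf
  | r1 v => kink_wf v
  | r2' => arcs_wf
  | r2 => bigon_wf
  | r3 v => triangle'_wf v
  | cup x => twoPoints_wf x x
  | swap x y => twoPoints_wf y x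
  | slide x v => leg_wf x (if v then 3 else 2)

end Kind

variable {e : Type} [Finite e] {R S : Type} [CommRing R] [CommRing S] (c : ZMod 2 →+* R) (ξ : U → R)

def Kind.poly (k : Kind U) : TMat R k.src k.tgt :=
  TMat.map c k.map + k.slideCol.elim 0 fun u => ξ u • TMat.map c k.slideH

def Step.poly {T T' : Tangle e U} (m : Step T T') : TMat R T T' :=
  mul (mul (TMat.map c m.before.cyl) (fillR m.E (m.kind.poly c ξ))) (TMat.map c m.after.cyl)

def Movie.poly : {T T' : Tangle e U} → Movie T T' → TMat R T T'
  | _, _, .nil T => tone R T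
  | _, _, .cons m M => mul (m.poly c ξ) M.poly

section map

variable (ψ : R →+* S)

theorem Kind.map_poly (k : Kind U) :
  TMat.map ψ (k.poly c ξ) = k.poly (ψ.comp c) fun u => ψ (ξ u) := by
  unfold Kind.poly
  rw [TMat.map_add]
  refine congrArg₂ _ rfl ?_
  rcases k.slideCol with _ | u
  · exact TMat.map_zero ψ
  · exact TMat.map_smul ψ _ _

theorem Step.map_poly {T T' : Tangle e U} (m : Step T T') :
  TMat.map ψ (m.poly c ξ) = m.poly (ψ.comp c) fun u => ψ (ξ u) := by
  unfold Step.poly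
  rw [TMat.map_mul, TMat.map_mul, map_fillR, Kind.map_poly]
  rfl

theorem map_tone {T : Tangle e U} : TMat.map ψ (tone R T) = tone S T := map_tr ψ _ _ _

theorem Movie.map_poly : {T T' : Tangle e U} → (M : Movie T T') →
  TMat.map ψ (M.poly c ξ) = M.poly (ψ.comp c) fun u => ψ (ξ u)
  | _, _, .nil T => map_tone ψ
  | _, _, .cons m M => by
    rw [Movie.poly, TMat.map_mul, m.map_poly, M.map_poly]
    rfl

end map

section fill

variable {h : Type} [Finite h] {E : Tangle (h ⊕ e) U} {L L' : Tangle h U}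

theorem fillR_add (φ φ' : TMat R L L') : fillR E (φ + φ') = fillR E φ + fillR E φ' := by
  funext ε ε'
  change _ = fillR E φ ε ε' + fillR E φ' ε ε'
  by_cases hc : ∀ c, ε (.inr c) = ε' (.inr c)
  · simp only [fillR, dif_pos hc]
    exact map_add (Cob.linear R _) _ _
  · simp only [fillR_ne _ hc, add_zero]

theorem fillR_smul (r : R) (φ : TMat R L L') : fillR E (r • φ) = r • fillR E φ := by
  funext ε ε'
  change _ = r • fillR E φ ε ε'
  by_cases hc : ∀ c, ε (.inr c) = ε' (.inr c)
  · simp only [fillR, dif_pos hc]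
    exact map_smul (Cob.linear R _) _ _
  · simp only [fillR_ne _ hc, smul_zero]

theorem fillR_zero : fillR E (0 : TMat R L L') = 0 := by
  have := fillR_smul (E := E) 0 (0 : TMat R L L')
  rwa [zero_smul, zero_smul] at this

end fill

open MvPolynomial

variable {T T' : Tangle e U} (X : Finset U)

theorem toFree_zero {X : Type} [Fintype X] : toFree (0 : PMat X T T') = 0 := by
  refine block_ext fun a b => ?_
  rw [block_toFree, coM_zero, ite_self]
  rfl

theorem toFree_weight_smul (y : U) (H : TMat (ZMod 2) T T') :
  (∑ x : X, if y = x.1 then liftXi X x H else 0)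
    = toFree (weight X y • TMat.map C H) := by
  unfold weight
  split_ifs with hy
  · rw [sum_eq_single (⟨y, hy⟩ : X), if_pos rfl]
    · exact toFree_X_smul (⟨y, hy⟩ : X) H
    · intro x _ hx
      exact if_neg fun h => hx (Subtype.ext h.symm)
    · exact fun h => (h (Finset.mem_univ _)).elim
  · rw [zero_smul, toFree_zero]
    exact sum_eq_zero fun x _ => if_neg fun (h' : y = x.1) => hy (h'.symm ▸ x.2)

theorem Step.IsElementary.fill_src_nice {m : Step T T'} (hm : m.IsElementary) :
  (m.E.fill m.kind.src).Nice := fill_nice m.kind.src_wf.nice hm.wf.nice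

theorem Step.IsElementary.fill_tgt_nice {m : Step T T'} (hm : m.IsElementary) :
  (m.E.fill m.kind.tgt).Nice := fill_nice m.kind.tgt_wf.nice hm.wf.nice

theorem Step.DBN_eq {m : Step T T'} (hm : m.E.WF) :
  m.DBN X = toFree (m.poly C (weight X)) := by
  have e1 : lift X (fillMap m.E _ _ m.kind.map)
      + (∑ y : X, if m.kind.slideCol = some y.1 then liftXi X y (fillMap m.E _ _ m.kind.slideH) else 0)
      = toFree (fillR m.E (m.kind.poly C (weight X))) := by
    rw [Kind.poly, fillR_add, toFree_add, ← map_fillR C m.kind.map, fillMap_eq hm.nice,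
      fillMap_eq hm.nice]
    refine congrArg₂ (· + ·) (toFree_map _) ?_
    rcases m.kind.slideCol with _ | u
    · refine Eq.trans ?_ ((congrArg toFree fillR_zero).trans toFree_zero).symm
      exact sum_eq_zero fun y _ => if_neg (Option.some_ne_none _).symm
    · refine Eq.trans ?_ ((toFree_weight_smul X u _).trans (congrArg toFree
        ((congrArg _ (map_fillR C _)).trans (fillR_smul _ _).symm)))
      exact sum_congr rfl fun y _ => if_congr Option.some_inj rfl rfl
  unfold Step.DBN Step.poly
  rw [e1]
  refine (congrArg₂ Mat.comp (congrArg₂ Mat.comp (toFree_map m.before.cyl) rfl)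
    (toFree_map m.after.cyl)).trans ?_
  refine (congrArg (fun K => Mat.comp K (toFree (TMat.map C m.after.cyl)))
    (toFree_mul (fill_nice m.kind.src_wf.nice hm.nice) _ _)).trans ?_
  exact toFree_mul (fill_nice m.kind.tgt_wf.nice hm.nice) _ _

theorem Movie.IsDecorated.wf_src {X : Finset U} : {T T' : Tangle e U} → {M : Movie T T'} →
  M.IsDecorated X → T.WF ∧ T.Pointed X
  | _, _, .nil _, h => h
  | _, _, .cons _ _, h => ⟨h.1, h.2.1⟩

theorem Movie.IsDecorated.wf_tgt {X : Finset U} : {T T' : Tangle e U} → {M : Movie T T'} →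
  M.IsDecorated X → T'.WF ∧ T'.Pointed X
  | _, _, .nil _, h => h
  | _, _, .cons _ M, h => wf_tgt (M := M) h.2.2.2

theorem Movie.DBN_eq : {T T' : Tangle e U} → {M : Movie T T'} → M.IsDecorated X →
  M.DBN X = toFree (M.poly C (weight X))
  | _, _, .nil T, h => by
    refine Eq.trans ?_ (congrArg toFree (map_tone C))
    rw [← matOne_eq h.1.nice]
    exact toFree_map _
  | _, _, .cons (T' := T') m M, h => by
    refine (congrArg₂ Mat.comp (Step.DBN_eq X h.2.2.1.wf) (Movie.DBN_eq (M := M) h.2.2.2)).trans ?_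
    exact toFree_mul h.2.2.2.wf_src.1.nice _ _

section glue

variable {I o : Type} [Finite I] [Finite o] {E : I → Type} [∀ i, Finite (E i)] {D : ArcDiagram E o}
  [CharP R 2]

theorem Kind.poly_iso : ∀ k : Kind U, k = .iso → k.poly c ξ = fun _ _ => 1
  | _, rfl => by
    funext ε ε' V
    refine (add_zero _).trans ?_
    change c (if V = ∅ then 1 else 0) = 1
    have : IsEmpty (Circ ((iso : Kind U).src.res ε) ((iso : Kind U).tgt.res ε')) :=
      ⟨fun q => by obtain ⟨s, _⟩ := q.exists_rep; exact s.elim Fin.elim0 Fin.elim0⟩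
    rw [if_pos (Set.eq_empty_of_isEmpty V), map_one]

variable {T T' : ∀ i, Tangle (E i) U}

theorem glueStep_poly (hD : D.WF) (i₀ : I) (m : ∀ i, Step (T i) (T' i)) (iso : ∀ i, i ≠ i₀ → (m i).kind = .iso)
  (hm : ∀ i, (m i).IsElementary) (hT : ∀ i, (T i).Nice) (hT' : ∀ i, (T' i).Nice) :
  (D.glueStep i₀ m).poly c ξ = phi (glueT D T) (glueT D T') fun i => (m i).poly c ξ := by
  have h1 := fun i => (hm i).fill_src_nice
  have h2 := fun i => (hm i).fill_tgt_nice
  have n0 := (glueT D T).nice hD hT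
  have n1 := (mixT D (fun i => (m i).E) (onlyAt_src i₀ m iso)).nice hD h1
  have n2 := (mixT D (fun i => (m i).E) (onlyAt_tgt i₀ m iso)).nice hD h2
  have n3 := (glueT D T').nice hD hT'
  have e2 := phi_fillR D (onlyAt_src i₀ m iso) (onlyAt_tgt i₀ m iso) hD (fun i => (hm i).wf.nice)
    (fun i => (m i).kind.src_wf.nice) (fun i => (m i).kind.tgt_wf.nice) (fun i => (m i).kind.poly c ξ)
    fun i hi => Kind.poly_iso c ξ _ (iso i hi)
  have e1 := (congrArg (TMat.map c) (glueStep_before i₀ m iso hD hm hT h1)).trans (map_phi c _ _ _)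
  have e3 := (congrArg (TMat.map c) (glueStep_after i₀ m iso hD hm h2 hT')).trans (map_phi c _ _ _)
  refine (congrArg₂ mul (congrArg₂ mul e1 e2.symm) e3).trans ?_
  refine (congrArg₂ mul (phi_mul _ _ _ hD hT h1 h2 n0 n1 n2 _ _) rfl).trans ?_
  exact phi_mul _ _ _ hD hT h2 hT' n0 n2 n3 _ _

theorem JointMovie.glue_poly (hD : D.WF) (X : I → Finset U) : {T T' : ∀ i, Tangle (E i) U} → (M : JointMovie T T') →
  (∀ i, (M.movie i).IsDecorated (X i)) →
  (M.glue D).poly c ξ = phi (glueT D T) (glueT D T') fun i => (M.movie i).poly c ξ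
  | _, _, .nil T, h => ((glueT D T).phi_tone hD fun i => (h i).1.nice).symm
  | T, T'', .cons (T' := T') i₀ m iso M, h => by
    have hT := fun i => (h i).1.nice
    have hM := fun i => (h i).2.2.2
    have hT' : ∀ i, (T' i).Nice := fun i => (hM i).wf_src.1.nice
    have hT'' : ∀ i, (T'' i).Nice := fun i => (hM i).wf_tgt.1.nice
    refine (congrArg₂ mul (glueStep_poly c ξ hD i₀ m iso (fun i => (h i).2.2.1) hT hT')
      (JointMovie.glue_poly hD X M hM)).trans ?_
    exact phi_mul _ _ _ hD hT hT' hT'' ((glueT D T).nice hD hT) ((glueT D T').nice hD hT')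
      ((glueT D T'').nice hD hT'') _ _

end glue

variable [CharP R 2]

theorem Step.poly_closed {m : Step T T'} (hm : m.IsElementary) (hT : T.Nice) (hT' : T'.Nice)
  (hk : Closed ξ (m.kind.poly c ξ)) : Closed ξ (m.poly c ξ) := by
  unfold Step.poly
  rw [hm.before.cyl_eq hT, hm.after.cyl_eq hm.fill_tgt_nice, map_cyl, map_cyl]
  exact ((TIso.cyl_closed R _ hT).mul hT hm.fill_src_nice hm.fill_tgt_nice
    (fillR_closed m.kind.src_wf.nice m.kind.tgt_wf.nice hm.wf.nice hk)).mul hT hm.fill_tgt_nice hT'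
    (TIso.cyl_closed R _ hm.fill_tgt_nice)

theorem Movie.poly_closed (hk : ∀ k : Kind U, Closed ξ (k.poly c ξ)) {X : Finset U} :
  {T T' : Tangle e U} → {M : Movie T T'} → M.IsDecorated X → Closed ξ (M.poly c ξ)
  | _, _, .nil T, h => Closed.one ξ h.1.nice
  | _, _, .cons _ _, h => (Step.poly_closed c ξ h.2.2.1 h.1.nice h.2.2.2.wf_src.1.nice (hk _)).mul
    h.1.nice h.2.2.2.wf_src.1.nice h.2.2.2.wf_tgt.1.nice (Movie.poly_closed hk h.2.2.2)

end

section
open MvPolynomial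

variable {e U : Type} [Finite e] {R : Type} [CommRing R]

section congr

variable (c : ZMod 2 →+* R) {ξ ξ' : U → R} {X : Finset U} (hξ : ∀ u ∈ X, ξ u = ξ' u)

theorem Kind.poly_congr {k : Kind U} (h : ∀ u ∈ k.slideCol, ξ u = ξ' u) : k.poly c ξ = k.poly c ξ' := by
  unfold Kind.poly
  rcases hk : k.slideCol with _ | u
  · rfl
  · simp only [Option.elim, h u hk]

theorem Kind.exists_slideCol : ∀ {k : Kind U} {u : U}, k.slideCol = some u → ∃ p, k.src.col p = some u
  | slide _ _, _, h => ⟨(0 : Fin 1), h⟩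

include hξ

theorem Movie.poly_congr : {T T' : Tangle e U} → {M : Movie T T'} → M.IsDecorated X →
  M.poly c ξ = M.poly c ξ'
  | _, _, .nil _, _ => rfl
  | T, _, .cons m M, h => by
    refine congrArg₂ TMat.mul ?_ (Movie.poly_congr h.2.2.2)
    unfold Step.poly
    rw [Kind.poly_congr c]
    intro u hu
    obtain ⟨p, hp⟩ := Kind.exists_slideCol hu
    obtain ⟨σ, hσ⟩ := h.2.2.1.before.pt
    have h1 : (m.E.fill m.kind.src).col (.inl (.inl p)) = some u := hp
    have h2 := (hσ (σ.symm ⟨.inl (.inl p), by rw [h1]; exact Option.some_ne_none u⟩)).1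
    rw [Equiv.apply_symm_apply] at h2
    exact hξ u (h.2.1 _ u (h2.symm.trans h1))

end congr

section commute

variable {T T' : Tangle e U} (hT : T.Nice) (hT' : T'.Nice)

theorem mulRight_cubeAct (u : U) : ∃ s : Finset T'.P, mulRight (T := T) (cubeAct T' u)
  = ∑ p ∈ s, mulRight (dots (ZMod 2) T' (Pi.single (T'.pt p 0) 1)) := by
  refine ⟨Finset.univ.filter fun p => T'.col p = some u, ?_⟩
  rw [cubeAct, fsum_eq, ← Finset.sum_filter]
  exact map_sum ((TMat.mulₗ (ZMod 2) T T' T').flip) _ _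

include hT hT'

theorem commute_mulRight_dots (s t : T'.S) :
  Commute (mulRight (T := T) (dots (ZMod 2) T' (Pi.single s 1)))
    (mulRight (dots (ZMod 2) T' (Pi.single t 1))) :=
  LinearMap.ext fun M => (mul_dots_comm hT hT' M s t).symm

theorem commute_mulRight_cubeAct (u v : U) :
  Commute (mulRight (T := T) (cubeAct T' u)) (mulRight (cubeAct T' v)) := by
  obtain ⟨s, hs⟩ := mulRight_cubeAct (T := T) (T' := T') u
  obtain ⟨t, ht⟩ := mulRight_cubeAct (T := T) (T' := T') v
  rw [hs, ht]
  exact Commute.sum_left _ _ _ fun p _ => Commute.sum_right _ _ _ fun q _ =>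
    commute_mulRight_dots hT hT' _ _

theorem mulRight_cubeAct_sq (u : U) :
  mulRight (T := T) (cubeAct T' u) * mulRight (cubeAct T' u) = 0 := by
  obtain ⟨s, hs⟩ := mulRight_cubeAct (T := T) (T' := T') u
  rw [hs]
  refine sum_sq_eq_zero (fun f => LinearMap.ext fun M => TMat.add_self (f M)) s _
    (fun p q => commute_mulRight_dots hT hT' _ _) fun p => ?_
  exact LinearMap.ext fun M => mul_dots_sq hT hT' M _

theorem commute_mulRight_cubeD (u : U) :
  Commute (mulRight (T := T) (cubeD T')) (mulRight (cubeAct T' u)) := by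
  obtain ⟨s, hs⟩ := mulRight_cubeAct (T := T) (T' := T') u
  have h : mulRight (T := T) (cubeD T') = ∑ c, mulRight (sad (ZMod 2) T' c) := by
    rw [cubeD, fsum_eq]
    exact map_sum ((TMat.mulₗ (ZMod 2) T T' T').flip) _ _
  rw [hs, h]
  refine Commute.sum_left _ _ _ fun c _ => Commute.sum_right _ _ _ fun p _ => LinearMap.ext fun M => ?_
  change TMat.mul (TMat.mul M (dots _ _ _)) (sad _ _ _) = TMat.mul (TMat.mul M (sad _ _ _)) (dots _ _ _)
  rw [TMat.mul_assoc hT hT' hT' hT', TMat.mul_assoc hT hT' hT' hT']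
  exact congrArg _ (dots_comm_tr hT' _ _ _ _)

/-- Homotopies between the free resolutions correspond to homotopies with polynomial weights. -/
theorem homotopic_iff (X : Finset U) (f g : PMat X T T') :
  RComplex.Homotopic (T.DBN X) (T'.DBN X) (toFree f) (toFree g) ↔ THomotopic (weight X) f g := by
  have e : RComplex.Homotopic (T.DBN X) (T'.DBN X) (toFree f) (toFree g)
      ↔ ResHomotopic (cubeD T) (cubeD T') (fun x : X => cubeAct T x.1) (fun x : X => cubeAct T' x.1)
        (toFree (f - g)) := by
    unfold RComplex.Homotopic RComplex.Linear ResHomotopic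
    rw [DBN_d X hT, DBN_d X hT', toFree_sub]
    simp only [DBN_act X hT, DBN_act X hT']
    rfl
  rw [e, THomotopic, diff_weight, diff_weight]
  constructor
  · exact fun h => h.exists_poly hT hT' (fun _ _ => commute_mulRight_cubeAct hT hT' _ _)
      (fun _ => mulRight_cubeAct_sq hT hT' _) fun _ => commute_mulRight_cubeD hT hT' _
  · rintro ⟨h, hh⟩
    rw [hh]
    exact resHomotopic_toFree hT hT' h

end commute

theorem THomotopic.map {S : Type} [CommRing S] (ψ : R →+* S) {T T' : Tangle e U} {ξ : U → R} {f g : TMat R T T'}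
  (h : THomotopic ξ f g) : THomotopic (fun u => ψ (ξ u)) (TMat.map ψ f) (TMat.map ψ g) := by
  obtain ⟨H, hH⟩ := h
  refine ⟨TMat.map ψ H, ?_⟩
  rw [← TMat.map_sub, hH, TMat.map_add, TMat.map_mul, TMat.map_mul, map_diff, map_diff]

theorem THomotopic.congr {T T' : Tangle e U} {ξ ξ' : U → R} {f g : TMat R T T'} (h : THomotopic ξ f g)
  {X : Finset U} (hξ : ∀ u ∈ X, ξ u = ξ' u) (hT : T.Pointed X) (hT' : T'.Pointed X) :
  THomotopic ξ' f g := by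
  obtain ⟨H, hH⟩ := h
  refine ⟨H, ?_⟩
  rw [hH, diff_congr fun p u hu => hξ u (hT p u hu), diff_congr fun p u hu => hξ u (hT' p u hu)]

theorem weight_rename {X Y : Finset U} (h : X ⊆ Y) {u : U} (hu : u ∈ X) :
  rename (fun x : X => (⟨x.1, h x.2⟩ : Y)) (weight X u) = weight Y u := by
  rw [weight, dif_pos hu, rename_X, weight, dif_pos (h hu)]

theorem THomotopic.rename {X Y : Finset U} (hXY : X ⊆ Y) {T T' : Tangle e U} {M N : Movie T T'}
  (hM : M.IsDecorated X) (hN : N.IsDecorated X)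
  (h : THomotopic (weight X) (M.poly C (weight X)) (N.poly C (weight X))) :
  THomotopic (weight Y) (M.poly C (weight Y)) (N.poly C (weight Y)) := by
  have hξ : ∀ u ∈ X, (MvPolynomial.rename (R := ZMod 2) fun x : X => (⟨x.1, hXY x.2⟩ : Y)).toRingHom (weight X u)
      = weight Y u := fun u => weight_rename hXY
  have h1 := (h.map (MvPolynomial.rename (R := ZMod 2) fun x : X => (⟨x.1, hXY x.2⟩ : Y)).toRingHom).congr
    hξ hM.wf_src.2 hM.wf_tgt.2
  rw [Movie.map_poly, Movie.map_poly, Movie.poly_congr _ hξ hM, Movie.poly_congr _ hξ hN] at h1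
  convert h1 using 2 <;> exact Subsingleton.elim _ _

/-- A homotopy of glued movies from homotopies of the movies. -/
theorem JointMovie.homotopic_glue {I o : Type} [Finite I] [Finite o] {E : I → Type} [∀ i, Finite (E i)]
  {D : ArcDiagram E o} (hD : D.WF) {X : I → Finset U} {Y : Finset U} (hXY : ∀ i, X i ⊆ Y)
  {T T' : ∀ i, Tangle (E i) U} {M N : JointMovie T T'}
  (hk : ∀ k : Kind U, Closed (weight Y) (k.poly C (weight Y)))
  (hM : ∀ i, (M.movie i).IsDecorated (X i)) (hN : ∀ i, (N.movie i).IsDecorated (X i))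
  (h : ∀ i, THomotopic (weight (X i)) ((M.movie i).poly C (weight (X i))) ((N.movie i).poly C (weight (X i)))) :
  THomotopic (weight Y) ((M.glue D).poly C (weight Y)) ((N.glue D).poly C (weight Y)) := by
  rw [JointMovie.glue_poly _ _ hD X M hM, JointMovie.glue_poly _ _ hD X N hN]
  exact phi_homotopic _ _ hD (fun i => (hM i).wf_src.1.nice) (fun i => (hM i).wf_tgt.1.nice)
    (fun i => Movie.poly_closed C _ hk (hM i)) (fun i => Movie.poly_closed C _ hk (hN i))
    fun i => (h i).rename (hXY i) (hM i) (hN i)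

end

section
open MvPolynomial

section outside

variable {U I o : Type} [Finite I] [Finite o] {E h : I → Type} [∀ i, Finite (E i)] [∀ i, Finite (h i)]
  {D : ArcDiagram E o} {i₀ : I} {F : ∀ i, Tangle (h i ⊕ E i) U}

theorem outT_wf (hD : D.WF) (hF : ∀ i, (F i).WF) (hh : ∀ i, i ≠ i₀ → IsEmpty (h i)) :
  (outT D i₀ F).WF := by
  rintro (⟨i, s⟩ | t)
  · let g : ((F i).C × Fin 4) ⊕ ((F i).P × Fin 2) ⊕ (h i ⊕ E i) →
        ((outT D i₀ F).C × Fin 4) ⊕ ((outT D i₀ F).P × Fin 2) ⊕ (h i₀ ⊕ o) := fun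
      | .inl (c, k) => .inl (⟨i, c⟩, k)
      | .inr (.inl (p, k)) => .inr (.inl (.inl ⟨i, p⟩, k))
      | .inr (.inr (.inl q)) => .inr (.inr (.inl (collapse hh i q)))
      | .inr (.inr (.inr q)) => .inr (.inl (.inr ⟨i, q⟩, 0))
    have hg : ∀ x, (outT D i₀ F).ends (g x) = .inl ⟨i, (F i).ends x⟩ := by
      rintro (⟨c, k⟩ | ⟨p, k⟩ | q | q)
      · rfl
      · rfl
      · revert q
        refine collapse_ind hh (P := fun i q => (outT D i₀ F).ends (.inr (.inr (.inl (collapse hh i q))))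
          = .inl ⟨i, (F i).ends (.inr (.inr (.inl q)))⟩) (fun q => ?_) i
        rw [collapse_self]
        rfl
      · rfl
    have hc : Function.Injective (collapse hh i) := by
      by_cases hi : i = i₀
      · subst hi
        intro p q hpq
        rwa [collapse_self, collapse_self] at hpq
      · exact fun p => ((hh i hi).false p).elim
    have hi : Function.Injective g := by
      rintro (⟨c, k⟩ | ⟨p, k⟩ | q | q) (⟨c', k'⟩ | ⟨p', k'⟩ | q' | q') hx <;>
        first
        | exact congrArg (fun q => Sum.inr (Sum.inr (Sum.inl q))) (hc (Sum.inl.inj (Sum.inr.inj (Sum.inr.inj hx))))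
        | (cases hx <;> rfl)
    have he : (outT D i₀ F).ends ⁻¹' {.inl ⟨i, s⟩} = g '' ((F i).ends ⁻¹' {s}) := by
      refine Set.Subset.antisymm ?_ ?_
      · have key : ∀ y, (outT D i₀ F).ends y = .inl ⟨i, s⟩ → ∃ x, g x = y := by
          rintro (⟨⟨j, c⟩, k⟩ | ⟨⟨j, p⟩ | ⟨j, q⟩, k⟩ | q | q) hy
          · obtain rfl : j = i := congrArg Sigma.fst (Sum.inl.inj hy)
            exact ⟨.inl (c, k), rfl⟩
          · obtain rfl : j = i := congrArg Sigma.fst (Sum.inl.inj hy)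
            exact ⟨.inr (.inl (p, k)), rfl⟩
          · fin_cases k
            · obtain rfl : j = i := congrArg Sigma.fst (Sum.inl.inj hy)
              exact ⟨.inr (.inr (.inr q)), rfl⟩
            · cases hy
          · obtain rfl : i₀ = i := congrArg Sigma.fst (Sum.inl.inj hy)
            exact ⟨.inr (.inr (.inl q)), congrArg (fun q => Sum.inr (Sum.inr (Sum.inl q))) (collapse_self hh q)⟩
          · cases hy
        intro y hy
        obtain ⟨x, rfl⟩ := key y hy
        refine ⟨x, ?_, rfl⟩
        have := (hg x).symm.trans hy
        exact eq_of_heq (Sigma.mk.inj (Sum.inl.inj this)).2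
      · rintro _ ⟨x, hx, rfl⟩
        exact (hg x).trans (congrArg (fun s : (F i).S => (Sum.inl ⟨i, s⟩ : (Σ i, (F i).S) ⊕ D.S)) hx)
    rw [he, Set.ncard_image_of_injective _ hi]
    exact hF i s
  · let g : (Σ i, E i) ⊕ o → ((outT D i₀ F).C × Fin 4) ⊕ ((outT D i₀ F).P × Fin 2) ⊕ (h i₀ ⊕ o) := fun
      | .inl q => .inr (.inl (.inr q, 1))
      | .inr q => .inr (.inr (.inr q))
    have hg : ∀ x, (outT D i₀ F).ends (g x) = .inr (D.bd x) := by rintro (q | q) <;> rfl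
    have hi : Function.Injective g := by
      rintro (q | q) (q' | q') hx <;> cases hx <;> rfl
    have he : (outT D i₀ F).ends ⁻¹' {.inr t} = g '' (D.bd ⁻¹' {t}) := by
      refine Set.Subset.antisymm ?_ ?_
      · have key : ∀ y, (outT D i₀ F).ends y = .inr t → ∃ x, g x = y := by
          rintro (⟨⟨j, c⟩, k⟩ | ⟨⟨j, p⟩ | ⟨j, q⟩, k⟩ | q | q) hy
          · cases hy
          · cases hy
          · fin_cases k
            · cases hy
            · exact ⟨.inl ⟨j, q⟩, rfl⟩
          · cases hy
          · exact ⟨.inr q, rfl⟩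
        intro y hy
        obtain ⟨x, rfl⟩ := key y hy
        exact ⟨x, Sum.inr.inj ((hg x).symm.trans hy), rfl⟩
      · rintro _ ⟨x, hx, rfl⟩
        exact (hg x).trans (congrArg Sum.inr hx)
    rw [he, Set.ncard_image_of_injective _ hi]
    exact hD t

variable {T T' : ∀ i, Tangle (E i) U}

theorem JointMovie.DBN_glue (hD : D.WF) {X : I → Finset U} (Y : Finset U) : {T T' : ∀ i, Tangle (E i) U} →
  {M : JointMovie T T'} → (∀ i, (M.movie i).IsDecorated (X i)) →
  (M.glue D).DBN Y = toFree ((M.glue D).poly C (weight Y))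
  | _, _, .nil T, hM => by
    refine Eq.trans ?_ (congrArg toFree (map_tone C))
    rw [← matOne_eq ((glueT D T).nice hD fun i => (hM i).1.nice)]
    exact toFree_map _
  | _, _, .cons (T' := T') i₀ m iso M, hM => by
    have h1 := JointMovie.DBN_glue hD (M := M) Y fun i => (hM i).2.2.2
    have h2 := Step.DBN_eq Y (m := D.glueStep i₀ m) (outT_wf hD (fun i => (hM i).2.2.1.wf)
      fun i hi => by rw [iso i hi]; exact Fin.isEmpty)
    refine (congrArg₂ Mat.comp h2 h1).trans ?_
    exact toFree_mul ((glueT D T').nice hD fun i => (hM i).2.2.2.wf_src.1.nice) _ _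

end outside

end

section
section unit

variable {R : Type} [CommRing R] [CharP R 2] {N N' K : Type} [Finite N] [Finite N'] [Finite K]

def unitDisc (R N : Type) [CommRing R] : Set N → R := fun V => if V = ∅ then 1 else 0

/-- Only `r` and `r'` are identified by `o`. -/
def Glues (o : N' → K) (r r' : N') : Prop :=
  o r = o r' ∧ ∀ x y, o x = o y → x = y ∨ (x = r ∨ x = r') ∧ (y = r ∨ y = r')

theorem Glues.push_self {M : Type} [AddCommMonoid M] {o : N' → K} {r r' : N'} (h : Glues o r r') (w : N' → M) :
  push o w (o r) = if r = r' then w r else w r + w r' := by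
  have e : ∀ x, o x = o r ↔ x ∈ ({r, r'} : Finset N') := fun x => by
    rw [Finset.mem_insert, Finset.mem_singleton]
    constructor
    · intro hx
      rcases h.2 x r hx with h | h
      exacts [.inl h, h.1]
    · rintro (rfl | rfl)
      exacts [rfl, h.1.symm]
  rw [push_eq]
  simp only [e]
  rw [Finset.sum_ite_mem, Finset.univ_inter]
  split_ifs with hr
  · rw [← hr, Finset.pair_eq_singleton, Finset.sum_singleton]
  · exact Finset.sum_pair hr

theorem Glues.push_of_ne {M : Type} [AddCommMonoid M] {o : N' → K} {r r' y : N'} (h : Glues o r r')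
  (hy : o y ≠ o r) (w : N' → M) : push o w (o y) = w y := by
  have e : ∀ x, o x = o y ↔ x = y := fun x => ⟨fun hx => (h.2 x y hx).resolve_right fun h' =>
    hy (by rcases h'.2 with h2 | h2 <;> rw [h2]; exact h.1.symm), fun h => h ▸ rfl⟩
  rw [push_eq]
  simp [e]

attribute [-instance] fintypeOfFinite in
theorem saddle_unitDisc {i : N → K} {o : N' → K} {X : K → ℤ} {q q' : N} {r r' : N'}
  (hi : i.Surjective) (ho : o.Surjective) (gi : Glues i q q') (go : Glues o r r') (hqr : i q = o r)
  (hX : X = 2 • cnt i + 2 • cnt o - 2 • Pi.single (i q) 1) (good : ∀ k, X k ≤ 4) :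
  (Cob.mk K i o X 0).L (unitDisc R N)
    = if q = q' then dotAt r (unitDisc R N') + dotAt r' (unitDisc R N') else unitDisc R N' := by
  funext U
  have e1 : (Cob.mk K i o X 0).L (unitDisc R N) U = ev R X (push o (ind Uᶜ)) := by
    refine (finsum_eq_single _ ∅ fun V hV => ?_).trans ?_
    · rw [unitDisc, if_neg hV, zero_mul]
    · rw [unitDisc, if_pos rfl, one_mul, Cob.coef]
      refine congrArg (ev R X) ?_
      change 0 + push i (ind ∅) + push o (ind Uᶜ) = _
      rw [ind_empty, map_zero, zero_add, zero_add]
  have ci : cnt i (o r) = if q = q' then 1 else 2 := by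
    rw [← hqr]
    refine (gi.push_self _).trans ?_
    split_ifs <;> rfl
  have co : cnt o (o r) = if r = r' then 1 else 2 := by
    refine (go.push_self _).trans ?_
    split_ifs <;> rfl
  have X0 : X (o r) = 2 * cnt i (o r) + 2 * cnt o (o r) - 2 := by
    rw [hX, hqr]
    simp
  have hne : ∀ y, o y ≠ o r → X (o y) = 4 ∧ push o (ind Uᶜ) (o y) = ind Uᶜ y := fun y hy => by
    obtain ⟨x, hx⟩ := hi (o y)
    have h1 : cnt i (o y) = 1 := hx ▸ gi.push_of_ne (by rwa [hx, hqr]) _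
    have h2 : cnt o (o y) = 1 := go.push_of_ne hy _
    refine ⟨?_, go.push_of_ne hy _⟩
    rw [hX, hqr]
    simp [h1, h2, hy]
  have key : (∀ k, X k = 4 ∧ push o (ind Uᶜ) k = 1) ↔ (X (o r) = 4 ∧
      (if r = r' then ind Uᶜ r else ind Uᶜ r + ind Uᶜ r') = 1) ∧ ∀ y ∈ U, y = r ∨ y = r' := by
    rw [← go.push_self]
    constructor
    · refine fun h => ⟨h _, fun y hy => ?_⟩
      by_contra hy'
      have hy2 : o y ≠ o r := fun h' => (go.2 y r h').elim (fun h => hy' (.inl h)) fun h => hy' h.1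
      have := (hne y hy2).2.symm.trans (h _).2
      simp [ind, hy] at this
    · rintro ⟨h1, h2⟩ k
      obtain ⟨y, rfl⟩ := ho k
      by_cases hy : o y = o r
      · rwa [hy]
      · refine ⟨(hne y hy).1, (hne y hy).2.trans ?_⟩
        have : y ∉ U := fun h => hy (by rcases h2 y h with h | h <;> rw [h]; exact go.1.symm)
        simp [ind, this]
  rw [e1, ev]
  have hg := good (o r)
  rw [X0, ci, co] at hg
  rw [if_congr key rfl rfl, X0, ci, co]
  by_cases hq : q = q' <;> by_cases hr : r = r'
  · subst hr
    rw [if_neg (by simp [hq]), if_pos hq]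
    exact (CharTwo.add_self_eq_zero _).symm
  · rw [if_pos hq, if_pos hq, if_neg hr, if_neg hr]
    change _ = dotAt r (unitDisc R N') U + dotAt r' (unitDisc R N') U
    unfold dotAt unitDisc
    simp only [Set.sdiff_eq_empty, Set.subset_singleton_iff]
    by_cases h : r ∈ U <;> by_cases h' : r' ∈ U
    · have h1 : ¬ ∀ y ∈ U, y = r := fun hU => hr (hU r' h').symm
      have h2 : ¬ ∀ y ∈ U, y = r' := fun hU => hr (hU r h)
      simp [h, h', h1, h2, ind]
    · have h1 : (∀ y ∈ U, y = r ∨ y = r') ↔ ∀ y ∈ U, y = r :=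
        forall₂_congr fun y hy => or_iff_left fun e => h' (e ▸ hy)
      simp [h, h', h1, ind]
    · have h1 : (∀ y ∈ U, y = r ∨ y = r') ↔ ∀ y ∈ U, y = r' :=
        forall₂_congr fun y hy => or_iff_right fun e => h (e ▸ hy)
      simp [h, h', h1, ind]
    · simp [h, h', ind]
  · subst hr
    rw [if_neg hq, if_neg hq, if_pos rfl, if_pos rfl, unitDisc]
    refine if_congr ⟨fun h => Set.eq_empty_of_forall_notMem fun y hy => ?_, ?_⟩ rfl rfl
    · obtain rfl : y = r := (h.2 y hy).elim id id
      have := h.1.2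
      simp [ind, hy] at this
    · rintro rfl
      simp [ind]
  · simp [hq, hr] at hg

end unit

end

section
variable {e U : Type} [Finite e] {T : Tangle e U} {c : T.C} {ε ε' : T.C → Bool}

abbrev GlueK {N : Type} (q q' : N) : Type := Quot fun x y : N => x = q ∧ y = q'

theorem glues_glueK {N : Type} (q q' : N) : Glues (Quot.mk _ : N → GlueK q q') q q' := by
  refine ⟨Quot.sound ⟨rfl, rfl⟩, fun x y h => ?_⟩
  have h1 : (if x = q' then q else x) = if y = q' then q else y :=
    congrArg (Quot.lift (fun x => if x = q' then q else x) (by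
      rintro x y ⟨rfl, rfl⟩
      simp)) h
  split_ifs at h1 with hx hy hy
  · exact .inl (hx.trans hy.symm)
  · exact .inr ⟨.inr hx, .inl h1.symm⟩
  · exact .inr ⟨.inl h1, .inr hy⟩
  · exact .inl h1

theorem Glues.of_lift {N K : Type} {o : N → K} {r r' : N} (h : o r = o r') (ψ : K → GlueK r r')
  (hψ : ∀ x, ψ (o x) = Quot.mk _ x) : Glues o r r' := by
  refine ⟨h, fun x y hxy => (glues_glueK r r').2 x y ?_⟩
  rw [← hψ, ← hψ, hxy]

/-- A function on the components of one smoothing which identifies the two strands at a crossing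
is a function on the components of the other smoothing. -/
theorem Tangle.near_lift {Z : Type} (hε : ∀ d, d ≠ c → ε d = ε' d) (f : T.S → Z)
  (hf : ∀ s t, T.resLink ε s t → f s = f t) (hc : f (T.cr c 0) = f (T.cr c 2)) :
  ∀ s t, T.resLink ε' s t → f s = f t := by
  have h01 : f (T.cr c 0) = f (T.cr c 1) ∧ f (T.cr c 0) = f (T.cr c 3) := by
    rcases h : ε c
    · exact ⟨hf _ _ (.zero₁ c h), hc.trans (hf _ _ (.zero₂ c h))⟩
    · exact ⟨hc.trans (hf _ _ (.one₁ c h)).symm, (hf _ _ (.one₂ c h)).symm⟩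
  rintro _ _ (p | ⟨d, h⟩ | ⟨d, h⟩ | ⟨d, h⟩ | ⟨d, h⟩)
  · exact hf _ _ (.pt p)
  all_goals
    by_cases hd : d = c
    · subst hd
      simp only [← h01.1, ← h01.2, ← hc]
    · rw [← hε d hd] at h
      first
      | exact hf _ _ (.zero₁ d h)
      | exact hf _ _ (.zero₂ d h)
      | exact hf _ _ (.one₁ d h)
      | exact hf _ _ (.one₂ d h)

theorem Tangle.Edge.near (h : T.Edge c ε ε') : ∀ d, d ≠ c → ε d = ε' d := fun d hd => by
  rw [h.2, update_of_ne hd]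

/-- The two strands at a crossing lie on the same component of a saddle. -/
theorem TrK.mk_band (h : T.Edge c ε ε') :
  (TrK.mk (T.cr c 0) : TrK T ε ε') = TrK.mk (T.cr c 2) :=
  (Quot.sound (.inl (.zero₁ c h.1))).trans
    (Quot.sound (.inr (.one₁ c (by rw [h.2, update_self]))))

variable {R : Type} [CommRing R] [CharP R 2] {a : Flat e}

open StackK Cob

theorem unitDisc_hcomp_saddle (ha : a.Mfd) (hT : T.Nice) (h : T.Edge c ε ε') :
  hcomp (unitDisc R (Circ a (T.res ε))) ((trCob T ε ε' (Pi.single (T.cr c 0) 1) 0).L 1)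
    = if (Circ.r (T.cmp ε (T.cr c 0)) : Circ a (T.res ε)) = Circ.r (T.cmp ε (T.cr c 2))
      then dotAt (Circ.r (T.cmp ε' (T.cr c 0))) (unitDisc R _)
        + dotAt (Circ.r (T.cmp ε' (T.cr c 2))) (unitDisc R _)
      else unitDisc R (Circ a (T.res ε')) := by
  set q : Circ a (T.res ε) := Circ.r (T.cmp ε (T.cr c 0))
  set q' : Circ a (T.res ε) := Circ.r (T.cmp ε (T.cr c 2))
  let γ : T.S → GlueK q q' := fun s => Quot.mk _ (Circ.r (T.cmp ε s))
  have hγ : ∀ s t, T.resLink ε s t → γ s = γ t := fun s t hst => by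
    simp only [γ, Tangle.cmp_eq hst]
  have hc : γ (T.cr c 0) = γ (T.cr c 2) := Quot.sound ⟨rfl, rfl⟩
  have hγ' := Tangle.near_lift h.near γ hγ hc
  let α : TrK T ε ε' → GlueK q q' := Quot.lift γ fun s t hst => hst.elim (hγ s t) (hγ' s t)
  obtain ⟨β, ena, enb, enc⟩ : ∃ β : StackK a (T.res ε) (T.res ε') → GlueK q q',
      (∀ x, β (na x) = Quot.mk _ (Circ.l x)) ∧ (∀ x, β (nb x) = Quot.mk _ (Circ.r x)) ∧
      ∀ s, β (nc (T.cmp ε' s)) = γ s :=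
    ⟨StackK.lift (fun x => Quot.mk _ (Circ.l x)) (fun x => Quot.mk _ (Circ.r x))
      (Tangle.cmpLift γ hγ') (fun p => by rw [Circ.glue]) fun p => rfl, fun x => lift_na _ _ _ _ _ x,
      fun x => lift_nb _ _ _ _ _ x, fun s => lift_nc _ _ _ _ _ (T.cmp ε' s)⟩
  have eab : β ∘ qab = Quot.mk _ := Circ.funext (fun x => by simp [ena]) fun x => by simp [enb]
  have eα : (fun x => α (TrK.out x)) = β ∘ qbc :=
    Circ.funext (Tangle.cmp_ind fun s => by simp [enb, α]; rfl)
      (Tangle.cmp_ind fun s => by simp [enc, α]; rfl)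
  have main := L_tens_right_of (R := R) (hT.sad c ε ε' h.1 h.2) (stackCob_good ha (hT.mfd ε) (hT.mfd ε'))
    ⟨GlueK q q', Quot.mk _, β ∘ qac, 2 • cnt (Quot.mk _ : _ → GlueK q q') + 2 • cnt (β ∘ qac)
      - 2 • Pi.single (γ (T.cr c 0)) 1, 0⟩ α β (fun x => congrFun eα x) (fun Z f g hfg => ?_)
    (fun p _ h2 => ?_) (fun x => (congrFun eab x).symm) (fun _ => rfl) ?_ ?_ (unitDisc R _)
  · refine main.2.trans (saddle_unitDisc Quot.mk_surjective ?_ (glues_glueK q q') ?_ ?_ rfl main.1)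
    · rintro ⟨x⟩
      revert x
      refine Circ.ind (fun x => ⟨Circ.l x, ?_⟩) (Tangle.cmp_ind fun s => ⟨Circ.r (T.cmp ε' s), ?_⟩)
      · simp [ena]
      · simp [enc]; rfl
    · let γ' : T.S → GlueK (Circ.r (T.cmp ε' (T.cr c 0)) : Circ a (T.res ε'))
        (Circ.r (T.cmp ε' (T.cr c 2))) := fun s => Quot.mk _ (Circ.r (T.cmp ε' s))
      have hγ₁ := Tangle.near_lift (fun d hd => (h.near d hd).symm) γ'
        (fun s t hst => by simp only [γ', Tangle.cmp_eq hst]) (Quot.sound ⟨rfl, rfl⟩)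
      let ψ : Circ a (T.res ε) → _ := Circ.lift (fun x => Quot.mk _ (Circ.l x)) (Tangle.cmpLift γ' hγ₁)
        fun p => congrArg _ (Circ.glue p)
      refine Glues.of_lift ?_ (Quot.lift ψ ?_) (Circ.ind (fun x => ?_) (Tangle.cmp_ind fun s => ?_))
      · simpa [enc] using hc
      · rintro _ _ ⟨rfl, rfl⟩
        simp only [q, q', ψ]
        exact Quot.sound ⟨rfl, rfl⟩
      · simp only [Function.comp_apply, qac_l, ena]
        exact Circ.lift_l ..
      · simp only [Function.comp_apply, qac_r, enc]
        exact Circ.lift_r ..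
    · simp [enc, γ]; rfl
  · have hg : ∀ s, f (TrK.mk s) = g (nb (T.cmp ε s)) ∧ f (TrK.mk s) = g (nc (T.cmp ε' s)) := fun s => by
      have hl := hfg (Circ.l (T.cmp ε s))
      have hr := hfg (Circ.r (T.cmp ε' s))
      simp only [TrK.out_l, TrK.out_r, Sum.elim_inr, qbc_l, qbc_r] at hl hr
      exact ⟨hl, hr⟩
    have e1 : f (TrK.mk (T.cr c 0)) = f (TrK.mk (T.cr c 2)) := congrArg f (TrK.mk_band h)
    refine ⟨Quot.lift (fun x => g (qab x)) ?_, Quot.ind fun s => ?_, StackK.ind (fun x => ?_)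
      (fun x => ?_) (Tangle.cmp_ind fun s => ?_)⟩
    · rintro _ _ ⟨rfl, rfl⟩
      simp only [q, q', qab_r, ← (hg _).1, e1]
    · exact (congrArg g (qab_r _)).trans (hg s).1.symm
    · rw [ena]
      exact congrArg g (qab_l x)
    · rw [enb]
      exact congrArg g (qab_r x)
    · rw [enc]
      exact (congrArg g (qab_r _)).trans ((hg s).1.symm.trans (hg s).2)
  · rintro ⟨x⟩
    have := h2 (qab x)
    rwa [show β (qab x) = _ from congrFun eab x] at this
  · have e4 : (β ∘ fun p => nb ((T.res ε).pt p)) = fun p => α (TrK.mk (T.bd p)) := by ext p; simp [enb]; rfl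
    have e5 : push α (push TrK.mk (Pi.single (T.cr c 0) (1 : ℤ))) = Pi.single (γ (T.cr c 0)) 1 := by
      rw [push_single, push_single]
      rfl
    simp only [map_sub, map_add, map_nsmul, push_cnt, eab, e4, e5]
    change _ = cnt _ - _ + 2 • cnt (fun x => α (TrK.out x)) + _ - _
    rw [eα]
    change _ = cnt (fun p => α (TrK.mk (T.bd p))) - _ + _ + _ - _
    abel
  · change 0 = push α (push TrK.mk 0) + push β 0
    rw [map_zero, map_zero, map_zero, add_zero]

theorem saddle_hcomp_unitDisc (hT : T.Nice) (ha : a.Mfd) (h : T.Edge c ε ε') :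
  hcomp ((trCob T ε ε' (Pi.single (T.cr c 0) 1) 0).L 1) (unitDisc R (Circ (T.res ε') a))
    = if (Circ.l (T.cmp ε' (T.cr c 0)) : Circ (T.res ε') a) = Circ.l (T.cmp ε' (T.cr c 2))
      then dotAt (Circ.l (T.cmp ε (T.cr c 0))) (unitDisc R _)
        + dotAt (Circ.l (T.cmp ε (T.cr c 2))) (unitDisc R _)
      else unitDisc R (Circ (T.res ε) a) := by
  set q : Circ (T.res ε') a := Circ.l (T.cmp ε' (T.cr c 0))
  set q' : Circ (T.res ε') a := Circ.l (T.cmp ε' (T.cr c 2))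
  let γ : T.S → GlueK q q' := fun s => Quot.mk _ (Circ.l (T.cmp ε' s))
  have hγ' : ∀ s t, T.resLink ε' s t → γ s = γ t := fun s t hst => by
    simp only [γ, Tangle.cmp_eq hst]
  have hc : γ (T.cr c 0) = γ (T.cr c 2) := Quot.sound ⟨rfl, rfl⟩
  have hγ := Tangle.near_lift (fun d hd => (h.near d hd).symm) γ hγ' hc
  let α : TrK T ε ε' → GlueK q q' := Quot.lift γ fun s t hst => hst.elim (hγ s t) (hγ' s t)
  obtain ⟨β, ena, enb, enc⟩ : ∃ β : StackK (T.res ε) (T.res ε') a → GlueK q q',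
      (∀ s, β (na (T.cmp ε s)) = γ s) ∧ (∀ x, β (nb x) = Quot.mk _ (Circ.l x)) ∧
      ∀ x, β (nc x) = Quot.mk _ (Circ.r x) :=
    ⟨StackK.lift (Tangle.cmpLift γ hγ) (fun x => Quot.mk _ (Circ.l x)) (fun x => Quot.mk _ (Circ.r x))
      (fun p => rfl) fun p => by rw [Circ.glue], fun s => lift_na _ _ _ _ _ (T.cmp ε s),
      fun x => lift_nb _ _ _ _ _ x, fun x => lift_nc _ _ _ _ _ x⟩
  have ebc : β ∘ qbc = Quot.mk _ := Circ.funext (fun x => by simp [enb]) fun x => by simp [enc]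
  have eα : (fun x => α (TrK.out x)) = β ∘ qab :=
    Circ.funext (Tangle.cmp_ind fun s => by simp [ena, α]; rfl)
      (Tangle.cmp_ind fun s => by simp [enb, α]; rfl)
  have main := L_tens_left_of (R := R) (hT.sad c ε ε' h.1 h.2) (stackCob_good (hT.mfd ε) (hT.mfd ε') ha)
    ⟨GlueK q q', Quot.mk _, β ∘ qac, 2 • cnt (Quot.mk _ : _ → GlueK q q') + 2 • cnt (β ∘ qac)
      - 2 • Pi.single (γ (T.cr c 0)) 1, 0⟩ α β (fun x => congrFun eα x) (fun Z f g hfg => ?_)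
    (fun p _ h2 => ?_) (fun x => (congrFun ebc x).symm) (fun _ => rfl) ?_ ?_ (unitDisc R _)
  · refine main.2.trans (saddle_unitDisc Quot.mk_surjective ?_ (glues_glueK q q') ?_ ?_ rfl main.1)
    · rintro ⟨x⟩
      revert x
      refine Circ.ind (Tangle.cmp_ind fun s => ⟨Circ.l (T.cmp ε s), ?_⟩) (fun x => ⟨Circ.r x, ?_⟩)
      · simp [ena]; rfl
      · simp [enc]
    · let γ' : T.S → GlueK (Circ.l (T.cmp ε (T.cr c 0)) : Circ (T.res ε) a)
        (Circ.l (T.cmp ε (T.cr c 2))) := fun s => Quot.mk _ (Circ.l (T.cmp ε s))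
      have hγ₁ := Tangle.near_lift h.near γ'
        (fun s t hst => by simp only [γ', Tangle.cmp_eq hst]) (Quot.sound ⟨rfl, rfl⟩)
      let ψ : Circ (T.res ε') a → _ := Circ.lift (Tangle.cmpLift γ' hγ₁) (fun x => Quot.mk _ (Circ.r x))
        fun p => congrArg _ (Circ.glue p)
      refine Glues.of_lift ?_ (Quot.lift ψ ?_) (Circ.ind (Tangle.cmp_ind fun s => ?_) (fun x => ?_))
      · simpa [ena] using hc
      · rintro _ _ ⟨rfl, rfl⟩
        simp only [q, q', ψ]
        exact Quot.sound ⟨rfl, rfl⟩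
      · simp only [Function.comp_apply, qac_l, ena]
        exact Circ.lift_l ..
      · simp only [Function.comp_apply, qac_r, enc]
        exact Circ.lift_r ..
    · simp [ena]; rfl
  · have hg : ∀ s, f (TrK.mk s) = g (na (T.cmp ε s)) ∧ f (TrK.mk s) = g (nb (T.cmp ε' s)) := fun s => by
      have hl := hfg (Circ.l (T.cmp ε s))
      have hr := hfg (Circ.r (T.cmp ε' s))
      simp only [TrK.out_l, TrK.out_r, Sum.elim_inl, qab_l, qab_r] at hl hr
      exact ⟨hl, hr⟩
    have e1 : f (TrK.mk (T.cr c 0)) = f (TrK.mk (T.cr c 2)) := congrArg f (TrK.mk_band h)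
    refine ⟨Quot.lift (fun x => g (qbc x)) ?_, Quot.ind fun s => ?_, StackK.ind
      (Tangle.cmp_ind fun s => ?_) (fun x => ?_) (fun x => ?_)⟩
    · rintro _ _ ⟨rfl, rfl⟩
      simp only [q, q', qbc_l, ← (hg _).2, e1]
    · exact (congrArg g (qbc_l _)).trans (hg s).2.symm
    · rw [ena]
      exact (congrArg g (qbc_l _)).trans ((hg s).2.symm.trans (hg s).1)
    · rw [enb]
      exact congrArg g (qbc_l x)
    · rw [enc]
      exact congrArg g (qbc_r x)
  · rintro ⟨x⟩
    have := h2 (qbc x)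
    rwa [show β (qbc x) = _ from congrFun ebc x] at this
  · have e4 : (β ∘ fun p => nb ((T.res ε').pt p)) = fun p => α (TrK.mk (T.bd p)) := by ext p; simp [enb]; rfl
    have e5 : push α (push TrK.mk (Pi.single (T.cr c 0) (1 : ℤ))) = Pi.single (γ (T.cr c 0)) 1 := by
      rw [push_single, push_single]
      rfl
    simp only [map_sub, map_add, map_nsmul, push_cnt, ebc, e4, e5]
    change _ = cnt _ - _ + 2 • cnt (fun x => α (TrK.out x)) + _ - _
    rw [eα]
    change _ = cnt (fun p => α (TrK.mk (T.bd p))) - _ + _ + _ - _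
    abel
  · change 0 = push α (push TrK.mk 0) + push β 0
    rw [map_zero, map_zero, map_zero, add_zero]

end

section
/-! ## Computation of the circles of explicit diagrams -/

structure Tab (n : ℕ) where
  s : ℕ
  {c p : ℕ}
  cr : Fin c → Fin 4 → Fin s
  pt : Fin p → Fin 2 → Fin s
  bd : Fin n → Fin s

namespace Tab

variable {n : ℕ} {U : Type}

abbrev tangle (t : Tab n) (col : Fin t.p → Option U) : Tangle (Fin n) U :=
  { t with S := Fin t.s, C := Fin t.c, P := Fin t.p, col }

variable (t t' : Tab n) (ε : Fin t.c → Bool) (ε' : Fin t'.c → Bool)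

/-- The segments that are joined in a resolution. -/
def joints : List (Fin t.s × Fin t.s) :=
  ((List.finRange t.p).map Sum.inl ++ (List.finRange t.c).flatMap fun c =>
    [Sum.inr (c, false), Sum.inr (c, true)]).map ((t.tangle (U := Empty) fun _ => none).joint ε)

def enc : Fin t.s ⊕ Fin t'.s → ℕ := Sum.elim (fun i => i) fun j => t.s + j

def pairs : List (ℕ × ℕ) :=
  (t.joints ε).map (fun x => (t.enc t' (.inl x.1), t.enc t' (.inl x.2)))
    ++ ((t'.joints ε').map (fun x => (t.enc t' (.inr x.1), t.enc t' (.inr x.2)))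
      ++ (List.finRange n).map fun q => (t.enc t' (.inl (t.bd q)), t.enc t' (.inr (t'.bd q))))

/-- Label the elements of the classes of an equivalence relation. -/
def classes : List (ℕ × ℕ) → List ℕ → List ℕ
  | [], l => l
  | (x, y) :: L, l => classes L (l.map fun z => if z = l.getD x x then l.getD y y else z)

def lab (z : ℕ) : ℕ := (classes (t.pairs t' ε ε') (List.range (t.s + t'.s))).getD z z

theorem classes_spec {Z : Type} (f : ℕ → Z) : ∀ (L : List (ℕ × ℕ)) (l : List ℕ),
  (∀ x ∈ L, f x.1 = f x.2) → (∀ z, f (l.getD z z) = f z) → ∀ z, f ((classes L l).getD z z) = f z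
  | [], _, _, h => h
  | (x, y) :: L, l, hL, h => by
    refine classes_spec f L _ (fun p hp => hL p (List.mem_cons_of_mem _ hp)) fun z => ?_
    have hxy : f x = f y := hL (x, y) List.mem_cons_self
    have hz := h z
    rw [List.getD_eq_getElem?_getD] at hz ⊢
    rw [List.getElem?_map]
    rcases e : l[z]? with _ | w
    · rfl
    · rw [e] at hz
      change f (if w = _ then _ else w) = _
      split_ifs with hw
      · rw [h, ← hxy, ← h x, ← hw]
        exact hz
      · exact hz

variable {t t'} {col : Fin t.p → Option U} {col' : Fin t'.p → Option U} {ε ε'}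

variable (t t' ε ε' col col') in
abbrev Circles : Type := Circ ((t.tangle col).res ε) ((t'.tangle col').res ε')

theorem mem_joints {x y : Fin t.s} : (x, y) ∈ t.joints ε ↔ (t.tangle col).resLink ε x y := by
  constructor
  · intro h
    obtain ⟨j, -, hj⟩ := List.mem_map.1 h
    have e : (t.tangle col).joint ε j = (x, y) := by
      rw [← hj]
      rcases j with p | ⟨c, _ | _⟩ <;> rfl
    have := (t.tangle col).resLink_joint ε j
    rwa [e] at this
  · intro h
    obtain ⟨j, rfl, rfl⟩ := (t.tangle col).exists_joint ε x y h
    refine List.mem_map.2 ⟨j, ?_, ?_⟩ <;> rcases j with p | ⟨c, _ | _⟩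
    all_goals first | rfl | simp

theorem mem_pairs {x y : ℕ} : (x, y) ∈ t.pairs t' ε ε' ↔ ∃ i j : Fin t.s ⊕ Fin t'.s,
  circLink ((t.tangle col).res ε) ((t'.tangle col').res ε') i j ∧ x = t.enc t' i ∧ y = t.enc t' j := by
  simp only [pairs, List.mem_append, List.mem_map, Prod.exists, Prod.mk.injEq]
  constructor
  · rintro (⟨i, j, h, rfl, rfl⟩ | ⟨i, j, h, rfl, rfl⟩ | ⟨q, -, rfl, rfl⟩)
    exacts [⟨_, _, .left (mem_joints.1 h), rfl, rfl⟩, ⟨_, _, .right (mem_joints.1 h), rfl, rfl⟩,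
      ⟨_, _, .bd q, rfl, rfl⟩]
  · rintro ⟨_, _, h | h | q, rfl, rfl⟩
    exacts [.inl ⟨_, _, mem_joints.2 h, rfl, rfl⟩, .inr (.inl ⟨_, _, mem_joints.2 h, rfl, rfl⟩),
      .inr (.inr ⟨q, List.mem_finRange q, rfl, rfl⟩)]

variable (col col' ε ε') in
def circle (z : ℕ) : Option (Circles t t' ε ε' col col') :=
  if h : z < t.s then some (Quot.mk _ (.inl ⟨z, h⟩))
  else if h : z - t.s < t'.s then some (Quot.mk _ (.inr ⟨z - t.s, h⟩)) else none

theorem circle_enc (i : Fin t.s ⊕ Fin t'.s) : circle ε ε' col col' (t.enc t' i) = some (Quot.mk _ i) := by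
  rcases i with i | i <;> simp [circle, enc] <;> rfl

theorem circle_lab (z : ℕ) : circle ε ε' col col' (t.lab t' ε ε' z) = circle ε ε' col col' z := by
  refine classes_spec _ _ _ (fun x hx => ?_) (fun z => ?_) z
  · obtain ⟨i, j, h, h1, h2⟩ := mem_pairs.1 hx
    rw [h1, h2]
    exact (circle_enc i).trans ((congrArg some (Quot.sound h)).trans (circle_enc j).symm)
  · rw [List.getD_eq_getElem?_getD]
    by_cases h : z < t.s + t'.s
    · rw [List.getElem?_range h]; rfl
    · rw [List.getElem?_eq_none (by simpa using h)]; rfl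

variable (t t' ε ε') in
/-- The labels are constant on the circles. -/
abbrev Valid : Prop := ∀ x ∈ t.pairs t' ε ε', t.lab t' ε ε' x.1 = t.lab t' ε ε' x.2

theorem lab_eq_iff (h : Valid t t' ε ε') (i j : Fin t.s ⊕ Fin t'.s) :
  t.lab t' ε ε' (t.enc t' i) = t.lab t' ε ε' (t.enc t' j)
    ↔ (Quot.mk _ i : Circles t t' ε ε' col col') = Quot.mk _ j := by
  constructor
  · intro e
    refine Option.some_injective _ ((circle_enc i).symm.trans (Eq.trans ?_ (circle_enc j)))
    rw [← circle_lab, e, circle_lab]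
  · exact congrArg (Quot.lift (fun i => t.lab t' ε ε' (t.enc t' i)) fun i j hij =>
      h _ (mem_pairs.2 ⟨i, j, hij, rfl, rfl⟩))

variable {R : Type} [CommRing R] [CharP R 2]

def discs (S : Type) [CommRing S] {e : Type} {T T' : Tangle e U} (m : (T.C → Bool) → (T'.C → Bool) → Bool) :
  TMat S T T' := fun ε ε' => if m ε ε' then unitDisc S _ else 0

variable (R col col' ε ε') in
/-- The undotted discs, with a dot at a given segment. -/
def term : ℕ → Set (Circles t t' ε ε' col col') → R
  | 0 => unitDisc R _
  | z + 1 => (circle ε ε' col col' z).elim 0 fun q => dotAt q (unitDisc R _)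

theorem term_lab (i : Fin t.s ⊕ Fin t'.s) : term ε ε' col col' R (t.lab t' ε ε' (t.enc t' i) + 1)
  = dotAt (Quot.mk _ i) (unitDisc R _) := by
  rw [term, circle_lab, circle_enc]
  rfl

variable (t t' ε ε') in
/-- The composition of discs with a saddle. -/
def band (η : Fin t.c → Bool) (η' : Fin t'.c → Bool) (i j : Fin t.s ⊕ Fin t'.s) : List ℕ :=
  if t.lab t' η η' (t.enc t' i) = t.lab t' η η' (t.enc t' j)
    then [t.lab t' ε ε' (t.enc t' i) + 1, t.lab t' ε ε' (t.enc t' j) + 1] else [0]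

def upd {c : ℕ} (ε : Fin c → Bool) (i : Fin c) (v : Bool) : Fin c → Bool := fun j => if j = i then v else ε j

theorem upd_eq {c : ℕ} (_ : DecidableEq (Fin c)) (ε : Fin c → Bool) (i : Fin c) (v : Bool) :
  update ε i v = upd ε i v := by
  ext j
  by_cases h : j = i
  · subst h; simp [upd]
  · simp [upd, h]

theorem sum_band (η η' i j) (h : Valid t t' η η') : ((band t t' ε ε' η η' i j).map (term ε ε' col col' R)).sum
  = if (Quot.mk _ i : Circles t t' η η' col col') = Quot.mk _ j
    then dotAt (Quot.mk _ i) (unitDisc R _) + dotAt (Quot.mk _ j) (unitDisc R _) else unitDisc R _ := by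
  rw [band]
  simp only [lab_eq_iff (col := col) (col' := col') h]
  split_ifs
  · exact congrArg₂ (· + ·) (term_lab i) ((add_zero _).trans (term_lab j))
  · exact add_zero _

variable (m : (Fin t.c → Bool) → (Fin t'.c → Bool) → Bool)

theorem edge_iff {c : Fin t.c} {η : Fin t.c → Bool} :
  (t.tangle col).Edge c ε η ↔ ε c = false ∧ η = upd ε c true := by
  rw [Tangle.Edge, upd_eq]

theorem edge_iff' {c : Fin t.c} {η : Fin t.c → Bool} :
  (t.tangle col).Edge c η ε ↔ ε c = true ∧ η = upd ε c false := by
  rw [edge_iff]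
  constructor <;> rintro ⟨h, rfl⟩ <;> refine ⟨if_pos rfl, funext fun j => ?_⟩ <;>
    by_cases hj : j = c <;> simp [upd, hj, h]

variable (hT : (t.tangle col).Nice) (hT' : (t'.tangle col').Nice) (hv : ∀ η η', Valid t t' η η')
include hT hT' hv

theorem sad_mul_discs (c : Fin t.c) :
  TMat.mul (sad R (t.tangle col) c) (discs R (T' := t'.tangle col') m) ε ε'
    = ((if !ε c && m (upd ε c true) ε' then band t t' ε ε' (upd ε c true) ε' (.inl (t.cr c 0)) (.inl (t.cr c 2))
      else []).map (term ε ε' col col' R)).sum := by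
  have h0 : TMat.mul (sad R (t.tangle col) c) (discs R (T' := t'.tangle col') m) ε ε'
      = hcomp (sad R (t.tangle col) c ε (upd ε c true)) (discs R (T := t.tangle col) (T' := t'.tangle col') m (upd ε c true) ε') := by
    refine finsum_eq_single _ _ fun η hη => ?_
    rw [sad, tr, if_neg fun h => hη (edge_iff.1 h).2, zero_hcomp]
  rw [h0]
  rcases hc : ε c with _ | _
  · rw [sad, tr, if_pos (edge_iff.2 ⟨hc, rfl⟩), discs]
    rcases m (upd ε c true) ε' with _ | _
    · exact hcomp_zero _
    · exact (saddle_hcomp_unitDisc hT (hT'.mfd ε') (edge_iff.2 ⟨hc, rfl⟩)).trans (sum_band _ _ _ _ (hv _ _)).symm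
  · rw [sad, tr, if_neg fun h => Bool.noConfusion (h.1.symm.trans hc), zero_hcomp]
    rfl

theorem discs_mul_sad (c : Fin t'.c) :
  TMat.mul (discs R (T := t.tangle col) m) (sad R (t'.tangle col') c) ε ε'
    = ((if ε' c && m ε (upd ε' c false) then band t t' ε ε' ε (upd ε' c false) (.inr (t'.cr c 0)) (.inr (t'.cr c 2))
      else []).map (term ε ε' col col' R)).sum := by
  have h0 : TMat.mul (discs R (T := t.tangle col) m) (sad R (t'.tangle col') c) ε ε'
      = hcomp (discs R (T := t.tangle col) (T' := t'.tangle col') m ε (upd ε' c false)) (sad R (t'.tangle col') c (upd ε' c false) ε') := by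
    refine finsum_eq_single _ _ fun η hη => ?_
    rw [sad, tr, if_neg fun h => hη (edge_iff'.1 h).2, hcomp_zero]
  rw [h0]
  rcases hc : ε' c with _ | _
  · rw [sad, tr, if_neg fun h => Bool.noConfusion ((edge_iff'.1 h).1.symm.trans hc), hcomp_zero]
    rfl
  · rw [sad, tr, if_pos (edge_iff'.2 ⟨hc, rfl⟩), discs]
    rcases m ε (upd ε' c false) with _ | _
    · exact zero_hcomp _
    · exact (unitDisc_hcomp_saddle (hT.mfd ε) hT' (edge_iff'.2 ⟨hc, rfl⟩)).trans (sum_band _ _ _ _ (hv _ _)).symm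

omit hT hT' hv

variable (t t' ε ε') in
def codes : List ℕ :=
  ((List.finRange t.c).flatMap fun c => if !ε c && m (upd ε c true) ε'
    then band t t' ε ε' (upd ε c true) ε' (.inl (t.cr c 0)) (.inl (t.cr c 2)) else [])
  ++ (List.finRange t'.c).flatMap fun c => if ε' c && m ε (upd ε' c false)
    then band t t' ε ε' ε (upd ε' c false) (.inr (t'.cr c 0)) (.inr (t'.cr c 2)) else []

theorem sum_eq_zero_of_even {M : Type} [AddCommGroup M] [Module R M] (f : ℕ → M) (l : List ℕ)
  (h : ∀ x ∈ l, l.count x % 2 = 0) : (l.map f).sum = 0 := by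
  rw [Finset.sum_list_map_count]
  refine sum_eq_zero fun x hx => ?_
  obtain ⟨k, hk⟩ := Nat.dvd_of_mod_eq_zero (h x (List.mem_toFinset.1 hx))
  rw [← Nat.cast_smul_eq_nsmul R]
  have : ((l.count x : ℕ) : R) = 0 := by
    rw [hk, Nat.cast_mul, Nat.cast_ofNat, CharTwo.two_eq_zero, zero_mul]
  convert zero_smul R (f x)

end Tab

end

section
namespace Tab

variable {n : ℕ} {U : Type} {t t' : Tab n} {col : Fin t.p → Option U} {col' : Fin t'.p → Option U}
  {R : Type} [CommRing R] [CharP R 2]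

def vecs : ℕ → List (List Bool)
  | 0 => [[]]
  | n + 1 => (vecs n).flatMap fun l => [false :: l, true :: l]

theorem exists_vec : ∀ {c : ℕ} (ε : Fin c → Bool), ∃ v ∈ vecs c, ε = fun i : Fin c => v.getD i false
  | 0, ε => ⟨[], List.mem_cons_self, funext fun i => i.elim0⟩
  | c + 1, ε => by
    obtain ⟨v, hv, h⟩ := exists_vec fun i : Fin c => ε i.succ
    refine ⟨ε 0 :: v, List.mem_flatMap.2 ⟨v, hv, by cases ε 0 <;> simp⟩, funext fun i => ?_⟩
    exact Fin.cases rfl (congrFun h) i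

abbrev All {c c' : ℕ} (P : (Fin c → Bool) → (Fin c' → Bool) → Prop) : Prop :=
  ∀ v ∈ vecs c, ∀ v' ∈ vecs c', P (fun i => v.getD i false) fun i => v'.getD i false

theorem All.spec {c c' : ℕ} {P : (Fin c → Bool) → (Fin c' → Bool) → Prop} (h : All P) (ε ε') : P ε ε' := by
  obtain ⟨v, hv, rfl⟩ := exists_vec ε
  obtain ⟨v', hv', rfl⟩ := exists_vec ε'
  exact h v hv v' hv'

variable (t t') in
/-- The terms of the boundary of a matrix of discs and the given terms cancel. -/
abbrev Check (m : (Fin t.c → Bool) → (Fin t'.c → Bool) → Bool)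
  (x : (Fin t.c → Bool) → (Fin t'.c → Bool) → List ℕ) : Prop :=
  All fun ε ε' => Valid t t' ε ε' ∧ ∀ l ∈ [codes t t' ε ε' m ++ x ε ε'], ∀ k ∈ l, l.count k % 2 = 0

variable {m : (Fin t.c → Bool) → (Fin t'.c → Bool) → Bool}
    {x : (Fin t.c → Bool) → (Fin t'.c → Bool) → List ℕ}

theorem sum_map_flatMap {M ι : Type} [AddCommGroup M] (f : ℕ → M) (g : ι → List ℕ) : ∀ l : List ι,
  ((l.flatMap g).map f).sum = (l.map fun i => ((g i).map f).sum).sum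
  | [] => rfl
  | i :: l => by
    rw [List.flatMap_cons, List.map_append, List.sum_append, sum_map_flatMap f g l]
    rfl

variable (hT : (t.tangle col).Nice) (hT' : (t'.tangle col').Nice)

include hT hT'

theorem Check.sum_eq (h : Check t t' m x) (ε ε') :
  TMat.mul (∑ᶠ c, sad R (t.tangle col) c) (discs R (T' := t'.tangle col') m) ε ε'
    + TMat.mul (discs R (T := t.tangle col) m) (∑ᶠ c, sad R (t'.tangle col') c) ε ε'
    + ((x ε ε').map (term ε ε' col col' R)).sum = 0 := by
  have e := sum_eq_zero_of_even (R := R) (term ε ε' col col' R) _ ((h.spec ε ε').2 _ List.mem_cons_self)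
  have hv := fun η η' => (h.spec η η').1
  rw [List.map_append, List.sum_append, codes, List.map_append, List.sum_append] at e
  refine Eq.trans (congrArg₂ (· + ·) (congrArg₂ (· + ·) ?_ ?_) rfl) e
  · rw [fsum_eq, TMat.sum_mul, sum_map_flatMap, ← Fin.sum_univ_def, Finset.sum_apply,
      Finset.sum_apply]
    exact sum_congr rfl fun c _ => sad_mul_discs m hT hT' hv c
  · rw [fsum_eq, TMat.mul_sum, sum_map_flatMap, ← Fin.sum_univ_def, Finset.sum_apply,
      Finset.sum_apply]
    exact sum_congr rfl fun c _ => discs_mul_sad m hT hT' hv c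

end Tab

end

section
open TMat (mul)

variable {U : Type} {R : Type} [CommRing R] [CharP R 2]

section

variable {e : Type} [Finite e] (T : Tangle e U) (ξ : U → R)

variable (R) in
def dotMat (s : T.S) : TMat R T T := dots R T (Pi.single s 1)

variable (R) in
def sads : TMat R T T := ∑ᶠ c, sad R T c

theorem diff_of_isEmpty (h : IsEmpty T.P) : diff T ξ = sads R T := by
  rw [diff, finsum_of_isEmpty (α := T.P), add_zero, sads]

theorem diff_of_fin {p : ℕ} (f : T.P ≃ Fin p) : diff T ξ = sads R T
  + ∑ i, (T.col (f.symm i)).elim 0 fun u => ξ u • dotMat R T (T.pt (f.symm i) 0) := by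
  rw [diff, ← finsum_comp_equiv f.symm, sads]
  exact congrArg _ (fsum_eq _)

variable {T}

theorem sads_of_isEmpty (h : IsEmpty T.C) : sads R T = 0 := finsum_of_isEmpty _

theorem dotMat_mul_sads (hT : T.Nice) {a b : T.S}
  (h : ∀ c ε ε', T.Edge c ε ε' → T.cmp ε a = T.cmp ε b ∨ T.cmp ε' a = T.cmp ε' b) :
  mul (dotMat R T a) (sads R T) = mul (dotMat R T b) (sads R T) := by
  rw [sads, fsum_eq, TMat.mul_sum, TMat.mul_sum]
  refine sum_congr rfl fun c _ => ?_
  ext1 ε; ext1 ε'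
  rw [dotMat, dotMat]
  by_cases hc : T.Edge c ε ε'
  · rcases h c ε ε' hc with h | h
    · rw [dots_mul hT hT, dots_mul hT hT, h]
    · rw [sad, dots_comm_tr hT, dots_comm_tr hT, mul_dots hT hT, mul_dots hT hT, h]
  · rw [dots_mul hT hT, dots_mul hT hT, sad, tr, if_neg hc, dotAt_zero, dotAt_zero]

theorem dotMat_comm_sads (hT : T.Nice) (a : T.S) :
  mul (dotMat R T a) (sads R T) = mul (sads R T) (dotMat R T a) := by
  rw [sads, fsum_eq, TMat.mul_sum, TMat.sum_mul]
  exact sum_congr rfl fun c _ => dots_comm_tr hT _ _ _ a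

theorem add_self_eq_zero {T' : Tangle e U} (M : TMat R T T') : M + M = 0 := by
  ext1 ε; ext1 ε'; ext1 V
  exact CharTwo.add_self_eq_zero (M ε ε' V)

variable {T' : Tangle e U} {M M₀ H : TMat R T T'} {S D D₁ : TMat R T T} {S' D' D₁' : TMat R T' T'}

theorem closed_add_smul {w : R} (hd : diff T ξ = S + w • D) (hd' : diff T' ξ = S' + w • D')
  (h0 : mul S M = mul M S')
  (h1 : mul S H + mul D M = mul H S' + mul M D')
  (h2 : mul D H = mul H D') : Closed ξ (M + w • H) := by
  rw [Closed, hd, hd']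
  have := congrArg (fun X => mul M S' + w • X + w • w • mul H D') h1
  convert this using 1 <;> simp only [TMat.add_mul, TMat.mul_add, TMat.smul_mul, TMat.mul_smul, smul_add, h0, h2]
    <;> abel

theorem closed_of_comm {v w : R} (hd : diff T ξ = v • D + w • D₁) (hd' : diff T' ξ = v • D' + w • D₁')
  (h : mul D M₀ = mul M₀ D') (h₁ : mul D₁ M₀ = mul M₀ D₁') (hM : M = M₀)
  (hH : H = 0 := by rfl) : Closed ξ (M + H) := by
  rw [hM, hH, add_zero, Closed, hd, hd', TMat.add_mul, TMat.mul_add, TMat.smul_mul, TMat.smul_mul, TMat.mul_smul,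
    TMat.mul_smul, h, h₁]

variable {ξ}

theorem closed_mul_dots (hT : T.Nice) (hT' : T'.Nice) {a b : T'.S}
  (h : ∀ c ε ε', T'.Edge c ε ε' → T'.cmp ε a = T'.cmp ε b ∨ T'.cmp ε' a = T'.cmp ε' b)
  (hd : diff T ξ = 0) (hd' : diff T' ξ = sads R T')
  (hM : M = fun ε ε' => dotAt (Circ.r (T'.cmp ε' a)) (M₀ ε ε') + dotAt (Circ.r (T'.cmp ε' b)) (M₀ ε ε'))
  (hH : H = 0 := by rfl) : Closed ξ (M + H) := by
  have e : M = mul M₀ (dotMat R T' a) + mul M₀ (dotMat R T' b) :=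
    hM.trans (funext fun ε => funext fun ε' => (congrArg₂ (· + ·) (mul_dots hT hT' M₀ a ε ε')
      (mul_dots hT hT' M₀ b ε ε')).symm)
  rw [hH, add_zero, Closed, hd, hd', TMat.zero_mul, e, TMat.add_mul, TMat.mul_assoc hT hT' hT' hT',
    TMat.mul_assoc hT hT' hT' hT', dotMat_mul_sads hT' h, add_self_eq_zero]

theorem closed_dots_mul (hT : T.Nice) (hT' : T'.Nice) {a b : T.S}
  (h : ∀ c ε ε', T.Edge c ε ε' → T.cmp ε a = T.cmp ε b ∨ T.cmp ε' a = T.cmp ε' b)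
  (hd : diff T ξ = sads R T) (hd' : diff T' ξ = 0)
  (hM : M = fun ε ε' => dotAt (Circ.l (T.cmp ε a)) (M₀ ε ε') + dotAt (Circ.l (T.cmp ε b)) (M₀ ε ε'))
  (hH : H = 0 := by rfl) : Closed ξ (M + H) := by
  have e : M = mul (dotMat R T a) M₀ + mul (dotMat R T b) M₀ :=
    hM.trans (funext fun ε => funext fun ε' => (congrArg₂ (· + ·) (dots_mul hT hT' M₀ a ε ε')
      (dots_mul hT hT' M₀ b ε ε')).symm)
  rw [hH, add_zero, Closed, hd, hd', TMat.mul_zero, e, TMat.mul_add, ← TMat.mul_assoc hT hT hT hT',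
    ← TMat.mul_assoc hT hT hT hT', ← dotMat_comm_sads hT, ← dotMat_comm_sads hT, dotMat_mul_sads hT h,
    add_self_eq_zero]

/-- A tube with two ends, expanded in discs. -/
theorem tube_eq (c : ZMod 2 →+* R) {a b : Flat e} {q q' : Circ a b} (hq : q ≠ q') (h : ∀ x, x = q ∨ x = q') :
  (fun V => c (tube a b V)) = dotAt q (unitDisc R _) + dotAt q' (unitDisc R _) := by
  funext V
  have e0 : ∀ W : Set (Circ a b), W = ∅ ↔ q ∉ W ∧ q' ∉ W := fun W => by
    rw [Set.eq_empty_iff_forall_notMem]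
    exact ⟨fun hW => ⟨hW q, hW q'⟩, fun hW x => by rcases h x with rfl | rfl; exacts [hW.1, hW.2]⟩
  have e1 : Vᶜ.ncard = 1 ↔ (q ∈ V ↔ q' ∉ V) := by
    rw [Set.ncard_eq_one]
    constructor
    · rintro ⟨x, hx⟩
      have h1 := Set.ext_iff.1 hx q
      have h2 := Set.ext_iff.1 hx q'
      simp only [Set.mem_compl_iff, Set.mem_singleton_iff] at h1 h2
      rcases h x with rfl | rfl <;> simp [hq, hq.symm] at h1 h2 <;> simp [h1, h2]
    · intro hV
      by_cases hqV : q ∈ V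
      · refine ⟨q', Set.ext fun x => ?_⟩
        rcases h x with rfl | rfl <;> simp [hq, hqV, hV.1 hqV]
      · refine ⟨q, Set.ext fun x => ?_⟩
        rcases h x with rfl | rfl <;> simp [hq.symm, hqV, not_not.1 (mt hV.2 hqV)]
  simp only [tube, e1, Pi.add_apply, dotAt, unitDisc, e0, Set.mem_sdiff, Set.mem_singleton_iff]
  by_cases h1 : q ∈ V <;> by_cases h2 : q' ∈ V <;> simp [h1, h2, hq, hq.symm]

end

namespace Tab

variable {n : ℕ} {t t' : Tab n} {col : Fin t.p → Option U} {col' : Fin t'.p → Option U}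
  {m d : (Fin t.c → Bool) → (Fin t'.c → Bool) → Bool}
  (hT : (t.tangle col).Nice) (hT' : (t'.tangle col').Nice)

variable (t t') in
/-- The terms of the commutator with dots. -/
def dotTerms (d : (Fin t.c → Bool) → (Fin t'.c → Bool) → Bool) (a : Fin t.s) (b : Fin t'.s)
  (ε : Fin t.c → Bool) (ε' : Fin t'.c → Bool) : List ℕ :=
  if d ε ε' then [t.lab t' ε ε' (t.enc t' (.inl a)) + 1, t.lab t' ε ε' (t.enc t' (.inr b)) + 1] else []

include hT hT'

theorem sum_dotTerms (a : Fin t.s) (b : Fin t'.s) (ε ε') :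
  ((dotTerms t t' d a b ε ε').map (term ε ε' col col' R)).sum
    = mul (dotMat R (t.tangle col) a) (discs R (T' := t'.tangle col') d) ε ε'
      + mul (discs R (T := t.tangle col) d) (dotMat R (t'.tangle col') b) ε ε' := by
  rw [dotMat, dotMat, dots_mul hT hT', mul_dots hT hT', discs, dotTerms]
  rcases d ε ε' with _ | _
  · refine ((congrArg₂ (· + ·) (dotAt_zero _) (dotAt_zero _)).trans (add_zero _)).symm
  · exact congrArg₂ (· + ·) (term_lab (.inl a)) ((add_zero _).trans (term_lab (.inr b)))

theorem Check.closed (h : Check t t' m fun _ _ => []) :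
  mul (sads R (t.tangle col)) (discs R (T' := t'.tangle col') m)
    = mul (discs R m) (sads R (t'.tangle col')) := by
  funext ε ε' V
  have := congrFun (h.sum_eq (R := R) hT hT' ε ε') V
  exact CharTwo.add_eq_zero.1 ((add_zero _).symm.trans this)

theorem Check.closed_add {a : Fin t.s} {b : Fin t'.s} (h : Check t t' m (dotTerms t t' d a b)) :
  mul (sads R (t.tangle col)) (discs R (T' := t'.tangle col') m)
      + mul (dotMat R (t.tangle col) a) (discs R (T' := t'.tangle col') d)
    = mul (discs R m) (sads R (t'.tangle col')) + mul (discs R d) (dotMat R (t'.tangle col') b) := by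
  funext ε ε' V
  have := h.sum_eq (R := R) hT hT' ε ε'
  rw [sum_dotTerms hT hT', add_add_add_comm] at this
  exact CharTwo.add_eq_zero.1 (congrFun this V)

theorem Check.dot {a : Fin t.s} {b : Fin t'.s} (h : Check t t' (fun _ _ => false) (dotTerms t t' d a b)) :
  mul (dotMat R (t.tangle col) a) (discs R (T' := t'.tangle col') d)
    = mul (discs R d) (dotMat R (t'.tangle col') b) := by
  have e : (discs R fun _ _ => false : TMat R (t.tangle col) (t'.tangle col')) = 0 := rfl
  have := h.closed_add (R := R) hT hT'
  rwa [e, TMat.mul_zero, TMat.zero_mul, zero_add, zero_add] at this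

end Tab

open Tab Kind

variable {n : ℕ} (c : ZMod 2 →+* R) (ξ : U → R)

theorem map_discs {e : Type} {T T' : Tangle e U} (m : (T.C → Bool) → (T'.C → Bool) → Bool)
  (P : (T.C → Bool) → (T'.C → Bool) → Prop) {x : ∀ ε ε', Decidable (P ε ε')}
  (h : ∀ ε ε', m ε ε' = true ↔ P ε ε') :
  (TMat.map c fun ε ε' => if P ε ε' then disc (T.res ε) (T'.res ε') else 0 : TMat R T T') = discs R m := by
  funext ε ε' V
  change c ((if P ε ε' then disc (T.res ε) (T'.res ε') else 0) V) = (if m ε ε' then unitDisc R _ else 0) V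
  simp only [h]
  split_ifs
  · change c (if V = ∅ then 1 else 0) = if V = ∅ then 1 else 0
    split_ifs <;> simp
  · exact map_zero c

theorem map_disc {e : Type} {T T' : Tangle e U} :
  (TMat.map c fun ε ε' => disc (T.res ε) (T'.res ε') : TMat R T T') = discs R fun _ _ => true := by
  rw [← map_discs c _ (fun _ _ => True) (fun _ _ => by simp) (x := fun _ _ => instDecidableTrue)]
  simp only [if_true]

variable (t t' : Tab n) (m : (Fin t.c → Bool) → (Fin t'.c → Bool) → Bool) (i j : Fin t.s ⊕ Fin t'.s) in
/-- There are two circles, unless `m` is false. -/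
abbrev TwoCircles : Prop := All fun ε ε' => Valid t t' ε ε' ∧ (m ε ε' →
  t.lab t' ε ε' (t.enc t' i) ≠ t.lab t' ε ε' (t.enc t' j) ∧ ∀ k,
    t.lab t' ε ε' (t.enc t' k) = t.lab t' ε ε' (t.enc t' i) ∨
    t.lab t' ε ε' (t.enc t' k) = t.lab t' ε ε' (t.enc t' j))

theorem map_tube {t t' : Tab n} {col : Fin t.p → Option U} {col' : Fin t'.p → Option U}
  {m : (Fin t.c → Bool) → (Fin t'.c → Bool) → Bool} {i j : Fin t.s ⊕ Fin t'.s} (h : TwoCircles t t' m i j)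
  {P : (Fin t.c → Bool) → (Fin t'.c → Bool) → Prop} {x : ∀ ε ε', Decidable (P ε ε')}
  (hm : ∀ ε ε', m ε ε' = true ↔ P ε ε') :
  (TMat.map c fun ε ε' => if P ε ε' then tube _ _ else 0 : TMat R (t.tangle col) (t'.tangle col'))
    = fun ε ε' => dotAt (Quot.mk _ i) (discs R m ε ε') + dotAt (Quot.mk _ j) (discs R m ε ε') := by
  funext ε ε'
  obtain ⟨hv, h⟩ := h.spec ε ε'
  change (fun V => c ((if P ε ε' then tube _ _ else 0) V)) = _
  simp only [discs, ← hm]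
  split_ifs with h1
  · simp only [ne_eq, lab_eq_iff (col := col) (col' := col') hv] at h
    exact tube_eq c (h h1).1 (Quot.ind (h h1).2)
  · exact (funext fun _ => map_zero c).trans
      ((congrArg₂ (· + ·) (dotAt_zero _) (dotAt_zero _)).trans (add_zero _)).symm

variable {ξ}

theorem closed_discs {t t' : Tab n} {m : (Fin t.c → Bool) → (Fin t'.c → Bool) → Bool}
  (h : Check t t' m fun _ _ => []) {col : Fin t.p → Option U} {col' : Fin t'.p → Option U}
  (hT : (t.tangle col).WF) (hT' : (t'.tangle col').WF) {M N : TMat R (t.tangle col) (t'.tangle col')}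
  (hM : M = discs R m) (hN : N = 0 := by rfl) (hp : IsEmpty (Fin t.p) := by exact Fin.isEmpty')
  (hp' : IsEmpty (Fin t'.p) := by exact Fin.isEmpty') : Closed ξ (M + N) := by
  unfold Closed
  rw [hM, hN, add_zero, diff_of_isEmpty _ _ hp, diff_of_isEmpty _ _ hp']
  exact h.closed hT.nice hT'.nice

/-- A crossing with a basepoint on a leg. -/
abbrev legTab (k : Fin 4) : Tab 4 :=
  ⟨5, ![update ![0, 1, 2, 3] k 4], ![![k.castSucc, 4]], ![0, 1, 2, 3]⟩

theorem closed_slide (x : U) {k k' : Fin 4} {m d : (Fin 1 → Bool) → (Fin 1 → Bool) → Bool}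
  (h0 : Check (legTab k) (legTab k') m fun _ _ => [])
  (h1 : Check (legTab k) (legTab k') d (dotTerms _ _ m k.castSucc k'.castSucc))
  (h2 : Check (legTab k) (legTab k') (fun _ _ => false) (dotTerms _ _ d k.castSucc k'.castSucc))
  {M H : TMat R (leg x k) (leg x k')} (hM : M = discs R m) (hH : H = discs R d) :
  Closed ξ (M + ξ x • H) := by
  have e : ∀ k, diff (leg x k) ξ = sads R (leg x k) + ξ x • dotMat R (leg x k) k.castSucc := fun k =>
    (diff_of_fin _ ξ (Equiv.refl (Fin 1))).trans (congrArg _ (Fin.sum_univ_one _))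
  subst hM hH
  exact closed_add_smul ξ (e k) (e k') (h0.closed (leg_wf x k).nice (leg_wf x k').nice)
    (h1.closed_add (leg_wf x k).nice (leg_wf x k').nice) (h2.dot (leg_wf x k).nice (leg_wf x k').nice)

abbrev pointsTab : Tab 2 := ⟨3, ![], ![![0, 1], ![1, 2]], ![0, 2]⟩

abbrev arcTab : Tab 2 := ⟨1, ![], ![], ![0, 0]⟩

theorem diff_twoPoints (x y : U) : diff (twoPoints x y) ξ
  = ξ x • dotMat R (twoPoints x y) (0 : Fin 3) + ξ y • dotMat R (twoPoints x y) (1 : Fin 3) := by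
  have := (diff_of_fin (twoPoints x y) ξ (Equiv.refl (Fin 2))).trans (congrArg _ (Fin.sum_univ_two _))
  rw [sads_of_isEmpty Fin.isEmpty'] at this
  exact this.trans (zero_add _)

theorem diff_arc : diff arc ξ = (0 : TMat R _ _) := by
  rw [diff_of_isEmpty _ _ Fin.isEmpty', sads_of_isEmpty Fin.isEmpty']

theorem diff_arc_eq (x : U) : diff arc ξ
  = ξ x • dotMat R (arc : Tangle (Fin 2) U) (0 : Fin 1) + ξ x • dotMat R (arc : Tangle (Fin 2) U) (0 : Fin 1) :=
  (diff_arc (ξ := ξ)).trans (add_self_eq_zero _).symm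

abbrev kinkTab : Bool → Tab 2
  | false => ⟨3, ![![0, 0, 1, 2]], ![], ![1, 2]⟩
  | true => ⟨3, ![![1, 0, 0, 2]], ![], ![1, 2]⟩

def r3Dec (v : Bool) (ε ε' : Fin 3 → Bool) : Decidable (r3Entry v ε ε') := by
  unfold r3Entry
  infer_instance

theorem Tangle.Edge.tgt {e : Type} {T : Tangle e U} {d : T.C} {ε ε' : T.C → Bool} (h : T.Edge d ε ε') : ε' d = true := by
  rw [h.2, update_self]

theorem Kind.poly_closed : ∀ k : Kind U, Closed ξ (k.poly c ξ)
  | iso => closed_discs (t := ⟨0, ![], ![], ![]⟩) (t' := ⟨0, ![], ![], ![]⟩) (m := fun _ _ => true)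
    (by decide +kernel) (src_wf iso) (tgt_wf iso) (map_disc c)
  | birth => closed_discs (t := ⟨0, ![], ![], ![]⟩) (t' := ⟨1, ![], ![], ![]⟩) (m := fun _ _ => true)
    (by decide +kernel) (src_wf birth) (tgt_wf birth) (map_disc c)
  | death => closed_discs (t := ⟨1, ![], ![], ![]⟩) (t' := ⟨0, ![], ![], ![]⟩) (m := fun _ _ => true)
    (by decide +kernel) (src_wf death) (tgt_wf death) (map_disc c)
  | saddle => closed_discs (t := ⟨2, ![], ![], ![0, 0, 1, 1]⟩) (t' := ⟨2, ![], ![], ![0, 1, 1, 0]⟩)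
    (m := fun _ _ => true) (by decide +kernel) (src_wf saddle) (tgt_wf saddle) (map_disc c)
  | r1 true => closed_discs (t := arcTab) (t' := kinkTab true) (m := fun _ ε' => ε' 0)
    (by decide +kernel) arc_wf (kink_wf true) (map_discs c _ _ (by simp))
  | r1' false => closed_discs (t := kinkTab false) (t' := arcTab) (m := fun ε _ => !ε 0)
    (by decide +kernel) (kink_wf false) arc_wf (map_discs c _ _ (by simp))
  | r2 => closed_discs (t := ⟨2, ![], ![], ![0, 1, 1, 0]⟩)
    (t' := ⟨6, ![![1, 5, 4, 0], ![4, 5, 2, 3]], ![], ![0, 1, 2, 3]⟩) (m := fun _ ε' => ε' 0 != ε' 1)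
    (by decide +kernel) arcs_wf bigon_wf (map_discs c _ _ (by simp))
  | r2' => closed_discs (t := ⟨6, ![![1, 5, 4, 0], ![4, 5, 2, 3]], ![], ![0, 1, 2, 3]⟩)
    (t' := ⟨2, ![], ![], ![0, 1, 1, 0]⟩) (m := fun ε _ => ε 0 != ε 1)
    (by decide +kernel) bigon_wf arcs_wf (map_discs c _ _ (by simp))
  | r3 false => closed_discs
    (t := ⟨9, ![![1, 6, 7, 0], ![2, 3, 8, 6], ![7, 8, 4, 5]], ![], ![0, 1, 2, 3, 4, 5]⟩)
    (t' := ⟨9, ![![7, 6, 5, 0], ![8, 3, 4, 6], ![1, 2, 8, 7]], ![], ![0, 1, 2, 3, 4, 5]⟩)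
    (m := fun ε ε' => @decide _ (r3Dec false ε ε')) (by decide +kernel) (triangle_wf false) (triangle'_wf false)
    (map_discs c _ _ fun _ _ => @decide_eq_true_iff _ (r3Dec ..))
  | r3 true => closed_discs
    (t := ⟨9, ![![1, 6, 7, 0], ![2, 3, 8, 6], ![8, 4, 5, 7]], ![], ![0, 1, 2, 3, 4, 5]⟩)
    (t' := ⟨9, ![![7, 6, 5, 0], ![8, 3, 4, 6], ![2, 8, 7, 1]], ![], ![0, 1, 2, 3, 4, 5]⟩)
    (m := fun ε ε' => @decide _ (r3Dec true ε ε')) (by decide +kernel) (triangle_wf true) (triangle'_wf true)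
    (map_discs c _ _ fun _ _ => @decide_eq_true_iff _ (r3Dec ..))
  | slide x false => closed_slide (k := 0) (k' := 2) (m := fun ε ε' => ε 0 == ε' 0) (d := fun ε ε' => ε 0 && !ε' 0) x
    (by decide +kernel) (by decide +kernel) (by decide +kernel) (map_discs c _ _ (by simp)) (map_discs c _ _ (by simp))
  | slide x true => closed_slide (k := 1) (k' := 3) (m := fun ε ε' => ε 0 == ε' 0) (d := fun ε ε' => ε 0 && !ε' 0) x
    (by decide +kernel) (by decide +kernel) (by decide +kernel) (map_discs c _ _ (by simp)) (map_discs c _ _ (by simp))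
  | swap x y =>
    have h : ∀ a b : Fin 3, Check pointsTab pointsTab (fun _ _ => false) (dotTerms _ _ (fun _ _ => true) a b) := by
      decide +kernel
    have e := fun a b => (h a b).dot (R := R) (twoPoints_wf x y).nice (twoPoints_wf y x).nice
    closed_of_comm ξ (diff_twoPoints x y)
      ((diff_twoPoints y x).trans (add_comm _ _)) (e 0 1) (e 1 0) (map_disc c)
  | cap x =>
    have h : ∀ a : Fin 3, Check pointsTab arcTab (fun _ _ => false) (dotTerms _ _ (fun _ _ => true) a 0) := by
      decide +kernel
    have e := fun a => (h a).dot (R := R) (twoPoints_wf x x).nice arc_wf.nice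
    closed_of_comm ξ (diff_twoPoints x x) (diff_arc_eq x) (e 0) (e 1) (map_disc c)
  | cup x =>
    have h : ∀ a : Fin 3, Check arcTab pointsTab (fun _ _ => false) (dotTerms _ _ (fun _ _ => true) 0 a) := by
      decide +kernel
    have e := fun a => (h a).dot (R := R) arc_wf.nice (twoPoints_wf x x).nice
    closed_of_comm ξ (diff_arc_eq x) (diff_twoPoints x x) (e 0) (e 1) (map_disc c)
  | r1 false => closed_mul_dots (T := arc) (T' := kink false) arc_wf.nice (kink_wf false).nice
    (a := (0 : Fin 3)) (b := (1 : Fin 3)) (fun d ε ε' h => .inr (by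
      obtain rfl : d = (0 : Fin 1) := Subsingleton.elim (α := Fin 1) _ _
      exact Tangle.cmp_eq (.one₁ (T := kink false) (0 : Fin 1) h.tgt)))
    diff_arc (diff_of_isEmpty _ _ Fin.isEmpty')
    (map_tube (t := arcTab) (t' := kinkTab false) (m := fun _ ε' => !ε' 0) (i := .inr 0) (j := .inr 1) c
      (by decide +kernel) (by simp))
  | r1' true => closed_dots_mul (T := kink true) (T' := arc) (kink_wf true).nice arc_wf.nice
    (a := (1 : Fin 3)) (b := (0 : Fin 3)) (fun d ε ε' h => .inl (by
      obtain rfl : d = (0 : Fin 1) := Subsingleton.elim (α := Fin 1) _ _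
      exact Tangle.cmp_eq (.zero₁ (T := kink true) (0 : Fin 1) h.1)))
    (diff_of_isEmpty _ _ Fin.isEmpty') diff_arc
    (map_tube (t := kinkTab true) (t' := arcTab) (m := fun ε _ => ε 0) (i := .inl 1) (j := .inl 0) c
      (by decide +kernel) (by simp))

end

end BarNatan

end

theorem proposition4p5 {d : ℕ} {U : Type} {e : Fin d → Type} [∀ i, Finite (e i)]
    {o : Type} [Finite o] (D : BarNatan.ArcDiagram e o) (hD : D.WF)
    (X : Fin d → Finset U) (T T' : ∀ i, BarNatan.Tangle (e i) U)
    (M₁ M₂ : BarNatan.JointMovie T T')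
    (h₁ : ∀ i, (M₁.movie i).IsDecorated (X i)) (h₂ : ∀ i, (M₂.movie i).IsDecorated (X i))
    (H : ∀ i, BarNatan.RComplex.Homotopic ((T i).DBN (X i)) ((T' i).DBN (X i))
      ((M₁.movie i).DBN (X i)) ((M₂.movie i).DBN (X i)))
    (Y : Finset U) (hY : ∀ x, x ∈ Y ↔ ∃ i, x ∈ X i) :
    BarNatan.RComplex.Homotopic ((D.glue T).DBN Y) ((D.glue T').DBN Y)
      ((M₁.glue D).DBN Y) ((M₂.glue D).DBN Y) := by
  have hT : ∀ i, (T i).WF := fun i => (h₁ i).wf_src.1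
  have hT' : ∀ i, (T' i).WF := fun i => (h₁ i).wf_tgt.1
  rw [BarNatan.JointMovie.DBN_glue hD Y h₁, BarNatan.JointMovie.DBN_glue hD Y h₂,
    BarNatan.homotopic_iff ((BarNatan.glueT D T).nice hD fun i => (hT i).nice)
      ((BarNatan.glueT D T').nice hD fun i => (hT' i).nice)]
  refine BarNatan.JointMovie.homotopic_glue hD (fun i x hx => (hY x).2 ⟨i, hx⟩)
    (fun k => BarNatan.Kind.poly_closed _ k) h₁ h₂ fun i => ?_
  rw [← BarNatan.homotopic_iff (hT i).nice (hT' i).nice, ← BarNatan.Movie.DBN_eq (X i) (h₁ i),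
    ← BarNatan.Movie.DBN_eq (X i) (h₂ i)]
  exact H i
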